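/- Fix a deletion probability $q\in[0,1)$ and an insertion probability $q'\in[0,1)$. The insertion-deletion channel acts on $x\in\{0,1\}^{\mathbb N}$ as follows: before each bit $x_j$ insert $G_j$ independent uniform bits, where the $G_j$ are independent with $\Pr[G_j=\nu]=(q')^{\nu}(1-q')$; then delete each bit of the resulting string independently with probability $q$. For an $\mathbb N$-valued law $S$, a shifted trace of $x$ is obtained by drawing $s\sim S$ and applying the channel to $(x_s,x_{s+1},\dots)$. Let $h(n)=n^{1/5}\log^7 n$. For $f:\{0,1\}^l\to\overline{\mathbb D}$ put $$g_x^f(\zeta_0,\dots,\zeta_l)=\sum_{0\le k_0<k_1<\dots<k_l}(-1)^{x_{k_0}}f(x_{k_1},\dots,x_{k_l})\,\zeta_0^{k_0-1}\zeta_1^{k_1-k_0-1}\cdots\zeta_l^{k_l-k_{l-1}-1}.$$ **Theorem.** There is $c_0>0$ depending only on $q,q'$ such that for all $0<c_2<c_1\le c_0$ and all $C>0$ there are an algorithm, a constant $\kappa>0$ and a constant $K$ with the following property. For every $A$, all sufficiently large $n$ (depending on $q,q',c_1,c_2,C,A$), every $l\le 2n^{1/5}+1$, every $f:\{0,1\}^l\to\overline{\mathbb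 D}$, every $z_0=(1-n^{-4/5}\log^6 n)e^{i\theta}$ with $|\theta|\le n^{-2/5}$, every real $z_1=\dots=z_l=z$ with $z\in[1-c_1,1-c_2]$, or, if $q<1/2$, alternatively with $z\in[-c_1,c_1]$, every $x\in\{0,1\}^{\mathbb N}$ and every shift law $S$ with $\operatorname{supp}S\subseteq[a,a+\eta]\subseteq[0,n-1]$ for some $a$ and some $\eta\le C\,h(n)$: the series $g_x^f(z_0,z,\dots,z)$ converges absolutely; and the algorithm, given $n,l,q,q',f,z_0,z$, the law $S$, the bits $x_0,\dots,x_{n-1}$ and $m=\lceil\exp(h(n))\rceil$ independent samples, each of which is a shifted trace of $x$ with probability $1-e^{-h(n)}$ and is drawn from an arbitrary unknown (adversarial) distribution with probability $e^{-h(n)}$, always halts within $\exp\big(K\,h(n)\,(\log h(n))^{K}\big)=\exp(\widetilde O(h(n)))$ steps, and with probability at least $1-e^{-An}$ its output $v$ satisfies $$\big|v-g_x^f(z_0,z,\dots,z)\big|\le e^{-\kappa h(n)}.$$ (In particular the failure probability is $\exp(-\omega(n))$.) The algorithm is a single program, independent of $n$, for a random access machine with integer registers (constants, addition, truncated subtraction,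 comparison, indirect addressing) and real registers (integer constants, conversion of integers, $+,-,\times,\div$, comparison, indirect addressing), each instruction, test and access to a read-only input entry costing one step. -/

import Mathlib

open MeasureTheory
open scoped ENNReal

noncomputable section

namespace TraceRec

/-! ### The insertion-deletion channel with a random shift -/

/-- The number `G` of bits inserted before a given bit: `Pr[G = k] = q'^k (1 - q')`. -/
def insertCount (q' : Set.Ico (0 : ℝ) 1) : PMF ℕ :=
  ⟨fun k => ENNReal.ofReal ((q' : ℝ) ^ k * (1 - q')), by
    have h0 : (0 : ℝ) ≤ q' := q'.2.1
    have h1 : (q' : ℝ) < 1 := q'.2.2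
    have hs : HasSum (fun k : ℕ => (q' : ℝ) ^ k * (1 - q')) 1 := by
      have h := (hasSum_geometric_of_lt_one h0 h1).mul_right (1 - (q' : ℝ))
      rwa [inv_mul_cancel₀ (by linarith)] at h
    have hn : ∀ k : ℕ, 0 ≤ (q' : ℝ) ^ k * (1 - q') := fun k =>
      mul_nonneg (pow_nonneg h0 k) (by linarith)
    have h := ENNReal.ofReal_tsum_of_nonneg hn hs.summable
    rw [hs.tsum_eq, ENNReal.ofReal_one] at h
    rw [h]
    exact ENNReal.summable.hasSum⟩

/-- A coin that is `true` (the bit is deleted) with probability `q`. -/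
def deletionCoin (q : Set.Ico (0 : ℝ) 1) : PMF Bool :=
  PMF.ofFintype (fun b => if b then ENNReal.ofReal q else ENNReal.ofReal (1 - q)) (by
    have h0 : (0 : ℝ) ≤ q := q.2.1
    have h1 : (q : ℝ) < 1 := q.2.2
    simp only [Fintype.sum_bool, if_true, Bool.false_eq_true, if_false]
    rw [← ENNReal.ofReal_add h0 (by linarith)]
    simp)

/-- `k` independent uniformly distributed bits. -/
def uniformBits : ℕ → PMF (List Bool)
  | 0 => PMF.pure []
  | k + 1 => (PMF.uniformOfFintype Bool).bind fun b =>
      (uniformBits k).bind fun L => PMF.pure (b :: L)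

/-- Delete each bit of a finite string independently with probability `q`. -/
def deleteBits (q : Set.Ico (0 : ℝ) 1) : List Bool → PMF (List Bool)
  | [] => PMF.pure []
  | b :: L => (deletionCoin q).bind fun d =>
      (deleteBits q L).bind fun L' => PMF.pure (if d then L' else b :: L')

/-- What the channel outputs for one bit `b` of the message: a geometric number of uniform bits is
inserted before `b`, then each of these bits (the last one is `b`) is deleted with probability
`q`. -/
def blockPMF (q q' : Set.Ico (0 : ℝ) 1) (b : Bool) : PMF (List Bool) :=
  (insertCount q').bind fun k => (uniformBits k).bind fun L => deleteBits q (L ++ [b])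

/-- Finite bit strings form a countable discrete measurable space. -/
instance instMeasurableSpaceListBool : MeasurableSpace (List Bool) := ⊤

instance instDiscreteMeasurableSpaceListBool : DiscreteMeasurableSpace (List Bool) :=
  ⟨fun _ => trivial⟩

/-- The concatenation of the first `k` blocks. -/
def prefixBlocks (L : ℕ → List Bool) : ℕ → List Bool
  | 0 => []
  | k + 1 => prefixBlocks L k ++ L k

open scoped Classical in
/-- The concatenation `L 0 ++ L 1 ++ ...` as an infinite string. (If it is finite, which for the
channel has probability zero, it is padded with `false`.) -/
def concatBlocks (L : ℕ → List Bool) (r : ℕ) : Bool :=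
  if h : ∃ k, r < (prefixBlocks L k).length
  then (prefixBlocks L (Nat.find h)).getD r false else false

/-- The law of the output of the insertion-deletion channel with deletion probability `q` and
insertion probability `q'` on the infinite message `x`. -/
def channelLaw (q q' : Set.Ico (0 : ℝ) 1) (x : ℕ → Bool) : Measure (ℕ → Bool) :=
  (Measure.infinitePi fun j => (blockPMF q q' (x j)).toMeasure).map concatBlocks

/-- The law of a shifted trace of `x`: a shift `s` is drawn from `S`, and the channel is applied to
`(x_s, x_{s+1}, ...)`. -/
def shiftedTraceLaw (q q' : Set.Ico (0 : ℝ) 1) (S : PMF ℕ) (x : ℕ → Bool) : Measure (ℕ → Bool) :=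
  S.toMeasure.bind fun s => channelLaw q q' fun j => x (s + j)

/-- The law of one sample: with probability `ε` a false sample, drawn from `ν`, and with
probability `1 - ε` a genuine shifted trace of `x`. -/
def sampleLaw (q q' : Set.Ico (0 : ℝ) 1) (S : PMF ℕ) (x : ℕ → Bool) (ε : ℝ)
    (ν : Measure (ℕ → Bool)) : Measure (ℕ → Bool) :=
  ENNReal.ofReal (1 - ε) • shiftedTraceLaw q q' S x + ENNReal.ofReal ε • ν

lemma measurable_prefixBlocks (k : ℕ) :
    Measurable fun L : ℕ → List Bool => prefixBlocks L k := by
  induction k with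
  | zero => exact measurable_const
  | succ k ih =>
    exact (measurable_of_countable fun p : List Bool × List Bool => p.1 ++ p.2).comp
      (ih.prodMk (measurable_pi_apply k))

/-- Concatenation is measurable, so that `channelLaw` is the push-forward that it should be. -/
lemma measurable_concatBlocks : Measurable concatBlocks := by
  classical
  refine measurable_pi_lambda _ fun r => ?_
  have hlen : ∀ k, MeasurableSet {L : ℕ → List Bool | r < (prefixBlocks L k).length} := fun k =>
    measurable_prefixBlocks k (MeasurableSet.of_discrete (s := {l : List Bool | r < l.length}))
  have hget : ∀ k, MeasurableSet
      {L : ℕ → List Bool | (prefixBlocks L k).getD r false = true} := fun k =>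
    measurable_prefixBlocks k
      (MeasurableSet.of_discrete (s := {l : List Bool | l.getD r false = true}))
  refine measurable_to_bool ?_
  have : (fun L : ℕ → List Bool => concatBlocks L r) ⁻¹' {true} =
      ⋃ k, ({L | r < (prefixBlocks L k).length} ∩ (⋂ i, ⋂ _ : i < k,
        {L | r < (prefixBlocks L i).length}ᶜ)) ∩
        {L | (prefixBlocks L k).getD r false = true} := by
    ext L
    simp only [Set.mem_preimage, Set.mem_singleton_iff, Set.mem_iUnion, Set.mem_inter_iff,
      Set.mem_ofPred_eq, Set.mem_iInter, Set.mem_compl_iff]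
    unfold concatBlocks
    constructor
    · intro h
      split_ifs at h with hk
      exact ⟨Nat.find hk, ⟨Nat.find_spec hk, fun i hi => Nat.find_min hk hi⟩, h⟩
    · rintro ⟨k, ⟨h1, h2⟩, h3⟩
      have hk : ∃ k, r < (prefixBlocks L k).length := ⟨k, h1⟩
      rw [dif_pos hk, (Nat.find_eq_iff hk).2 ⟨h1, h2⟩]
      exact h3
  rw [this]
  exact MeasurableSet.iUnion fun k => ((hlen k).inter
    (MeasurableSet.iInter fun i => MeasurableSet.iInter fun _ => (hlen i).compl)).inter (hget k)

instance instIsProbabilityMeasureChannelLaw (q q' : Set.Ico (0 : ℝ) 1) (x : ℕ → Bool) :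
    IsProbabilityMeasure (channelLaw q q' x) :=
  Measure.isProbabilityMeasure_map measurable_concatBlocks.aemeasurable

instance instIsProbabilityMeasureShiftedTraceLaw (q q' : Set.Ico (0 : ℝ) 1) (S : PMF ℕ)
    (x : ℕ → Bool) : IsProbabilityMeasure (shiftedTraceLaw q q' S x) := by
  constructor
  rw [shiftedTraceLaw, Measure.bind_apply MeasurableSet.univ
    (measurable_of_countable _).aemeasurable]
  simp

/-! ### The generating function -/

/-- The term of `g_x^f(ζ_0, ..., ζ_l)` that belongs to the indices `k_0 < ... < k_l`. -/
def gTerm {l : ℕ} (f : (Fin l → Bool) → ℂ) (x : ℕ → Bool) (ζ : Fin (l + 1) → ℂ)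
    (k : Fin (l + 1) ↪o ℕ) : ℂ :=
  (if x (k 0) then -1 else 1) * f (fun i => x (k i.succ)) * ζ 0 ^ ((k 0 : ℤ) - 1) *
    ∏ i : Fin l, ζ i.succ ^ (k i.succ - k i.castSucc - 1)

/-- `g_x^f(ζ_0, ..., ζ_l)`, the sum over all `k_0 < ... < k_l` in `ℕ`. -/
def gPoly {l : ℕ} (f : (Fin l → Bool) → ℂ) (x : ℕ → Bool) (ζ : Fin (l + 1) → ℂ) : ℂ :=
  ∑' k : Fin (l + 1) ↪o ℕ, gTerm f x ζ k

/-- `h(n) = n^{1/5} log^7 n`. -/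
def hFun (n : ℕ) : ℝ := (n : ℝ) ^ (1 / 5 : ℝ) * Real.log n ^ 7

/-- The number of samples, `exp(h(n))` rounded up. -/
def numSamples (n : ℕ) : ℕ := ⌈Real.exp (hFun n)⌉₊

/-- `(1 - n^{-4/5} log^6 n) e^{iθ}`. -/
def zZero (n : ℕ) (θ : ℝ) : ℂ :=
  ((1 - (n : ℝ) ^ (-(4 / 5) : ℝ) * Real.log n ^ 6 : ℝ) : ℂ) * Complex.exp (θ * Complex.I)

/-! ### The machine model: programs for a real random access machine -/

/-- The input of a machine: finitely many integers and reals that stand in the first registers at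
the start, and read-only arrays of reals and of bits. -/
structure Input where
  ints : List ℕ
  reals : List ℝ
  realArr : ℕ → ℕ → ℝ
  bitArr : ℕ → ℕ → Bool

/-- The memory: integer registers and real registers. -/
structure Mem where
  N : ℕ → ℕ
  R : ℕ → ℝ

/-- The elementary instructions. The only constants in a program are integers. -/
inductive Instr
  /-- `N[a] := k` -/
  | constN (a k : ℕ)
  /-- `N[a] := N[b] + N[c]` -/
  | addN (a b c : ℕ)
  /-- `N[a] := max (N[b] - N[c]) 0` -/
  | subN (a b c : ℕ)
  /-- `N[a] := N[N[b]]` -/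
  | loadN (a b : ℕ)
  /-- `N[N[a]] := N[b]` -/
  | storeN (a b : ℕ)
  /-- `R[a] := k` -/
  | constR (a : ℕ) (k : ℤ)
  /-- `R[a] := N[b]` -/
  | castR (a b : ℕ)
  /-- `R[a] := R[b] + R[c]` -/
  | addR (a b c : ℕ)
  /-- `R[a] := R[b] - R[c]` -/
  | subR (a b c : ℕ)
  /-- `R[a] := R[b] * R[c]` -/
  | mulR (a b c : ℕ)
  /-- `R[a] := R[b] / R[c]` -/
  | divR (a b c : ℕ)
  /-- `R[a] := R[N[b]]` -/
  | loadR (a b : ℕ)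
  /-- `R[N[a]] := R[b]` -/
  | storeR (a b : ℕ)
  /-- `R[a] :=` entry `N[b]` of the `k`-th real input array -/
  | readR (a k b : ℕ)
  /-- `N[a] :=` entry `N[c]` (0 or 1) of the `N[b]`-th input array of bits -/
  | readBit (a b c : ℕ)

namespace Mem

/-- Write to an integer register. -/
def setN (s : Mem) (a v : ℕ) : Mem := { s with N := Function.update s.N a v }

/-- Write to a real register. -/
def setR (s : Mem) (a : ℕ) (v : ℝ) : Mem := { s with R := Function.update s.R a v }

end Mem

/-- The effect of an elementary instruction. -/
def Instr.exec (I : Input) (s : Mem) : Instr → Mem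
  | .constN a k => s.setN a k
  | .addN a b c => s.setN a (s.N b + s.N c)
  | .subN a b c => s.setN a (s.N b - s.N c)
  | .loadN a b => s.setN a (s.N (s.N b))
  | .storeN a b => s.setN (s.N a) (s.N b)
  | .constR a k => s.setR a k
  | .castR a b => s.setR a (s.N b)
  | .addR a b c => s.setR a (s.R b + s.R c)
  | .subR a b c => s.setR a (s.R b - s.R c)
  | .mulR a b c => s.setR a (s.R b * s.R c)
  | .divR a b c => s.setR a (s.R b / s.R c)
  | .loadR a b => s.setR a (s.R (s.N b))
  | .storeR a b => s.setR (s.N a) (s.R b)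
  | .readR a k b => s.setR a (I.realArr k (s.N b))
  | .readBit a b c => s.setN a (I.bitArr (s.N b) (s.N c)).toNat

/-- The tests. -/
inductive Test
  /-- `N[a] < N[b]` -/
  | ltN (a b : ℕ)
  /-- `R[a] < R[b]` -/
  | ltR (a b : ℕ)

/-- A test holds in a memory. -/
def Test.holds (s : Mem) : Test → Prop
  | .ltN a b => s.N a < s.N b
  | .ltR a b => s.R a < s.R b

/-- Programs. -/
inductive Prog
  | instr (i : Instr)
  | seq (P Q : Prog)
  | ite (b : Test) (P Q : Prog)
  | while (b : Test) (P : Prog)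

/-- `Exec I P s t s'`: on input `I`, started in the memory `s`, the program `P` halts after exactly
`t` steps in the memory `s'`. Every elementary instruction and every evaluation of a test is one
step. -/
inductive Exec (I : Input) : Prog → Mem → ℕ → Mem → Prop
  | instr (i : Instr) (s : Mem) : Exec I (.instr i) s 1 (i.exec I s)
  | seq {P Q : Prog} {s s' s'' : Mem} {t t' : ℕ} :
      Exec I P s t s' → Exec I Q s' t' s'' → Exec I (.seq P Q) s (t + t') s''
  | ite_true {b : Test} {P Q : Prog} {s s' : Mem} {t : ℕ} :
      b.holds s → Exec I P s t s' → Exec I (.ite b P Q) s (t + 1) s'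
  | ite_false {b : Test} {P Q : Prog} {s s' : Mem} {t : ℕ} :
      ¬ b.holds s → Exec I Q s t s' → Exec I (.ite b P Q) s (t + 1) s'
  | while_true {b : Test} {P : Prog} {s s' s'' : Mem} {t t' : ℕ} :
      b.holds s → Exec I P s t s' → Exec I (.while b P) s' t' s'' →
        Exec I (.while b P) s (t + t' + 1) s''
  | while_false {b : Test} {P : Prog} {s : Mem} :
      ¬ b.holds s → Exec I (.while b P) s 1 s

/-- The machine is deterministic: the final memory and the number of steps are unique. -/
lemma Exec.unique {I : Input} {P : Prog} {s s₁ s₂ : Mem} {t₁ t₂ : ℕ}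
    (h₁ : Exec I P s t₁ s₁) (h₂ : Exec I P s t₂ s₂) : t₁ = t₂ ∧ s₁ = s₂ := by
  induction h₁ generalizing t₂ s₂ with
  | instr i s => cases h₂; exact ⟨rfl, rfl⟩
  | seq _ _ ih ih' =>
    cases h₂ with
    | seq a b =>
      obtain ⟨rfl, rfl⟩ := ih a
      obtain ⟨rfl, rfl⟩ := ih' b
      exact ⟨rfl, rfl⟩
  | ite_true hb _ ih =>
    cases h₂ with
    | ite_true _ a => obtain ⟨rfl, rfl⟩ := ih a; exact ⟨rfl, rfl⟩
    | ite_false hb' _ => exact absurd hb hb'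
  | ite_false hb _ ih =>
    cases h₂ with
    | ite_true hb' _ => exact absurd hb' hb
    | ite_false _ a => obtain ⟨rfl, rfl⟩ := ih a; exact ⟨rfl, rfl⟩
  | while_true hb _ _ ih ih' =>
    cases h₂ with
    | while_true _ a b =>
      obtain ⟨rfl, rfl⟩ := ih a
      obtain ⟨rfl, rfl⟩ := ih' b
      exact ⟨rfl, rfl⟩
    | while_false hb' => exact absurd hb hb'
  | while_false hb =>
    cases h₂ with
    | while_true hb' _ _ => exact absurd hb' hb
    | while_false _ => exact ⟨rfl, rfl⟩

/-- The memory at the start: the integers and reals of the input in the first registers, and zeros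
everywhere else. -/
def Input.initMem (I : Input) : Mem where
  N a := I.ints.getD a 0
  R a := I.reals.getD a 0

/-- On input `I` the program halts after at most `T` steps with `R[0] + i R[1] = v`. -/
def Prog.Outputs (P : Prog) (I : Input) (T : ℝ) (v : ℂ) : Prop :=
  ∃ (t : ℕ) (s : Mem), Exec I P I.initMem t s ∧ (t : ℝ) ≤ T ∧ v = ⟨s.R 0, s.R 1⟩

/-- The input of the estimation problem: `n`, `l`, the number `m` of samples; `q`, `q'`, the point
`(z0, z, ..., z)`; the law of the shift and the table of `f` (its real and imaginary parts, the
argument `w` being coded by the integer with binary digits `w`); the bits `x_0, ..., x_{n-1}` and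
the samples `Y_0, ..., Y_{m-1}`. -/
def estimationInput (q q' : ℝ) (n l m : ℕ) (f : (Fin l → Bool) → ℂ) (z0 : ℂ) (z : ℝ) (S : PMF ℕ)
    (x : ℕ → Bool) (Y : Fin m → ℕ → Bool) : Input where
  ints := [n, l, m]
  reals := [q, q', z0.re, z0.im, z]
  realArr k i :=
    if k = 0 then (S i).toReal
    else if k = 1 then (f fun j => i.testBit j).re
    else if k = 2 then (f fun j => i.testBit j).im
    else 0
  bitArr k j :=
    match k with
    | 0 => if j < n then x j else false
    | i + 1 => if h : i < m then Y ⟨i, h⟩ j else false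

end TraceRec

end

/-! The generating functions of all words are treated as one vector. The nodes of a binary tree are
the words, the parent of a word is the word without its first letter, and γ_x collects the sums over
the occurrences of each word in x, a word of length k being scaled by r^k. Deciding whether the
first bit of x is used gives γ_x = M_{x_0} γ_{σx}, where σ drops the first bit and M_b is a diagonal
operator plus r times the passage from every node to its child labelled b (`treeSum_eq_transfer`).
So γ_x is an ordered product of operators, one for each bit. Each M_b preserves the root coordinate,
and for r = 1/n, tiny compared with 1 - |z0|, it contracts the vectors that vanish at the root. The
quantity sought is a fixed linear functional of γ_x divided by r^(l+1) z0
(`treeFunctional_treeSum`).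

The channel is inverted letter by letter. Operators N_b for the letters of the trace are wanted such
that the mean of their product over the block of a bit b is M_b. A deletion turns N_b into Q_b = q +
(1-q) N_b, and the insertions contribute the series (1-q') Σ (q' (Q_0+Q_1)/2)^k. With Δ = (1-q') +
q' (M_0+M_1)/2 the choice Q_b = Δ⁻¹ M_b makes the series equal to Δ and the block mean equal to M_b
(`pmfMean_blockPMF_eq`). The N_b also contract the vectors that vanish at the root: on the levels
with z because z ≥ q or q < 1/2, on the levels with z0 because 1 - |z0| dominates θ²
(`contracts_of_large`). Hence the product of the N_b over the first m letters of a trace, applied to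
the indicator of the root, has norm at most one for every string, and its mean is γ_x up to 2ρ^m
(`norm_integral_traceStat_sub_le`).

With a random shift the mean becomes Σ S_i γ_{σ^i x}. Since x_0, ..., x_{n-1} are known, this is a
known operator applied to γ_{σ^n x}, triangular with respect to the tree. It is inverted level by
level, and then the n operators of the message are applied. The inversion alone may be badly
conditioned, but the composite map is not (`ShiftBound.norm_le`): over the window of possible shifts
a node deviates from a pure power of its diagonal entry only by a relative error η r / z, and the
averages of z^{-(i-a)} and z0^{-(i-a)} over the shifts do not cancel.

The stability argument needs z positive and not too small. For |z| ≤ c₁ the generating function is a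
power series in z, and it is extrapolated from O(h) positive nodes by Lagrange interpolation
(`norm_gPoly_sub_extra_le`).

All losses, namely n^(l+1), 2^l and the interpolation coefficients, stay below exp(h/8). So the
estimate from one string deviates by at most exp(h/8) whatever the string is. This makes the
adversarial fraction exp(-h) harmless, and Hoeffding's inequality with exp(h) samples gives a
failure probability far below exp(-An) (`measure_estimate_le`).

The algorithm is written in a small loop language over complex arrays, whose compiler to the machine
is verified once (`Stmt.compile_spec`). No loop bound exceeds the number m of samples, so the time
is polynomial in m (`Stmt.cost_le`), that is exp(O(h)). -/

noncomputable section
namespace TraceRec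

/-! ### A structured language with complex cells, and its compiler -/

/-- The state of a structured program: 32 integer variables and 32 arrays of complex numbers. -/
@[ext] structure St where
  v : Fin 32 → ℕ
  x : Fin 32 → ℕ → ℂ

namespace St

def setV (σ : St) (a : Fin 32) (k : ℕ) : St := { σ with v := Function.update σ.v a k }

def setX (σ : St) (k : Fin 32) (i : ℕ) (c : ℂ) : St :=
  { σ with x := Function.update σ.x k (Function.update (σ.x k) i c) }

@[simp] lemma setV_v (σ : St) (a b : Fin 32) (k : ℕ) :
    (σ.setV a k).v b = if b = a then k else σ.v b := by
  simp [setV, Function.update_apply]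

@[simp] lemma setV_x (σ : St) (a : Fin 32) (k : ℕ) : (σ.setV a k).x = σ.x := rfl

@[simp] lemma setX_v (σ : St) (k : Fin 32) (i : ℕ) (c : ℂ) : (σ.setX k i c).v = σ.v := rfl

@[simp] lemma setX_x (σ : St) (k k' : Fin 32) (i j : ℕ) (c : ℂ) :
    (σ.setX k i c).x k' j = if k' = k ∧ j = i then c else σ.x k' j := by
  by_cases h : k' = k
  · subst h; simp [setX, Function.update_apply]
  · simp [setX, h]

end St

/-- Complex-valued expressions. -/
inductive CExp
  | sc (k : Fin 32)
  | arr (k a : Fin 32)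
  | int (c : ℤ)
  | iu
  | nat (a : Fin 32)
  | rd (k : ℕ) (a : Fin 32)
  | add (e e' : CExp)
  | sub (e e' : CExp)
  | mul (e e' : CExp)
  | div (e e' : CExp)
  | re (e : CExp)
  | im (e : CExp)

namespace CExp

def eval (I : Input) (σ : St) : CExp → ℂ
  | sc k => σ.x k 0
  | arr k a => σ.x k (σ.v a)
  | int c => c
  | iu => Complex.I
  | nat a => σ.v a
  | rd k a => I.realArr k (σ.v a)
  | add e e' => e.eval I σ + e'.eval I σ
  | sub e e' => e.eval I σ - e'.eval I σ
  | mul e e' => e.eval I σ * e'.eval I σ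
  | div e e' => e.eval I σ / e'.eval I σ
  | re e => (e.eval I σ).re
  | im e => (e.eval I σ).im

/-- Code that puts into `N[40]` the address of the cell `k` with index `N[a]`. -/
def addrCode (k a : Fin 32) : List Instr :=
  [.addN 40 a a, .addN 40 40 40, .addN 40 40 40, .addN 40 40 40, .addN 40 40 40, .addN 40 40 40,
    .addN 40 40 40, .constN 41 (2 * k), .addN 40 40 41]

/-- Code that evaluates an expression into the registers `128 t + 64` and `128 t + 65`. -/
def code : CExp → ℕ → List Instr
  | sc k, t => [.constN 40 (2 * k), .loadR (128 * t + 64) 40, .constN 40 (2 * k + 1),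
      .loadR (128 * t + 65) 40]
  | arr k a, t => addrCode k a ++ [.loadR (128 * t + 64) 40, .constN 41 1, .addN 40 40 41,
      .loadR (128 * t + 65) 40]
  | int c, t => [.constR (128 * t + 64) c, .constR (128 * t + 65) 0]
  | iu, t => [.constR (128 * t + 64) 0, .constR (128 * t + 65) 1]
  | nat a, t => [.castR (128 * t + 64) a, .constR (128 * t + 65) 0]
  | rd k a, t => [.readR (128 * t + 64) k a, .constR (128 * t + 65) 0]
  | add e e', t => e.code t ++ (e'.code (t + 1) ++
      [.addR (128 * t + 64) (128 * t + 64) (128 * t + 192),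
       .addR (128 * t + 65) (128 * t + 65) (128 * t + 193)])
  | sub e e', t => e.code t ++ (e'.code (t + 1) ++
      [.subR (128 * t + 64) (128 * t + 64) (128 * t + 192),
       .subR (128 * t + 65) (128 * t + 65) (128 * t + 193)])
  | mul e e', t => e.code t ++ (e'.code (t + 1) ++
      [.mulR (128 * t + 66) (128 * t + 64) (128 * t + 192),
       .mulR (128 * t + 67) (128 * t + 65) (128 * t + 193),
       .mulR (128 * t + 68) (128 * t + 64) (128 * t + 193),
       .mulR (128 * t + 69) (128 * t + 65) (128 * t + 192),
       .subR (128 * t + 64) (128 * t + 66) (128 * t + 67),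
       .addR (128 * t + 65) (128 * t + 68) (128 * t + 69)])
  | div e e', t => e.code t ++ (e'.code (t + 1) ++
      [.mulR (128 * t + 66) (128 * t + 64) (128 * t + 192),
       .mulR (128 * t + 67) (128 * t + 65) (128 * t + 193),
       .mulR (128 * t + 68) (128 * t + 65) (128 * t + 192),
       .mulR (128 * t + 69) (128 * t + 64) (128 * t + 193),
       .addR (128 * t + 66) (128 * t + 66) (128 * t + 67),
       .subR (128 * t + 68) (128 * t + 68) (128 * t + 69),
       .mulR (128 * t + 67) (128 * t + 192) (128 * t + 192),
       .mulR (128 * t + 69) (128 * t + 193) (128 * t + 193),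
       .addR (128 * t + 67) (128 * t + 67) (128 * t + 69),
       .divR (128 * t + 64) (128 * t + 66) (128 * t + 67),
       .divR (128 * t + 65) (128 * t + 68) (128 * t + 67)])
  | re e, t => e.code t ++ [.constR (128 * t + 65) 0]
  | im e, t => e.code t ++ [.constR (128 * t + 66) 0,
      .addR (128 * t + 64) (128 * t + 65) (128 * t + 66), .constR (128 * t + 65) 0]

end CExp

/-- The effect of a list of instructions. -/
def execList (I : Input) (s : Mem) (L : List Instr) : Mem := L.foldl (Instr.exec I) s

lemma execList_append (I : Input) (s : Mem) (L L' : List Instr) :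
    execList I s (L ++ L') = execList I (execList I s L) L' := List.foldl_append

@[simp] lemma execList_nil (I : Input) (s : Mem) : execList I s [] = s := rfl

@[simp] lemma execList_cons (I : Input) (s : Mem) (i : Instr) (L : List Instr) :
    execList I s (i :: L) = execList I (i.exec I s) L := rfl

/-- A list of instructions as a program. -/
def Prog.ofList : List Instr → Prog
  | [] => .instr (.constN 40 0)
  | i :: L => .seq (.instr i) (Prog.ofList L)

/-- The empty list still has to be a program, a dummy write to the scratch register 40; this
accounts for the extra step and for `setN 40 0`. -/
lemma exec_ofList (I : Input) (L : List Instr) (s : Mem) :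
    Exec I (Prog.ofList L) s (L.length + 1) ((execList I s L).setN 40 0) := by
  induction L generalizing s with
  | nil => exact Exec.instr _ _
  | cons i L ih =>
    have := Exec.seq (Exec.instr i s) (ih (i.exec I s))
    rw [List.length_cons, add_comm L.length 1, add_assoc]
    exact this

/-- The memory `s` represents the state `σ`. -/
def Rep (σ : St) (s : Mem) : Prop :=
  (∀ a : Fin 32, s.N a = σ.v a) ∧ ∀ (k : Fin 32) (i : ℕ),
    s.R (128 * i + 2 * k) = (σ.x k i).re ∧ s.R (128 * i + 2 * k + 1) = (σ.x k i).im

/-- Variables live in the integer registers below 32 and array cells in the real registers with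
residue below 64 modulo 128. Everything else is scratch, so code that writes only there leaves the
represented state alone. -/
lemma Rep.of_agree {σ : St} {s s' : Mem} (h : Rep σ s) (hN : ∀ a < 32, s'.N a = s.N a)
    (hR : ∀ j, j % 128 < 64 → s'.R j = s.R j) : Rep σ s' := by
  refine ⟨fun a => (hN a a.2).trans (h.1 a), fun k i => ⟨?_, ?_⟩⟩
  · rw [hR _ (by have := k.2; omega)]; exact (h.2 k i).1
  · rw [hR _ (by have := k.2; omega)]; exact (h.2 k i).2

/-- There is no integer multiplication: the factor 128 comes from seven doublings. -/
lemma addrCode_spec (I : Input) (k a : Fin 32) (s : Mem) :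
    (∀ b < 32, (execList I s (CExp.addrCode k a)).N b = s.N b) ∧
    (execList I s (CExp.addrCode k a)).N 40 = 128 * s.N a + 2 * k ∧
    (execList I s (CExp.addrCode k a)).R = s.R := by
  have ha := a.2
  refine ⟨fun b hb => ?_, ?_, ?_⟩
  · have h1 : b ≠ 40 := by omega
    have h2 : b ≠ 41 := by omega
    simp [CExp.addrCode, Instr.exec, Mem.setN, h1, h2]
  · simp [CExp.addrCode, Instr.exec, Mem.setN]
    omega
  · simp [CExp.addrCode, Instr.exec, Mem.setN]

/-- The scratch registers form a stack indexed by the depth t. The second operand is evaluated at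
depth t + 1, and the clause `j < 128 * t + 64` guarantees that the first operand survives this. -/
lemma CExp.code_spec (I : Input) (σ : St) (e : CExp) (t : ℕ) (s : Mem) (h : Rep σ s) :
    (∀ a < 32, (execList I s (e.code t)).N a = s.N a) ∧
    (∀ j, j < 128 * t + 64 ∨ j % 128 < 64 → (execList I s (e.code t)).R j = s.R j) ∧
    (execList I s (e.code t)).R (128 * t + 64) = (e.eval I σ).re ∧
    (execList I s (e.code t)).R (128 * t + 65) = (e.eval I σ).im := by
  -- The part common to the four binary operations: both operands are available after the two
  -- evaluations.
  have key : ∀ (e e' : CExp) (t : ℕ) (s : Mem), Rep σ s →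
      (∀ (t : ℕ) (s : Mem), Rep σ s →
        (∀ a < 32, (execList I s (e.code t)).N a = s.N a) ∧
        (∀ j, j < 128 * t + 64 ∨ j % 128 < 64 → (execList I s (e.code t)).R j = s.R j) ∧
        (execList I s (e.code t)).R (128 * t + 64) = (e.eval I σ).re ∧
        (execList I s (e.code t)).R (128 * t + 65) = (e.eval I σ).im) →
      (∀ (t : ℕ) (s : Mem), Rep σ s →
        (∀ a < 32, (execList I s (e'.code t)).N a = s.N a) ∧
        (∀ j, j < 128 * t + 64 ∨ j % 128 < 64 → (execList I s (e'.code t)).R j = s.R j) ∧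
        (execList I s (e'.code t)).R (128 * t + 64) = (e'.eval I σ).re ∧
        (execList I s (e'.code t)).R (128 * t + 65) = (e'.eval I σ).im) →
      ∃ s', execList I (execList I s (e.code t)) (e'.code (t + 1)) = s' ∧
        (∀ a < 32, s'.N a = s.N a) ∧
        (∀ j, j < 128 * t + 64 ∨ j % 128 < 64 → s'.R j = s.R j) ∧
        s'.R (128 * t + 64) = (e.eval I σ).re ∧ s'.R (128 * t + 65) = (e.eval I σ).im ∧
        s'.R (128 * t + 192) = (e'.eval I σ).re ∧
        s'.R (128 * t + 193) = (e'.eval I σ).im := by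
    intro e e' t s h he he'
    obtain ⟨a1, a2, a3, a4⟩ := he t s h
    obtain ⟨b1, b2, b3, b4⟩ := he' (t + 1) (execList I s (e.code t))
      (h.of_agree a1 fun j hj => a2 j (Or.inr hj))
    refine ⟨_, rfl, fun a ha => (b1 a ha).trans (a1 a ha), fun j hj => ?_, ?_, ?_, b3, b4⟩
    · rw [b2 j (by omega), a2 j hj]
    · rw [b2 _ (by omega), a3]
    · rw [b2 _ (by omega), a4]
  induction e generalizing t s with
  | sc k =>
    have hk := h.2 k 0
    simp only [mul_zero, zero_add] at hk
    refine ⟨fun a ha => ?_, fun j hj => ?_, ?_, ?_⟩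
    · have h1 : a ≠ 40 := by omega
      simp [CExp.code, Instr.exec, Mem.setN, Mem.setR, Function.update_apply, h1]
    · have h1 : j ≠ 128 * t + 64 := by omega
      have h2 : j ≠ 128 * t + 65 := by omega
      simp [CExp.code, Instr.exec, Mem.setN, Mem.setR, Function.update_apply, h1, h2]
    · simp [CExp.code, Instr.exec, Mem.setN, Mem.setR, Function.update_apply, CExp.eval, hk.1]
    -- The second load must not read the register 128 t + 64 that the first load has just
    -- overwritten.
    · have h1 : 2 * (k : ℕ) ≠ 128 * t + 63 := by have := k.2; omega
      simp [CExp.code, Instr.exec, Mem.setN, Mem.setR, Function.update_apply, CExp.eval, hk.2, h1]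
  | arr k a =>
    obtain ⟨a1, a2, a3⟩ := addrCode_spec I k a s
    have hk := h.2 k (σ.v a)
    rw [h.1 a] at a2
    simp only [CExp.code, execList_append]
    generalize execList I s (CExp.addrCode k a) = s' at *
    refine ⟨fun b hb => ?_, fun j hj => ?_, ?_, ?_⟩
    · have h1 : b ≠ 40 := by omega
      have h2 : b ≠ 41 := by omega
      simp [Instr.exec, Mem.setN, Mem.setR, Function.update_apply, h1, h2, a1 b hb]
    · have h1 : j ≠ 128 * t + 64 := by omega
      have h2 : j ≠ 128 * t + 65 := by omega
      simp [Instr.exec, Mem.setN, Mem.setR, Function.update_apply, h1, h2, a3]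
    · simp [Instr.exec, Mem.setN, Mem.setR, Function.update_apply, CExp.eval, a2, a3, hk.1]
    · have h1 : 128 * σ.v a + 2 * (k : ℕ) ≠ 128 * t + 63 := by have := k.2; omega
      simp [Instr.exec, Mem.setN, Mem.setR, Function.update_apply, CExp.eval, a2, a3, hk.2, h1]
  | int c =>
    refine ⟨fun a ha => ?_, fun j hj => ?_, ?_, ?_⟩
    · simp [CExp.code, Instr.exec, Mem.setR]
    · have h1 : j ≠ 128 * t + 64 := by omega
      have h2 : j ≠ 128 * t + 65 := by omega
      simp [CExp.code, Instr.exec, Mem.setR, Function.update_apply, h1, h2]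
    · simp [CExp.code, Instr.exec, Mem.setR, Function.update_apply, CExp.eval]
    · simp [CExp.code, Instr.exec, Mem.setR, Function.update_apply, CExp.eval]
  | iu =>
    refine ⟨fun a ha => ?_, fun j hj => ?_, ?_, ?_⟩
    · simp [CExp.code, Instr.exec, Mem.setR]
    · have h1 : j ≠ 128 * t + 64 := by omega
      have h2 : j ≠ 128 * t + 65 := by omega
      simp [CExp.code, Instr.exec, Mem.setR, Function.update_apply, h1, h2]
    · simp [CExp.code, Instr.exec, Mem.setR, Function.update_apply, CExp.eval]
    · simp [CExp.code, Instr.exec, Mem.setR, Function.update_apply, CExp.eval]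
  | nat a =>
    refine ⟨fun a ha => ?_, fun j hj => ?_, ?_, ?_⟩
    · simp [CExp.code, Instr.exec, Mem.setR]
    · have h1 : j ≠ 128 * t + 64 := by omega
      have h2 : j ≠ 128 * t + 65 := by omega
      simp [CExp.code, Instr.exec, Mem.setR, Function.update_apply, h1, h2]
    · simp [CExp.code, Instr.exec, Mem.setR, Function.update_apply, CExp.eval, h.1]
    · simp [CExp.code, Instr.exec, Mem.setR, Function.update_apply, CExp.eval]
  | rd k a =>
    refine ⟨fun a ha => ?_, fun j hj => ?_, ?_, ?_⟩
    · simp [CExp.code, Instr.exec, Mem.setR]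
    · have h1 : j ≠ 128 * t + 64 := by omega
      have h2 : j ≠ 128 * t + 65 := by omega
      simp [CExp.code, Instr.exec, Mem.setR, Function.update_apply, h1, h2]
    · simp [CExp.code, Instr.exec, Mem.setR, Function.update_apply, CExp.eval, h.1]
    · simp [CExp.code, Instr.exec, Mem.setR, Function.update_apply, CExp.eval]
  | add e e' ih ih' =>
    obtain ⟨s', hs, a1, a2, a3, a4, a5, a6⟩ := key e e' t s h ih ih'
    simp only [CExp.code, execList_append, hs]
    refine ⟨fun a ha => ?_, fun j hj => ?_, ?_, ?_⟩
    · simp [Instr.exec, Mem.setR, a1 a ha]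
    · have h1 : j ≠ 128 * t + 64 := by omega
      have h2 : j ≠ 128 * t + 65 := by omega
      simp [Instr.exec, Mem.setR, Function.update_apply, h1, h2, a2 j hj]
    · simp [Instr.exec, Mem.setR, Function.update_apply, CExp.eval, a3, a5]
    · simp [Instr.exec, Mem.setR, Function.update_apply, CExp.eval, a4, a6]
  | sub e e' ih ih' =>
    obtain ⟨s', hs, a1, a2, a3, a4, a5, a6⟩ := key e e' t s h ih ih'
    simp only [CExp.code, execList_append, hs]
    refine ⟨fun a ha => ?_, fun j hj => ?_, ?_, ?_⟩
    · simp [Instr.exec, Mem.setR, a1 a ha]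
    · have h1 : j ≠ 128 * t + 64 := by omega
      have h2 : j ≠ 128 * t + 65 := by omega
      simp [Instr.exec, Mem.setR, Function.update_apply, h1, h2, a2 j hj]
    · simp [Instr.exec, Mem.setR, Function.update_apply, CExp.eval, a3, a5]
    · simp [Instr.exec, Mem.setR, Function.update_apply, CExp.eval, a4, a6]
  | mul e e' ih ih' =>
    obtain ⟨s', hs, a1, a2, a3, a4, a5, a6⟩ := key e e' t s h ih ih'
    simp only [CExp.code, execList_append, hs]
    refine ⟨fun a ha => ?_, fun j hj => ?_, ?_, ?_⟩
    · simp [Instr.exec, Mem.setR, a1 a ha]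
    · have h1 : j ≠ 128 * t + 64 := by omega
      have h2 : j ≠ 128 * t + 65 := by omega
      have h3 : j ≠ 128 * t + 66 := by omega
      have h4 : j ≠ 128 * t + 67 := by omega
      have h5 : j ≠ 128 * t + 68 := by omega
      have h6 : j ≠ 128 * t + 69 := by omega
      simp [Instr.exec, Mem.setR, Function.update_apply, h1, h2, h3, h4, h5, h6, a2 j hj]
    · simp [Instr.exec, Mem.setR, Function.update_apply, CExp.eval,
        a3, a4, a5, a6]
    · simp [Instr.exec, Mem.setR, Function.update_apply, CExp.eval,
        a3, a4, a5, a6]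
  | div e e' ih ih' =>
    obtain ⟨s', hs, a1, a2, a3, a4, a5, a6⟩ := key e e' t s h ih ih'
    simp only [CExp.code, execList_append, hs]
    refine ⟨fun a ha => ?_, fun j hj => ?_, ?_, ?_⟩
    · simp [Instr.exec, Mem.setR, a1 a ha]
    · have h1 : j ≠ 128 * t + 64 := by omega
      have h2 : j ≠ 128 * t + 65 := by omega
      have h3 : j ≠ 128 * t + 66 := by omega
      have h4 : j ≠ 128 * t + 67 := by omega
      have h5 : j ≠ 128 * t + 68 := by omega
      have h6 : j ≠ 128 * t + 69 := by omega
      simp [Instr.exec, Mem.setR, Function.update_apply, h1, h2, h3, h4, h5, h6, a2 j hj]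
    · simp [Instr.exec, Mem.setR, Function.update_apply, CExp.eval,
        a3, a4, a5, a6, Complex.div_re, Complex.normSq_apply, add_div]
    · simp [Instr.exec, Mem.setR, Function.update_apply, CExp.eval,
        a3, a4, a5, a6, Complex.div_im, Complex.normSq_apply, sub_div]
  | re e ih =>
    obtain ⟨a1, a2, a3, a4⟩ := ih t s h
    simp only [CExp.code, execList_append]
    refine ⟨fun a ha => ?_, fun j hj => ?_, ?_, ?_⟩
    · simp [Instr.exec, Mem.setR, a1 a ha]
    · have h2 : j ≠ 128 * t + 65 := by omega
      simp [Instr.exec, Mem.setR, Function.update_apply, h2, a2 j hj]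
    · simp [Instr.exec, Mem.setR, Function.update_apply, CExp.eval, a3]
    · simp [Instr.exec, Mem.setR, Function.update_apply, CExp.eval]
  | im e ih =>
    obtain ⟨a1, a2, a3, a4⟩ := ih t s h
    simp only [CExp.code, execList_append]
    refine ⟨fun a ha => ?_, fun j hj => ?_, ?_, ?_⟩
    · simp [Instr.exec, Mem.setR, a1 a ha]
    · have h1 : j ≠ 128 * t + 64 := by omega
      have h2 : j ≠ 128 * t + 65 := by omega
      have h3 : j ≠ 128 * t + 66 := by omega
      simp [Instr.exec, Mem.setR, Function.update_apply, h1, h2, h3, a2 j hj]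
    · simp [Instr.exec, Mem.setR, Function.update_apply, CExp.eval, a4]
    · simp [Instr.exec, Mem.setR, Function.update_apply, CExp.eval]

/-- Statements. `loop i b P` runs `P` for `i = 0, ..., b - 1`. -/
inductive Stmt
  | setN (a : Fin 32) (k : ℕ)
  | addN (a b c : Fin 32)
  | subN (a b c : Fin 32)
  | readBit (a b c : Fin 32)
  | set (k : Fin 32) (e : CExp)
  | setArr (k a : Fin 32) (e : CExp)
  | seq (P Q : Stmt)
  | ifN (a b : Fin 32) (P Q : Stmt)
  | ifR (k k' : Fin 32) (P Q : Stmt)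
  | loop (i b : Fin 32) (P : Stmt)

infixr:60 " ;; " => Stmt.seq

namespace Stmt

open scoped Classical in
/-- The effect of a statement. -/
def run (I : Input) : Stmt → St → St
  | setN a k, σ => σ.setV a k
  | addN a b c, σ => σ.setV a (σ.v b + σ.v c)
  | subN a b c, σ => σ.setV a (σ.v b - σ.v c)
  | readBit a b c, σ => σ.setV a (I.bitArr (σ.v b) (σ.v c)).toNat
  | set k e, σ => σ.setX k 0 (e.eval I σ)
  | setArr k a e, σ => σ.setX k (σ.v a) (e.eval I σ)
  | seq P Q, σ => Q.run I (P.run I σ)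
  | ifN a b P Q, σ => if σ.v a < σ.v b then P.run I σ else Q.run I σ
  | ifR k k' P Q, σ => if (σ.x k 0).re < (σ.x k' 0).re then P.run I σ else Q.run I σ
  | loop i b P, σ =>
      (fun τ => (P.run I τ).setV i ((P.run I τ).v i + 1))^[σ.v b] (σ.setV i 0)

/-- The integer variables that a statement may change. -/
def writes : Stmt → Finset (Fin 32)
  | setN a _ => {a}
  | addN a _ _ => {a}
  | subN a _ _ => {a}
  | readBit a _ _ => {a}
  | set _ _ => ∅
  | setArr _ _ _ => ∅
  | seq P Q => P.writes ∪ Q.writes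
  | ifN _ _ P Q => P.writes ∪ Q.writes
  | ifR _ _ P Q => P.writes ∪ Q.writes
  | loop i _ P => {i} ∪ P.writes

/-- The arrays that a statement may change. -/
def writesX : Stmt → Finset (Fin 32)
  | setN _ _ => ∅
  | addN _ _ _ => ∅
  | subN _ _ _ => ∅
  | readBit _ _ _ => ∅
  | set k _ => {k}
  | setArr k _ _ => {k}
  | seq P Q => P.writesX ∪ Q.writesX
  | ifN _ _ P Q => P.writesX ∪ Q.writesX
  | ifR _ _ P Q => P.writesX ∪ Q.writesX
  | loop _ _ P => P.writesX

/-- The variables that bound the loops of a statement. -/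
def bounds : Stmt → Finset (Fin 32)
  | seq P Q => P.bounds ∪ Q.bounds
  | ifN _ _ P Q => P.bounds ∪ Q.bounds
  | ifR _ _ P Q => P.bounds ∪ Q.bounds
  | loop _ b P => {b} ∪ P.bounds
  | _ => ∅

/-- No loop changes its own counter or the bounds of the loops. -/
def wf : Stmt → Bool
  | seq P Q => P.wf && Q.wf && decide (Disjoint P.writes Q.bounds)
  | ifN _ _ P Q => P.wf && Q.wf
  | ifR _ _ P Q => P.wf && Q.wf
  | loop i b P => P.wf && decide (i ∉ P.writes) && decide (i ≠ b) &&
      decide (Disjoint ({i} ∪ P.writes) ({b} ∪ P.bounds))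
  | _ => true

/-- The translation into a program of the machine. -/
def compile : Stmt → Prog
  | setN a k => .ofList [.constN a k]
  | addN a b c => .ofList [.addN a b c]
  | subN a b c => .ofList [.subN a b c]
  | readBit a b c => .ofList [.readBit a b c]
  | set k e => .ofList (e.code 0 ++ [.constN 40 (2 * k), .storeR 40 64, .constN 40 (2 * k + 1),
      .storeR 40 65])
  | setArr k a e => .ofList (e.code 0 ++ (CExp.addrCode k a ++ [.storeR 40 64, .constN 41 1,
      .addN 40 40 41, .storeR 40 65]))
  | seq P Q => .seq P.compile Q.compile
  | ifN a b P Q => .ite (.ltN a b) P.compile Q.compile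
  | ifR k k' P Q => .ite (.ltR (2 * k) (2 * k')) P.compile Q.compile
  | loop i b P => .seq (.instr (.constN i 0)) (.while (.ltN i b)
      (.seq P.compile (.seq (.instr (.constN 41 1)) (.instr (.addN i i 41)))))

/-- A bound for the number of steps if no loop is run more than `B` times. -/
def cost (B : ℕ) : Stmt → ℕ
  | setN _ _ => 2
  | addN _ _ _ => 2
  | subN _ _ _ => 2
  | readBit _ _ _ => 2
  | set _ e => (e.code 0).length + 5
  | setArr _ _ e => (e.code 0).length + 14
  | seq P Q => P.cost B + Q.cost B
  | ifN _ _ P Q => P.cost B + Q.cost B + 1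
  | ifR _ _ P Q => P.cost B + Q.cost B + 1
  | loop _ _ P => B * (P.cost B + 3) + 2

lemma run_loop (I : Input) (i b : Fin 32) (P : Stmt) (σ : St) : (loop i b P).run I σ =
    (fun τ => (P.run I τ).setV i ((P.run I τ).v i + 1))^[σ.v b] (σ.setV i 0) := rfl

lemma run_v_of_notMem (I : Input) {a : Fin 32} {P : Stmt} (h : a ∉ P.writes) (σ : St) :
    (P.run I σ).v a = σ.v a := by
  induction P generalizing σ with
  | setN | addN | subN | readBit =>
    simp only [writes, Finset.mem_singleton] at h
    simp [run, h]
  | set | setArr => simp [run]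
  | seq P Q ih ih' =>
    simp only [writes, Finset.mem_union, not_or] at h
    simp [run, ih h.1, ih' h.2]
  | ifN _ _ P Q ih ih' | ifR _ _ P Q ih ih' =>
    simp only [writes, Finset.mem_union, not_or] at h
    simp only [run]
    split_ifs
    · exact ih h.1 σ
    · exact ih' h.2 σ
  | loop i b P ih =>
    simp only [writes, Finset.mem_union, Finset.mem_singleton, not_or] at h
    rw [run_loop]
    have : ∀ (n : ℕ) (τ : St), ((fun τ => (P.run I τ).setV i ((P.run I τ).v i + 1))^[n] τ).v a =
        τ.v a := by
      intro n
      induction n with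
      | zero => intro τ; rfl
      | succ n ihn =>
        intro τ
        rw [Function.iterate_succ_apply, ihn]
        simp [h.1, ih h.2]
    rw [this]
    simp [h.1]

lemma run_x_of_notMem (I : Input) {k : Fin 32} {P : Stmt} (h : k ∉ P.writesX) (σ : St) :
    (P.run I σ).x k = σ.x k := by
  induction P generalizing σ with
  | setN | addN | subN | readBit => simp [run]
  | set | setArr =>
    simp only [writesX, Finset.mem_singleton] at h
    funext j
    simp [run, h]
  | seq P Q ih ih' =>
    simp only [writesX, Finset.mem_union, not_or] at h
    simp [run, ih h.1, ih' h.2]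
  | ifN _ _ P Q ih ih' | ifR _ _ P Q ih ih' =>
    simp only [writesX, Finset.mem_union, not_or] at h
    simp only [run]
    split_ifs
    · exact ih h.1 σ
    · exact ih' h.2 σ
  | loop i b P ih =>
    rw [run_loop]
    have : ∀ (n : ℕ) (τ : St), ((fun τ => (P.run I τ).setV i ((P.run I τ).v i + 1))^[n] τ).x k =
        τ.x k := by
      intro n
      induction n with
      | zero => intro τ; rfl
      | succ n ihn =>
        intro τ
        rw [Function.iterate_succ_apply, ihn]
        simp only [St.setV_x]
        exact ih h τ
    rw [this]
    simp

/-- The invariant rule for loops. -/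
lemma run_loop_induct (I : Input) {i b : Fin 32} {P : Stmt} (hi : i ∉ P.writes) (σ : St)
    (Inv : ℕ → St → Prop) (h0 : Inv 0 (σ.setV i 0))
    (hs : ∀ j < σ.v b, ∀ τ, τ.v i = j → Inv j τ → Inv (j + 1) ((P.run I τ).setV i (j + 1))) :
    Inv (σ.v b) ((loop i b P).run I σ) := by
  rw [run_loop]
  have : ∀ n ≤ σ.v b,
      ((fun τ => (P.run I τ).setV i ((P.run I τ).v i + 1))^[n] (σ.setV i 0)).v i = n ∧
      Inv n ((fun τ => (P.run I τ).setV i ((P.run I τ).v i + 1))^[n] (σ.setV i 0)) := by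
    intro n
    induction n with
    | zero => intro _; exact ⟨by simp, h0⟩
    | succ n ih =>
      intro hn
      obtain ⟨h1, h2⟩ := ih (by omega)
      rw [Function.iterate_succ_apply']
      generalize (fun τ => (P.run I τ).setV i ((P.run I τ).v i + 1))^[n] (σ.setV i 0) = τ at *
      simp only [run_v_of_notMem I hi, h1]
      exact ⟨by simp, hs n (by omega) τ h1 h2⟩
  exact (this _ le_rfl).2

/-- Since `wf` forbids a statement to change the bounds of loops that are still to run, the bounds
at the start are those in force throughout, and a single hypothesis on the initial state controls
the whole running time. -/
lemma compile_spec (I : Input) (B : ℕ) (P : Stmt) (hw : P.wf = true) (σ : St) (s : Mem)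
    (hr : Rep σ s) (hB : ∀ b ∈ P.bounds, σ.v b ≤ B) :
    ∃ t s', Exec I P.compile s t s' ∧ t ≤ P.cost B ∧ Rep (P.run I σ) s' := by
  have h40 : ∀ (σ : St) (s : Mem), Rep σ s → Rep σ (s.setN 40 0) := fun σ s h =>
    h.of_agree (fun a ha => by
      have : a ≠ 40 := by omega
      simp [Mem.setN, this]) fun _ _ => rfl
  have setv : ∀ (σ : St) (s : Mem) (a : Fin 32) (k : ℕ), Rep σ s →
      Rep (σ.setV a k) (s.setN a k) := by
    intro σ s a k h
    refine ⟨fun b => ?_, fun k i => h.2 k i⟩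
    simp only [Mem.setN, St.setV_v, Function.update_apply, ← h.1 b, Fin.ext_iff]
  have setx : ∀ (σ : St) (s s' : Mem) (k : Fin 32) (i : ℕ) (c : ℂ), Rep σ s →
      (∀ a < 32, s'.N a = s.N a) →
      (∀ j, j % 128 < 64 → j ≠ 128 * i + 2 * k → j ≠ 128 * i + 2 * k + 1 → s'.R j = s.R j) →
      s'.R (128 * i + 2 * k) = c.re → s'.R (128 * i + 2 * k + 1) = c.im →
      Rep (σ.setX k i c) s' := by
    intro σ s s' k i c h hN hR h1 h2
    refine ⟨fun b => (hN b b.2).trans (h.1 b), fun k' i' => ?_⟩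
    have hk := k.2
    have hk' := k'.2
    by_cases hc : k' = k ∧ i' = i
    · obtain ⟨rfl, rfl⟩ := hc
      simp [h1, h2]
    · simp only [St.setX_x, hc, if_false]
      rw [Fin.ext_iff] at hc
      rw [hR _ (by omega) (by omega) (by omega), hR _ (by omega) (by omega) (by omega)]
      exact h.2 k' i'
  induction P generalizing σ s with
  | setN a k => exact ⟨_, _, exec_ofList I _ s, le_rfl, h40 _ _ (setv σ s a k hr)⟩
  | addN a b c =>
    refine ⟨_, _, exec_ofList I _ s, le_rfl, h40 _ _ ?_⟩
    have := setv σ s a (s.N b + s.N c) hr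
    rw [hr.1, hr.1] at this
    simpa [Instr.exec, run, hr.1] using this
  | subN a b c =>
    refine ⟨_, _, exec_ofList I _ s, le_rfl, h40 _ _ ?_⟩
    have := setv σ s a (s.N b - s.N c) hr
    rw [hr.1, hr.1] at this
    simpa [Instr.exec, run, hr.1] using this
  | readBit a b c =>
    refine ⟨_, _, exec_ofList I _ s, le_rfl, h40 _ _ ?_⟩
    simpa [Instr.exec, run, hr.1] using setv σ s a _ hr
  | set k e =>
    refine ⟨_, _, exec_ofList I _ s, by simp [cost], h40 _ _ ?_⟩
    obtain ⟨a1, a2, a3, a4⟩ := e.code_spec I σ 0 s hr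
    rw [execList_append]
    generalize execList I s (e.code 0) = s' at *
    have hk := k.2
    refine setx σ s _ k 0 _ hr (fun a ha => ?_) (fun j hj h1 h2 => ?_) ?_ ?_
    · have h1 : a ≠ 40 := by omega
      simp [Instr.exec, Mem.setN, Mem.setR, Function.update_apply, h1, a1 a ha]
    · have h1' : j ≠ 2 * (k : ℕ) := by omega
      have h2' : j ≠ 2 * (k : ℕ) + 1 := by omega
      simp [Instr.exec, Mem.setN, Mem.setR, Function.update_apply, h1', h2', a2 j (Or.inr hj)]
    · simpa [Instr.exec, Mem.setN, Mem.setR, Function.update_apply] using a3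
    · have h1 : 65 ≠ 2 * (k : ℕ) := by omega
      simpa [Instr.exec, Mem.setN, Mem.setR, Function.update_apply, h1] using a4
  | setArr k a e =>
    refine ⟨_, _, exec_ofList I _ s, by simp [cost, CExp.addrCode], h40 _ _ ?_⟩
    obtain ⟨a1, a2, a3, a4⟩ := e.code_spec I σ 0 s hr
    rw [execList_append, execList_append]
    generalize execList I s (e.code 0) = s' at *
    obtain ⟨b1, b2, b3⟩ := addrCode_spec I k a s'
    generalize execList I s' (CExp.addrCode k a) = s'' at *
    rw [a1 a a.2, hr.1] at b2
    have hk := k.2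
    refine setx σ s _ k _ _ hr (fun a ha => ?_) (fun j hj h1 h2 => ?_) ?_ ?_
    · have h1 : a ≠ 40 := by omega
      have h2 : a ≠ 41 := by omega
      simp [Instr.exec, Mem.setN, Mem.setR, Function.update_apply, h1, h2, b1 a ha, a1 a ha]
    · simp [Instr.exec, Mem.setN, Mem.setR, Function.update_apply, b2, b3, h1, h2,
        a2 j (Or.inr hj)]
    · simpa [Instr.exec, Mem.setN, Mem.setR, Function.update_apply, b2, b3] using a3
    · have h1 : 65 ≠ 128 * σ.v a + 2 * (k : ℕ) := by omega
      simpa [Instr.exec, Mem.setN, Mem.setR, Function.update_apply, b2, b3, h1] using a4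
  | seq P Q ih ih' =>
    simp only [wf, Bool.and_eq_true, decide_eq_true_eq] at hw
    obtain ⟨t, s', h1, h2, h3⟩ := ih hw.1.1 σ s hr fun b hb => hB b (by simp [bounds, hb])
    obtain ⟨t', s'', h4, h5, h6⟩ := ih' hw.1.2 (P.run I σ) s' h3 fun b hb => by
      rw [run_v_of_notMem I (fun h => Finset.disjoint_left.1 hw.2 h hb)]
      exact hB b (by simp [bounds, hb])
    exact ⟨_, _, Exec.seq h1 h4, by simp only [cost]; omega, h6⟩
  | ifN a b P Q ih ih' =>
    simp only [wf, Bool.and_eq_true] at hw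
    simp only [run]
    split_ifs with hc
    · obtain ⟨t, s', h1, h2, h3⟩ := ih hw.1 σ s hr fun b hb => hB b (by simp [bounds, hb])
      exact ⟨_, _, Exec.ite_true (by simpa [Test.holds, hr.1] using hc) h1,
        by simp only [cost]; omega, h3⟩
    · obtain ⟨t, s', h1, h2, h3⟩ := ih' hw.2 σ s hr fun b hb => hB b (by simp [bounds, hb])
      exact ⟨_, _, Exec.ite_false (by simpa [Test.holds, hr.1] using hc) h1,
        by simp only [cost]; omega, h3⟩
  | ifR k k' P Q ih ih' =>
    simp only [wf, Bool.and_eq_true] at hw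
    have e1 := (hr.2 k 0).1
    have e2 := (hr.2 k' 0).1
    simp only [mul_zero, zero_add] at e1 e2
    simp only [run]
    split_ifs with hc
    · obtain ⟨t, s', h1, h2, h3⟩ := ih hw.1 σ s hr fun b hb => hB b (by simp [bounds, hb])
      exact ⟨_, _, Exec.ite_true (by simpa [Test.holds, e1, e2] using hc) h1,
        by simp only [cost]; omega, h3⟩
    · obtain ⟨t, s', h1, h2, h3⟩ := ih' hw.2 σ s hr fun b hb => hB b (by simp [bounds, hb])
      exact ⟨_, _, Exec.ite_false (by simpa [Test.holds, e1, e2] using hc) h1,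
        by simp only [cost]; omega, h3⟩
  | loop i b P ih =>
    simp only [wf, Bool.and_eq_true, decide_eq_true_eq] at hw
    obtain ⟨⟨⟨hw1, hi⟩, hib⟩, hd⟩ := hw
    rw [run_loop]
    -- The machine compares counter and bound while `run` iterates a fixed number of times; the two
    -- are matched by induction on the number of remaining rounds, bound minus counter.
    have main : ∀ (n : ℕ) (τ : St) (s : Mem), Rep τ s → τ.v b = τ.v i + n → n ≤ B →
        (∀ c ∈ P.bounds, τ.v c ≤ B) → ∃ t s',
        Exec I (.while (.ltN i b)
          (.seq P.compile (.seq (.instr (.constN 41 1)) (.instr (.addN i i 41))))) s t s' ∧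
        t ≤ n * (P.cost B + 3) + 1 ∧
        Rep ((fun τ => (P.run I τ).setV i ((P.run I τ).v i + 1))^[n] τ) s' := by
      intro n
      induction n with
      | zero =>
        intro τ s hr hn _ _
        exact ⟨_, _, Exec.while_false (by simp [Test.holds, hr.1, hn]), by omega, hr⟩
      | succ n ihn =>
        intro τ s hr hn hnB hc
        obtain ⟨t, s', h1, h2, h3⟩ := ih hw1 τ s hr hc
        have hr' : Rep ((P.run I τ).setV i ((P.run I τ).v i + 1))
            (Instr.exec I (Instr.exec I s' (.constN 41 1)) (.addN i i 41)) := by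
          have hi' : (i : ℕ) ≠ 41 := by have := i.2; omega
          have := setv _ (s'.setN 41 1) i ((P.run I τ).v i + 1)
            (h3.of_agree (fun a ha => by
              have : a ≠ 41 := by omega
              simp [Mem.setN, this]) fun _ _ => rfl)
          simpa [Instr.exec, Mem.setN, hi', h3.1] using this
        have hb' : b ∉ P.writes := fun h => Finset.disjoint_left.1 hd
          (Finset.mem_union_right _ h) (by simp)
        obtain ⟨t', s'', h4, h5, h6⟩ := ihn _ _ hr' (by
            simp only [St.setV_v, if_true, if_neg (Ne.symm hib), run_v_of_notMem I hi,
              run_v_of_notMem I hb']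
            omega) (by omega) (by
            intro c hcP
            have hci : c ≠ i := by
              rintro rfl
              exact Finset.disjoint_left.1 hd (by simp) (Finset.mem_union_right _ hcP)
            have hcw : c ∉ P.writes := fun h => Finset.disjoint_left.1 hd
              (Finset.mem_union_right _ h) (Finset.mem_union_right _ hcP)
            simp only [St.setV_v, hci, if_false, run_v_of_notMem I hcw]
            exact hc c hcP)
        refine ⟨_, _, Exec.while_true (by simp [Test.holds, hr.1, hn])
          (Exec.seq h1 (Exec.seq (Exec.instr _ _) (Exec.instr _ _))) h4, ?_, h6⟩
        rw [add_mul]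
        omega
    obtain ⟨t, s', h1, h2, h3⟩ := main (σ.v b) (σ.setV i 0) _ (setv σ s i 0 hr)
      (by simp [Ne.symm hib]) (hB b (by simp [bounds])) (fun c hc => by
        have hci : c ≠ i := by
          rintro rfl
          exact Finset.disjoint_left.1 hd (by simp) (Finset.mem_union_right _ hc)
        simp only [St.setV_v, hci, if_false]
        exact hB c (by simp [bounds, hc]))
    refine ⟨_, _, Exec.seq (Exec.instr _ _) h1, ?_, h3⟩
    have : σ.v b * (P.cost B + 3) ≤ B * (P.cost B + 3) :=
      Nat.mul_le_mul_right _ (hB b (by simp [bounds]))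
    simp only [cost]
    omega

end Stmt
end TraceRec
end

noncomputable section
namespace TraceRec

/-! ### Transfer operators on the binary tree

The nodes are numbered as in a heap: the children of `j` are `2 j + 1` and `2 j + 2`. -/

open scoped BoundedContinuousFunction

/-- The value at the parent of the node `e`, if `e` is the child with label `b`. -/
def coupling (b : Bool) (g : ℕ → ℂ) (e : ℕ) : ℂ :=
  if e ≠ 0 ∧ decide (e % 2 = 0) = b then g ((e - 1) / 2) else 0

/-- The transfer operator of one bit. -/
def transfer (d : ℕ → ℂ) (r : ℝ) (b : Bool) (g : ℕ → ℂ) (e : ℕ) : ℂ :=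
  d e * g e + r * coupling b g e

/-- Every node except the root is a child with exactly one label, so the average over an inserted
bit couples each node to its parent independently of labels. -/
lemma coupling_true_add_false (g : ℕ → ℂ) (e : ℕ) :
    coupling true g e + coupling false g e = if e = 0 then 0 else g ((e - 1) / 2) := by
  unfold coupling
  by_cases h : e = 0 <;> by_cases h' : e % 2 = 0 <;> simp [h, h']

lemma norm_coupling_le {g : ℕ → ℂ} {B : ℝ} (hB : 0 ≤ B) (b : Bool) (e : ℕ)
    (h : ‖g ((e - 1) / 2)‖ ≤ B) : ‖coupling b g e‖ ≤ B := by
  unfold coupling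
  split_ifs
  · exact h
  · simpa using hB

/-- Multiplication by a bounded function. -/
def diagL (D : ℕ →ᵇ ℂ) : (ℕ →ᵇ ℂ) →L[ℂ] (ℕ →ᵇ ℂ) := ContinuousLinearMap.mul ℂ (ℕ →ᵇ ℂ) D

@[simp] lemma diagL_apply (D g : ℕ →ᵇ ℂ) (e : ℕ) : diagL D g e = D e * g e := rfl

lemma norm_diagL_le (D : ℕ →ᵇ ℂ) : ‖diagL D‖ ≤ ‖D‖ :=
  ContinuousLinearMap.opNorm_mul_apply_le ℂ (ℕ →ᵇ ℂ) D

def couplingL (b : Bool) : (ℕ →ᵇ ℂ) →L[ℂ] (ℕ →ᵇ ℂ) :=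
  LinearMap.mkContinuous
    { toFun := fun g => BoundedContinuousFunction.ofNormedAddCommGroupDiscrete (coupling b g) ‖g‖
        fun e => norm_coupling_le (norm_nonneg _) b e (g.norm_coe_le_norm _)
      map_add' := fun g g' => by
        ext e
        simp only [BoundedContinuousFunction.coe_ofNormedAddCommGroupDiscrete,
          BoundedContinuousFunction.coe_add, Pi.add_apply, coupling]
        split_ifs <;> simp
      map_smul' := fun c g => by
        ext e
        simp only [BoundedContinuousFunction.coe_ofNormedAddCommGroupDiscrete,
          BoundedContinuousFunction.coe_smul, coupling, RingHom.id_apply]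
        split_ifs <;> simp } 1 fun g => by
    rw [one_mul]
    exact (BoundedContinuousFunction.norm_le (norm_nonneg _)).2 fun e =>
      norm_coupling_le (norm_nonneg _) b e (g.norm_coe_le_norm _)

@[simp] lemma couplingL_apply (b : Bool) (g : ℕ →ᵇ ℂ) (e : ℕ) :
    couplingL b g e = coupling b g e := rfl

lemma norm_couplingL_le (b : Bool) : ‖couplingL b‖ ≤ 1 :=
  LinearMap.mkContinuous_norm_le _ zero_le_one _

/-- The weight r results from scaling the coordinate of a word of length k by r^k. A small r makes
the operator a perturbation of its diagonal in the supremum norm; the price is a factor r^{-(l+1)}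
in the final estimate. -/
def transferL (D : ℕ →ᵇ ℂ) (r : ℝ) (b : Bool) : (ℕ →ᵇ ℂ) →L[ℂ] (ℕ →ᵇ ℂ) :=
  diagL D + (r : ℂ) • couplingL b

@[simp] lemma transferL_apply (D : ℕ →ᵇ ℂ) (r : ℝ) (b : Bool) (g : ℕ →ᵇ ℂ) (e : ℕ) :
    transferL D r b g e = transfer D r b g e := by
  simp [transferL, transfer]

/-- `(1 - q') + q' (M_0 + M_1) / 2`. -/
def deltaL (D : ℕ →ᵇ ℂ) (r q' : ℝ) : (ℕ →ᵇ ℂ) →L[ℂ] (ℕ →ᵇ ℂ) :=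
  ((1 - q' : ℝ) : ℂ) • 1 + ((q' / 2 : ℝ) : ℂ) • (transferL D r true + transferL D r false)

lemma deltaL_apply (D : ℕ →ᵇ ℂ) (r q' : ℝ) (g : ℕ →ᵇ ℂ) (e : ℕ) :
    deltaL D r q' g e = (1 - q' + q' * D e) * g e +
      q' * r / 2 * (if e = 0 then 0 else g ((e - 1) / 2)) := by
  rw [← coupling_true_add_false]
  simp [deltaL, transfer]
  ring

/-- The operator of one bit of the trace. -/
def traceL (D : ℕ →ᵇ ℂ) (r q q' : ℝ) (b : Bool) : (ℕ →ᵇ ℂ) →L[ℂ] (ℕ →ᵇ ℂ) :=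
  ((1 - q : ℝ) : ℂ)⁻¹ • (Ring.inverse (deltaL D r q') * transferL D r b - (q : ℂ) • 1)

lemma norm_delta_diag {q' : ℝ} (h0 : 0 ≤ q') {w : ℂ} (hw : 0 ≤ w.re) :
    1 - q' ≤ ‖(1 - q' + q' * w : ℂ)‖ := by
  refine le_trans ?_ (Complex.re_le_norm _)
  simp only [Complex.add_re, Complex.sub_re, Complex.one_re, Complex.ofReal_re, Complex.mul_re,
    Complex.ofReal_im, zero_mul, sub_zero]
  nlinarith

/-- The operator is its diagonal δ times 1 + δ⁻¹ C, where C carries the couplings. Since |δ| ≥ 1 -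
q' and ‖C‖ ≤ q' r, the condition r < 1 - q' makes the Neumann series converge. -/
lemma isUnit_deltaL {D : ℕ →ᵇ ℂ} {r q' : ℝ} (h0 : 0 ≤ q') (h1 : q' < 1) (hr : 0 ≤ r)
    (hr' : r < 1 - q') (hD : ∀ e, 0 ≤ (D e).re) : IsUnit (deltaL D r q') := by
  have hc : 0 < 1 - q' := by linarith
  have hb : ∀ e, ‖(1 - q' + q' * D e : ℂ)⁻¹‖ ≤ (1 - q')⁻¹ := fun e => by
    rw [norm_inv]
    exact inv_anti₀ hc (norm_delta_diag h0 (hD e))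
  have hne : ∀ e, (1 - q' + q' * D e : ℂ) ≠ 0 := fun e => by
    rw [← norm_pos_iff]
    exact hc.trans_le (norm_delta_diag h0 (hD e))
  set δ : ℕ →ᵇ ℂ := ((1 - q' : ℝ) : ℂ) • 1 + (q' : ℂ) • D with hδ
  set δi : ℕ →ᵇ ℂ := BoundedContinuousFunction.ofNormedAddCommGroupDiscrete
    (fun e => (1 - q' + q' * D e : ℂ)⁻¹) _ hb with hδi
  have hδe : ∀ e, δ e = 1 - q' + q' * D e := fun e => by simp [hδ]
  have hδie : ∀ e, δi e = (1 - q' + q' * D e : ℂ)⁻¹ := fun e => rfl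
  have hδin : ‖δi‖ ≤ (1 - q')⁻¹ :=
    (BoundedContinuousFunction.norm_le (inv_nonneg.2 hc.le)).2 hb
  have h1 : diagL δ * diagL δi = 1 := by
    ext g e
    simp [hδe, hδie, hne e]
  have h2 : diagL δi * diagL δ = 1 := by
    ext g e
    simp [hδe, hδie, hne e]
  set Cb := ((q' * r / 2 : ℝ) : ℂ) • (couplingL true + couplingL false) with hCb
  have hCn : ‖Cb‖ ≤ q' * r := by
    rw [hCb, norm_smul, Complex.norm_real, Real.norm_of_nonneg (by positivity)]
    have := (norm_add_le (couplingL true) (couplingL false)).trans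
      (add_le_add (norm_couplingL_le _) (norm_couplingL_le _))
    nlinarith [mul_nonneg h0 hr]
  have hdec : deltaL D r q' = diagL δ * (1 + diagL δi * Cb) := by
    rw [mul_add, mul_one, ← mul_assoc, h1, one_mul]
    ext g e
    simp [deltaL, hδe, hCb, transfer]
    ring
  rw [hdec]
  refine IsUnit.mul ⟨⟨diagL δ, diagL δi, h1, h2⟩, rfl⟩ ?_
  have : ‖-(diagL δi * Cb)‖ < 1 := by
    rw [norm_neg]
    calc ‖diagL δi * Cb‖ ≤ ‖diagL δi‖ * ‖Cb‖ := norm_mul_le _ _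
      _ ≤ (1 - q')⁻¹ * (q' * r) := by
        gcongr
        exact (norm_diagL_le _).trans hδin
      _ < 1 := by
        rw [inv_mul_lt_iff₀ hc, mul_one]
        nlinarith
  have h5 := isUnit_one_sub_of_norm_lt_one (R := (ℕ →ᵇ ℂ) →L[ℂ] (ℕ →ᵇ ℂ)) this
  rwa [sub_neg_eq_add] at h5

/-- What the analysis needs to know about the diagonal `D`, the weight `r` of the couplings, and
the rate `ρ` of contraction. -/
structure Contracts (D : ℕ →ᵇ ℂ) (r q q' ρ : ℝ) : Prop where
  q0 : 0 ≤ q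
  q1 : q < 1
  q'0 : 0 ≤ q'
  q'1 : q' < 1
  r0 : 0 ≤ r
  rlt : r < 1 - q'
  D0 : D 0 = 1
  re : ∀ e, 0 ≤ (D e).re
  lt : ρ < 1
  M : ∀ e ≠ 0, ‖D e‖ + r ≤ ρ
  N : ∀ e ≠ 0, ‖(D e / (1 - q' + q' * D e) - q) / (1 - q)‖ +
    3 / ((1 - q') ^ 2 * (1 - q)) * r ≤ ρ

namespace Contracts

variable {D : ℕ →ᵇ ℂ} {r q q' ρ : ℝ}

lemma ρ0 (h : Contracts D r q q' ρ) : 0 ≤ ρ :=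
  le_trans (add_nonneg (norm_nonneg _) h.r0) (h.M 1 one_ne_zero)

lemma isUnit (h : Contracts D r q q' ρ) : IsUnit (deltaL D r q') :=
  isUnit_deltaL h.q'0 h.q'1 h.r0 h.rlt h.re

lemma transfer_zero (h : Contracts D r q q' ρ) (b : Bool) (g : ℕ → ℂ) :
    transfer D r b g 0 = g 0 := by
  simp [transfer, coupling, h.D0]

lemma norm_transfer_le (h : Contracts D r q q' ρ) (b : Bool) {g : ℕ → ℂ} {B : ℝ} {e : ℕ}
    (he : e ≠ 0) (hg : ‖g e‖ ≤ B) (hg' : ‖g ((e - 1) / 2)‖ ≤ B) :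
    ‖transfer D r b g e‖ ≤ ρ * B := by
  have hB : 0 ≤ B := (norm_nonneg _).trans hg
  calc ‖transfer D r b g e‖ ≤ ‖D e‖ * ‖g e‖ + r * ‖coupling b g e‖ := by
        refine (norm_add_le _ _).trans (le_of_eq ?_)
        rw [norm_mul, norm_mul, Complex.norm_real, Real.norm_of_nonneg h.r0]
    _ ≤ ‖D e‖ * B + r * B := by
        have := h.r0
        have := norm_coupling_le hB b e hg'
        gcongr
    _ ≤ ρ * B := by rw [← add_mul]; exact mul_le_mul_of_nonneg_right (h.M e he) hB

lemma norm_transferL_le (h : Contracts D r q q' ρ) (b : Bool) : ‖transferL D r b‖ ≤ 1 := by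
  refine ContinuousLinearMap.opNorm_le_bound _ zero_le_one fun g => ?_
  rw [one_mul]
  refine (BoundedContinuousFunction.norm_le (norm_nonneg _)).2 fun e => ?_
  rw [transferL_apply]
  by_cases he : e = 0
  · subst he; rw [h.transfer_zero]; exact g.norm_coe_le_norm 0
  · refine (h.norm_transfer_le b he (g.norm_coe_le_norm _) (g.norm_coe_le_norm _)).trans ?_
    nlinarith [h.lt, norm_nonneg g]

/-- The equations that determine the operator of a bit of the trace. -/
lemma traceL_eq (h : Contracts D r q q' ρ) (b : Bool) (g : ℕ →ᵇ ℂ) : ∃ k : ℕ →ᵇ ℂ,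
    (∀ e, (1 - q' + q' * D e) * k e + q' * r / 2 * (if e = 0 then 0 else k ((e - 1) / 2)) =
      transfer D r b g e) ∧
    ∀ e, traceL D r q q' b g e = (k e - q * g e) / (1 - q) := by
  refine ⟨Ring.inverse (deltaL D r q') (transferL D r b g), fun e => ?_, fun e => ?_⟩
  · rw [← deltaL_apply, ← transferL_apply]
    have := Ring.mul_inverse_cancel _ h.isUnit
    change (deltaL D r q' * Ring.inverse (deltaL D r q')) (transferL D r b g) e = _
    rw [this]
    rfl
  · simp [traceL]
    ring

lemma delta_ne (h : Contracts D r q q' ρ) (e : ℕ) : (1 - q' + q' * D e : ℂ) ≠ 0 := by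
  rw [← norm_pos_iff]
  exact (sub_pos.2 h.q'1).trans_le (norm_delta_diag h.q'0 (h.re e))

lemma traceL_zero (h : Contracts D r q q' ρ) (b : Bool) (g : ℕ →ᵇ ℂ) :
    traceL D r q q' b g 0 = g 0 := by
  obtain ⟨k, h1, h2⟩ := h.traceL_eq b g
  have := h1 0
  rw [h.transfer_zero, h.D0] at this
  have hk : k 0 = g 0 := by simpa using this
  have : (1 - q : ℂ) ≠ 0 := by
    have := h.q1
    rw [sub_ne_zero]
    exact_mod_cast this.ne'
  rw [h2, hk]
  field_simp

/-- The diagonal entry at e is (d/(1-q'+q'd) - q)/(1-q). What remains are couplings to the parent,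
through g and through k = Δ⁻¹ M_b g. They amount to at most r (1 + 2/(1-q')) ≤ 3r/(1-q') times ‖g‖,
and dividing by (1-q')(1-q) produces the constant in the field `N` of `Contracts`. -/
lemma norm_traceL_apply_le (h : Contracts D r q q' ρ) (b : Bool) (g : ℕ →ᵇ ℂ) {e : ℕ}
    (he : e ≠ 0) : ‖traceL D r q q' b g e‖ ≤ ρ * ‖g‖ := by
  obtain ⟨k, h1, h2⟩ := h.traceL_eq b g
  have hc : 0 < 1 - q' := sub_pos.2 h.q'1
  have hp : 0 < 1 - q := sub_pos.2 h.q1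
  have hr := h.r0
  have hq' := h.q'0
  have hq'1 := h.q'1
  have hrlt := h.rlt
  have hpar : ∀ e : ℕ, ‖(if e = 0 then 0 else k ((e - 1) / 2) : ℂ)‖ ≤ ‖k‖ := fun e => by
    split_ifs
    · simp
    · exact k.norm_coe_le_norm _
  have hcoef : ‖(q' * r / 2 : ℂ)‖ ≤ r / 2 := by
    have : (q' * r / 2 : ℂ) = ((q' * r / 2 : ℝ) : ℂ) := by push_cast; ring
    rw [this, Complex.norm_real, Real.norm_of_nonneg (by positivity)]
    nlinarith
  -- A bootstrap: the equations give ‖k‖ ≤ ‖g‖/(1-q') + ‖k‖/2, because the coupling coefficient is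
  -- at most (1-q')/2.
  have hk : ‖k‖ ≤ 4 / (1 - q') * ‖g‖ := by
    have key : ∀ e, ‖k e‖ ≤ (1 - q')⁻¹ * (‖g‖ + (1 - q') / 2 * ‖k‖) := by
      intro e
      rw [← div_eq_inv_mul, le_div_iff₀ hc]
      have e1 : (1 - q' + q' * D e) * k e = transferL D r b g e -
          q' * r / 2 * (if e = 0 then 0 else k ((e - 1) / 2)) := by
        rw [transferL_apply, ← h1 e]; ring
      have e2 : ‖transferL D r b g e‖ ≤ ‖g‖ :=
        ((transferL D r b g).norm_coe_le_norm e).trans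
          (((transferL D r b).le_opNorm g).trans
            (mul_le_of_le_one_left (norm_nonneg _) (h.norm_transferL_le b)))
      calc ‖k e‖ * (1 - q') ≤ ‖k e‖ * ‖(1 - q' + q' * D e : ℂ)‖ := by
            gcongr
            exact norm_delta_diag hq' (h.re e)
        _ = ‖(1 - q' + q' * D e) * k e‖ := by rw [norm_mul, mul_comm]
        _ ≤ ‖transferL D r b g e‖ + ‖(q' * r / 2 : ℂ)‖ * ‖k‖ := by
            rw [e1]
            refine (norm_sub_le _ _).trans ?_
            rw [norm_mul _ (ite _ _ _)]
            gcongr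
            exact hpar e
        _ ≤ ‖g‖ + (1 - q') / 2 * ‖k‖ := by
            gcongr
            linarith
    have := (BoundedContinuousFunction.norm_le (f := k) (by positivity)).2 key
    rw [mul_add, ← mul_assoc, show (1 - q')⁻¹ * ((1 - q') / 2) = 1 / 2 by field_simp] at this
    have h4 : 4 / (1 - q') * ‖g‖ = 4 * ((1 - q')⁻¹ * ‖g‖) := by ring
    have : 0 ≤ (1 - q')⁻¹ * ‖g‖ := by positivity
    linarith
  have hδ := h.delta_ne e
  have hpne : (1 - q : ℂ) ≠ 0 := by
    rw [sub_ne_zero]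
    exact_mod_cast h.q1.ne'
  have e3 : traceL D r q q' b g e = (D e / (1 - q' + q' * D e) - q) / (1 - q) * g e +
      (1 - q' + q' * D e)⁻¹ * (1 - q : ℂ)⁻¹ * (r * coupling b g e - q' * r / 2 *
        (if e = 0 then 0 else k ((e - 1) / 2))) := by
    have e1 := h1 e
    rw [transfer] at e1
    have e1' : k e = (1 - q' + q' * D e)⁻¹ * (D e * g e + r * coupling b g e -
        q' * r / 2 * (if e = 0 then 0 else k ((e - 1) / 2))) := by
      rw [← e1]; field_simp; ring
    rw [h2, e1']
    field_simp
    ring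
  have hi1 : ‖(1 - q' + q' * D e : ℂ)⁻¹‖ ≤ (1 - q')⁻¹ := by
    rw [norm_inv]
    exact inv_anti₀ hc (norm_delta_diag hq' (h.re e))
  have hi2 : ‖(1 - q : ℂ)⁻¹‖ = (1 - q)⁻¹ := by
    have : (1 - q : ℂ)⁻¹ = (((1 - q)⁻¹ : ℝ) : ℂ) := by push_cast; ring
    rw [this, Complex.norm_real, Real.norm_of_nonneg (by positivity)]
  have hrest : ‖(r * coupling b g e - q' * r / 2 *
        (if e = 0 then 0 else k ((e - 1) / 2)) : ℂ)‖ ≤ r * (3 / (1 - q')) * ‖g‖ := by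
    calc _ ≤ ‖(r : ℂ)‖ * ‖coupling b g e‖ + ‖(q' * r / 2 : ℂ)‖ * ‖k‖ := by
          refine (norm_sub_le _ _).trans ?_
          rw [norm_mul, norm_mul _ (ite _ _ _)]
          gcongr
          exact hpar e
      _ ≤ r * ‖g‖ + r / 2 * (4 / (1 - q') * ‖g‖) := by
          rw [Complex.norm_real, Real.norm_of_nonneg hr]
          have := norm_coupling_le (norm_nonneg g) b e (g.norm_coe_le_norm _)
          gcongr
      _ = r * (1 + 2 / (1 - q')) * ‖g‖ := by ring
      _ ≤ r * (3 / (1 - q')) * ‖g‖ := by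
          gcongr
          rw [le_div_iff₀ hc, add_mul, div_mul_cancel₀ _ hc.ne']
          linarith
  rw [e3]
  calc _ ≤ ‖(D e / (1 - q' + q' * D e) - q) / (1 - q)‖ * ‖g‖ +
        (1 - q')⁻¹ * (1 - q)⁻¹ * (r * (3 / (1 - q')) * ‖g‖) := by
        refine (norm_add_le _ _).trans ?_
        rw [norm_mul, norm_mul ((1 - q' + q' * D e : ℂ)⁻¹ * (1 - q : ℂ)⁻¹), norm_mul, hi2]
        gcongr
        exact g.norm_coe_le_norm _
    _ = (‖(D e / (1 - q' + q' * D e) - q) / (1 - q)‖ +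
          3 / ((1 - q') ^ 2 * (1 - q)) * r) * ‖g‖ := by
        field_simp
    _ ≤ ρ * ‖g‖ := by
        gcongr
        exact h.N e he

lemma norm_traceL_le (h : Contracts D r q q' ρ) (b : Bool) : ‖traceL D r q q' b‖ ≤ 1 := by
  refine ContinuousLinearMap.opNorm_le_bound _ zero_le_one fun g => ?_
  rw [one_mul]
  refine (BoundedContinuousFunction.norm_le (norm_nonneg _)).2 fun e => ?_
  by_cases he : e = 0
  · subst he; rw [h.traceL_zero]; exact g.norm_coe_le_norm 0
  · refine (h.norm_traceL_apply_le b g he).trans ?_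
    nlinarith [h.lt, norm_nonneg g]

/-- The root coordinate is preserved, so the vectors vanishing there are invariant, and only on them
is the operator a strict contraction. Differences of vectors with the same root value are of this
kind, which makes every truncation below harmless. -/
lemma norm_traceL_root_le (h : Contracts D r q q' ρ) (b : Bool) {g : ℕ →ᵇ ℂ} (hg : g 0 = 0) :
    ‖traceL D r q q' b g‖ ≤ ρ * ‖g‖ := by
  refine (BoundedContinuousFunction.norm_le (mul_nonneg h.ρ0 (norm_nonneg _))).2 fun e => ?_
  by_cases he : e = 0
  · subst he; rw [h.traceL_zero, hg, norm_zero]; exact mul_nonneg h.ρ0 (norm_nonneg _)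
  · exact h.norm_traceL_apply_le b g he

lemma norm_transferL_root_le (h : Contracts D r q q' ρ) (b : Bool) {g : ℕ →ᵇ ℂ} (hg : g 0 = 0) :
    ‖transferL D r b g‖ ≤ ρ * ‖g‖ := by
  refine (BoundedContinuousFunction.norm_le (mul_nonneg h.ρ0 (norm_nonneg _))).2 fun e => ?_
  rw [transferL_apply]
  by_cases he : e = 0
  · subst he; rw [h.transfer_zero, hg, norm_zero]; exact mul_nonneg h.ρ0 (norm_nonneg _)
  · exact h.norm_transfer_le b he (g.norm_coe_le_norm _) (g.norm_coe_le_norm _)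

/-- The averages of `traceL` over the channel. -/
lemma add_smul_traceL (h : Contracts D r q q' ρ) (b : Bool) :
    (q : ℂ) • 1 + ((1 - q : ℝ) : ℂ) • traceL D r q q' b =
      Ring.inverse (deltaL D r q') * transferL D r b := by
  have hpne : ((1 - q : ℝ) : ℂ) ≠ 0 := by exact_mod_cast (sub_pos.2 h.q1).ne'
  rw [traceL, smul_smul, mul_inv_cancel₀ hpne, one_smul]
  abel

end Contracts

end TraceRec
end

noncomputable section
namespace TraceRec

/-! ### Expectations over the channel -/

open scoped BoundedContinuousFunction

section PMFMean

variable {α β : Type*} {V : Type*} [NormedAddCommGroup V] [NormedSpace ℝ V]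

/-- The expectation of a function under a discrete law. -/
def pmfMean (μ : PMF α) (g : α → V) : V := ∑' a, (μ a).toReal • g a

lemma summable_pmf_toReal (μ : PMF α) : Summable fun a => (μ a).toReal :=
  ENNReal.summable_toReal μ.tsum_coe_ne_top

variable [CompleteSpace V]

lemma summable_pmf_smul (μ : PMF α) {g : α → V} {B : ℝ} (hg : ∀ a, ‖g a‖ ≤ B) :
    Summable fun a => (μ a).toReal • g a :=
  Summable.of_norm_bounded ((summable_pmf_toReal μ).mul_right B) fun a => by
    rw [norm_smul, Real.norm_of_nonneg ENNReal.toReal_nonneg]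
    exact mul_le_mul_of_nonneg_left (hg a) ENNReal.toReal_nonneg

lemma pmfMean_pure (a : α) (g : α → V) : pmfMean (PMF.pure a) g = g a := by
  classical
  rw [pmfMean, tsum_eq_single a fun b hb => by simp [PMF.pure_apply, hb]]
  simp [PMF.pure_apply]

lemma pmfMean_bind (μ : PMF α) (κ : α → PMF β) {g : β → V} {B : ℝ} (hg : ∀ b, ‖g b‖ ≤ B) :
    pmfMean (μ.bind κ) g = pmfMean μ fun a => pmfMean (κ a) g := by
  have hs : Summable fun p : α × β => (μ p.1 * κ p.1 p.2).toReal := by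
    refine ENNReal.summable_toReal ?_
    rw [ENNReal.tsum_prod (f := fun a b => μ a * κ a b)]
    simp [ENNReal.tsum_mul_left, PMF.tsum_coe]
  have hs' : Summable fun p : α × β => (μ p.1 * κ p.1 p.2).toReal • g p.2 :=
    Summable.of_norm_bounded (hs.mul_right B) fun p => by
      rw [norm_smul, Real.norm_of_nonneg ENNReal.toReal_nonneg]
      exact mul_le_mul_of_nonneg_left (hg _) ENNReal.toReal_nonneg
  have hcol : ∀ b, Summable fun a => (μ a * κ a b).toReal := fun b => by
    refine ENNReal.summable_toReal ?_
    rw [← PMF.bind_apply]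
    exact (μ.bind κ).apply_ne_top b
  calc pmfMean (μ.bind κ) g = ∑' b, ∑' a, (μ a * κ a b).toReal • g b := by
        refine tsum_congr fun b => ?_
        rw [PMF.bind_apply, ENNReal.tsum_toReal_eq fun a =>
          ENNReal.mul_ne_top (μ.apply_ne_top a) ((κ a).apply_ne_top b)]
        exact ((hcol b).tsum_smul_const (g b)).symm
    _ = ∑' a, ∑' b, (μ a * κ a b).toReal • g b :=
        Summable.tsum_comm (f := fun a b => (μ a * κ a b).toReal • g b) hs'
    _ = pmfMean μ fun a => pmfMean (κ a) g := by
        refine tsum_congr fun a => ?_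
        change _ = (μ a).toReal • ∑' b, (κ a b).toReal • g b
        rw [← (summable_pmf_smul (κ a) hg).tsum_const_smul]
        refine tsum_congr fun b => ?_
        rw [ENNReal.toReal_mul, mul_smul]

end PMFMean

/-! ### Operator-valued means over deletions, insertions and blocks. -/

section Algebra

variable {α : Type*} {A : Type*} [NormedRing A] [NormedAlgebra ℝ A] [CompleteSpace A]

lemma pmfMean_const_mul (μ : PMF α) {g : α → A} {B : ℝ} (hg : ∀ a, ‖g a‖ ≤ B) (u : A) :
    pmfMean μ (fun a => u * g a) = u * pmfMean μ g := by
  rw [pmfMean, pmfMean, ← (summable_pmf_smul μ hg).tsum_mul_left]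
  simp only [mul_smul_comm]

lemma pmfMean_mul_const (μ : PMF α) {g : α → A} {B : ℝ} (hg : ∀ a, ‖g a‖ ≤ B) (u : A) :
    pmfMean μ (fun a => g a * u) = pmfMean μ g * u := by
  rw [pmfMean, pmfMean, ← (summable_pmf_smul μ hg).tsum_mul_right]
  simp only [smul_mul_assoc]

/-- The ordered product of the operators of the letters of a string. -/
def listProd (N : Bool → A) (L : List Bool) : A := (L.map N).prod

@[simp] lemma listProd_nil (N : Bool → A) : listProd N [] = 1 := rfl

@[simp] lemma listProd_cons (N : Bool → A) (b : Bool) (L : List Bool) :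
    listProd N (b :: L) = N b * listProd N L := by simp [listProd]

lemma listProd_append (N : Bool → A) (L L' : List Bool) :
    listProd N (L ++ L') = listProd N L * listProd N L' := by simp [listProd]

variable [NormOneClass A]

lemma norm_listProd_le {N : Bool → A} (hN : ∀ b, ‖N b‖ ≤ 1) (L : List Bool) :
    ‖listProd N L‖ ≤ 1 := by
  induction L with
  | nil => simp
  | cons b L ih =>
    rw [listProd_cons]
    exact (norm_mul_le _ _).trans (mul_le_one₀ (hN b) (norm_nonneg _) ih)

/-- The average of the operator of a letter and the identity over a deletion. -/
def deletionMean (q : ℝ) (N : Bool → A) (b : Bool) : A := q • 1 + (1 - q) • N b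

lemma norm_deletionMean_le {q : ℝ} (h0 : 0 ≤ q) (h1 : q ≤ 1) {N : Bool → A}
    (hN : ∀ b, ‖N b‖ ≤ 1) (b : Bool) : ‖deletionMean q N b‖ ≤ 1 := by
  refine (norm_add_le _ _).trans ?_
  rw [norm_smul, norm_smul, norm_one, Real.norm_of_nonneg h0, Real.norm_of_nonneg (by linarith)]
  nlinarith [hN b]

/-- The letters are deleted independently, so the mean of the ordered product is the ordered product
of the means, although the factors do not commute. -/
lemma pmfMean_deleteBits (q : Set.Ico (0 : ℝ) 1) {N : Bool → A} (hN : ∀ b, ‖N b‖ ≤ 1)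
    (L : List Bool) :
    pmfMean (deleteBits q L) (listProd N) = listProd (deletionMean q N) L := by
  have hb := norm_listProd_le hN
  have h0 : (0 : ℝ) ≤ q := q.2.1
  have h1 : (0 : ℝ) ≤ 1 - q := by linarith [q.2.2]
  induction L with
  | nil => rw [deleteBits, pmfMean_pure]; rfl
  | cons b L ih =>
    rw [deleteBits, pmfMean_bind _ _ hb, listProd_cons]
    have : ∀ d : Bool, pmfMean ((deleteBits q L).bind fun L' =>
        PMF.pure (if d then L' else b :: L')) (listProd N) =
        (if d then 1 else N b) * listProd (deletionMean q N) L := by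
      intro d
      rw [pmfMean_bind _ _ hb, ← ih, ← pmfMean_const_mul _ hb]
      refine congrArg _ (funext fun L' => ?_)
      rw [pmfMean_pure]
      cases d <;> simp
    simp only [this]
    rw [pmfMean, tsum_bool]
    simp [deletionCoin, PMF.ofFintype_apply, ENNReal.toReal_ofReal h0, ENNReal.toReal_ofReal h1,
      deletionMean, add_mul, add_comm]

lemma pmfMean_uniformBits {Q : Bool → A} (hQ : ∀ b, ‖Q b‖ ≤ 1) (k : ℕ) :
    pmfMean (uniformBits k) (listProd Q) = ((2⁻¹ : ℝ) • (Q true + Q false)) ^ k := by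
  have hb := norm_listProd_le hQ
  induction k with
  | zero => rw [uniformBits, pmfMean_pure, listProd_nil, pow_zero]
  | succ k ih =>
    rw [uniformBits, pmfMean_bind _ _ hb, pow_succ']
    have : ∀ d : Bool, pmfMean ((uniformBits k).bind fun L => PMF.pure (d :: L)) (listProd Q) =
        Q d * ((2⁻¹ : ℝ) • (Q true + Q false)) ^ k := by
      intro d
      rw [pmfMean_bind _ _ hb, ← ih, ← pmfMean_const_mul _ hb]
      refine congrArg _ (funext fun L' => ?_)
      rw [pmfMean_pure, listProd_cons]
    simp only [this]
    rw [pmfMean, tsum_bool]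
    simp [PMF.uniformOfFintype_apply, add_mul, add_comm]

lemma norm_half_le {Q : Bool → A} (hQ : ∀ b, ‖Q b‖ ≤ 1) :
    ‖(2⁻¹ : ℝ) • (Q true + Q false)‖ ≤ 1 := by
  rw [norm_smul]
  have := (norm_add_le (Q true) (Q false)).trans (add_le_add (hQ _) (hQ _))
  norm_num
  linarith

/-- Conditionally on k insertions the mean is the k-th power of the average of the two
`deletionMean`s times the factor of the genuine bit; the geometric law of k turns this into a
geometric series. -/
lemma pmfMean_blockPMF (q q' : Set.Ico (0 : ℝ) 1) {N : Bool → A} (hN : ∀ b, ‖N b‖ ≤ 1)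
    (b : Bool) : pmfMean (blockPMF q q' b) (listProd N) =
      (∑' k : ℕ, ((q' : ℝ) ^ k * (1 - q')) •
        ((2⁻¹ : ℝ) • (deletionMean q N true + deletionMean q N false)) ^ k) *
        deletionMean q N b := by
  have hb := norm_listProd_le hN
  have hQ := norm_deletionMean_le q.2.1 q.2.2.le hN
  have hQb := norm_listProd_le hQ
  have h1 : ∀ k : ℕ, ‖((2⁻¹ : ℝ) • (deletionMean q N true + deletionMean q N false)) ^ k‖ ≤ 1 :=
    fun k => (norm_pow_le _ k).trans (pow_le_one₀ (norm_nonneg _) (norm_half_le hQ))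
  rw [blockPMF, pmfMean_bind _ _ hb]
  have : ∀ k : ℕ, pmfMean ((uniformBits k).bind fun L => deleteBits q (L ++ [b])) (listProd N) =
      ((2⁻¹ : ℝ) • (deletionMean q N true + deletionMean q N false)) ^ k * deletionMean q N b := by
    intro k
    rw [pmfMean_bind _ _ hb, ← pmfMean_uniformBits hQ, ← pmfMean_mul_const _ hQb]
    refine congrArg _ (funext fun L => ?_)
    rw [pmfMean_deleteBits q hN, listProd_append]
    simp
  simp only [this]
  rw [pmfMean_mul_const _ h1, pmfMean]
  congr 1
  refine tsum_congr fun k => ?_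
  congr 1
  change (ENNReal.ofReal _).toReal = _
  rw [ENNReal.toReal_ofReal]
  exact mul_nonneg (pow_nonneg q'.2.1 k) (by linarith [q'.2.2])

/-- The channel turns the operators of the trace into the operators of the message. -/
lemma pmfMean_blockPMF_eq (q q' : Set.Ico (0 : ℝ) 1) {N M : Bool → A} (hN : ∀ b, ‖N b‖ ≤ 1)
    {Δ Δi : A} (hΔ : Δ * Δi = 1) (hΔ' : Δi * Δ = 1)
    (hΔM : Δ = (1 - (q' : ℝ)) • 1 + ((q' : ℝ) / 2) • (M true + M false))
    (hQ : ∀ b, deletionMean q N b = Δi * M b) (b : Bool) :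
    pmfMean (blockPMF q q' b) (listProd N) = M b := by
  have h0 : (0 : ℝ) ≤ q' := q'.2.1
  have h1 : (q' : ℝ) < 1 := q'.2.2
  rw [pmfMean_blockPMF q q' hN]
  set Qb := (2⁻¹ : ℝ) • (deletionMean q N true + deletionMean q N false) with hQb
  have hn : ‖Qb‖ ≤ 1 := norm_half_le (norm_deletionMean_le q.2.1 q.2.2.le hN)
  have hx : ‖(q' : ℝ) • Qb‖ < 1 := by
    rw [norm_smul, Real.norm_of_nonneg h0]
    nlinarith [norm_nonneg Qb]
  -- Here 1 - q' Q̄ = Δ⁻¹ (Δ - q' (M_0 + M_1)/2), and the bracket is 1 - q' by the definition of Δ.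
  -- Hence the series of the insertions sums to Δ.
  have h2 : (1 : A) - (q' : ℝ) • Qb = (1 - (q' : ℝ)) • Δi := by
    have : (1 : A) = Δi * Δ := hΔ'.symm
    rw [this, hQb, hQ, hQ, hΔM, ← mul_add, mul_add, mul_smul_comm, mul_smul_comm, mul_one,
      smul_smul]
    rw [show (q' : ℝ) * 2⁻¹ = q' / 2 by ring]
    abel
  have h3 : (∑' k : ℕ, ((q' : ℝ) ^ k * (1 - q')) • Qb ^ k) =
      (1 - (q' : ℝ)) • ∑' k : ℕ, ((q' : ℝ) • Qb) ^ k := by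
    have hs : Summable fun k : ℕ => ((q' : ℝ) • Qb) ^ k := summable_geometric_of_norm_lt_one hx
    rw [← hs.tsum_const_smul]
    refine tsum_congr fun k => ?_
    rw [smul_pow (q' : ℝ) Qb k, smul_smul, mul_comm]
  have h4 := geom_series_mul_neg ((q' : ℝ) • Qb) hx
  rw [h2, mul_smul_comm, ← smul_mul_assoc, ← h3] at h4
  have h5 : (∑' k : ℕ, ((q' : ℝ) ^ k * (1 - q')) • Qb ^ k) = Δ := by
    calc _ = (∑' k : ℕ, ((q' : ℝ) ^ k * (1 - q')) • Qb ^ k) * Δi * Δ := by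
          rw [mul_assoc, hΔ', mul_one]
      _ = Δ := by rw [h4, one_mul]
  rw [h5, hQ, ← mul_assoc, hΔ, one_mul]

/-- The law of the concatenation of the first `k` blocks. -/
def prefixPMF (q q' : Set.Ico (0 : ℝ) 1) (x : ℕ → Bool) : ℕ → PMF (List Bool)
  | 0 => PMF.pure []
  | k + 1 => (prefixPMF q q' x k).bind fun L =>
      (blockPMF q q' (x k)).bind fun L' => PMF.pure (L ++ L')

/-- The product of the operators of the first `k` bits. -/
def seqProd (M : Bool → A) (x : ℕ → Bool) : ℕ → A
  | 0 => 1
  | k + 1 => seqProd M x k * M (x k)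

lemma pmfMean_prefixPMF (q q' : Set.Ico (0 : ℝ) 1) (x : ℕ → Bool) {N M : Bool → A}
    (hN : ∀ b, ‖N b‖ ≤ 1) (h : ∀ b, pmfMean (blockPMF q q' b) (listProd N) = M b) (k : ℕ) :
    pmfMean (prefixPMF q q' x k) (listProd N) = seqProd M x k := by
  have hb := norm_listProd_le hN
  induction k with
  | zero => rw [prefixPMF, pmfMean_pure]; rfl
  | succ k ih =>
    rw [prefixPMF, pmfMean_bind _ _ hb, seqProd, ← ih, ← pmfMean_mul_const _ hb]
    refine congrArg _ (funext fun L => ?_)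
    rw [pmfMean_bind _ _ hb, ← h, ← pmfMean_const_mul _ hb]
    refine congrArg _ (funext fun L' => ?_)
    rw [pmfMean_pure, listProd_append]

end Algebra

/-- The length of a long prefix of the trace is large. -/
lemma pmfMean_prefixPMF_pow_length (q q' : Set.Ico (0 : ℝ) 1) {ρ : ℝ} (h0 : 0 ≤ ρ) (h1 : ρ < 1) :
    ∃ θ : ℝ, 0 ≤ θ ∧ θ < 1 ∧ ∀ (x : ℕ → Bool) (k : ℕ),
      pmfMean (prefixPMF q q' x k) (fun L => ρ ^ L.length) = θ ^ k := by
  have hN : ∀ b : Bool, ‖(fun _ => ρ : Bool → ℝ) b‖ ≤ 1 := fun b => by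
    simpa [Real.norm_of_nonneg h0] using h1.le
  have hl : (fun L : List Bool => ρ ^ L.length) = listProd fun _ => ρ := by
    funext L; simp [listProd]
  have hq0 : (0 : ℝ) ≤ q := q.2.1
  have hq1 : (q : ℝ) < 1 := q.2.2
  have hq'0 : (0 : ℝ) ≤ q' := q'.2.1
  have hq'1 : (q' : ℝ) < 1 := q'.2.2
  -- The product formula for blocks is applied in the commutative ring ℝ with every letter replaced
  -- by ρ. Then θ is the mean of ρ to the length of one block, and θ < 1 because the genuine bit
  -- survives with positive probability.
  set Q : ℝ := q + (1 - q) * ρ with hQ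
  have hQ0 : 0 ≤ Q := add_nonneg hq0 (mul_nonneg (by linarith) h0)
  have hQ1 : Q < 1 := by rw [hQ]; nlinarith
  have hG0 : 0 ≤ ∑' k : ℕ, ((q' : ℝ) ^ k * (1 - q')) * Q ^ k := tsum_nonneg fun k =>
    mul_nonneg (mul_nonneg (pow_nonneg hq'0 k) (by linarith)) (pow_nonneg hQ0 k)
  have hs : HasSum (fun k : ℕ => (q' : ℝ) ^ k * (1 - q')) 1 := by
    have h := (hasSum_geometric_of_lt_one hq'0 hq'1).mul_right (1 - (q' : ℝ))
    rwa [inv_mul_cancel₀ (by linarith)] at h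
  have hG1 : ∑' k : ℕ, ((q' : ℝ) ^ k * (1 - q')) * Q ^ k ≤ 1 := by
    have hle : ∀ k : ℕ, ((q' : ℝ) ^ k * (1 - q')) * Q ^ k ≤ (q' : ℝ) ^ k * (1 - q') := fun k =>
      mul_le_of_le_one_right (mul_nonneg (pow_nonneg hq'0 k) (by linarith))
        (pow_le_one₀ hQ0 hQ1.le)
    exact (Summable.tsum_le_tsum hle (Summable.of_nonneg_of_le (fun k =>
      mul_nonneg (mul_nonneg (pow_nonneg hq'0 k) (by linarith)) (pow_nonneg hQ0 k)) hle
      hs.summable) hs.summable).trans_eq hs.tsum_eq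
  refine ⟨(∑' k : ℕ, ((q' : ℝ) ^ k * (1 - q')) * Q ^ k) * Q, mul_nonneg hG0 hQ0, by nlinarith,
    fun x k => ?_⟩
  rw [hl, pmfMean_prefixPMF q q' x (M := fun _ => (∑' k : ℕ, ((q' : ℝ) ^ k * (1 - q')) * Q ^ k) * Q)
    hN (fun b => ?_)]
  · induction k with
    | zero => rfl
    | succ k ih => rw [seqProd, ih, pow_succ]
  · rw [pmfMean_blockPMF q q' hN]
    simp only [deletionMean, smul_eq_mul, mul_one, ← hQ]
    rw [show (2 : ℝ)⁻¹ * (Q + Q) = Q by ring]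

/-- The law of the concatenation of the first `k` blocks of the channel. -/
lemma map_prefixBlocks (q q' : Set.Ico (0 : ℝ) 1) (x : ℕ → Bool) (k : ℕ) :
    (Measure.infinitePi fun j => (blockPMF q q' (x j)).toMeasure).map
      (fun L => prefixBlocks L k) = (prefixPMF q q' x k).toMeasure := by
  set P := Measure.infinitePi fun j => (blockPMF q q' (x j)).toMeasure with hP
  induction k with
  | zero =>
    simp only [prefixBlocks, prefixPMF]
    rw [Measure.map_const, measure_univ, one_smul, PMF.toMeasure_pure]
  | succ k ih =>
    have hind : ProbabilityTheory.iIndepFun (fun (i : ℕ) (L : ℕ → List Bool) => L i) P :=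
      ProbabilityTheory.iIndepFun_infinitePi (X := fun _ => id) fun _ => measurable_id
    have h1 := hind.indepFun_finset (Finset.range k) {k} (by simp) fun i => measurable_pi_apply i
    -- The first k blocks are written as a function of the coordinates below k only, which makes
    -- their independence of block k available.
    set φ : (Finset.range k → List Bool) → List Bool := fun u =>
      prefixBlocks (fun i => if h : i ∈ Finset.range k then u ⟨i, h⟩ else []) k with hφ
    have hφm : Measurable φ := by
      refine (measurable_prefixBlocks k).comp (measurable_pi_lambda _ fun i => ?_)
      by_cases h : i ∈ Finset.range k
      · simp only [h, dif_pos]; exact measurable_pi_apply _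
      · simp only [h, dif_neg, not_false_iff]; exact measurable_const
    have hφe : ∀ L : ℕ → List Bool, φ (fun i => L i) = prefixBlocks L k := by
      intro L
      have : ∀ j ≤ k, prefixBlocks (fun i => if h : i ∈ Finset.range k then L i else []) j =
          prefixBlocks L j := by
        intro j
        induction j with
        | zero => intro _; rfl
        | succ j ihj =>
          intro hj
          rw [prefixBlocks, prefixBlocks, ihj (by omega)]
          simp [show j < k by omega]
      exact this k le_rfl
    have h2 : ProbabilityTheory.IndepFun (fun L => prefixBlocks L k) (fun L => L k) P := by
      have := h1.comp hφm (measurable_pi_apply (⟨k, by simp⟩ : ({k} : Finset ℕ)))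
      rw [show (φ ∘ fun (a : ℕ → List Bool) (i : Finset.range k) => a i) =
        fun L => prefixBlocks L k from funext hφe] at this
      exact this
    have h3 := (ProbabilityTheory.indepFun_iff_map_prod_eq_prod_map_map
      (measurable_prefixBlocks k).aemeasurable (measurable_pi_apply k).aemeasurable).1 h2
    rw [ih] at h3
    have h4 : P.map (fun L => L k) = (blockPMF q q' (x k)).toMeasure :=
      Measure.infinitePi_map_eval _ k
    rw [h4] at h3
    have happ : Measurable fun p : List Bool × List Bool => p.1 ++ p.2 := measurable_of_countable _
    have h5 : P.map (fun L => prefixBlocks L (k + 1)) =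
        (P.map fun L => (prefixBlocks L k, L k)).map fun p => p.1 ++ p.2 := by
      rw [Measure.map_map happ ((measurable_prefixBlocks k).prodMk (measurable_pi_apply k))]
      rfl
    rw [h5, h3]
    refine Measure.ext fun s hs => ?_
    rw [Measure.map_apply happ hs, Measure.prod_apply (happ hs), prefixPMF,
      PMF.toMeasure_bind_apply _ _ _ hs, lintegral_countable']
    refine tsum_congr fun L => ?_
    rw [PMF.toMeasure_apply_singleton _ _ (measurableSet_singleton _), mul_comm]
    congr 1
    rw [PMF.toMeasure_bind_apply _ _ _ hs, PMF.toMeasure_apply _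
      (measurable_prodMk_left (happ hs))]
    refine tsum_congr fun L' => ?_
    rw [PMF.toMeasure_pure_apply _ _ hs]
    by_cases hc : L ++ L' ∈ s <;> simp [Set.indicator, hc]

lemma integral_prefixBlocks (q q' : Set.Ico (0 : ℝ) 1) (x : ℕ → Bool) (k : ℕ)
    {V : Type*} [NormedAddCommGroup V] [NormedSpace ℝ V] [CompleteSpace V]
    [SecondCountableTopology V] [MeasurableSpace V] [BorelSpace V]
    {h : List Bool → V} {B : ℝ} (hh : ∀ L, ‖h L‖ ≤ B) :
    ∫ L, h (prefixBlocks L k) ∂(Measure.infinitePi fun j => (blockPMF q q' (x j)).toMeasure) =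
      pmfMean (prefixPMF q q' x k) h := by
  have hm : AEStronglyMeasurable h (prefixPMF q q' x k).toMeasure :=
    (measurable_of_countable h).aestronglyMeasurable
  rw [← integral_map (φ := fun L => prefixBlocks L k) (measurable_prefixBlocks k).aemeasurable
    (by rw [map_prefixBlocks]; exact hm), map_prefixBlocks, PMF.integral_eq_tsum _ _
    (Integrable.of_bound hm B (Filter.Eventually.of_forall hh))]
  rfl

/-- The first `K` letters of a string. -/
def firstLetters (K : ℕ) (y : ℕ → Bool) : List Bool := (List.range K).map y

/-- The prefixes are nested, so any prefix long enough to contain the letter can replace the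
shortest one. -/
lemma concatBlocks_eq (L : ℕ → List Bool) (k r : ℕ) (h : r < (prefixBlocks L k).length) :
    concatBlocks L r = (prefixBlocks L k).getD r false := by
  classical
  have hmono : ∀ i j, i ≤ j → prefixBlocks L i <+: prefixBlocks L j := by
    intro i j hij
    induction j, hij using Nat.le_induction with
    | base => exact List.prefix_rfl
    | succ j _ ih => exact ih.trans (List.prefix_append _ _)
  have hk : ∃ k, r < (prefixBlocks L k).length := ⟨k, h⟩
  unfold concatBlocks
  rw [dif_pos hk]
  obtain ⟨t, ht⟩ := hmono _ _ (Nat.find_min' hk h)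
  rw [← ht, List.getD_append _ _ _ _ (Nat.find_spec hk)]

/-- Either string may be the longer one; only the length of their common initial segment c matters,
since what follows is damped by contraction. -/
lemma firstLetters_concatBlocks (L : ℕ → List Bool) (k K : ℕ) :
    ∃ c u w, firstLetters K (concatBlocks L) = c ++ u ∧ prefixBlocks L k = c ++ w ∧
      c.length = min K (prefixBlocks L k).length := by
  refine ⟨(prefixBlocks L k).take K, (firstLetters K (concatBlocks L)).drop
    (min K (prefixBlocks L k).length), (prefixBlocks L k).drop K, ?_,
    (List.take_append_drop _ _).symm, by simp⟩
  have : (prefixBlocks L k).take K = (firstLetters K (concatBlocks L)).take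
      (min K (prefixBlocks L k).length) := by
    refine List.ext_getElem (by simp [firstLetters]) fun i h1 h2 => ?_
    rw [List.length_take] at h1
    have h3 : i < (prefixBlocks L k).length := by omega
    simp only [List.getElem_take, firstLetters, List.getElem_map, List.getElem_range]
    rw [concatBlocks_eq L k i h3, List.getD_eq_getElem _ _ h3]
  rw [this, List.take_append_drop]

lemma measurable_firstLetters (K : ℕ) : Measurable (firstLetters K) := by
  induction K with
  | zero => exact measurable_const
  | succ K ih =>
    have : firstLetters (K + 1) = fun y => firstLetters K y ++ [y K] := by
      funext y; simp [firstLetters, List.range_succ]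
    rw [this]
    exact (measurable_of_countable fun p : List Bool × Bool => p.1 ++ [p.2]).comp
      (ih.prodMk (measurable_pi_apply K))

end TraceRec
end

noncomputable section
namespace TraceRec

/-! ### The mean of the statistic of a trace -/

open scoped BoundedContinuousFunction

/-- The indicator function of the root. -/
def rootOne : ℕ →ᵇ ℂ := BoundedContinuousFunction.ofNormedAddCommGroupDiscrete
  (fun e => if e = 0 then 1 else 0) 1 fun e => by split_ifs <;> simp

@[simp] lemma rootOne_apply (e : ℕ) : rootOne e = if e = 0 then 1 else 0 := rfl

lemma norm_rootOne_le : ‖rootOne‖ ≤ 1 :=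
  (BoundedContinuousFunction.norm_le zero_le_one).2 fun e => by
    rw [rootOne_apply]; split_ifs <;> simp

/-- Makes the identity operator have norm one, as the norm bounds for products of operators require.
-/
instance : Nontrivial (ℕ →ᵇ ℂ) := ⟨rootOne, 0, fun h => by
  have := congrArg (fun g : ℕ →ᵇ ℂ => g 0) h
  simp at this⟩

/-- The statistic of the first `K` letters of a trace. -/
def traceStat (D : ℕ →ᵇ ℂ) (r q q' : ℝ) (K : ℕ) (y : ℕ → Bool) : ℕ →ᵇ ℂ :=
  listProd (traceL D r q q') (firstLetters K y) rootOne

namespace Contracts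

variable {D : ℕ →ᵇ ℂ} {r q q' ρ : ℝ}

lemma listProd_traceL_zero (h : Contracts D r q q' ρ) (L : List Bool) (g : ℕ →ᵇ ℂ) :
    listProd (traceL D r q q') L g 0 = g 0 := by
  induction L with
  | nil => rfl
  | cons b L ih =>
    rw [listProd_cons]
    exact (h.traceL_zero b _).trans ih

lemma norm_listProd_traceL_le (h : Contracts D r q q' ρ) (L : List Bool) (g : ℕ →ᵇ ℂ) :
    ‖listProd (traceL D r q q') L g‖ ≤ ‖g‖ := by
  refine ((listProd (traceL D r q q') L).le_opNorm g).trans ?_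
  exact mul_le_of_le_one_left (norm_nonneg _) (norm_listProd_le h.norm_traceL_le L)

lemma norm_listProd_traceL_root_le (h : Contracts D r q q' ρ) (L : List Bool) {g : ℕ →ᵇ ℂ}
    (hg : g 0 = 0) : ‖listProd (traceL D r q q') L g‖ ≤ ρ ^ L.length * ‖g‖ := by
  induction L with
  | nil => simp [listProd_nil]
  | cons b L ih =>
    rw [listProd_cons, List.length_cons, pow_succ']
    have h0 : listProd (traceL D r q q') L g 0 = 0 := by rw [h.listProd_traceL_zero, hg]
    calc ‖traceL D r q q' b (listProd (traceL D r q q') L g)‖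
        ≤ ρ * ‖listProd (traceL D r q q') L g‖ := h.norm_traceL_root_le b h0
      _ ≤ ρ * (ρ ^ L.length * ‖g‖) := mul_le_mul_of_nonneg_left ih h.ρ0
      _ = _ := by ring

lemma traceStat_zero (h : Contracts D r q q' ρ) (K : ℕ) (y : ℕ → Bool) :
    traceStat D r q q' K y 0 = 1 := by
  rw [traceStat, h.listProd_traceL_zero]; simp

lemma norm_traceStat_le (h : Contracts D r q q' ρ) (K : ℕ) (y : ℕ → Bool) :
    ‖traceStat D r q q' K y‖ ≤ 1 :=
  (h.norm_listProd_traceL_le _ _).trans norm_rootOne_le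

lemma norm_seqProd_root_le (h : Contracts D r q q' ρ) (x : ℕ → Bool) (k : ℕ) {g : ℕ →ᵇ ℂ}
    (hg : g 0 = 0) : ‖seqProd (transferL D r) x k g‖ ≤ ρ ^ k * ‖g‖ := by
  induction k generalizing g with
  | zero => simp [seqProd]
  | succ k ih =>
    have h0 : transferL D r (x k) g 0 = 0 := by rw [transferL_apply, h.transfer_zero, hg]
    calc ‖seqProd (transferL D r) x k (transferL D r (x k) g)‖
        ≤ ρ ^ k * ‖transferL D r (x k) g‖ := ih h0
      _ ≤ ρ ^ k * (ρ * ‖g‖) := mul_le_mul_of_nonneg_left (h.norm_transferL_root_le _ hg)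
          (pow_nonneg h.ρ0 k)
      _ = _ := by ring

lemma pmfMean_block {q q' : Set.Ico (0 : ℝ) 1} (h : Contracts D r q q' ρ) (b : Bool) :
    pmfMean (blockPMF q q' b) (listProd (traceL D r q q')) = transferL D r b := by
  refine pmfMean_blockPMF_eq q q' h.norm_traceL_le (Ring.mul_inverse_cancel _ h.isUnit)
    (Ring.inverse_mul_cancel _ h.isUnit) ?_ (fun b => ?_) b
  · rw [deltaL]; rfl
  · rw [← h.add_smul_traceL b]; rfl

/-- The mean of the statistic of a trace. -/
lemma norm_integral_traceStat_sub_le {q q' : Set.Ico (0 : ℝ) 1} (h : Contracts D r q q' ρ)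
    {γ : (ℕ → Bool) → ℕ →ᵇ ℂ} (h0 : ∀ x, γ x 0 = 1) (h1 : ∀ x, ‖γ x‖ ≤ 1)
    (h2 : ∀ x, γ x = transferL D r (x 0) (γ fun j => x (j + 1))) (x : ℕ → Bool) (K e : ℕ) :
    ‖∫ y, traceStat D r q q' K y e ∂(channelLaw q q' x) - γ x e‖ ≤ 2 * ρ ^ K := by
  obtain ⟨θ, hθ0, hθ1, hθ⟩ := pmfMean_prefixPMF_pow_length q q' h.ρ0 h.lt
  have hγ : ∀ k x, γ x = seqProd (transferL D r) x k (γ fun j => x (k + j)) := by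
    intro k
    induction k with
    | zero => intro x; simp [seqProd]
    | succ k ih =>
      intro x
      rw [ih x, h2 fun j => x (k + j), seqProd]
      simp only [add_zero]
      change _ = seqProd (transferL D r) x k (transferL D r (x k) _)
      simp only [add_assoc, add_comm 1]
  set P := Measure.infinitePi fun j => (blockPMF q q' (x j)).toMeasure with hP
  have hmeas : Measurable fun y => traceStat D r q q' K y e :=
    (measurable_of_countable fun L => listProd (traceL D r q q') L rootOne e).comp
      (measurable_firstLetters K)
  have hb : ∀ L, ‖listProd (traceL D r q q') L rootOne e‖ ≤ 1 := fun L =>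
    (BoundedContinuousFunction.norm_coe_le_norm _ e).trans
      ((h.norm_listProd_traceL_le _ _).trans norm_rootOne_le)
  -- The number k of blocks is auxiliary. The first K letters are compared with the first k blocks,
  -- whose mean is an exact product of k transfer operators; this in turn is compared with γ, and
  -- then k tends to infinity.
  have key : ∀ k : ℕ, ‖∫ y, traceStat D r q q' K y e ∂(channelLaw q q' x) - γ x e‖ ≤
      2 * ρ ^ K + 2 * θ ^ k + 2 * ρ ^ k := by
    intro k
    have e1 : ∫ y, traceStat D r q q' K y e ∂(channelLaw q q' x) =
        ∫ L, traceStat D r q q' K (concatBlocks L) e ∂P := by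
      rw [channelLaw, integral_map measurable_concatBlocks.aemeasurable
        hmeas.aestronglyMeasurable]
    have e2 : ∫ L, listProd (traceL D r q q') (prefixBlocks L k) rootOne e ∂P =
        seqProd (transferL D r) x k rootOne e := by
      rw [integral_prefixBlocks q q' x k
        (h := fun L => listProd (traceL D r q q') L rootOne e) hb,
        ← pmfMean_prefixPMF q q' x h.norm_traceL_le h.pmfMean_block k]
      have hs := summable_pmf_smul (V := (ℕ →ᵇ ℂ) →L[ℂ] (ℕ →ᵇ ℂ)) (prefixPMF q q' x k)
        (g := listProd (traceL D r q q')) (B := 1) (norm_listProd_le h.norm_traceL_le)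
      -- A continuous functional carries the identity between operator-valued means over to the
      -- coordinate e.
      set ev : ((ℕ →ᵇ ℂ) →L[ℂ] (ℕ →ᵇ ℂ)) →L[ℂ] ℂ :=
        (BoundedContinuousFunction.evalCLM ℂ e).comp
          (ContinuousLinearMap.apply ℂ (ℕ →ᵇ ℂ) rootOne) with hev
      have := ev.map_tsum hs
      change _ = ev _
      refine Eq.trans ?_ this.symm
      refine tsum_congr fun L => ?_
      have : ∀ (c : ℝ) (T : (ℕ →ᵇ ℂ) →L[ℂ] (ℕ →ᵇ ℂ)), ev (c • T) = c • ev T := fun c T =>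
        ev.map_smul (c : ℂ) T
      rw [this]
      rfl
    have e3 : ∫ L, ρ ^ (prefixBlocks L k).length ∂P = θ ^ k := by
      rw [← hθ x k, integral_prefixBlocks q q' x k (h := fun L => ρ ^ L.length) (B := 1)]
      intro L
      rw [norm_pow, Real.norm_of_nonneg h.ρ0]
      exact pow_le_one₀ h.ρ0 h.lt.le
    -- Behind the common segment c both strings send `rootOne` to a vector with root value 1 and
    -- norm at most 1. The difference vanishes at the root, and the operators of c shrink it by ρ to
    -- the length of c.
    have hd : ∀ L : ℕ → List Bool, ‖traceStat D r q q' K (concatBlocks L) e -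
        listProd (traceL D r q q') (prefixBlocks L k) rootOne e‖ ≤
        2 * ρ ^ K + 2 * ρ ^ (prefixBlocks L k).length := by
      intro L
      obtain ⟨c, u, w, hu, hw, hc⟩ := firstLetters_concatBlocks L k K
      rw [traceStat, hu, hw, listProd_append, listProd_append]
      change ‖listProd (traceL D r q q') c (listProd (traceL D r q q') u rootOne) e -
        listProd (traceL D r q q') c (listProd (traceL D r q q') w rootOne) e‖ ≤ _
      rw [← BoundedContinuousFunction.sub_apply, ← map_sub]
      refine (BoundedContinuousFunction.norm_coe_le_norm _ e).trans
        ((h.norm_listProd_traceL_root_le c (by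
          rw [BoundedContinuousFunction.sub_apply, h.listProd_traceL_zero,
            h.listProd_traceL_zero, sub_self])).trans ?_)
      have hn : ‖listProd (traceL D r q q') u rootOne - listProd (traceL D r q q') w rootOne‖ ≤
          2 := by
        refine (norm_sub_le _ _).trans ?_
        linarith [(h.norm_listProd_traceL_le u rootOne).trans norm_rootOne_le,
          (h.norm_listProd_traceL_le w rootOne).trans norm_rootOne_le]
      have hp : ρ ^ c.length ≤ ρ ^ K + ρ ^ (prefixBlocks L k).length := by
        have h3 := pow_nonneg h.ρ0 K
        have h4 := pow_nonneg h.ρ0 (prefixBlocks L k).length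
        rw [hc]
        rcases min_choice K (prefixBlocks L k).length with h5 | h5 <;> rw [h5] <;> linarith
      refine (mul_le_mul_of_nonneg_left hn (pow_nonneg h.ρ0 c.length)).trans ?_
      rw [hw] at hp
      linarith
    have i1 : Integrable (fun L => traceStat D r q q' K (concatBlocks L) e) P :=
      Integrable.of_bound (hmeas.comp measurable_concatBlocks).aestronglyMeasurable 1
        (Filter.Eventually.of_forall fun L => hb _)
    have i2 : Integrable (fun L => listProd (traceL D r q q') (prefixBlocks L k) rootOne e) P :=
      Integrable.of_bound ((measurable_of_countable fun L =>
        listProd (traceL D r q q') L rootOne e).comp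
        (measurable_prefixBlocks k)).aestronglyMeasurable 1
        (Filter.Eventually.of_forall fun L => hb _)
    have i3 : Integrable (fun L : ℕ → List Bool => ρ ^ (prefixBlocks L k).length) P :=
      Integrable.of_bound ((measurable_of_countable fun L : List Bool => ρ ^ L.length).comp
        (measurable_prefixBlocks k)).aestronglyMeasurable 1
        (Filter.Eventually.of_forall fun L => by
          rw [norm_pow, Real.norm_of_nonneg h.ρ0]
          exact pow_le_one₀ h.ρ0 h.lt.le)
    have h3 : ‖∫ y, traceStat D r q q' K y e ∂(channelLaw q q' x) -
        seqProd (transferL D r) x k rootOne e‖ ≤ 2 * ρ ^ K + 2 * θ ^ k := by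
      rw [e1, ← e2, ← integral_sub i1 i2]
      refine (norm_integral_le_of_norm_le (((integrable_const (2 * ρ ^ K))).add (i3.const_mul 2))
        (Filter.Eventually.of_forall hd)).trans (le_of_eq ?_)
      have e4 : ∫ L : ℕ → List Bool, 2 * ρ ^ (prefixBlocks L k).length ∂P = 2 * θ ^ k := by
        rw [integral_const_mul, e3]
      rw [integral_add' (integrable_const _) (i3.const_mul 2), e4]
      simp
    have h4 : ‖seqProd (transferL D r) x k rootOne e - γ x e‖ ≤ 2 * ρ ^ k := by
      rw [hγ k x, ← BoundedContinuousFunction.sub_apply, ← map_sub]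
      refine (BoundedContinuousFunction.norm_coe_le_norm _ e).trans
        ((h.norm_seqProd_root_le x k (by simp [h0])).trans ?_)
      have hn : ‖rootOne - γ fun j => x (k + j)‖ ≤ 2 := by
        refine (norm_sub_le _ _).trans ?_
        linarith [norm_rootOne_le, h1 fun j => x (k + j)]
      nlinarith [pow_nonneg h.ρ0 k]
    calc _ ≤ _ := norm_sub_le_norm_sub_add_norm_sub _ (seqProd (transferL D r) x k rootOne e) _
      _ ≤ _ := by linarith
  have hlim : Filter.Tendsto (fun k : ℕ => 2 * ρ ^ K + 2 * θ ^ k + 2 * ρ ^ k) Filter.atTop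
      (nhds (2 * ρ ^ K + 2 * 0 + 2 * 0)) :=
    (((tendsto_pow_atTop_nhds_zero_of_lt_one hθ0 hθ1).const_mul 2).const_add _).add
      ((tendsto_pow_atTop_nhds_zero_of_lt_one h.ρ0 h.lt).const_mul 2)
  have := ge_of_tendsto' hlim key
  simpa using this

end Contracts

end TraceRec
end

noncomputable section
namespace TraceRec

/-! ### The generating function on the tree -/

open scoped BoundedContinuousFunction

/-- The values of the generating functions of the indicator functions of words. -/
def treeSum (d : ℕ → ℂ) (r : ℝ) : ℕ → (ℕ → Bool) → ℂ
  | 0, _ => 1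
  | e + 1, x => ∑' j : ℕ, d (e + 1) ^ j * (if x j = decide ((e + 1) % 2 = 0) then
      r * treeSum d r (e / 2) (fun i => x (j + 1 + i)) else 0)

section TreeSum

variable {d : ℕ → ℂ} {r : ℝ}

lemma norm_treeSum_term_le (hr : 0 ≤ r) (e : ℕ) (x : ℕ → Bool) (j : ℕ)
    (h : ∀ x, ‖treeSum d r (e / 2) x‖ ≤ 1) :
    ‖d (e + 1) ^ j * (if x j = decide ((e + 1) % 2 = 0) then
      r * treeSum d r (e / 2) (fun i => x (j + 1 + i)) else 0)‖ ≤ ‖d (e + 1)‖ ^ j * r := by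
  rw [norm_mul, norm_pow]
  refine mul_le_mul_of_nonneg_left ?_ (pow_nonneg (norm_nonneg _) j)
  split_ifs
  · rw [norm_mul, Complex.norm_real, Real.norm_of_nonneg hr]
    exact mul_le_of_le_one_right hr (h _)
  · simpa using hr

/-- The sum over the position of the first letter is at most r/(1-‖d‖) ≤ 1 times the bound for the
parent, so the scaling by r keeps all levels bounded by one. -/
lemma norm_treeSum_le (hr : 0 ≤ r) (hd : ∀ e ≠ 0, ‖d e‖ + r ≤ 1) (hd' : ∀ e ≠ 0, ‖d e‖ < 1)
    (e : ℕ) (x : ℕ → Bool) : ‖treeSum d r e x‖ ≤ 1 := by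
  induction e using Nat.strong_induction_on generalizing x with
  | _ e ih =>
    cases e with
    | zero => simp [treeSum]
    | succ e =>
      have h1 := (hasSum_geometric_of_lt_one (norm_nonneg _) (hd' (e + 1) e.succ_ne_zero)).mul_right
        r
      rw [treeSum]
      refine (tsum_of_norm_bounded h1 fun j =>
        norm_treeSum_term_le hr e x j (ih (e / 2) (by omega))).trans ?_
      have := hd (e + 1) e.succ_ne_zero
      have := hd' (e + 1) e.succ_ne_zero
      rw [inv_mul_le_iff₀ (by linarith)]
      linarith

lemma summable_treeSum_term (hr : 0 ≤ r) (hd : ∀ e ≠ 0, ‖d e‖ + r ≤ 1)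
    (hd' : ∀ e ≠ 0, ‖d e‖ < 1) (e : ℕ) (x : ℕ → Bool) :
    Summable fun j : ℕ => d (e + 1) ^ j * (if x j = decide ((e + 1) % 2 = 0) then
      r * treeSum d r (e / 2) (fun i => x (j + 1 + i)) else 0) :=
  Summable.of_norm_bounded ((summable_geometric_of_lt_one (norm_nonneg _)
    (hd' (e + 1) e.succ_ne_zero)).mul_right r) fun j =>
    norm_treeSum_term_le hr e x j (norm_treeSum_le hr hd hd' _)

/-- The term j = 0, in which the first bit is used, is the coupling to the parent; in all other
terms one factor d splits off and the string is shifted. -/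
lemma treeSum_eq_transfer (hr : 0 ≤ r) (hd : ∀ e ≠ 0, ‖d e‖ + r ≤ 1)
    (hd' : ∀ e ≠ 0, ‖d e‖ < 1) (h0 : d 0 = 1) (x : ℕ → Bool) (e : ℕ) :
    treeSum d r e x = transfer d r (x 0) (fun e => treeSum d r e fun j => x (j + 1)) e := by
  cases e with
  | zero => simp [treeSum, transfer, coupling, h0]
  | succ e =>
    have hs := summable_treeSum_term hr hd hd' e x
    rw [treeSum, hs.tsum_eq_zero_add, transfer, coupling, add_comm]
    congr 1
    · rw [treeSum, ← (summable_treeSum_term hr hd hd' e _).tsum_mul_left]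
      refine tsum_congr fun j => ?_
      have : ∀ i, j + 1 + 1 + i = j + 1 + i + 1 := fun i => by omega
      simp only [this]
      rw [pow_succ']
      ring
    · rw [pow_zero, one_mul]
      have : ∀ i, 0 + 1 + i = i + 1 := fun i => by omega
      simp only [this]
      by_cases h : x 0 = decide ((e + 1) % 2 = 0)
      · rw [if_pos h, if_pos ⟨e.succ_ne_zero, h.symm⟩]; rfl
      · rw [if_neg h, if_neg fun h' => h h'.2.symm, mul_zero]

end TreeSum

/-- The node of a word. -/
def node : (k : ℕ) → (Fin k → Bool) → ℕ
  | 0, _ => 0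
  | k + 1, w => 2 * node k (Fin.tail w) + 1 + (w 0).toNat

/-- The product of the powers of the variables that belongs to an increasing sequence. -/
def gapProd {k : ℕ} (ζ : Fin (k + 1) → ℂ) (s : Fin (k + 1) → ℕ) : ℂ :=
  ζ 0 ^ s 0 * ∏ i : Fin k, ζ i.succ ^ (s i.succ - s i.castSucc - 1)

/-- `gapProd` for a sequence of arbitrary length. -/
def gapProd' : {k : ℕ} → (Fin k → ℂ) → (Fin k → ℕ) → ℂ
  | 0, _, _ => 1
  | _ + 1, ζ, s => gapProd ζ s

/-- An increasing sequence is given by its first element and the rest. -/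
def orderEmbSucc (k : ℕ) : (Fin (k + 1) ↪o ℕ) ≃ ℕ × (Fin k ↪o ℕ) where
  toFun s := (s 0, OrderEmbedding.ofStrictMono (fun i => s i.succ - (s 0 + 1)) fun i j hij => by
    have h1 : s i.succ < s j.succ := s.strictMono (Fin.succ_lt_succ_iff.2 hij)
    have h2 : s 0 < s i.succ := s.strictMono (Fin.succ_pos i)
    change s i.succ - (s 0 + 1) < s j.succ - (s 0 + 1)
    omega)
  invFun p := OrderEmbedding.ofStrictMono (Fin.cons p.1 fun i => p.1 + 1 + p.2 i) (by
    intro i j hij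
    refine Fin.cases ?_ (fun j hij => ?_) j hij
    · intro h; exact absurd h (Fin.not_lt_zero i)
    · refine Fin.cases ?_ (fun i hij => ?_) i hij
      · intro _
        simp only [Fin.cons_zero, Fin.cons_succ]
        omega
      · have := p.2.strictMono (Fin.succ_lt_succ_iff.1 hij)
        simp only [Fin.cons_succ]
        omega)
  left_inv s := by
    ext i
    refine Fin.cases rfl (fun i => ?_) i
    have h2 : s 0 < s i.succ := s.strictMono (Fin.succ_pos i)
    change s 0 + 1 + (s i.succ - (s 0 + 1)) = s i.succ
    omega
  right_inv p := by
    refine Prod.ext rfl ?_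
    ext i
    change p.1 + 1 + p.2 i - (p.1 + 1) = p.2 i
    omega

lemma orderEmbSucc_symm_zero {k : ℕ} (p : ℕ × (Fin k ↪o ℕ)) : (orderEmbSucc k).symm p 0 = p.1 :=
  rfl

lemma orderEmbSucc_symm_succ {k : ℕ} (p : ℕ × (Fin k ↪o ℕ)) (i : Fin k) :
    (orderEmbSucc k).symm p i.succ = p.1 + 1 + p.2 i := rfl

/-- After the removal of the first element s 0 the rest is re-indexed from s 0 + 1, so the gap s 1 -
s 0 - 1 becomes the first element of the rest. -/
lemma gapProd_symm {k : ℕ} (ζ : Fin (k + 1) → ℂ) (p : ℕ × (Fin k ↪o ℕ)) :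
    gapProd ζ ((orderEmbSucc k).symm p) = ζ 0 ^ p.1 * gapProd' (Fin.tail ζ) p.2 := by
  rw [gapProd, orderEmbSucc_symm_zero]
  congr 1
  cases k with
  | zero => simp [gapProd']
  | succ k =>
    rw [gapProd', gapProd, Fin.prod_univ_succ]
    congr 1
    · rw [orderEmbSucc_symm_succ]
      change _ ^ (p.1 + 1 + p.2 0 - p.1 - 1) = _
      rw [show p.1 + 1 + p.2 0 - p.1 - 1 = p.2 0 by omega]
      rfl
    · refine Finset.prod_congr rfl fun i _ => ?_
      rw [← Fin.succ_castSucc, orderEmbSucc_symm_succ, orderEmbSucc_symm_succ]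
      rw [show p.1 + 1 + p.2 i.succ - (p.1 + 1 + p.2 i.castSucc) - 1 =
        p.2 i.succ - p.2 i.castSucc - 1 by omega]
      rfl

instance instSubsingletonOrderEmbFinZero : Subsingleton (Fin 0 ↪o ℕ) :=
  ⟨fun s t => by ext i; exact i.elim0⟩

/-- The first element and the gaps vary independently over ℕ, so the sum is a product of geometric
series. -/
lemma hasSum_norm_gapProd' {k : ℕ} (ζ : Fin k → ℂ) (hζ : ∀ i, ‖ζ i‖ < 1) :
    HasSum (fun s : Fin k ↪o ℕ => ‖gapProd' ζ s‖) (∏ i, (1 - ‖ζ i‖)⁻¹) := by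
  induction k with
  | zero =>
    have := Unique.mk' (Fin 0 ↪o ℕ)
    simpa only [gapProd', norm_one, Finset.univ_eq_empty, Finset.prod_empty] using
      hasSum_unique fun s : Fin 0 ↪o ℕ => (1 : ℝ)
  | succ k ih =>
    rw [← (orderEmbSucc k).symm.hasSum_iff]
    have h1 := hasSum_geometric_of_lt_one (norm_nonneg _) (hζ 0)
    have h2 := ih (Fin.tail ζ) fun i => hζ i.succ
    have h3 := h1.summable.mul_of_nonneg h2.summable (fun j => pow_nonneg (norm_nonneg _) j)
      fun s => norm_nonneg _
    have h4 := h1.mul h2 h3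
    rw [Fin.prod_univ_succ]
    refine h4.congr_fun ?_
    intro p
    change ‖gapProd ζ ((orderEmbSucc k).symm p)‖ = _
    rw [gapProd_symm, norm_mul, norm_pow]

lemma summable_mul_gapProd' {k : ℕ} (ζ : Fin k → ℂ) (hζ : ∀ i, ‖ζ i‖ < 1)
    (G : (Fin k ↪o ℕ) → ℂ) (B : ℝ) (hG : ∀ s, ‖G s‖ ≤ B) :
    Summable fun s : Fin k ↪o ℕ => G s * gapProd' ζ s := by
  refine Summable.of_norm_bounded ((hasSum_norm_gapProd' ζ hζ).summable.mul_left B) fun s => ?_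
  rw [norm_mul]
  exact mul_le_mul_of_nonneg_right (hG s) (norm_nonneg _)

lemma treeSum_node_succ (d : ℕ → ℂ) (r : ℝ) {k : ℕ} (w : Fin (k + 1) → Bool) (x : ℕ → Bool) :
    treeSum d r (node (k + 1) w) x = ∑' j : ℕ, d (node (k + 1) w) ^ j * (if x j = w 0 then
      r * treeSum d r (node k (Fin.tail w)) (fun i => x (j + 1 + i)) else 0) := by
  rw [node, show 2 * node k (Fin.tail w) + 1 + (w 0).toNat =
    (2 * node k (Fin.tail w) + (w 0).toNat) + 1 by omega, treeSum]
  have h1 : (2 * node k (Fin.tail w) + (w 0).toNat) / 2 = node k (Fin.tail w) := by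
    have := (w 0).toNat_le; omega
  have h2 : decide ((2 * node k (Fin.tail w) + (w 0).toNat + 1) % 2 = 0) = w 0 := by
    cases w 0 <;> simp <;> omega
  rw [h1, h2]

/-- The tree computes the sums over increasing sequences: the variable of the `i`-th letter of a
word of length `k` is the common value of `d` at the level `k - i`. -/
lemma sum_treeSum_node {d : ℕ → ℂ} {r : ℝ} (hr : 0 < r) (hd : ∀ e ≠ 0, ‖d e‖ + r ≤ 1)
    (dl : ℕ → ℂ) (k : ℕ) (hdl : ∀ j ≤ k, ∀ w : Fin j → Bool, d (node j w) = dl j)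
    (F : (Fin k → Bool) → ℂ) (x : ℕ → Bool) :
    ∑ w, F w * treeSum d r (node k w) x =
      r ^ k * ∑' s : Fin k ↪o ℕ, F (fun i => x (s i)) * gapProd' (fun i => dl (k - i)) s := by
  have hd' : ∀ e ≠ 0, ‖d e‖ < 1 := fun e he => by linarith [hd e he]
  have hrC : (r : ℂ) ≠ 0 := by exact_mod_cast hr.ne'
  have hdl1 : ∀ j ≤ k, j ≠ 0 → ‖dl j‖ < 1 := by
    intro j hj hj0
    rw [← hdl j hj fun _ => true]
    refine hd' _ ?_
    obtain ⟨j, rfl⟩ := Nat.exists_eq_succ_of_ne_zero hj0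
    simp [node]
  induction k generalizing x with
  | zero =>
    rw [tsum_eq_single default fun b hb => absurd (Subsingleton.elim b _) hb, Fintype.sum_unique]
    simp only [node, treeSum, gapProd', pow_zero, one_mul, mul_one]
    congr 1
    exact Subsingleton.elim _ _
  | succ k ih =>
    have hG : ∀ w, ‖F w‖ ≤ ∑ w, ‖F w‖ := fun w =>
      Finset.single_le_sum (f := fun w => ‖F w‖) (fun _ _ => norm_nonneg _) (Finset.mem_univ w)
    have hζ : ∀ i : Fin (k + 1), ‖dl (k + 1 - i)‖ < 1 := fun i => hdl1 _ (by omega) (by omega)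
    have hs := summable_mul_gapProd' (fun i : Fin (k + 1) => dl (k + 1 - i)) hζ
      (fun s => F fun i => x (s i)) _ fun s => hG _
    have hcons : ∀ (p : ℕ × (Fin k ↪o ℕ)), (fun i => x ((orderEmbSucc k).symm p i)) =
        Fin.cons (x p.1) fun i => x (p.1 + 1 + p.2 i) := by
      intro p
      ext i
      exact Fin.cases rfl (fun i => rfl) i
    have htail : Fin.tail (fun i : Fin (k + 1) => dl (k + 1 - i)) = fun i : Fin k => dl (k - i) := by
      ext i
      simp [Fin.tail]
    rw [← (orderEmbSucc k).symm.summable_iff] at hs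
    rw [← (orderEmbSucc k).symm.tsum_eq]
    have hf : ∀ p : ℕ × (Fin k ↪o ℕ), F (fun i => x ((orderEmbSucc k).symm p i)) *
        gapProd' (fun i : Fin (k + 1) => dl (k + 1 - i)) ((orderEmbSucc k).symm p) =
        dl (k + 1) ^ p.1 * (F (Fin.cons (x p.1) fun i => x (p.1 + 1 + p.2 i)) *
          gapProd' (fun i : Fin k => dl (k - i)) p.2) := by
      intro p
      rw [hcons, gapProd', gapProd_symm, htail]
      simp only [Fin.val_zero, Nat.sub_zero]
      ring
    simp only [Function.comp_def, hf] at hs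
    simp only [hf]
    rw [hs.tsum_prod]
    simp only [tsum_mul_left]
    have h1 : ∀ j : ℕ, ∑' s : Fin k ↪o ℕ, F (Fin.cons (x j) fun i => x (j + 1 + s i)) *
          gapProd' (fun i : Fin k => dl (k - i)) s =
        ((r : ℂ) ^ k)⁻¹ * ∑ w, F (Fin.cons (x j) w) *
          treeSum d r (node k w) (fun i => x (j + 1 + i)) := by
      intro j
      rw [ih (fun j' hj' w => hdl j' (by omega) w) (fun w => F (Fin.cons (x j) w))
        (fun i => x (j + 1 + i)) (fun j' hj' => hdl1 j' (by omega)), ← mul_assoc,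
        inv_mul_cancel₀ (pow_ne_zero k hrC), one_mul]
    simp only [h1]
    rw [← tsum_mul_left]
    have h2 : ∀ w : Fin (k + 1) → Bool, F w * treeSum d r (node (k + 1) w) x =
        ∑' j : ℕ, F w * (dl (k + 1) ^ j * (if x j = w 0 then
      r * treeSum d r (node k (Fin.tail w)) (fun i => x (j + 1 + i)) else 0)) := by
      intro w
      rw [treeSum_node_succ, tsum_mul_left, hdl _ le_rfl]
    simp only [h2]
    rw [← Summable.tsum_finsetSum]
    · refine tsum_congr fun j => ?_
      -- Of the two possible first letters of w only x j contributes.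
      rw [← (Fin.consEquiv fun _ => Bool).sum_comp, Fintype.sum_prod_type, Fintype.sum_bool]
      have hc : ∀ (b : Bool) (w : Fin k → Bool),
        (Fin.consEquiv fun _ => Bool) (b, w) = (Fin.cons b w : Fin (k + 1) → Bool) := fun _ _ => rfl
      simp only [hc, Fin.cons_zero, Fin.tail_cons]
      cases x j <;>
      · simp only [if_true, Bool.false_eq_true, Bool.true_eq_false, if_false, mul_zero,
          Finset.sum_const_zero, zero_add, add_zero, Finset.mul_sum]
        refine Finset.sum_congr rfl fun w _ => ?_
        field_simp
        ring
    · intro w _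
      refine Summable.mul_left _ ?_
      refine Summable.of_norm_bounded ((summable_geometric_of_lt_one (norm_nonneg _)
        (hdl1 (k + 1) le_rfl k.succ_ne_zero)).mul_right r) fun j => ?_
      rw [norm_mul, norm_pow]
      refine mul_le_mul_of_nonneg_left ?_ (pow_nonneg (norm_nonneg _) j)
      split_ifs
      · rw [norm_mul, Complex.norm_real, Real.norm_of_nonneg hr.le]
        exact mul_le_of_le_one_right hr.le (norm_treeSum_le hr.le hd hd' _ _)
      · simpa using hr.le

/-- The values of the diagonal on the tree: `1` at the root, `z0` on the top level, `z` in
between. The top level starts at the node `T`. -/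
def treeDiag (z z0 : ℂ) (T : ℕ) (e : ℕ) : ℂ := if e = 0 then 1 else if e < T then z else z0

/-- The integer with the binary digits `w`. -/
def wordCode : {k : ℕ} → (Fin k → Bool) → ℕ
  | 0, _ => 0
  | _ + 1, w => 2 * wordCode (Fin.tail w) + (w 0).toNat

/-- Level k of the heap starts at 2^k - 1 and is ordered by the binary codes of the words. -/
lemma node_eq {k : ℕ} (w : Fin k → Bool) : node k w + 1 = 2 ^ k + wordCode w := by
  induction k with
  | zero => rfl
  | succ k ih =>
    have := ih (Fin.tail w)
    rw [node, wordCode, pow_succ]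
    omega

lemma wordCode_lt {k : ℕ} (w : Fin k → Bool) : wordCode w < 2 ^ k := by
  induction k with
  | zero => simp [wordCode]
  | succ k ih =>
    have := ih (Fin.tail w)
    have := (w 0).toNat_le
    rw [wordCode, pow_succ]
    omega

lemma wordCode_testBit (k c : ℕ) (hc : c < 2 ^ k) :
    wordCode (fun j : Fin k => c.testBit j) = c := by
  induction k generalizing c with
  | zero => simp at hc; simp [wordCode, hc]
  | succ k ih =>
    have h1 : Fin.tail (fun j : Fin (k + 1) => c.testBit j) = fun j : Fin k => (c / 2).testBit j := by
      ext j
      simp [Fin.tail, Nat.testBit_succ]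
    rw [wordCode, h1, ih _ (by rw [pow_succ] at hc; omega)]
    have h2 : (c.testBit 0).toNat = c % 2 := by
      rw [Nat.testBit_zero]
      rcases Nat.mod_two_eq_zero_or_one c with h | h <;> simp [h]
    simp only [Fin.val_zero, h2]
    omega

lemma testBit_wordCode {k : ℕ} (w : Fin k → Bool) (j : Fin k) : (wordCode w).testBit j = w j := by
  induction k with
  | zero => exact j.elim0
  | succ k ih =>
    have := (w 0).toNat_le
    refine Fin.cases ?_ (fun j => ?_) j
    · rw [wordCode, Fin.val_zero, Nat.testBit_zero]
      cases w 0 <;> simp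
    · rw [wordCode, Fin.val_succ, Nat.testBit_succ,
        show (2 * wordCode (Fin.tail w) + (w 0).toNat) / 2 = wordCode (Fin.tail w) by omega, ih]
      rfl

lemma sum_words {k : ℕ} (G : (Fin k → Bool) → ℂ) :
    ∑ w, G w = ∑ c ∈ Finset.range (2 ^ k), G fun j => c.testBit j := by
  refine Finset.sum_bij (fun w _ => wordCode w) (fun w _ => Finset.mem_range.2 (wordCode_lt w))
    (fun w _ w' _ h => ?_) (fun c hc => ⟨_, Finset.mem_univ _,
      wordCode_testBit k c (Finset.mem_range.1 hc)⟩) fun w _ => ?_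
  · ext j
    rw [← testBit_wordCode w, h, testBit_wordCode]
  · simp only [testBit_wordCode]

/-- The linear functional that recovers the generating function of `f` from the tree. -/
def treeFunctional {l : ℕ} (f : (Fin l → Bool) → ℂ) (v : ℕ → ℂ) : ℂ :=
  ∑ c ∈ Finset.range (2 ^ l), (f fun j => c.testBit j) *
    (v (2 ^ (l + 1) - 1 + 2 * c) - v (2 ^ (l + 1) - 1 + 2 * c + 1))

section Generating

variable {l : ℕ} {f : (Fin l → Bool) → ℂ} {z z0 : ℂ}

/-- The exponent k_0 - 1 may be -1; one factor z0 makes all exponents natural numbers. -/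
lemma gTerm_mul (x : ℕ → Bool) (h0 : z0 ≠ 0) (s : Fin (l + 1) ↪o ℕ) :
    gTerm f x (Fin.cons z0 fun _ => z) s * z0 =
      ((if x (s 0) then -1 else 1) * f (fun i => x (s i.succ))) *
        gapProd' (Fin.cons z0 fun _ => z : Fin (l + 1) → ℂ) s := by
  rw [gTerm, gapProd', gapProd]
  simp only [Fin.cons_zero, Fin.cons_succ]
  rw [zpow_sub_one₀ h0, zpow_natCast]
  field_simp

lemma summable_gTerm (hf : ∀ w, ‖f w‖ ≤ 1) (hz : ‖z‖ < 1) (hz0 : ‖z0‖ < 1) (h0 : z0 ≠ 0)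
    (x : ℕ → Bool) : Summable (gTerm f x (Fin.cons z0 fun _ => z)) := by
  have h := summable_mul_gapProd' (Fin.cons z0 fun _ => z : Fin (l + 1) → ℂ)
    (fun i => Fin.cases hz0 (fun _ => hz) i)
    (fun s => (if x (s 0) then -1 else 1) * f (fun i => x (s i.succ))) 1 fun s => by
      rw [norm_mul]
      split_ifs <;> simpa using hf _
  simp only [← gTerm_mul x h0] at h
  exact (summable_mul_right_iff h0).1 h

lemma treeDiag_node {j : ℕ} (hj : j ≤ l + 1) (w : Fin j → Bool) :
    treeDiag z z0 (2 ^ (l + 1) - 1) (node j w) =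
      if j = 0 then 1 else if j = l + 1 then z0 else z := by
  have h1 := node_eq w
  have h2 := wordCode_lt w
  rw [treeDiag]
  rcases Nat.eq_zero_or_pos j with rfl | hj0
  · simp [node]
  · have h3 : 2 ^ 1 ≤ 2 ^ j := Nat.pow_le_pow_right (by norm_num) hj0
    rw [if_neg (show ¬ node j w = 0 by omega), if_neg (show ¬ j = 0 by omega)]
    rcases hj.eq_or_lt with rfl | hlt
    · rw [if_neg (show ¬ node (l + 1) w < 2 ^ (l + 1) - 1 by omega), if_pos rfl]
    · have h4 : 2 ^ (j + 1) ≤ 2 ^ (l + 1) := Nat.pow_le_pow_right (by norm_num) hlt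
      rw [pow_succ] at h4
      rw [if_pos (show node j w < 2 ^ (l + 1) - 1 by omega), if_neg (show ¬ j = l + 1 by omega)]

/-- On the level l + 1 the nodes come in sibling pairs that differ in the first letter only. Left
minus right sibling produces the sign (-1)^{x_{k_0}}, and the common rest of the word is weighted by
f. The first letter is the lowest bit, whence the indices 2c and 2c + 1 on that level. -/
theorem treeFunctional_treeSum {r : ℝ} (hr : 0 < r)
    (hd : ∀ e ≠ 0, ‖treeDiag z z0 (2 ^ (l + 1) - 1) e‖ + r ≤ 1) (h0 : z0 ≠ 0) (x : ℕ → Bool) :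
    treeFunctional f (fun e => treeSum (treeDiag z z0 (2 ^ (l + 1) - 1)) r e x) =
      r ^ (l + 1) * (z0 * gPoly f x (Fin.cons z0 fun _ => z)) := by
  have h := sum_treeSum_node (d := treeDiag z z0 (2 ^ (l + 1) - 1)) hr hd
    (fun j => if j = 0 then 1 else if j = l + 1 then z0 else z) (l + 1)
    (fun j hj w => treeDiag_node hj w) (fun w => (if w 0 then -1 else 1) * f (Fin.tail w)) x
  have h1 : (fun i : Fin (l + 1) => (if l + 1 - (i : ℕ) = 0 then 1 else
      if l + 1 - (i : ℕ) = l + 1 then z0 else z : ℂ)) = Fin.cons z0 fun _ => z := by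
    ext i
    refine Fin.cases ?_ (fun i => ?_) i
    · simp
    · rw [if_neg (by have := i.2; rw [Fin.val_succ]; omega),
        if_neg (by rw [Fin.val_succ]; omega), Fin.cons_succ]
  rw [h1] at h
  have h2 : (∑' s : Fin (l + 1) ↪o ℕ, ((if x (s 0) then -1 else 1) *
      f (Fin.tail fun i => x (s i))) * gapProd' (Fin.cons z0 fun _ => z : Fin (l + 1) → ℂ) s) =
      z0 * gPoly f x (Fin.cons z0 fun _ => z) := by
    rw [gPoly, mul_comm, ← tsum_mul_right]
    exact tsum_congr fun s => (gTerm_mul x h0 s).symm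
  rw [h2] at h
  rw [← h, treeFunctional, ← (Fin.consEquiv fun _ => Bool).sum_comp, Fintype.sum_prod_type,
    Fintype.sum_bool, ← Finset.sum_add_distrib, sum_words]
  refine Finset.sum_congr rfl fun c hc => ?_
  have hc' := Finset.mem_range.1 hc
  have hn : ∀ b : Bool, node (l + 1) (Fin.cons b fun j => c.testBit j) =
      2 ^ (l + 1) - 1 + 2 * c + b.toNat := by
    intro b
    have h3 := node_eq (fun j : Fin l => c.testBit j)
    rw [wordCode_testBit l c hc'] at h3
    change 2 * node l (fun j => c.testBit j) + 1 + b.toNat = _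
    rw [pow_succ]
    omega
  have hc2 : ∀ b : Bool, (Fin.consEquiv fun _ => Bool) (b, fun j : Fin l => c.testBit j) =
    (Fin.cons b fun j => c.testBit j : Fin (l + 1) → Bool) := fun _ => rfl
  simp only [hc2, hn, Fin.cons_zero, Fin.tail_cons, Bool.toNat_true, Bool.toNat_false, if_true,
    Bool.false_eq_true, if_false, add_zero]
  ring

end Generating

end TraceRec
end

noncomputable section
namespace TraceRec

/-! ### Inversion of the random shift -/

/-- The conditions under which the random shift can be undone. -/
structure ShiftBound (S : ℕ → ℝ) (n a η : ℕ) (z : ℝ) (z0 : ℂ) (r : ℝ) : Prop where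
  nonneg : ∀ i, 0 ≤ S i
  sum_eq : ∑ i ∈ Finset.range n, S i = 1
  supp : ∀ i, S i ≠ 0 → a ≤ i ∧ i ≤ a + η
  lt : a + η < n
  z_pos : 0 < z
  z_le : z ≤ ‖z0‖
  z0_le : ‖z0‖ + r ≤ 1
  r0 : 0 ≤ r
  small : η * (r / z) ≤ 1 / 4
  top : 1 / 2 ≤ ‖∑ i ∈ Finset.range n, (S i : ℂ) * z0⁻¹ ^ (i - a)‖

lemma transfer_root {d : ℕ → ℂ} (h0 : d 0 = 1) (r : ℝ) (b : Bool) (g : ℕ → ℂ) :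
    transfer d r b g 0 = g 0 := by
  simp [transfer, coupling, h0]

namespace ShiftBound

variable {S : ℕ → ℝ} {n a η : ℕ} {z : ℝ} {z0 : ℂ} {r : ℝ}

lemma z_add_le (h : ShiftBound S n a η z z0 r) : z + r ≤ 1 := by linarith [h.z_le, h.z0_le]

lemma z_le_one (h : ShiftBound S n a η z z0 r) : z ≤ 1 := by linarith [h.z_add_le, h.r0]

lemma z0_ne (h : ShiftBound S n a η z z0 r) : z0 ≠ 0 := by
  rw [← norm_pos_iff]; linarith [h.z_le, h.z_pos]

/-- The values of a node along the interval of the possible shifts. -/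
lemma norm_node_sub_le (h : ShiftBound S n a η z z0 r) {d : ℕ → ℂ} {x : ℕ → Bool}
    {V : ℕ → ℕ → ℂ} (hV : ∀ s < n, V s = transfer d r (x s) (V (s + 1))) {e : ℕ}
    (he : z ≤ ‖d e‖) {B : ℝ} (hB : 0 ≤ B)
    (hpar : ∀ j ≤ η, ‖V (a + j) ((e - 1) / 2)‖ ≤ z⁻¹ ^ j * B) (j : ℕ) (hj : j ≤ η) :
    ‖V (a + j) e - (d e)⁻¹ ^ j * V a e‖ ≤ z⁻¹ ^ j * (η * (r / z)) * B := by
  have hz := h.z_pos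
  have hr := h.r0
  suffices hs : ‖V (a + j) e - (d e)⁻¹ ^ j * V a e‖ ≤ z⁻¹ ^ j * (j * (r / z)) * B by
    refine hs.trans ?_
    gcongr
  have hd0 : d e ≠ 0 := by rw [← norm_pos_iff]; linarith
  have hdi : ‖(d e)⁻¹‖ ≤ z⁻¹ := by
    rw [norm_inv]; exact inv_anti₀ hz he
  induction j with
  | zero => simp
  | succ j ih =>
    have h1 := hV (a + j) (by have := h.lt; omega)
    -- The relation V_s = d V_{s+1} + r (parent) is solved for V_{s+1}; every step of the window
    -- adds at most r/z to the relative error.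
    have h2 : V (a + (j + 1)) e - (d e)⁻¹ ^ (j + 1) * V a e =
        (d e)⁻¹ * (V (a + j) e - (d e)⁻¹ ^ j * V a e) -
          (d e)⁻¹ * (r * coupling (x (a + j)) (V (a + (j + 1))) e) := by
      rw [h1, transfer, pow_succ']
      field_simp
      rw [← add_assoc]
      ring
    have h3 : ‖coupling (x (a + j)) (V (a + (j + 1))) e‖ ≤ z⁻¹ ^ (j + 1) * B :=
      norm_coupling_le (by positivity) _ _ (hpar _ hj)
    rw [h2]
    calc _ ≤ ‖(d e)⁻¹‖ * ‖V (a + j) e - (d e)⁻¹ ^ j * V a e‖ +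
          ‖(d e)⁻¹‖ * (r * ‖coupling (x (a + j)) (V (a + (j + 1))) e‖) := by
          refine (norm_sub_le _ _).trans ?_
          rw [norm_mul, norm_mul, norm_mul, Complex.norm_real, Real.norm_of_nonneg h.r0]
      _ ≤ z⁻¹ * (z⁻¹ ^ j * (j * (r / z)) * B) + z⁻¹ * (r * (z⁻¹ ^ (j + 1) * B)) := by
          have := ih (by omega)
          gcongr
      _ = _ := by
          rw [div_eq_mul_inv]
          push_cast
          ring

lemma sum_range_eq (h : ShiftBound S n a η z z0 r) {F G : ℕ → ℂ}
    (hFG : ∀ j ≤ η, F (a + j) = G (a + j)) :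
    ∑ i ∈ Finset.range n, (S i : ℂ) * F i = ∑ i ∈ Finset.range n, (S i : ℂ) * G i := by
  refine Finset.sum_congr rfl fun i _ => ?_
  by_cases hi : S i = 0
  · simp [hi]
  · obtain ⟨h1, h2⟩ := h.supp i hi
    have := hFG (i - a) (by omega)
    rw [Nat.add_sub_cancel' h1] at this
    rw [this]

lemma norm_sum_range_le (h : ShiftBound S n a η z z0 r) {F : ℕ → ℂ} {G : ℕ → ℝ}
    (hFG : ∀ j ≤ η, ‖F (a + j)‖ ≤ G (a + j)) :
    ‖∑ i ∈ Finset.range n, (S i : ℂ) * F i‖ ≤ ∑ i ∈ Finset.range n, S i * G i := by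
  refine (norm_sum_le _ _).trans (Finset.sum_le_sum fun i _ => ?_)
  rw [norm_mul, Complex.norm_real, Real.norm_of_nonneg (h.nonneg i)]
  by_cases hi : S i = 0
  · simp [hi]
  · obtain ⟨h1, h2⟩ := h.supp i hi
    have := hFG (i - a) (by omega)
    rw [Nat.add_sub_cancel' h1] at this
    exact mul_le_mul_of_nonneg_left this (h.nonneg i)

/-- For real z in (0, 1] all weights are at least one and nothing cancels; this is why the middle
levels need a positive z. -/
lemma one_le_weight (h : ShiftBound S n a η z z0 r) :
    1 ≤ ∑ i ∈ Finset.range n, S i * z⁻¹ ^ (i - a) := by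
  rw [← h.sum_eq]
  refine Finset.sum_le_sum fun i _ => le_mul_of_one_le_right (h.nonneg i) ?_
  exact one_le_pow₀ ((one_le_inv₀ h.z_pos).2 h.z_le_one)

/-- If the average over the shifts is small, then so is the unshifted value. -/
theorem norm_le (h : ShiftBound S n a η z z0 r) {N : ℕ} {x : ℕ → Bool}
    {V : ℕ → ℕ → ℂ} (hV : ∀ s < n, V s = transfer (treeDiag z z0 N) r (x s) (V (s + 1)))
    {δ : ℝ} (hroot : ∑ i ∈ Finset.range n, (S i : ℂ) * V i 0 = 0)
    (hδ : ∀ e < 2 * N + 1, ‖∑ i ∈ Finset.range n, (S i : ℂ) * V i e‖ ≤ δ)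
    (e : ℕ) (he : e < 2 * N + 1) : ‖V 0 e‖ ≤ 4 * δ := by
  have hz := h.z_pos
  have hr := h.r0
  have hδ0 : 0 ≤ δ := (norm_nonneg _).trans (hδ 0 (by omega))
  set d := treeDiag z z0 N with hd
  have hd0 : d 0 = 1 := by simp [hd, treeDiag]
  have hdz : ∀ e, z ≤ ‖d e‖ := by
    intro e
    rw [hd, treeDiag]
    split_ifs
    · simpa using h.z_le_one
    · rw [Complex.norm_real]; exact le_abs_self z
    · exact h.z_le
  have hd1 : ∀ e ≠ 0, ‖d e‖ + r ≤ 1 := by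
    intro e he
    rw [hd, treeDiag, if_neg he]
    split_ifs
    · rw [Complex.norm_real, Real.norm_of_nonneg hz.le]; exact h.z_add_le
    · exact h.z0_le
  -- the root vanishes
  have hroot0 : ∀ s ≤ n, V s 0 = 0 := by
    have h1 : ∀ s ≤ n, V s 0 = V n 0 := by
      intro s hs
      induction hs using Nat.decreasingInduction with
      | self => rfl
      | of_succ k hk ih => rw [hV k hk, transfer_root hd0, ih]
    intro s hs
    rw [h1 s hs]
    rw [Finset.sum_congr rfl fun i hi => by rw [h1 i (Finset.mem_range.1 hi).le],
      ← Finset.sum_mul, ← Complex.ofReal_sum, h.sum_eq, Complex.ofReal_one, one_mul] at hroot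
    exact hroot
  set σ := η * (r / z) with hσ
  have hσ0 : 0 ≤ σ := by positivity
  set D := ∑ i ∈ Finset.range n, S i * z⁻¹ ^ (i - a) with hD
  have hD1 : 1 ≤ D := h.one_le_weight
  -- a bound for the middle levels in terms of its values at `a`
  obtain ⟨W, hW0, hW, hWmax⟩ : ∃ W : ℝ, 0 ≤ W ∧ (∀ e < N, ‖V a e‖ ≤ W) ∧
      (W = 0 ∨ ∃ e < N, e ≠ 0 ∧ ‖V a e‖ = W) := by
    rcases Nat.eq_zero_or_pos N with rfl | hN
    · exact ⟨0, le_rfl, fun e he => absurd he (Nat.not_lt_zero e), Or.inl rfl⟩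
    · obtain ⟨m, hm, hmax⟩ := Finset.exists_max_image (Finset.range N) (fun e => ‖V a e‖)
        ⟨0, Finset.mem_range.2 hN⟩
      refine ⟨‖V a m‖, norm_nonneg _, fun e he => hmax e (Finset.mem_range.2 he), ?_⟩
      by_cases hm0 : m = 0
      · left; rw [hm0, hroot0 a (by have := h.lt; omega), norm_zero]
      · exact Or.inr ⟨m, Finset.mem_range.1 hm, hm0, rfl⟩
  -- Induction from the root downwards: if the parent obeys the bound with 2W, the child obeys it
  -- with W + 2σW ≤ 2W, because σ ≤ 1/4.
  have hmid : ∀ e < N, ∀ j ≤ η, ‖V (a + j) e‖ ≤ z⁻¹ ^ j * (2 * W) := by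
    intro e
    induction e using Nat.strong_induction_on with
    | _ e ih =>
      intro heN j hj
      rcases Nat.eq_zero_or_pos e with rfl | he0
      · rw [hroot0 (a + j) (by have := h.lt; omega), norm_zero]; positivity
      · have h1 := h.norm_node_sub_le hV (hdz e) (B := 2 * W) (by positivity)
          (ih ((e - 1) / 2) (by omega) (by omega)) j hj
        have hde : d e = z := by rw [hd, treeDiag, if_neg he0.ne', if_pos heN]
        rw [hde] at h1
        have h2 : ‖((z : ℂ))⁻¹ ^ j * V a e‖ ≤ z⁻¹ ^ j * W := by
          rw [norm_mul, norm_pow, norm_inv, Complex.norm_real, Real.norm_of_nonneg hz.le]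
          have := hW e heN
          gcongr
        have h3 := norm_le_norm_add_norm_sub' (V (a + j) e) (((z : ℂ))⁻¹ ^ j * V a e)
        have h4 : z⁻¹ ^ j * σ * (2 * W) ≤ z⁻¹ ^ j * (1 / 4) * (2 * W) := by
          have := h.small
          gcongr
        have h5 : 0 ≤ z⁻¹ ^ j * W := by positivity
        linarith
  -- the averages at the nodes of the tree
  have hav : ∀ e < 2 * N + 1, e ≠ 0 →
      ‖∑ i ∈ Finset.range n, (S i : ℂ) * ((d e)⁻¹ ^ (i - a) * V a e)‖ ≤ δ + 2 * σ * (D * W) := by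
    intro e he he0
    have h1 : ‖∑ i ∈ Finset.range n, (S i : ℂ) * (V i e - (d e)⁻¹ ^ (i - a) * V a e)‖ ≤
        ∑ i ∈ Finset.range n, S i * (z⁻¹ ^ (i - a) * σ * (2 * W)) := by
      refine h.norm_sum_range_le fun j hj => ?_
      rw [Nat.add_sub_cancel_left]
      exact h.norm_node_sub_le hV (hdz e) (by positivity)
        (hmid _ (by omega)) j hj
    have h2 : ∑ i ∈ Finset.range n, S i * (z⁻¹ ^ (i - a) * σ * (2 * W)) = 2 * σ * (D * W) := by
      rw [hD, Finset.sum_mul, Finset.mul_sum]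
      exact Finset.sum_congr rfl fun i _ => by ring
    have h3 := hδ e he
    rw [h2] at h1
    simp only [mul_sub, Finset.sum_sub_distrib] at h1
    have h4 := norm_le_norm_add_norm_sub (∑ i ∈ Finset.range n, (S i : ℂ) * V i e)
      (∑ i ∈ Finset.range n, (S i : ℂ) * ((d e)⁻¹ ^ (i - a) * V a e))
    linarith
  have hDW : D * W ≤ 2 * δ := by
    rcases hWmax with h1 | ⟨e, heN, he0, heW⟩
    · rw [h1, mul_zero]; positivity
    · have h1 := hav e (by omega) he0
      have hde : d e = z := by rw [hd, treeDiag, if_neg he0, if_pos heN]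
      have h2 : ∑ i ∈ Finset.range n, (S i : ℂ) * ((d e)⁻¹ ^ (i - a) * V a e) =
          (D : ℂ) * V a e := by
        rw [hde, hD, Complex.ofReal_sum, Finset.sum_mul]
        refine Finset.sum_congr rfl fun i _ => ?_
        push_cast
        ring
      rw [h2, norm_mul, Complex.norm_real, Real.norm_of_nonneg (by linarith), heW] at h1
      have h3 : 2 * σ * (D * W) ≤ 2 * (1 / 4) * (D * W) := by
        have := h.small
        have : 0 ≤ D := by linarith
        gcongr
      linarith
  have hWδ : W ≤ 2 * δ := (le_mul_of_one_le_left hW0 hD1).trans hDW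
  -- On the top level the weight of V a e has modulus at least 1/2 and the right side is at most δ +
  -- 2σ · 2δ ≤ 2δ; this is the origin of the factor 4.
  have hVa : ∀ e < 2 * N + 1, ‖V a e‖ ≤ 4 * δ := by
    intro e he
    rcases lt_or_ge e N with heN | heN
    · linarith [hW e heN]
    · rcases Nat.eq_zero_or_pos e with rfl | he0
      · rw [hroot0 a (by have := h.lt; omega), norm_zero]; positivity
      · have h1 := hav e he he0.ne'
        have hde : d e = z0 := by rw [hd, treeDiag, if_neg he0.ne', if_neg (by omega)]
        simp only [← mul_assoc] at h1
        rw [hde, ← Finset.sum_mul, norm_mul] at h1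
        have h2 : 2 * σ * (D * W) ≤ 2 * (1 / 4) * (2 * δ) := by
          have := h.small
          have : 0 ≤ D := by linarith
          gcongr
        simp only [← mul_assoc] at h2
        have h3 := mul_le_mul_of_nonneg_right h.top (norm_nonneg (V a e))
        linarith
  -- Before the window no inversion is needed: going back from a to 0 applies transfer operators,
  -- which do not increase the norm of a vector vanishing at the root.
  have hall : ∀ s ≤ a, ∀ e < 2 * N + 1, ‖V s e‖ ≤ 4 * δ := by
    intro s hs
    induction hs using Nat.decreasingInduction with
    | self => exact hVa
    | of_succ k hk ih =>
      intro e he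
      rcases Nat.eq_zero_or_pos e with rfl | he0
      · rw [hroot0 k (by have := h.lt; omega), norm_zero]; positivity
      · rw [hV k (by have := h.lt; omega), transfer]
        calc _ ≤ ‖d e‖ * ‖V (k + 1) e‖ + r * ‖coupling (x k) (V (k + 1)) e‖ := by
              refine (norm_add_le _ _).trans ?_
              rw [norm_mul, norm_mul, Complex.norm_real, Real.norm_of_nonneg hr]
          _ ≤ ‖d e‖ * (4 * δ) + r * (4 * δ) := by
              have h1 := ih e he
              have h2 : ‖coupling (x k) (V (k + 1)) e‖ ≤ 4 * δ :=
                norm_coupling_le (by positivity) _ _ (ih _ (by omega))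
              gcongr
          _ = (‖d e‖ + r) * (4 * δ) := by ring
          _ ≤ 1 * (4 * δ) := by
              have := hd1 e he0.ne'
              gcongr
          _ = 4 * δ := one_mul _
  exact hall 0 (Nat.zero_le _) e he

end ShiftBound

end TraceRec
end

noncomputable section
namespace TraceRec

/-! ### The solver -/

/-- `transfer` as a linear map. -/
def transferLin (d : ℕ → ℂ) (r : ℝ) (b : Bool) : (ℕ → ℂ) →ₗ[ℂ] (ℕ → ℂ) where
  toFun := transfer d r b
  map_add' g g' := by
    ext e
    simp only [transfer, coupling, Pi.add_apply]
    split_ifs <;> ring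
  map_smul' c g := by
    ext e
    simp only [transfer, coupling, Pi.smul_apply, smul_eq_mul, RingHom.id_apply]
    split_ifs <;> ring

/-- The product of the transfer operators of the last `k` of the bits `x 0, ..., x (n - 1)`. -/
def suffixLin (d : ℕ → ℂ) (r : ℝ) (x : ℕ → Bool) (n : ℕ) : ℕ → (ℕ → ℂ) →ₗ[ℂ] (ℕ → ℂ)
  | 0 => LinearMap.id
  | k + 1 => transferLin d r (x (n - 1 - k)) ∘ₗ suffixLin d r x n k

/-- The average over the shifts. -/
def shiftAvg (d : ℕ → ℂ) (r : ℝ) (x : ℕ → Bool) (S : ℕ → ℝ) (n : ℕ) : (ℕ → ℂ) →ₗ[ℂ] (ℕ → ℂ) :=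
  ∑ k ∈ Finset.range n, (S (n - 1 - k) : ℂ) • suffixLin d r x n (k + 1)

/-- The diagonal of `shiftAvg`. -/
def shiftDiag (d : ℕ → ℂ) (S : ℕ → ℝ) (n : ℕ) (e : ℕ) : ℂ :=
  ∑ k ∈ Finset.range n, (S (n - 1 - k) : ℂ) * d e ^ (k + 1)

/-- Approximate inverses of `shiftAvg`. -/
def solver (d : ℕ → ℂ) (r : ℝ) (x : ℕ → Bool) (S : ℕ → ℝ) (n : ℕ) :
    ℕ → (ℕ → ℂ) →ₗ[ℂ] (ℕ → ℂ)
  | 0 => 0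
  | k + 1 => solver d r x S n k + LinearMap.mulLeft ℂ (fun e => (shiftDiag d S n e)⁻¹) ∘ₗ
      (LinearMap.id - shiftAvg d r x S n ∘ₗ solver d r x S n k)

section Solver

variable {d : ℕ → ℂ} {r : ℝ} {x : ℕ → Bool} {S : ℕ → ℝ} {n : ℕ}

/-- The nodes below 2N + 1 have their parents below N. If g vanishes on the first N nodes, no
coupling reaches them and only the diagonal acts. -/
lemma suffixLin_apply_of_zero {g : ℕ → ℂ} {N : ℕ} (hg : ∀ e < N, g e = 0) (k e : ℕ)
    (he : e < 2 * N + 1) : suffixLin d r x n k g e = d e ^ k * g e := by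
  induction k generalizing e with
  | zero => simp [suffixLin]
  | succ k ih =>
    change transfer d r _ (suffixLin d r x n k g) e = _
    have hc : coupling (x (n - 1 - k)) (suffixLin d r x n k g) e = 0 := by
      unfold coupling
      split_ifs with h
      · rw [ih _ (by omega), hg _ (by omega), mul_zero]
      · rfl
    rw [transfer, hc, ih e he, mul_zero, add_zero, pow_succ', mul_assoc]

lemma shiftAvg_apply (v : ℕ → ℂ) (e : ℕ) : shiftAvg d r x S n v e =
    ∑ i ∈ Finset.range n, (S i : ℂ) * suffixLin d r x n (n - i) v e := by
  rw [shiftAvg, ← Finset.sum_range_reflect, LinearMap.sum_apply, Finset.sum_apply]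
  refine Finset.sum_congr rfl fun i hi => ?_
  have := Finset.mem_range.1 hi
  rw [show n - 1 - (n - 1 - i) = i by omega, show n - 1 - i + 1 = n - i by omega]
  rfl

lemma shiftDiag_eq (e : ℕ) : shiftDiag d S n e =
    ∑ i ∈ Finset.range n, (S i : ℂ) * d e ^ (n - i) := by
  rw [shiftDiag, ← Finset.sum_range_reflect]
  refine Finset.sum_congr rfl fun i hi => ?_
  have := Finset.mem_range.1 hi
  rw [show n - 1 - (n - 1 - i) = i by omega, show n - 1 - i + 1 = n - i by omega]

lemma shiftAvg_apply_of_zero {g : ℕ → ℂ} {N : ℕ} (hg : ∀ e < N, g e = 0) (e : ℕ)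
    (he : e < 2 * N + 1) : shiftAvg d r x S n g e = shiftDiag d S n e * g e := by
  rw [shiftAvg_apply, shiftDiag_eq, Finset.sum_mul]
  exact Finset.sum_congr rfl fun i _ => by rw [suffixLin_apply_of_zero hg _ e he, mul_assoc]

/-- Once the residual vanishes on k levels, `shiftAvg` acts on the correction as its diagonal on the
next level, and dividing by the diagonal removes the residual there. Each iteration settles one more
level. -/
lemma shiftAvg_solver {E : ℕ} (hD : ∀ e < E, shiftDiag d S n e ≠ 0) (g : ℕ → ℂ) (k e : ℕ)
    (he : e + 1 < 2 ^ k) (heE : e < E) : shiftAvg d r x S n (solver d r x S n k g) e = g e := by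
  induction k generalizing e with
  | zero => simp at he
  | succ k ih =>
    set R := g - shiftAvg d r x S n (solver d r x S n k g) with hR
    have h1 : ∀ e < min (2 ^ k - 1) E, (fun e => (shiftDiag d S n e)⁻¹ * R e) e = 0 := by
      intro e he
      have := lt_min_iff.1 he
      simp only [hR, Pi.sub_apply]
      rw [ih e (by omega) (by omega), sub_self, mul_zero]
    have h2 := shiftAvg_apply_of_zero (d := d) (r := r) (x := x) (S := S) (n := n) h1 e
      (by rw [pow_succ] at he; omega)
    have h3 : solver d r x S n (k + 1) g =
        solver d r x S n k g + fun e => (shiftDiag d S n e)⁻¹ * R e := rfl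
    rw [h3, map_add, Pi.add_apply, h2, mul_inv_cancel_left₀ (hD e heE), hR, Pi.sub_apply]
    ring

lemma suffixLin_eq_transfer (v : ℕ → ℂ) (s : ℕ) (hs : s < n) : suffixLin d r x n (n - s) v =
    transfer d r (x s) (suffixLin d r x n (n - (s + 1)) v) := by
  conv_lhs => rw [show n - s = n - (s + 1) + 1 by omega]
  change transfer d r (x (n - 1 - (n - (s + 1)))) _ = _
  rw [show n - 1 - (n - (s + 1)) = s by omega]

lemma suffixLin_family {γ : ℕ → ℕ → ℂ} (hγ : ∀ s < n, γ s = transfer d r (x s) (γ (s + 1)))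
    (s : ℕ) (hs : s ≤ n) : suffixLin d r x n (n - s) (γ n) = γ s := by
  induction hs using Nat.decreasingInduction with
  | self => simp [suffixLin]
  | of_succ k hk ih => rw [suffixLin_eq_transfer _ _ hk, ih, ← hγ k hk]

end Solver

/-- The estimate for the values of the generating functions of `x` when `g` is the average over the
shifts. -/
def estimator (d : ℕ → ℂ) (r : ℝ) (x : ℕ → Bool) (S : ℕ → ℝ) (n k : ℕ) :
    (ℕ → ℂ) →ₗ[ℂ] (ℕ → ℂ) :=
  suffixLin d r x n n ∘ₗ solver d r x S n k

namespace ShiftBound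

variable {S : ℕ → ℝ} {n a η : ℕ} {z : ℝ} {z0 : ℂ} {r : ℝ} {N : ℕ} {x : ℕ → Bool}

/-- The diagonal is d^(n-a) times the average of d^{-(i-a)} over the shifts, and `ShiftBound` keeps
the latter away from zero for each of the three values 1, z, z0. -/
lemma shiftDiag_ne_zero (h : ShiftBound S n a η z z0 r) (e : ℕ) :
    shiftDiag (treeDiag z z0 N) S n e ≠ 0 := by
  have hz := h.z_pos
  have hd : treeDiag z z0 N e ≠ 0 ∧
      ∑ i ∈ Finset.range n, (S i : ℂ) * (treeDiag z z0 N e)⁻¹ ^ (i - a) ≠ 0 := by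
    rw [treeDiag]
    split_ifs
    · refine ⟨one_ne_zero, ?_⟩
      simp only [inv_one, one_pow, mul_one]
      rw [← Complex.ofReal_sum, h.sum_eq]
      simp
    · refine ⟨by exact_mod_cast hz.ne', ?_⟩
      have := h.one_le_weight
      have h2 : (∑ i ∈ Finset.range n, (S i : ℂ) * ((z : ℂ))⁻¹ ^ (i - a)) =
          ((∑ i ∈ Finset.range n, S i * z⁻¹ ^ (i - a) : ℝ) : ℂ) := by push_cast; rfl
      rw [h2]
      exact_mod_cast (by linarith : (0 : ℝ) < _).ne'
    · refine ⟨h.z0_ne, fun h0 => ?_⟩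
      have := h.top
      rw [h0, norm_zero] at this
      norm_num at this
  obtain ⟨h1, h2⟩ := hd
  rw [shiftDiag_eq]
  have h3 : ∑ i ∈ Finset.range n, (S i : ℂ) * treeDiag z z0 N e ^ (n - i) =
      treeDiag z z0 N e ^ (n - a) *
        ∑ i ∈ Finset.range n, (S i : ℂ) * (treeDiag z z0 N e)⁻¹ ^ (i - a) := by
    rw [Finset.mul_sum, h.sum_range_eq (G := fun i => treeDiag z z0 N e ^ (n - a) *
      (treeDiag z z0 N e)⁻¹ ^ (i - a))]
    · exact Finset.sum_congr rfl fun i _ => by ring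
    · intro j hj
      have := h.lt
      simp only [Nat.add_sub_cancel_left]
      rw [show n - a = n - (a + j) + j by omega, pow_add, mul_assoc, ← mul_pow,
        mul_inv_cancel₀ h1, one_pow, mul_one]
  rw [h3]
  exact mul_ne_zero (pow_ne_zero _ h1) h2

/-- The solution of the triangular system may be large, as the diagonal contains d^(n-a). Its images
under the suffix products, however, form a family V with V_s = M_{x_s} V_{s+1} whose average over
the shifts is the small vector g, so V_0 is small. -/
theorem norm_estimator_le (h : ShiftBound S n a η z z0 r) {k : ℕ} (hk : 2 * N + 1 < 2 ^ k)
    {g : ℕ → ℂ} (hg0 : g 0 = 0) {δ : ℝ} (hg : ∀ e < 2 * N + 1, ‖g e‖ ≤ δ) (e : ℕ)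
    (he : e < 2 * N + 1) : ‖estimator (treeDiag z z0 N) r x S n k g e‖ ≤ 4 * δ := by
  have hex : ∀ e < 2 * N + 1, ∑ i ∈ Finset.range n, (S i : ℂ) *
      suffixLin (treeDiag z z0 N) r x n (n - i) (solver (treeDiag z z0 N) r x S n k g) e =
      g e := by
    intro e he
    rw [← shiftAvg_apply]
    exact shiftAvg_solver (E := 2 * N + 1) (fun e _ => h.shiftDiag_ne_zero e) g k e (by omega) he
  have := h.norm_le (N := N) (x := x) (V := fun s => suffixLin (treeDiag z z0 N) r x n (n - s)
    (solver (treeDiag z z0 N) r x S n k g)) (fun s hs => suffixLin_eq_transfer _ s hs) (δ := δ)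
    (by rw [hex 0 (by omega), hg0]) (fun e he => by rw [hex e he]; exact hg e he) e he
  exact this

/-- The computed solution and γ n have the same average over the shifts on the tree, so the
stability estimate with δ = 0 forces their images under all n operators to coincide there. -/
theorem estimator_family (h : ShiftBound S n a η z z0 r) {k : ℕ} (hk : 2 * N + 1 < 2 ^ k)
    {γ : ℕ → ℕ → ℂ} (hγ : ∀ s < n, γ s = transfer (treeDiag z z0 N) r (x s) (γ (s + 1)))
    (e : ℕ) (he : e < 2 * N + 1) :
    estimator (treeDiag z z0 N) r x S n k
      (fun e => ∑ i ∈ Finset.range n, (S i : ℂ) * γ i e) e = γ 0 e := by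
  set d := treeDiag z z0 N with hd
  set g : ℕ → ℂ := fun e => ∑ i ∈ Finset.range n, (S i : ℂ) * γ i e with hg
  have hgS : g = shiftAvg d r x S n (γ n) := by
    ext e
    rw [shiftAvg_apply]
    exact Finset.sum_congr rfl fun i hi => by
      rw [suffixLin_family hγ i (Finset.mem_range.1 hi).le]
  set v := solver d r x S n k g - γ n with hv
  have hex : ∀ e < 2 * N + 1, ∑ i ∈ Finset.range n, (S i : ℂ) *
      suffixLin d r x n (n - i) v e = 0 := by
    intro e he
    rw [← shiftAvg_apply, hv, map_sub, ← hgS, Pi.sub_apply,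
      shiftAvg_solver (E := 2 * N + 1) (fun e _ => h.shiftDiag_ne_zero e) g k e (by omega) he,
      sub_self]
  have := h.norm_le (N := N) (x := x) (V := fun s => suffixLin d r x n (n - s) v)
    (fun s hs => suffixLin_eq_transfer _ s hs) (δ := 0) (hex 0 (by omega))
    (fun e he => by rw [hex e he, norm_zero]) e he
  rw [mul_zero, norm_le_zero_iff, Nat.sub_zero, hv, map_sub, Pi.sub_apply, sub_eq_zero] at this
  rw [estimator, LinearMap.comp_apply, this]
  have h2 := suffixLin_family hγ 0 (Nat.zero_le _)
  rw [Nat.sub_zero] at h2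
  rw [h2]

end ShiftBound

/-- `treeFunctional` as a linear map. -/
def treeFunctionalLin {l : ℕ} (f : (Fin l → Bool) → ℂ) : (ℕ → ℂ) →ₗ[ℂ] ℂ where
  toFun := treeFunctional f
  map_add' v w := by
    simp only [treeFunctional, Pi.add_apply, ← Finset.sum_add_distrib]
    exact Finset.sum_congr rfl fun _ _ => by ring
  map_smul' c v := by
    simp only [treeFunctional, Pi.smul_apply, smul_eq_mul, RingHom.id_apply, Finset.mul_sum]
    exact Finset.sum_congr rfl fun _ _ => by ring

lemma norm_treeFunctional_le {l : ℕ} {f : (Fin l → Bool) → ℂ} (hf : ∀ w, ‖f w‖ ≤ 1) {v : ℕ → ℂ}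
    {B : ℝ} (hv : ∀ e < 2 * (2 ^ (l + 1) - 1) + 1, ‖v e‖ ≤ B) :
    ‖treeFunctional f v‖ ≤ 2 ^ l * (2 * B) := by
  have hp : (1 : ℕ) ≤ 2 ^ l := Nat.one_le_two_pow
  rw [treeFunctional]
  refine (norm_sum_le_of_le _ (f := fun c : ℕ => (f fun j => c.testBit j) *
    (v (2 ^ (l + 1) - 1 + 2 * c) - v (2 ^ (l + 1) - 1 + 2 * c + 1)))
    (n := fun _ => 2 * B) fun c hc => ?_).trans (by simp)
  have hc' := Finset.mem_range.1 hc
  have hB := (norm_nonneg _).trans (hv 0 (by omega))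
  rw [norm_mul]
  calc _ ≤ 1 * (B + B) := by
        refine mul_le_mul (hf _) ((norm_sub_le _ _).trans (add_le_add (hv _ ?_) (hv _ ?_)))
          (norm_nonneg _) zero_le_one <;> · rw [pow_succ]; omega
    _ = _ := by ring

lemma treeFunctional_congr {l : ℕ} {f : (Fin l → Bool) → ℂ} {v w : ℕ → ℂ}
    (h : ∀ e < 2 * (2 ^ (l + 1) - 1) + 1, v e = w e) :
    treeFunctional f v = treeFunctional f w := by
  have hp : (1 : ℕ) ≤ 2 ^ l := Nat.one_le_two_pow
  refine Finset.sum_congr rfl fun c hc => ?_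
  have hc' := Finset.mem_range.1 hc
  rw [h _ (by rw [pow_succ]; omega), h _ (by rw [pow_succ]; omega)]

end TraceRec
end

noncomputable section
namespace TraceRec

/-! ### Extrapolation -/

/-- The interpolation nodes. -/
def extraNode (β : ℝ) (D i : ℕ) : ℝ := β * (i + 1) / D

/-- The coefficients of the extrapolation from the nodes to `z`. -/
def extraCoeff (β z : ℝ) (D i : ℕ) : ℝ :=
  ∏ j ∈ (Finset.range D).erase i, (z - extraNode β D j) / (extraNode β D i - extraNode β D j)

section Extrapolation

variable {β z : ℝ} {D : ℕ}

lemma extraNode_sub (β : ℝ) (D i j : ℕ) :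
    extraNode β D i - extraNode β D j = β * ((i : ℝ) - j) / D := by
  unfold extraNode; ring

lemma extraNode_injOn (hβ : β ≠ 0) : Set.InjOn (extraNode β D) (Finset.range D) := by
  intro i hi j _ hij
  have hi' := Finset.mem_range.1 (Finset.mem_coe.1 hi)
  have hD : (D : ℝ) ≠ 0 := by
    have : 0 < D := by omega
    positivity
  have h := extraNode_sub β D i j
  rw [hij, sub_self, eq_comm, div_eq_zero_iff, mul_eq_zero, sub_eq_zero] at h
  rcases h with (h | h) | h
  · exact absurd h hβ
  · exact_mod_cast h
  · exact absurd h hD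

lemma extraCoeff_pow (hβ : β ≠ 0) {k : ℕ} (hk : k < D) :
    ∑ i ∈ Finset.range D, extraCoeff β z D i * extraNode β D i ^ k = z ^ k := by
  have h := Lagrange.eq_interpolate (s := Finset.range D) (v := extraNode β D)
    (f := (Polynomial.X ^ k : Polynomial ℝ)) (extraNode_injOn hβ)
    (by rw [Polynomial.degree_X_pow, Finset.card_range]; exact_mod_cast hk)
  have h2 := congrArg (Polynomial.eval z) h
  rw [Lagrange.interpolate_apply, Polynomial.eval_finsetSum] at h2
  simp only [Polynomial.eval_mul, Polynomial.eval_C, Polynomial.eval_pow, Polynomial.eval_X,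
    Lagrange.basis, Polynomial.eval_prod, Lagrange.basisDivisor, Polynomial.eval_sub] at h2
  rw [h2]
  refine Finset.sum_congr rfl fun i _ => ?_
  rw [mul_comm, extraCoeff]
  congr 1
  exact Finset.prod_congr rfl fun j _ => by rw [div_eq_inv_mul]

lemma prod_erase_range (i k : ℕ) :
    ∏ j ∈ (Finset.range (i + 1 + k)).erase i, |(i : ℝ) - j| = i.factorial * k.factorial := by
  induction k with
  | zero =>
    rw [add_zero, Finset.range_add_one, Finset.erase_insert (by simp), Nat.factorial_zero,
      Nat.cast_one, mul_one, ← Finset.prod_range_add_one_eq_factorial, Nat.cast_prod,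
      ← Finset.prod_range_reflect]
    refine Finset.prod_congr rfl fun j hj => ?_
    have := Finset.mem_range.1 hj
    rw [Nat.cast_sub (by omega), Nat.cast_sub (by omega)]
    push_cast
    rw [abs_of_pos (by linarith)]
    ring
  | succ k ih =>
    rw [← add_assoc, Finset.range_add_one, Finset.erase_insert_of_ne (by omega),
      Finset.prod_insert (by simp), ih, Nat.factorial_succ]
    push_cast
    rw [show (i : ℝ) - (i + 1 + k) = -(k + 1) by ring, abs_neg, abs_of_pos (by positivity)]
    ring

/-- Each numerator is at most 2β and the denominators are β|i-j|/D. The product is 2^{D-1}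
binom(D-1, i) D^{D-1}/(D-1)! ≤ 4^{D-1} e^D, and 4e < 11. -/
lemma abs_extraCoeff_le (hβ : 0 < β) (hz : |z| ≤ β) {i : ℕ} (hi : i < D) :
    |extraCoeff β z D i| ≤ 11 ^ D := by
  have hD : (0 : ℝ) < D := by
    have : 0 < D := by omega
    positivity
  have h1 : |extraCoeff β z D i| ≤
      ∏ j ∈ (Finset.range D).erase i, (2 * D) / |(i : ℝ) - j| := by
    rw [extraCoeff, Finset.abs_prod]
    refine Finset.prod_le_prod (fun _ _ => abs_nonneg _) fun j hj => ?_
    obtain ⟨hji, hj⟩ := Finset.mem_erase.1 hj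
    have hj := Finset.mem_range.1 hj
    have hij : (0 : ℝ) < |(i : ℝ) - j| := by
      rw [abs_pos, sub_ne_zero]; exact_mod_cast hji.symm
    have hjD : ((j : ℝ) + 1) / D ≤ 1 := by
      rw [div_le_one hD]; exact_mod_cast hj
    have h2 : |z - extraNode β D j| ≤ 2 * β := by
      have h3 : |extraNode β D j| ≤ β := by
        rw [extraNode, mul_div_assoc, abs_of_nonneg (by positivity)]
        exact mul_le_of_le_one_right hβ.le hjD
      exact (abs_sub _ _).trans (by linarith)
    rw [extraNode_sub, abs_div, abs_div, abs_mul, abs_of_pos hβ, abs_of_pos hD, div_div_eq_mul_div,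
      div_le_div_iff₀ (by positivity) hij]
    calc _ ≤ 2 * β * D * |(i : ℝ) - j| := by gcongr
      _ = _ := by ring
  refine h1.trans ?_
  obtain ⟨k, rfl⟩ : ∃ k, D = i + 1 + k := ⟨D - (i + 1), by omega⟩
  rw [Finset.prod_div_distrib, prod_erase_range, Finset.prod_const,
    Finset.card_erase_of_mem (Finset.mem_range.2 hi), Finset.card_range]
  set D : ℕ := i + 1 + k with hDdef
  have hD1 : D - 1 = i + k := by omega
  rw [hD1]
  have hch : ((i + k).choose i : ℝ) * i.factorial * k.factorial = (i + k).factorial := by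
    have := Nat.choose_mul_factorial_mul_factorial (n := i + k) (k := i) (by omega)
    rw [Nat.add_sub_cancel_left] at this
    exact_mod_cast this
  have hch2 : ((i + k).choose i : ℝ) ≤ 2 ^ (i + k) := by
    exact_mod_cast Nat.choose_le_two_pow (i + k) i
  have hexp : (D : ℝ) ^ (i + k) / (i + k).factorial ≤ Real.exp D :=
    Real.pow_div_factorial_le_exp _ hD.le _
  have h11 : 4 * Real.exp 1 ≤ 11 := by have := Real.exp_one_lt_d9; linarith
  have hff : (0 : ℝ) < i.factorial * k.factorial := by positivity
  calc (2 * (D : ℝ)) ^ (i + k) / (i.factorial * k.factorial)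
      = 2 ^ (i + k) * ((i + k).choose i : ℝ) * ((D : ℝ) ^ (i + k) / (i + k).factorial) := by
        rw [← hch, mul_pow]
        have : ((i + k).choose i : ℝ) ≠ 0 := by
          exact_mod_cast (Nat.choose_pos (by omega)).ne'
        field_simp
    _ ≤ 2 ^ (i + k) * 2 ^ (i + k) * Real.exp D := by gcongr
    _ = 4 ^ (i + k) * Real.exp 1 ^ D := by
        rw [← mul_pow, ← Real.exp_nat_mul, mul_one]; norm_num
    _ ≤ 4 ^ D * Real.exp 1 ^ D := by
        have : (4 : ℝ) ^ (i + k) ≤ 4 ^ D := pow_le_pow_right₀ (by norm_num) (by omega)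
        gcongr
    _ ≤ 11 ^ D := by rw [← mul_pow]; gcongr

lemma sum_abs_extraCoeff_le (hβ : 0 < β) (hz : |z| ≤ β) :
    ∑ i ∈ Finset.range D, |extraCoeff β z D i| ≤ 22 ^ D := by
  calc _ ≤ ∑ i ∈ Finset.range D, (11 : ℝ) ^ D :=
        Finset.sum_le_sum fun i hi => abs_extraCoeff_le hβ hz (Finset.mem_range.1 hi)
    _ = D * 11 ^ D := by simp
    _ ≤ 2 ^ D * 11 ^ D := by
        have : (D : ℝ) ≤ 2 ^ D := by exact_mod_cast D.lt_two_pow_self.le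
        gcongr
    _ = 22 ^ D := by rw [← mul_pow]; norm_num

/-- Interpolation is exact for degrees below D. For k ≥ D both terms are of order β^k = (2β)^k
2^{-k}; the factor 2^{-k} is kept so that the errors can be summed over all index sequences. -/
lemma abs_pow_sub_extra_le (hβ : 0 < β) (hβ' : β ≤ 1 / 2) (hz : |z| ≤ β) (k : ℕ) :
    |z ^ k - ∑ i ∈ Finset.range D, extraCoeff β z D i * extraNode β D i ^ k| ≤
      (1 + 22 ^ D) * (2 * β) ^ D * (1 / 2) ^ k := by
  rcases lt_or_ge k D with hk | hk
  · rw [extraCoeff_pow hβ.ne' hk, sub_self, abs_zero]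
    positivity
  · have h1 : |z ^ k| ≤ β ^ k := by rw [abs_pow]; gcongr
    have h2 : |∑ i ∈ Finset.range D, extraCoeff β z D i * extraNode β D i ^ k| ≤
        22 ^ D * β ^ k := by
      refine (Finset.abs_sum_le_sum_abs _ _).trans ?_
      refine le_trans ?_ (mul_le_mul_of_nonneg_right (sum_abs_extraCoeff_le (D := D) hβ hz)
        (by positivity))
      rw [Finset.sum_mul]
      refine Finset.sum_le_sum fun i hi => ?_
      have hi' := Finset.mem_range.1 hi
      have hD : (0 : ℝ) < D := by
        have : 0 < D := by omega
        positivity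
      have hjD : ((i : ℝ) + 1) / D ≤ 1 := by
        rw [div_le_one hD]; exact_mod_cast hi'
      have h3 : |extraNode β D i| ≤ β := by
        rw [extraNode, mul_div_assoc, abs_of_nonneg (by positivity)]
        exact mul_le_of_le_one_right hβ.le hjD
      rw [abs_mul, abs_pow]
      gcongr
    have h3 : β ^ k ≤ (2 * β) ^ D * (1 / 2) ^ k := by
      have : β ^ k = (2 * β) ^ k * (1 / 2) ^ k := by rw [← mul_pow]; ring
      rw [this]
      have := pow_le_pow_of_le_one (by positivity : 0 ≤ 2 * β) (by linarith) hk
      gcongr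
    calc _ ≤ β ^ k + 22 ^ D * β ^ k := (abs_sub _ _).trans (add_le_add h1 h2)
      _ = (1 + 22 ^ D) * β ^ k := by ring
      _ ≤ (1 + 22 ^ D) * ((2 * β) ^ D * (1 / 2) ^ k) := by gcongr
      _ = _ := by ring

end Extrapolation

/-- With all z_i equal the variable enters a term only through z to the sum of the gaps, so the
error is estimated term by term. Summing 2^{-k} over the sequences replaces each z_i by 1/2, whence
2^l; the factor ‖z0‖⁻¹ comes from the exponent k_0 - 1. -/
theorem norm_gPoly_sub_extra_le {l : ℕ} {f : (Fin l → Bool) → ℂ} (hf : ∀ w, ‖f w‖ ≤ 1) {z0 : ℂ}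
    (h0 : z0 ≠ 0) (hz0 : ‖z0‖ < 1) {β z : ℝ} {D : ℕ} (hβ : 0 < β) (hβ' : β ≤ 1 / 2) (hz : |z| ≤ β)
    (x : ℕ → Bool) :
    ‖gPoly f x (Fin.cons z0 fun _ => (z : ℂ)) - ∑ i ∈ Finset.range D, (extraCoeff β z D i : ℂ) *
      gPoly f x (Fin.cons z0 fun _ => (extraNode β D i : ℂ))‖ ≤
      (1 + 22 ^ D) * (2 * β) ^ D * (2 ^ l * ((1 - ‖z0‖)⁻¹ * ‖z0‖⁻¹)) := by
  have hnode : ∀ i ∈ Finset.range D, ‖(extraNode β D i : ℂ)‖ < 1 := by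
    intro i hi
    have hi' := Finset.mem_range.1 hi
    have hD : (0 : ℝ) < D := by
      have : 0 < D := by omega
      positivity
    have hjD : ((i : ℝ) + 1) / D ≤ 1 := by
      rw [div_le_one hD]; exact_mod_cast hi'
    rw [Complex.norm_real, Real.norm_eq_abs, extraNode, mul_div_assoc,
      abs_of_nonneg (by positivity)]
    have := mul_le_of_le_one_right hβ.le hjD
    linarith
  have hs : ∀ t : ℝ, ‖(t : ℂ)‖ < 1 → Summable (gTerm f x (Fin.cons z0 fun _ => (t : ℂ))) :=
    fun t ht => summable_gTerm hf ht hz0 h0 x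
  have hsz := hs z (by rw [Complex.norm_real, Real.norm_eq_abs]; linarith)
  have hsn : Summable fun s : Fin (l + 1) ↪o ℕ => ∑ i ∈ Finset.range D,
      (extraCoeff β z D i : ℂ) * gTerm f x (Fin.cons z0 fun _ => (extraNode β D i : ℂ)) s :=
    summable_sum fun i hi => (hs _ (hnode i hi)).mul_left _
  have h1 : ∑ i ∈ Finset.range D, (extraCoeff β z D i : ℂ) *
      gPoly f x (Fin.cons z0 fun _ => (extraNode β D i : ℂ)) =
      ∑' s : Fin (l + 1) ↪o ℕ, ∑ i ∈ Finset.range D,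
      (extraCoeff β z D i : ℂ) * gTerm f x (Fin.cons z0 fun _ => (extraNode β D i : ℂ)) s := by
    rw [Summable.tsum_finsetSum fun i hi => (hs _ (hnode i hi)).mul_left _]
    simp only [tsum_mul_left, gPoly]
  rw [h1, gPoly, ← hsz.tsum_sub hsn]
  have hb := (hasSum_norm_gapProd' (Fin.cons z0 fun _ => ((1 / 2 : ℝ) : ℂ) : Fin (l + 1) → ℂ)
    (fun i => Fin.cases hz0 (fun _ => by
      simp only [Fin.cons_succ, Complex.norm_real]; norm_num) i)).mul_left
      ((1 + 22 ^ D) * (2 * β) ^ D * ‖z0‖⁻¹)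
  refine (tsum_of_norm_bounded hb fun s => ?_).trans (le_of_eq ?_)
  · have hterm : ∀ t : ℝ, gTerm f x (Fin.cons z0 fun _ => (t : ℂ)) s =
        (if x (s 0) then -1 else 1) * f (fun i => x (s i.succ)) * z0 ^ ((s 0 : ℤ) - 1) *
          ((t ^ (∑ i : Fin l, (s i.succ - s i.castSucc - 1)) : ℝ) : ℂ) := by
      intro t
      rw [gTerm]
      simp only [Fin.cons_zero, Fin.cons_succ]
      rw [Finset.prod_pow_eq_pow_sum, Complex.ofReal_pow]
    set k := ∑ i : Fin l, (s i.succ - s i.castSucc - 1) with hk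
    have hdiff : gTerm f x (Fin.cons z0 fun _ => (z : ℂ)) s - ∑ i ∈ Finset.range D,
        (extraCoeff β z D i : ℂ) * gTerm f x (Fin.cons z0 fun _ => (extraNode β D i : ℂ)) s =
        (if x (s 0) then -1 else 1) * f (fun i => x (s i.succ)) * z0 ^ ((s 0 : ℤ) - 1) *
        ((z ^ k - ∑ i ∈ Finset.range D, extraCoeff β z D i * extraNode β D i ^ k : ℝ) : ℂ) := by
      simp only [hterm]
      push_cast
      rw [mul_sub, Finset.mul_sum]
      congr 1
      exact Finset.sum_congr rfl fun i _ => by ring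
    have h2 := abs_pow_sub_extra_le (D := D) hβ hβ' hz k
    have h3 : ‖gapProd' (Fin.cons z0 fun _ => ((1 / 2 : ℝ) : ℂ) : Fin (l + 1) → ℂ) s‖ =
        ‖z0‖ ^ (s 0) * (1 / 2) ^ k := by
      rw [gapProd', gapProd]
      simp only [Fin.cons_zero, Fin.cons_succ]
      rw [Finset.prod_pow_eq_pow_sum, norm_mul, norm_pow, norm_pow, Complex.norm_real]
      norm_num
      left
      rfl
    have h4 : ‖((if x (s 0) then -1 else 1 : ℂ)) * f (fun i => x (s i.succ))‖ ≤ 1 := by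
      rw [norm_mul]
      split_ifs <;> simpa using hf _
    have h5 : ‖z0 ^ ((s 0 : ℤ) - 1)‖ = ‖z0‖ ^ (s 0) * ‖z0‖⁻¹ := by
      rw [zpow_sub_one₀ h0, zpow_natCast, norm_mul, norm_pow, norm_inv]
    rw [hdiff, h3, norm_mul, norm_mul _ (z0 ^ _), h5, Complex.norm_real, Real.norm_eq_abs]
    calc _ ≤ 1 * (‖z0‖ ^ (s 0) * ‖z0‖⁻¹) * ((1 + 22 ^ D) * (2 * β) ^ D * (1 / 2) ^ k) := by
          gcongr
      _ = _ := by ring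
  · rw [Fin.prod_univ_succ]
    simp only [Fin.cons_zero, Fin.cons_succ, Complex.norm_real, Finset.prod_const,
      Finset.card_univ, Fintype.card_fin]
    norm_num
    ring

end TraceRec
end

noncomputable section
namespace TraceRec

/-! ### Concentration -/

section Concentration

open ProbabilityTheory

variable {Ω : Type*} [MeasurableSpace Ω] {m : ℕ} {μ : Fin m → Measure Ω}
  [∀ i, IsProbabilityMeasure (μ i)] {φ : Ω → ℂ} {G : ℂ} {B δ t : ℝ}

/-- Hoeffding's inequality for one direction c of the plane. The samples are independent but need
not have the same law; only a common interval of length 2B for the real parts is used. -/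
lemma measure_re_sum_ge_le (hφ : Measurable φ) (hB : 0 < B) (hφB : ∀ y, ‖φ y - G‖ ≤ B)
    (ht : 0 ≤ t) (hm : 0 < m) {c : ℂ} (hc : ‖c‖ = 1) :
    (Measure.pi μ).real {Y | m * t ≤ ∑ i, (c * (φ (Y i) - ∫ y, φ y ∂μ i)).re} ≤
      Real.exp (-(m * t ^ 2 / (2 * B ^ 2))) := by
  have hint : ∀ i, Integrable φ (μ i) := fun i =>
    Integrable.of_bound hφ.aestronglyMeasurable (B + ‖G‖) (Filter.Eventually.of_forall fun y => by
      have := norm_le_norm_add_norm_sub' (φ y) G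
      linarith [hφB y])
  have hψ : Measurable fun y => (c * φ y).re := Complex.measurable_re.comp (hφ.const_mul c)
  have hmem : ∀ y, (c * φ y).re ∈ Set.Icc ((c * G).re - B) ((c * G).re + B) := by
    intro y
    have h1 := Complex.abs_re_le_norm (c * (φ y - G))
    rw [norm_mul, hc, one_mul] at h1
    have h2 := abs_le.1 (h1.trans (hφB y))
    rw [mul_sub, Complex.sub_re] at h2
    exact ⟨by linarith [h2.1], by linarith [h2.2]⟩
  have hre : ∀ i, (c * ∫ y, φ y ∂μ i).re = ∫ y, (c * φ y).re ∂μ i := by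
    intro i
    rw [← integral_const_mul]
    exact (integral_re ((hint i).const_mul c)).symm
  have hint2 : ∀ i, ∫ Y, (c * φ (Y i)).re ∂(Measure.pi μ) = (c * ∫ y, φ y ∂μ i).re := by
    intro i
    rw [hre i, ← (measurePreserving_eval μ i).map_eq,
      integral_map (measurable_pi_apply i).aemeasurable hψ.aestronglyMeasurable]
  have hsub : ∀ i ∈ (Finset.univ : Finset (Fin m)), HasSubgaussianMGF
      (fun Y : Fin m → Ω => (c * (φ (Y i) - ∫ y, φ y ∂μ i)).re)
      ((‖((c * G).re + B) - ((c * G).re - B)‖₊ / 2) ^ 2) (Measure.pi μ) := by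
    intro i _
    have h1 := hasSubgaussianMGF_of_mem_Icc (μ := Measure.pi μ)
      (X := fun Y : Fin m → Ω => (c * φ (Y i)).re)
      (hψ.comp (measurable_pi_apply i)).aemeasurable
      (Filter.Eventually.of_forall fun Y => hmem (Y i))
    rw [hint2 i] at h1
    simpa only [mul_sub, Complex.sub_re] using h1
  have hind : iIndepFun (fun i (Y : Fin m → Ω) => (c * (φ (Y i) - ∫ y, φ y ∂μ i)).re)
      (Measure.pi μ) :=
    iIndepFun_pi (X := fun i y => (c * (φ y - ∫ y, φ y ∂μ i)).re) fun i =>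
      (Complex.measurable_re.comp ((hφ.sub_const _).const_mul c)).aemeasurable
  have h := HasSubgaussianMGF.measure_sum_ge_le_of_iIndepFun hind hsub (ε := m * t) (by positivity)
  refine h.trans (Real.exp_le_exp.2 (le_of_eq ?_))
  have hm' : (m : ℝ) ≠ 0 := by positivity
  rw [Finset.sum_const, Finset.card_univ, Fintype.card_fin]
  have h3 : ((‖((c * G).re + B) - ((c * G).re - B)‖₊ / 2) ^ 2 : NNReal) = (B ^ 2 : ℝ) := by
    push_cast
    rw [Real.norm_eq_abs, show (c * G).re + B - ((c * G).re - B) = 2 * B by ring,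
      abs_of_pos (by linarith)]
    ring
  rw [NNReal.coe_nsmul, h3, nsmul_eq_mul]
  field_simp

/-- The directions ±1 and ±i control real and imaginary part, which accounts for the factors 4 and
2; δ is the bias of the individual means. -/
theorem measure_average_sub_gt_le (hφ : Measurable φ) (hB : 0 < B) (hφB : ∀ y, ‖φ y - G‖ ≤ B)
    (hδ : ∀ i, ‖∫ y, φ y ∂μ i - G‖ ≤ δ) (ht : 0 ≤ t) (hm : 0 < m) :
    Measure.pi μ {Y | ¬ ‖(∑ i, φ (Y i)) / m - G‖ ≤ δ + 2 * t} ≤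
      ENNReal.ofReal (4 * Real.exp (-(m * t ^ 2 / (2 * B ^ 2)))) := by
  set A : ℂ → Set (Fin m → Ω) := fun c =>
    {Y | m * t ≤ ∑ i, (c * (φ (Y i) - ∫ y, φ y ∂μ i)).re} with hA
  set p := Real.exp (-(m * t ^ 2 / (2 * B ^ 2))) with hp
  have hAp : ∀ c : ℂ, ‖c‖ = 1 → Measure.pi μ (A c) ≤ ENNReal.ofReal p := by
    intro c hc
    rw [← ofReal_measureReal]
    exact ENNReal.ofReal_le_ofReal (measure_re_sum_ge_le hφ hB hφB ht hm hc)
  have hm' : (0 : ℝ) < m := by positivity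
  have hsub : {Y | ¬ ‖(∑ i, φ (Y i)) / m - G‖ ≤ δ + 2 * t} ⊆
      (A 1 ∪ A (-1)) ∪ (A Complex.I ∪ A (-Complex.I)) := by
    intro Y hY
    by_contra hcon
    simp only [Set.mem_union, not_or, hA, Set.mem_ofPred_eq, not_le] at hcon
    obtain ⟨⟨h1, h2⟩, h3, h4⟩ := hcon
    apply hY
    set W := ∑ i, (φ (Y i) - ∫ y, φ y ∂μ i) with hW
    have hc : ∀ c : ℂ, ∑ i, (c * (φ (Y i) - ∫ y, φ y ∂μ i)).re = (c * W).re := by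
      intro c
      rw [hW, Finset.mul_sum, Complex.re_sum]
    rw [hc] at h1 h2 h3 h4
    simp only [one_mul, neg_mul, Complex.neg_re, Complex.I_mul_re, neg_neg] at h1 h2 h3 h4
    have hWn : ‖W‖ ≤ m * (2 * t) := by
      refine (Complex.norm_le_abs_re_add_abs_im W).trans ?_
      have h5 : |W.re| ≤ m * t := abs_le.2 ⟨by linarith, h1.le⟩
      have h6 : |W.im| ≤ m * t := abs_le.2 ⟨by linarith, by linarith⟩
      linarith
    have hV : ‖∑ i : Fin m, (∫ y, φ y ∂μ i - G)‖ ≤ m * δ := by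
      refine (norm_sum_le_of_le _ fun i _ => hδ i).trans (le_of_eq ?_)
      simp
    have heq : (∑ i, φ (Y i)) / m - G = (W + ∑ i : Fin m, (∫ y, φ y ∂μ i - G)) / m := by
      have hmC : (m : ℂ) ≠ 0 := by exact_mod_cast hm.ne'
      rw [eq_div_iff hmC, sub_mul, div_mul_cancel₀ _ hmC, hW, ← Finset.sum_add_distrib]
      simp only [sub_add_sub_cancel, Finset.sum_sub_distrib, Finset.sum_const, Finset.card_univ,
        Fintype.card_fin, nsmul_eq_mul]
      ring
    rw [heq, norm_div, Complex.norm_natCast, div_le_iff₀ hm']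
    refine (norm_add_le _ _).trans ?_
    linarith
  refine (measure_mono hsub).trans ?_
  have hu : ∀ s t u v : Set (Fin m → Ω), Measure.pi μ ((s ∪ t) ∪ (u ∪ v)) ≤
      (Measure.pi μ s + Measure.pi μ t) + (Measure.pi μ u + Measure.pi μ v) := fun s t u v =>
    (measure_union_le _ _).trans (add_le_add (measure_union_le _ _) (measure_union_le _ _))
  refine (hu _ _ _ _).trans ((add_le_add (add_le_add (hAp _ (by simp)) (hAp _ (by simp)))
    (add_le_add (hAp _ (by simp)) (hAp _ (by simp)))).trans (le_of_eq ?_))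
  have hp0 : 0 ≤ p := (Real.exp_pos _).le
  rw [← ENNReal.ofReal_add hp0 hp0, ← ENNReal.ofReal_add (by positivity) (by positivity)]
  congr 1
  ring

end Concentration

/-! ### The laws of the samples -/

lemma shiftedTraceLaw_eq_sum (q q' : Set.Ico (0 : ℝ) 1) (S : PMF ℕ) (x : ℕ → Bool) (n : ℕ)
    (hS : ∀ i, S i ≠ 0 → i < n) : shiftedTraceLaw q q' S x =
      ∑ i ∈ Finset.range n, S i • channelLaw q q' fun j => x (i + j) := by
  ext A hA
  rw [shiftedTraceLaw, Measure.bind_apply hA (measurable_of_countable _).aemeasurable,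
    lintegral_countable', Measure.finsetSum_apply,
    tsum_eq_sum (s := Finset.range n)]
  · refine Finset.sum_congr rfl fun i _ => ?_
    rw [PMF.toMeasure_apply_singleton _ _ (measurableSet_singleton i), Measure.smul_apply,
      smul_eq_mul, mul_comm]
  · intro i hi
    rw [PMF.toMeasure_apply_singleton _ _ (measurableSet_singleton i)]
    by_cases h : S i = 0
    · rw [h, mul_zero]
    · exact absurd (Finset.mem_range.2 (hS i h)) hi

lemma integral_shiftedTraceLaw (q q' : Set.Ico (0 : ℝ) 1) (S : PMF ℕ) (x : ℕ → Bool) (n : ℕ)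
    (hS : ∀ i, S i ≠ 0 → i < n) {φ : (ℕ → Bool) → ℂ} (hφ : Measurable φ) {B : ℝ}
    (hB : ∀ y, ‖φ y‖ ≤ B) : ∫ y, φ y ∂shiftedTraceLaw q q' S x =
      ∑ i ∈ Finset.range n, ((S i).toReal : ℂ) * ∫ y, φ y ∂channelLaw q q' fun j => x (i + j) := by
  have hint : ∀ i ∈ Finset.range n, Integrable φ (S i • channelLaw q q' fun j => x (i + j)) := by
    intro i _
    exact (Integrable.of_bound hφ.aestronglyMeasurable B
      (Filter.Eventually.of_forall hB)).smul_measure (S.apply_ne_top i)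
  rw [shiftedTraceLaw_eq_sum q q' S x n hS, integral_finsetSum_measure hint]
  refine Finset.sum_congr rfl fun i _ => ?_
  rw [integral_smul_measure, Complex.real_smul]

lemma isProbabilityMeasure_sampleLaw (q q' : Set.Ico (0 : ℝ) 1) (S : PMF ℕ)
    (x : ℕ → Bool) {ε : ℝ} (h0 : 0 ≤ ε) (h1 : ε ≤ 1) (ν : Measure (ℕ → Bool))
    [IsProbabilityMeasure ν] : IsProbabilityMeasure (sampleLaw q q' S x ε ν) := by
  constructor
  rw [sampleLaw, Measure.add_apply, Measure.smul_apply, Measure.smul_apply, measure_univ,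
    measure_univ, smul_eq_mul, smul_eq_mul, mul_one, mul_one,
    ← ENNReal.ofReal_add (by linarith) h0]
  simp

/-- The statistic is within B of G on every string, not only on typical traces, so false samples of
any law move the mean by at most ε B. -/
lemma norm_integral_sampleLaw_sub_le (q q' : Set.Ico (0 : ℝ) 1) (S : PMF ℕ) (x : ℕ → Bool)
    {ε : ℝ} (h0 : 0 ≤ ε) (h1 : ε ≤ 1) (ν : Measure (ℕ → Bool)) [IsProbabilityMeasure ν]
    {φ : (ℕ → Bool) → ℂ} (hφ : Measurable φ) {G : ℂ} {B δ : ℝ} (hB : ∀ y, ‖φ y - G‖ ≤ B)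
    (hδ : ‖∫ y, φ y ∂shiftedTraceLaw q q' S x - G‖ ≤ δ) :
    ‖∫ y, φ y ∂sampleLaw q q' S x ε ν - G‖ ≤ δ + ε * B := by
  have hint : ∀ (P : Measure (ℕ → Bool)) [IsProbabilityMeasure P], Integrable φ P := fun P _ =>
    Integrable.of_bound hφ.aestronglyMeasurable (B + ‖G‖) (Filter.Eventually.of_forall fun y => by
      have := norm_le_norm_add_norm_sub' (φ y) G
      linarith [hB y])
  have hν : ‖∫ y, φ y ∂ν - G‖ ≤ B := by
    have : ∫ y, φ y ∂ν - G = ∫ y, (φ y - G) ∂ν := by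
      rw [integral_sub (hint ν) (integrable_const G)]; simp
    rw [this]
    refine (norm_integral_le_of_norm_le_const (Filter.Eventually.of_forall hB)).trans ?_
    simp
  have hB0 : 0 ≤ B := (norm_nonneg _).trans hν
  rw [sampleLaw, integral_add_measure ((hint _).smul_measure ENNReal.ofReal_ne_top)
    ((hint _).smul_measure ENNReal.ofReal_ne_top), integral_smul_measure, integral_smul_measure,
    ENNReal.toReal_ofReal (by linarith), ENNReal.toReal_ofReal h0, Complex.real_smul,
    Complex.real_smul]
  have heq : ((1 - ε : ℝ) : ℂ) * ∫ y, φ y ∂shiftedTraceLaw q q' S x + (ε : ℂ) * ∫ y, φ y ∂ν - G =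
      ((1 - ε : ℝ) : ℂ) * (∫ y, φ y ∂shiftedTraceLaw q q' S x - G) +
        (ε : ℂ) * (∫ y, φ y ∂ν - G) := by
    push_cast; ring
  rw [heq]
  refine (norm_add_le _ _).trans ?_
  rw [norm_mul, norm_mul, Complex.norm_real, Complex.norm_real, Real.norm_of_nonneg h0,
    Real.norm_of_nonneg (by linarith)]
  refine add_le_add ?_ (by gcongr)
  have hδ0 := (norm_nonneg _).trans hδ
  calc _ ≤ 1 * δ := by gcongr; linarith
    _ = δ := one_mul _

/-! ### The statistic of one interpolation node -/

open scoped BoundedContinuousFunction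

/-- `treeDiag` as a bounded function. -/
def treeDiagB (z z0 : ℂ) (N : ℕ) : ℕ →ᵇ ℂ :=
  BoundedContinuousFunction.ofNormedAddCommGroupDiscrete (treeDiag z z0 N) (1 + ‖z‖ + ‖z0‖)
    fun e => by
      unfold treeDiag
      split_ifs
      · rw [norm_one]; linarith [norm_nonneg z, norm_nonneg z0]
      · linarith [norm_nonneg z0]
      · linarith [norm_nonneg z]

@[simp] lemma treeDiagB_apply (z z0 : ℂ) (N e : ℕ) : treeDiagB z z0 N e = treeDiag z z0 N e := rfl

/-- The estimate of the generating function, up to a factor, from the statistic of a trace. -/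
def nodeLin {l : ℕ} (f : (Fin l → Bool) → ℂ) (z : ℝ) (z0 : ℂ) (r : ℝ) (x : ℕ → Bool)
    (S : ℕ → ℝ) (n k : ℕ) : (ℕ → ℂ) →ₗ[ℂ] ℂ :=
  treeFunctionalLin f ∘ₗ estimator (treeDiag z z0 (2 ^ (l + 1) - 1)) r x S n k

lemma ShiftBound.norm_treeDiag_add_le {z : ℝ} {z0 : ℂ} {r : ℝ} {S : ℕ → ℝ} {n a η N : ℕ}
    (h : ShiftBound S n a η z z0 r) (e : ℕ) (he : e ≠ 0) : ‖treeDiag z z0 N e‖ + r ≤ 1 := by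
  rw [treeDiag, if_neg he]
  split_ifs
  · rw [Complex.norm_real, Real.norm_of_nonneg h.z_pos.le]; exact h.z_add_le
  · exact h.z0_le

section NodeLin

variable {l : ℕ} {f : (Fin l → Bool) → ℂ} {z : ℝ} {z0 : ℂ} {r : ℝ} {x : ℕ → Bool}
  {S : ℕ → ℝ} {n a η k : ℕ}

lemma norm_nodeLin_le (hf : ∀ w, ‖f w‖ ≤ 1) (h : ShiftBound S n a η z z0 r)
    (hk : 2 * (2 ^ (l + 1) - 1) + 1 < 2 ^ k) {g : ℕ → ℂ} (hg0 : g 0 = 0) {δ : ℝ}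
    (hg : ∀ e < 2 * (2 ^ (l + 1) - 1) + 1, ‖g e‖ ≤ δ) :
    ‖nodeLin f z z0 r x S n k g‖ ≤ 2 ^ l * (2 * (4 * δ)) :=
  norm_treeFunctional_le hf fun e he => h.norm_estimator_le hk hg0 hg e he

/-- The stability bound with δ = 0 shows that the functional depends only on the finitely many nodes
of the tree. As a finite combination of coordinates it is measurable in the trace and commutes with
integrals. -/
lemma nodeLin_eq_sum (hf : ∀ w, ‖f w‖ ≤ 1) (h : ShiftBound S n a η z z0 r)
    (hk : 2 * (2 ^ (l + 1) - 1) + 1 < 2 ^ k) (g : ℕ → ℂ) :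
    nodeLin f z z0 r x S n k g = ∑ e ∈ Finset.range (2 * (2 ^ (l + 1) - 1) + 1),
      g e * nodeLin f z z0 r x S n k (Pi.single e 1) := by
  have h1 : ∀ e < 2 * (2 ^ (l + 1) - 1) + 1, (g - ∑ i ∈ Finset.range (2 * (2 ^ (l + 1) - 1) + 1),
      g i • (Pi.single i 1 : ℕ → ℂ)) e = 0 := by
    intro e he
    rw [Pi.sub_apply, Finset.sum_apply, Finset.sum_eq_single e]
    · simp
    · intro i _ hi
      simp [Pi.single_eq_of_ne' hi]
    · intro hi; exact absurd (Finset.mem_range.2 he) hi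
  have h2 := norm_nodeLin_le (x := x) hf h hk (h1 0 (by omega)) (δ := 0)
    fun e he => by rw [h1 e he, norm_zero]
  rw [mul_zero, mul_zero, mul_zero, norm_le_zero_iff, map_sub, sub_eq_zero, map_sum] at h2
  rw [h2]
  simp only [map_smul, smul_eq_mul]

lemma nodeLin_treeSum (h : ShiftBound S n a η z z0 r)
    (hk : 2 * (2 ^ (l + 1) - 1) + 1 < 2 ^ k) (hr : 0 < r) :
    nodeLin f z z0 r x S n k (fun e => ∑ i ∈ Finset.range n, (S i : ℂ) *
      treeSum (treeDiag z z0 (2 ^ (l + 1) - 1)) r e fun j => x (i + j)) =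
      r ^ (l + 1) * (z0 * gPoly f x (Fin.cons z0 fun _ => (z : ℂ))) := by
  have hd := h.norm_treeDiag_add_le (N := 2 ^ (l + 1) - 1)
  rw [← treeFunctional_treeSum hr hd h.z0_ne x]
  refine treeFunctional_congr fun e he => ?_
  rw [h.estimator_family hk (γ := fun s e =>
    treeSum (treeDiag z z0 (2 ^ (l + 1) - 1)) r e fun j => x (s + j)) _ e he]
  · simp only [zero_add]
  · intro s _
    ext e
    rw [treeSum_eq_transfer hr.le hd (fun e he => by linarith [hd e he]) (by simp [treeDiag])]
    have : (fun j => x (s + (j + 1))) = fun j => x (s + 1 + j) := by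
      ext j; congr 1; omega
    rw [this, add_zero]

end NodeLin

section NodeStat

variable {l : ℕ} {f : (Fin l → Bool) → ℂ} {z : ℝ} {z0 : ℂ} {r ρ : ℝ} {x : ℕ → Bool}
  {S : PMF ℕ} {n a η k : ℕ} {q q' : Set.Ico (0 : ℝ) 1}

/-- The estimate of the generating function from a trace. -/
def nodeStat (f : (Fin l → Bool) → ℂ) (z : ℝ) (z0 : ℂ) (r : ℝ) (x : ℕ → Bool)
    (S : PMF ℕ) (n k : ℕ) (q q' : ℝ) (K : ℕ) (y : ℕ → Bool) : ℂ :=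
  nodeLin f z z0 r x (fun i => (S i).toReal) n k
    (traceStat (treeDiagB z z0 (2 ^ (l + 1) - 1)) r q q' K y)

lemma measurable_traceStat (D : ℕ →ᵇ ℂ) (r q q' : ℝ) (K e : ℕ) :
    Measurable fun y => traceStat D r q q' K y e :=
  (measurable_of_countable fun L => listProd (traceL D r q q') L rootOne e).comp
    (measurable_firstLetters K)

lemma measurable_nodeStat (hf : ∀ w, ‖f w‖ ≤ 1)
    (h : ShiftBound (fun i => (S i).toReal) n a η z z0 r)
    (hk : 2 * (2 ^ (l + 1) - 1) + 1 < 2 ^ k) (q q' : ℝ) (K : ℕ) :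
    Measurable (nodeStat f z z0 r x S n k q q' K) := by
  have : nodeStat f z z0 r x S n k q q' K = fun y =>
      ∑ e ∈ Finset.range (2 * (2 ^ (l + 1) - 1) + 1),
        traceStat (treeDiagB z z0 (2 ^ (l + 1) - 1)) r q q' K y e *
          nodeLin f z z0 r x (fun i => (S i).toReal) n k (Pi.single e 1) :=
    funext fun y => nodeLin_eq_sum hf h hk _
  rw [this]
  exact Finset.measurable_fun_sum _ fun e _ => (measurable_traceStat _ _ _ _ _ _).mul_const _

/-- The average of `treeSum` over the shifts. -/
def treeMix (z : ℝ) (z0 : ℂ) (N : ℕ) (r : ℝ) (x : ℕ → Bool) (S : PMF ℕ) (n e : ℕ) : ℂ :=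
  ∑ i ∈ Finset.range n, ((S i).toReal : ℂ) * treeSum (treeDiag z z0 N) r e fun j => x (i + j)

lemma norm_treeMix_le (h : ShiftBound (fun i => (S i).toReal) n a η z z0 r) (hr : 0 < r)
    (N e : ℕ) : ‖treeMix z z0 N r x S n e‖ ≤ 1 := by
  have hd := h.norm_treeDiag_add_le (N := N)
  calc _ ≤ ∑ i ∈ Finset.range n, (S i).toReal * 1 := by
        refine h.norm_sum_range_le (G := fun _ => 1) fun j _ => ?_
        exact norm_treeSum_le hr.le hd (fun e he => by linarith [hd e he]) e _
    _ = 1 := by simp only [mul_one]; exact h.sum_eq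

lemma treeMix_zero (h : ShiftBound (fun i => (S i).toReal) n a η z z0 r) (N : ℕ) :
    treeMix z z0 N r x S n 0 = 1 := by
  simp only [treeMix, treeSum, mul_one]
  rw [← Complex.ofReal_sum, h.sum_eq, Complex.ofReal_one]

/-- The statistic of a string and the averaged generating functions both have root value 1 and norm
at most 1, so stability applies to their difference with δ = 2. -/
theorem norm_nodeStat_sub_le (hf : ∀ w, ‖f w‖ ≤ 1)
    (h : ShiftBound (fun i => (S i).toReal) n a η z z0 r)
    (hk : 2 * (2 ^ (l + 1) - 1) + 1 < 2 ^ k) (hr : 0 < r) {q q' : ℝ}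
    (hC : Contracts (treeDiagB z z0 (2 ^ (l + 1) - 1)) r q q' ρ) (K : ℕ) (y : ℕ → Bool) :
    ‖nodeStat f z z0 r x S n k q q' K y -
      r ^ (l + 1) * (z0 * gPoly f x (Fin.cons z0 fun _ => (z : ℂ)))‖ ≤ 2 ^ l * (2 * (4 * 2)) := by
  rw [← nodeLin_treeSum h hk hr, nodeStat, ← map_sub]
  refine norm_nodeLin_le hf h hk ?_ fun e _ => ?_
  · rw [Pi.sub_apply, hC.traceStat_zero]
    exact sub_eq_zero.2 (treeMix_zero h _).symm
  · refine (norm_sub_le _ _).trans ?_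
    have h1 := (BoundedContinuousFunction.norm_coe_le_norm _ e).trans (hC.norm_traceStat_le K y)
    have h2 := norm_treeMix_le (x := x) h hr (2 ^ (l + 1) - 1) e
    rw [treeMix] at h2
    linarith

/-- For each fixed shift the mean of the statistic misses the generating functions by at most 2ρ^K.
Averaging over the shifts keeps this bound, and stability carries it to the functional. -/
theorem norm_integral_nodeStat_sub_le (hf : ∀ w, ‖f w‖ ≤ 1)
    (h : ShiftBound (fun i => (S i).toReal) n a η z z0 r)
    (hk : 2 * (2 ^ (l + 1) - 1) + 1 < 2 ^ k) (hr : 0 < r)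
    (hC : Contracts (treeDiagB z z0 (2 ^ (l + 1) - 1)) r q q' ρ) (K : ℕ)
    (hS : ∀ i, S i ≠ 0 → i < n) :
    ‖∫ y, nodeStat f z z0 r x S n k q q' K y ∂shiftedTraceLaw q q' S x -
      r ^ (l + 1) * (z0 * gPoly f x (Fin.cons z0 fun _ => (z : ℂ)))‖ ≤
      2 ^ l * (2 * (4 * (2 * ρ ^ K))) := by
  set D := treeDiagB z z0 (2 ^ (l + 1) - 1) with hD
  have hd := h.norm_treeDiag_add_le (N := 2 ^ (l + 1) - 1)
  have hd' : ∀ e ≠ 0, ‖treeDiag z z0 (2 ^ (l + 1) - 1) e‖ < 1 := fun e he => by linarith [hd e he]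
  have hle : ∀ e y, ‖traceStat D r q q' K y e‖ ≤ 1 := fun e y =>
    (BoundedContinuousFunction.norm_coe_le_norm _ e).trans (hC.norm_traceStat_le K y)
  have hint : ∀ e, Integrable (fun y => traceStat D r q q' K y e) (shiftedTraceLaw q q' S x) :=
    fun e => Integrable.of_bound (measurable_traceStat _ _ _ _ _ e).aestronglyMeasurable 1
      (Filter.Eventually.of_forall fun y => hle e y)
  have hswap : ∫ y, nodeStat f z z0 r x S n k q q' K y ∂shiftedTraceLaw q q' S x =
      nodeLin f z z0 r x (fun i => (S i).toReal) n k
        (fun e => ∫ y, traceStat D r q q' K y e ∂shiftedTraceLaw q q' S x) := by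
    rw [nodeLin_eq_sum hf h hk]
    simp only [nodeStat]
    rw [integral_congr_ae (Filter.Eventually.of_forall fun y => nodeLin_eq_sum hf h hk _),
      integral_finsetSum]
    · exact Finset.sum_congr rfl fun e _ => integral_mul_const _ _
    · intro e _
      exact (hint e).mul_const _
  -- the generating functions as bounded functions
  set γ : (ℕ → Bool) → ℕ →ᵇ ℂ := fun x => BoundedContinuousFunction.ofNormedAddCommGroupDiscrete
    (fun e => treeSum (treeDiag z z0 (2 ^ (l + 1) - 1)) r e x) 1
    (fun e => norm_treeSum_le hr.le hd hd' e x) with hγ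
  have hγa : ∀ x e, γ x e = treeSum (treeDiag z z0 (2 ^ (l + 1) - 1)) r e x := fun _ _ => rfl
  have hmean := fun x e => hC.norm_integral_traceStat_sub_le (γ := γ)
    (fun x => by rw [hγa, treeSum])
    (fun x => (BoundedContinuousFunction.norm_le zero_le_one).2 fun e =>
      norm_treeSum_le hr.le hd hd' e x)
    (fun x => by
      ext e
      rw [transferL_apply, hγa, treeSum_eq_transfer hr.le hd hd' (by simp [treeDiag])]
      rfl) x K e
  rw [hswap, ← nodeLin_treeSum h hk hr, ← map_sub]
  refine norm_nodeLin_le hf h hk ?_ fun e _ => ?_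
  · rw [Pi.sub_apply]
    simp only [hC.traceStat_zero]
    rw [integral_const, probReal_univ, one_smul]
    exact sub_eq_zero.2 (treeMix_zero h _).symm
  · rw [Pi.sub_apply, integral_shiftedTraceLaw q q' S x n hS (measurable_traceStat _ _ _ _ _ e)
      (hle e), ← Finset.sum_sub_distrib]
    simp only [← mul_sub]
    refine (h.norm_sum_range_le (G := fun _ => 2 * ρ ^ K)
      (F := fun i => (∫ y, traceStat D r q q' K y e ∂channelLaw q q' fun j => x (i + j)) -
        treeSum (treeDiag z z0 (2 ^ (l + 1) - 1)) r e fun j => x (i + j))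
      fun j _ => hmean (fun i => x (a + j + i)) e).trans ?_
    rw [← Finset.sum_mul, h.sum_eq, one_mul]

end NodeStat

end TraceRec
end

noncomputable section
namespace TraceRec

/-! ### Large `n` -/

/-- `n` is large compared to `M`. -/
structure Large (M : ℝ) (n : ℕ) : Prop where
  log_ge : M ≤ Real.log n
  rpow_ge : M * Real.log n ^ 14 ≤ (n : ℝ) ^ (1 / 5 : ℝ)

/-- The power 14 is the one in h(n)² = n^{2/5} log^14 n. -/
lemma eventually_large (M : ℝ) : ∀ᶠ n : ℕ in Filter.atTop, Large M n := by
  have h1 : ∀ᶠ x : ℝ in Filter.atTop, M ≤ Real.log x :=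
    Real.tendsto_log_atTop.eventually_ge_atTop M
  have h2 : ∀ᶠ x : ℝ in Filter.atTop, M * Real.log x ^ 14 ≤ x ^ (1 / 5 : ℝ) := by
    have h3 := isLittleO_log_rpow_rpow_atTop (s := 1 / 5) 14 (by norm_num)
    have h4 := h3.bound (c := (|M| + 1)⁻¹) (by positivity)
    filter_upwards [h4, Filter.eventually_ge_atTop 1] with x hx hx1
    have hl : 0 ≤ Real.log x := Real.log_nonneg hx1
    have h5 : Real.log x ^ (14 : ℝ) = Real.log x ^ 14 := by
      rw [← Real.rpow_natCast]; norm_num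
    rw [h5, Real.norm_of_nonneg (by positivity), Real.norm_of_nonneg (by positivity),
      inv_mul_eq_div, le_div_iff₀ (by positivity)] at hx
    have h6 : M ≤ |M| + 1 := by linarith [le_abs_self M]
    have h7 : 0 ≤ Real.log x ^ 14 := by positivity
    nlinarith
  filter_upwards [tendsto_natCast_atTop_atTop.eventually h1,
    tendsto_natCast_atTop_atTop.eventually h2] with n h1 h2 using ⟨h1, h2⟩

namespace Large

variable {M : ℝ} {n : ℕ}

lemma pos (h : Large M n) (hM : 1 ≤ M) : (0 : ℝ) < n := by
  rcases Nat.eq_zero_or_pos n with rfl | hn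
  · have := h.log_ge
    simp at this
    linarith
  · exact_mod_cast hn

/-- The scale `X = n^{1/5}`. -/
lemma exists_scale (h : Large M n) (hM : 1 ≤ M) : ∃ X L : ℝ, 1 ≤ X ∧ M ≤ L ∧ M * L ^ 14 ≤ X ∧
    Real.log n = L ∧ (n : ℝ) ^ (1 / 5 : ℝ) = X ∧ (n : ℝ) = X ^ 5 ∧
    (n : ℝ) ^ (-(4 / 5) : ℝ) = (X ^ 4)⁻¹ ∧ (n : ℝ) ^ (-(2 / 5) : ℝ) = (X ^ 2)⁻¹ ∧
    hFun n = X * L ^ 7 := by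
  have hn := (h.pos hM).le
  refine ⟨(n : ℝ) ^ (1 / 5 : ℝ), Real.log n, ?_, h.log_ge, h.rpow_ge, rfl, rfl, ?_, ?_, ?_, rfl⟩
  · refine le_trans ?_ h.rpow_ge
    exact one_le_mul_of_one_le_of_one_le hM (one_le_pow₀ (hM.trans h.log_ge))
  · rw [← Real.rpow_natCast, ← Real.rpow_mul hn]; norm_num
  · rw [← Real.rpow_natCast, ← Real.rpow_mul hn, ← Real.rpow_neg hn]; norm_num
  · rw [← Real.rpow_natCast, ← Real.rpow_mul hn, ← Real.rpow_neg hn]; norm_num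

end Large

/-! ### The contraction factors -/

/-- How much the mean of a trace letter contracts the middle levels. -/
def midGap (q q' c : ℝ) : ℝ :=
  min ((1 - q') / (1 - q) * c) (if q < 1 / 2 then 1 - q / (1 - q) else 1)

lemma midGap_pos {q q' c : ℝ} (hq1 : q < 1) (hq'1 : q' < 1) (hc : 0 < c) :
    0 < midGap q q' c := by
  have h1 : 0 < 1 - q := by linarith
  have h2 : 0 < 1 - q' := by linarith
  refine lt_min (by positivity) ?_
  split_ifs with h
  · rw [sub_pos, div_lt_one h1]; linarith
  · exact one_pos

/-- The entry equals 1 - (1-q')/(1-q) · (1-t)/(1-q'+q't), which gives the upper bound. From below it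
is nonnegative when t ≥ q, because t/(1-q'+q't) ≥ t; otherwise it is at least -q/(1-q), which
exceeds -1 exactly because q < 1/2. -/
lemma abs_mid_le {q q' c t : ℝ} (hq0 : 0 ≤ q) (hq1 : q < 1) (hq'0 : 0 ≤ q') (hq'1 : q' < 1)
    (ht0 : 0 ≤ t) (ht : t ≤ 1 - c) (hc : 0 < c) (hqt : q ≤ t ∨ q < 1 / 2) :
    |(t / (1 - q' + q' * t) - q) / (1 - q)| ≤ 1 - midGap q q' c := by
  have h1 : 0 < 1 - q := by linarith
  have h2 : 0 < 1 - q' := by linarith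
  have hΔ : 0 < 1 - q' + q' * t := by positivity
  have hΔ1 : 1 - q' + q' * t ≤ 1 := by nlinarith
  have hup : (t / (1 - q' + q' * t) - q) / (1 - q) ≤ 1 - (1 - q') / (1 - q) * c := by
    have h3 : (t / (1 - q' + q' * t) - q) / (1 - q) =
        1 - (1 - q') / (1 - q) * ((1 - t) / (1 - q' + q' * t)) := by
      field_simp
      ring
    rw [h3]
    have h4 : c ≤ (1 - t) / (1 - q' + q' * t) := by
      rw [le_div_iff₀ hΔ]; nlinarith
    have h5 : 0 ≤ (1 - q') / (1 - q) := by positivity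
    nlinarith
  have htΔ : t ≤ t / (1 - q' + q' * t) := by
    rw [le_div_iff₀ hΔ]; nlinarith
  refine abs_le.2 ⟨?_, hup.trans (sub_le_sub_left (min_le_left _ _) _)⟩
  have h6 : midGap q q' c ≤ _ := min_le_right _ _
  split_ifs at h6 with h
  · have : -(q / (1 - q)) ≤ (t / (1 - q' + q' * t) - q) / (1 - q) := by
      rw [← neg_div]
      gcongr
      linarith
    linarith
  · have h7 : q ≤ t := by tauto
    have : 0 ≤ (t / (1 - q' + q' * t) - q) / (1 - q) := div_nonneg (by linarith) h1.le
    linarith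

/-- With u = 1 - z0 and κ = (1-q')/(1-q) the entry is 1 - κu - κ q' u²/(1-q'u): it shrinks by κ Re u
to first order, up to an error quadratic in u. -/
lemma norm_top_le {q q' τ : ℝ} {z0 : ℂ} (hq1 : q < 1) (hq'0 : 0 ≤ q') (hq'1 : q' < 1)
    (hre : z0.re ≤ 1 - τ) (hu : ‖1 - z0‖ ≤ 1 / 2) :
    ‖(z0 / (1 - q' + q' * z0) - q) / (1 - q)‖ ≤ 1 - (1 - q') / (1 - q) * τ +
      (((1 - q') / (1 - q)) ^ 2 / 2 + 2 * ((1 - q') / (1 - q))) * ‖1 - z0‖ ^ 2 := by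
  have h1 : 0 < 1 - q := by linarith
  have h2 : 0 < 1 - q' := by linarith
  set u := 1 - z0 with hu'
  set κ := (1 - q') / (1 - q) with hκ
  have hκ0 : 0 < κ := by positivity
  have hΔn : 1 / 2 ≤ ‖(1 - q' * u : ℂ)‖ := by
    have h3 : ‖(q' * u : ℂ)‖ ≤ 1 / 2 := by
      rw [norm_mul, Complex.norm_real, Real.norm_of_nonneg hq'0]
      nlinarith [norm_nonneg u]
    have h4 := norm_sub_norm_le (1 : ℂ) (q' * u)
    rw [norm_one] at h4
    linarith
  have hΔ : (1 - q' * u : ℂ) ≠ 0 := by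
    rw [← norm_pos_iff]; linarith
  have h1C : (1 - q : ℂ) ≠ 0 := by exact_mod_cast h1.ne'
  have heq : (z0 / (1 - q' + q' * z0) - q) / (1 - q) =
      (1 - κ * u) - κ * q' * (u ^ 2 / (1 - q' * u)) := by
    have hz : z0 = 1 - u := by rw [hu']; ring
    have h5 : (1 - q' + q' * z0 : ℂ) = 1 - q' * u := by rw [hz]; ring
    have hw := mul_inv_cancel₀ hΔ
    have hp := mul_inv_cancel₀ h1C
    rw [h5, hz, hκ]
    push_cast
    simp only [div_eq_mul_inv]
    linear_combination (1 - q : ℂ)⁻¹ * (1 - (1 - q') * u) * hw + hp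
  have ha : ‖(1 - κ * u : ℂ)‖ ≤ 1 - κ * u.re + κ ^ 2 * ‖u‖ ^ 2 / 2 := by
    have h6 : ‖(1 - κ * u : ℂ)‖ ^ 2 = 1 - 2 * κ * u.re + κ ^ 2 * ‖u‖ ^ 2 := by
      rw [Complex.sq_norm, Complex.sq_norm, Complex.normSq_apply, Complex.normSq_apply]
      simp only [Complex.sub_re, Complex.one_re, Complex.re_ofReal_mul, Complex.sub_im,
        Complex.one_im, Complex.im_ofReal_mul]
      ring
    -- This is √(1 + 2y) ≤ 1 + y with y = -κ Re u + κ²|u|²/2; the side condition 1 + y ≥ 0 holds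
    -- because 1 + 2y is a square.
    refine abs_le_of_sq_le_sq' ?_ ?_ |>.2
    · rw [h6]
      nlinarith [sq_nonneg (-κ * u.re + κ ^ 2 * ‖u‖ ^ 2 / 2)]
    · nlinarith [sq_nonneg ‖(1 - κ * u : ℂ)‖]
  have hb : ‖(κ * q' * (u ^ 2 / (1 - q' * u)) : ℂ)‖ ≤ 2 * κ * ‖u‖ ^ 2 := by
    rw [norm_mul, norm_mul, norm_div, norm_pow, Complex.norm_real, Complex.norm_real,
      Real.norm_of_nonneg hκ0.le, Real.norm_of_nonneg hq'0]
    have h7 : ‖u‖ ^ 2 / ‖(1 - q' * u : ℂ)‖ ≤ 2 * ‖u‖ ^ 2 := by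
      rw [div_le_iff₀ (by linarith)]
      nlinarith [sq_nonneg ‖u‖]
    calc κ * q' * (‖u‖ ^ 2 / ‖(1 - q' * u : ℂ)‖) ≤ κ * 1 * (2 * ‖u‖ ^ 2) := by gcongr
      _ = _ := by ring
  have hure : τ ≤ u.re := by
    rw [hu', Complex.sub_re, Complex.one_re]; linarith
  rw [heq]
  refine (norm_sub_le _ _).trans ?_
  nlinarith

lemma norm_one_sub_polar_sq_le {τ θ : ℝ} (h0 : 0 ≤ τ) (h1 : τ ≤ 1) :
    ‖1 - ((1 - τ : ℝ) : ℂ) * Complex.exp (θ * Complex.I)‖ ^ 2 ≤ τ ^ 2 + θ ^ 2 := by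
  rw [Complex.sq_norm, Complex.normSq_apply]
  simp only [Complex.sub_re, Complex.one_re, Complex.re_ofReal_mul, Complex.sub_im,
    Complex.one_im, Complex.im_ofReal_mul, Complex.exp_ofReal_mul_I_re,
    Complex.exp_ofReal_mul_I_im]
  have h2 := Real.one_sub_sq_div_two_le_cos (x := θ)
  nlinarith [Real.sin_sq_add_cos_sq θ, sq_nonneg θ]

end TraceRec
end

noncomputable section
namespace TraceRec

/-! ### The conditions on the parameters hold for large `n` -/

/-- `1 - |z0|`. -/
def gapZero (n : ℕ) : ℝ := (n : ℝ) ^ (-(4 / 5) : ℝ) * Real.log n ^ 6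

namespace Large

variable {M : ℝ} {n : ℕ}

lemma gapZero_pos (h : Large M n) (hM : 1 ≤ M) : 0 < gapZero n := by
  have := h.pos hM
  have := hM.trans h.log_ge
  unfold gapZero
  positivity

lemma gapZero_le (h : Large M n) (hM : 1 ≤ M) : gapZero n ≤ 1 / M := by
  obtain ⟨X, L, hX, hL, hXL, e1, e2, e3, e4, e5, e6⟩ := h.exists_scale hM
  rw [gapZero, e1, e4, inv_mul_eq_div, div_le_div_iff₀ (by positivity) (by positivity)]
  have h1 : L ^ 6 ≤ L ^ 14 := pow_le_pow_right₀ (by linarith) (by norm_num)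
  have h2 : X ≤ X ^ 4 := le_self_pow₀ hX (by norm_num)
  nlinarith

/-- The weight 1/n of the couplings is negligible against 1 - |z0|. -/
lemma inv_le_gapZero (h : Large M n) (hM : 1 ≤ M) : (n : ℝ)⁻¹ ≤ gapZero n / M := by
  obtain ⟨X, L, hX, hL, hXL, e1, e2, e3, e4, e5, e6⟩ := h.exists_scale hM
  rw [gapZero, e1, e4, e3, inv_mul_eq_div, div_div, inv_eq_one_div,
    div_le_div_iff₀ (by positivity) (by positivity)]
  have h1 : 1 ≤ L := by linarith
  have h2 : (1 : ℝ) ≤ L ^ 14 := one_le_pow₀ h1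
  have h3 : (1 : ℝ) ≤ L ^ 6 := one_le_pow₀ h1
  have h4 : M ≤ X := by nlinarith
  have h5 : M ≤ L ^ 6 * X := by nlinarith
  calc 1 * (X ^ 4 * M) = X ^ 4 * M := one_mul _
    _ ≤ X ^ 4 * (L ^ 6 * X) := by gcongr
    _ = _ := by ring

/-- Both sides have the scale n^{-4/5}; the factor log^6 n is what separates them. -/
lemma sq_le_gapZero (h : Large M n) (hM : 1 ≤ M) {θ : ℝ} (hθ : |θ| ≤ (n : ℝ) ^ (-(2 / 5) : ℝ)) :
    θ ^ 2 ≤ gapZero n / M := by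
  obtain ⟨X, L, hX, hL, hXL, e1, e2, e3, e4, e5, e6⟩ := h.exists_scale hM
  rw [e5] at hθ
  rw [gapZero, e1, e4, ← sq_abs]
  have h1 : 1 ≤ L := by linarith
  have h3 : M ≤ L ^ 6 := hL.trans (le_self_pow₀ h1 (by norm_num))
  calc |θ| ^ 2 ≤ ((X ^ 2)⁻¹) ^ 2 := by gcongr
    _ = (X ^ 4)⁻¹ * M / M := by field_simp
    _ ≤ (X ^ 4)⁻¹ * L ^ 6 / M := by gcongr

/-- Controls η r / z when η is of order h, r = 1/n and z is at least of order 1/h. -/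
lemma hFun_sq_le (h : Large M n) (hM : 1 ≤ M) : hFun n ^ 2 ≤ n / M := by
  obtain ⟨X, L, hX, hL, hXL, e1, e2, e3, e4, e5, e6⟩ := h.exists_scale hM
  rw [e6, e3, le_div_iff₀ (by positivity)]
  have h3 : X ^ 3 ≤ X ^ 5 := pow_le_pow_right₀ hX (by norm_num)
  calc (X * L ^ 7) ^ 2 * M = X ^ 2 * (M * L ^ 14) := by ring
    _ ≤ X ^ 2 * X := by gcongr
    _ = X ^ 3 := by ring
    _ ≤ X ^ 5 := h3

/-- Controls the phase that z0 acquires over the window of possible shifts. -/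
lemma hFun_mul_le (h : Large M n) (hM : 1 ≤ M) : hFun n * (n : ℝ) ^ (-(2 / 5) : ℝ) ≤ 1 / M := by
  obtain ⟨X, L, hX, hL, hXL, e1, e2, e3, e4, e5, e6⟩ := h.exists_scale hM
  rw [e6, e5, ← div_eq_mul_inv, div_le_div_iff₀ (by positivity) (by positivity)]
  have h1 : L ^ 7 ≤ L ^ 14 := pow_le_pow_right₀ (by linarith) (by norm_num)
  calc X * L ^ 7 * M ≤ X * (M * L ^ 14) := by
        rw [mul_assoc, mul_comm (L ^ 7)]; gcongr
    _ ≤ X * X := by gcongr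
    _ = 1 * X ^ 2 := by ring

lemma le_hFun (h : Large M n) (hM : 1 ≤ M) : M ≤ hFun n := by
  obtain ⟨X, L, hX, hL, hXL, e1, e2, e3, e4, e5, e6⟩ := h.exists_scale hM
  rw [e6]
  have h1 : L ≤ L ^ 7 := le_self_pow₀ (by linarith) (by norm_num)
  nlinarith

/-- `h(n)` is much larger than `n^{1/5} log n`. -/
lemma scale_log_le (h : Large M n) (hM : 1 ≤ M) :
    M * ((n : ℝ) ^ (1 / 5 : ℝ) * Real.log n) ≤ hFun n := by
  obtain ⟨X, L, hX, hL, hXL, e1, e2, e3, e4, e5, e6⟩ := h.exists_scale hM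
  rw [e6, e2, e1]
  have h1 : L ≤ L ^ 6 := le_self_pow₀ (by linarith) (by norm_num)
  have h2 : 0 ≤ X * L := mul_nonneg (by linarith) (by linarith)
  calc M * (X * L) ≤ L ^ 6 * (X * L) := by gcongr; linarith
    _ = _ := by ring

lemma one_le_scale (h : Large M n) (hM : 1 ≤ M) : 1 ≤ (n : ℝ) ^ (1 / 5 : ℝ) := by
  obtain ⟨X, L, hX, hL, hXL, e1, e2, e3, e4, e5, e6⟩ := h.exists_scale hM
  rwa [e2]

end Large

lemma zZero_eq (n : ℕ) (θ : ℝ) :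
    zZero n θ = ((1 - gapZero n : ℝ) : ℂ) * Complex.exp (θ * Complex.I) := rfl

lemma norm_zZero {n : ℕ} (h : gapZero n ≤ 1) (θ : ℝ) : ‖zZero n θ‖ = 1 - gapZero n := by
  rw [zZero_eq, norm_mul, Complex.norm_exp_ofReal_mul_I, mul_one, Complex.norm_real,
    Real.norm_of_nonneg (by linarith)]

lemma sum_toReal_eq_one (S : PMF ℕ) (n : ℕ) (hS : ∀ i, S i ≠ 0 → i < n) :
    ∑ i ∈ Finset.range n, (S i).toReal = 1 := by
  rw [← ENNReal.toReal_sum fun i _ => S.apply_ne_top i, ← tsum_eq_sum (L := .unconditional ℕ),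
    S.tsum_coe, ENNReal.toReal_one]
  intro i hi
  by_contra h
  exact hi (Finset.mem_range.2 (hS i h))

/-- The relative error of the couplings is at most C h · 200 h / n. For the top level, z0^{-j} has
real part at least cos(jθ) with j|θ| ≤ C h n^{-2/5} ≤ 1, hence at least 1/2, and real parts do not
cancel in the average. -/
lemma shiftBound_of_large {c C : ℝ} (hc : 0 < c) {M : ℝ} (hM1 : 2 ≤ M)
    (hMc : 1 / c ≤ M) (hMC : 800 * C ≤ M) {n : ℕ} (hn : Large M n) {θ t : ℝ}
    (hθ : |θ| ≤ (n : ℝ) ^ (-(2 / 5) : ℝ)) (ht0 : 0 < t) (ht : t ≤ 1 - c)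
    (ht' : 1 ≤ 200 * hFun n * t) {S : PMF ℕ} {a η : ℕ} (hη : (η : ℝ) ≤ C * hFun n)
    (han : a + η < n) (hS : S.support ⊆ Set.Icc a (a + η)) :
    ShiftBound (fun i => (S i).toReal) n a η t (zZero n θ) (n : ℝ)⁻¹ := by
  have hM : 1 ≤ M := by linarith
  have hn0 := hn.pos hM
  have hτ0 := hn.gapZero_pos hM
  have hτM := hn.gapZero_le hM
  have hM2 : 1 / M ≤ 1 / 2 := one_div_le_one_div_of_le (by norm_num) hM1
  have hτ1 : gapZero n ≤ 1 / 2 := by linarith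
  have hnorm := norm_zZero (by linarith : gapZero n ≤ 1) θ
  have hcM : 1 / M ≤ c := by
    rw [div_le_iff₀ (by linarith)]
    rw [div_le_iff₀ hc] at hMc
    linarith
  have hsupp : ∀ i, S i ≠ 0 → a ≤ i ∧ i ≤ a + η := fun i hi => hS ((S.mem_support_iff i).2 hi)
  have hsum := sum_toReal_eq_one S n fun i hi => by have := hsupp i hi; omega
  have hh := hn.le_hFun hM
  refine ⟨fun i => ENNReal.toReal_nonneg, hsum, fun i hi => hsupp i fun h => hi (by simp [h]), han,
    ht0, by rw [hnorm]; linarith, ?_, by positivity, ?_, ?_⟩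
  · rw [hnorm]
    have := hn.inv_le_gapZero hM
    have h1 : gapZero n / M ≤ gapZero n := div_le_self hτ0.le hM
    linarith
  · have hh2 := hn.hFun_sq_le hM
    have h1 : (n : ℝ)⁻¹ / t ≤ 200 * hFun n * (n : ℝ)⁻¹ := by
      rw [div_le_iff₀ ht0]
      calc (n : ℝ)⁻¹ = 1 * (n : ℝ)⁻¹ := (one_mul _).symm
        _ ≤ (200 * hFun n * t) * (n : ℝ)⁻¹ := by gcongr
        _ = _ := by ring
    have hC0 : 0 ≤ C * hFun n := (Nat.cast_nonneg η).trans hη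
    have hh0 : 0 < hFun n := by linarith
    have hC1 : 0 ≤ C := nonneg_of_mul_nonneg_left hC0 hh0
    calc (η : ℝ) * ((n : ℝ)⁻¹ / t) ≤ (C * hFun n) * (200 * hFun n * (n : ℝ)⁻¹) := by gcongr
      _ = 200 * C * hFun n ^ 2 * (n : ℝ)⁻¹ := by ring
      _ ≤ 200 * C * (n / M) * (n : ℝ)⁻¹ := by gcongr
      _ = 200 * C / M := by field_simp
      _ ≤ 1 / 4 := by rw [div_le_iff₀ (by linarith)]; linarith
  · have hz : ∀ j : ℕ, j ≤ η → 1 / 2 ≤ ((zZero n θ)⁻¹ ^ j).re := by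
      intro j hj
      have h1 : (zZero n θ)⁻¹ ^ j = (((1 - gapZero n)⁻¹ ^ j : ℝ) : ℂ) *
          Complex.exp (((-(j * θ) : ℝ) : ℂ) * Complex.I) := by
        rw [zZero_eq, mul_inv, mul_pow, ← Complex.exp_neg, ← Complex.exp_nat_mul]
        push_cast
        ring_nf
      rw [h1, Complex.re_ofReal_mul, Complex.exp_ofReal_mul_I_re, Real.cos_neg]
      have h2 : 1 ≤ (1 - gapZero n)⁻¹ ^ j :=
        one_le_pow₀ ((one_le_inv₀ (by linarith)).2 (by linarith))
      have h3 : |(j : ℝ) * θ| ≤ 1 := by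
        rw [abs_mul, Nat.abs_cast]
        have hC0 : 0 ≤ C * hFun n := (Nat.cast_nonneg η).trans hη
        have hh0 : 0 < hFun n := by linarith
        have hC1 : 0 ≤ C := nonneg_of_mul_nonneg_left hC0 hh0
        calc (j : ℝ) * |θ| ≤ (C * hFun n) * (n : ℝ) ^ (-(2 / 5) : ℝ) := by
              have : (j : ℝ) ≤ η := by exact_mod_cast hj
              gcongr
              linarith
          _ = C * (hFun n * (n : ℝ) ^ (-(2 / 5) : ℝ)) := by ring
          _ ≤ C * (1 / M) := by
              have := hn.hFun_mul_le hM
              gcongr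
          _ = C / M := by ring
          _ ≤ 1 := by rw [div_le_one (by linarith)]; linarith
      have h4 := Real.one_sub_sq_div_two_le_cos (x := (j : ℝ) * θ)
      have h5 : ((j : ℝ) * θ) ^ 2 ≤ 1 := by rw [← sq_abs]; exact pow_le_one₀ (abs_nonneg _) h3
      nlinarith
    refine le_trans ?_ (Complex.re_le_norm _)
    rw [Complex.re_sum]
    calc (1 / 2 : ℝ) = ∑ i ∈ Finset.range n, (S i).toReal * (1 / 2) := by
          rw [← Finset.sum_mul, hsum, one_mul]
      _ ≤ _ := by
          refine Finset.sum_le_sum fun i _ => ?_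
          rw [Complex.re_ofReal_mul]
          by_cases hi : S i = 0
          · simp [hi]
          · have := hsupp i hi
            exact mul_le_mul_of_nonneg_left (hz (i - a) (by omega)) ENNReal.toReal_nonneg

/-- The constant of the contraction. -/
def rateConst (q q' : ℝ) : ℝ := min (1 / 2) ((1 - q') / (1 - q) / 4)

lemma rateConst_pos {q q' : ℝ} (hq1 : q < 1) (hq'1 : q' < 1) : 0 < rateConst q q' := by
  have h1 : 0 < 1 - q := by linarith
  have h2 : 0 < 1 - q' := by linarith
  exact lt_min (by norm_num) (by positivity)

/-- A lower bound for what is large. -/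
def contractBound (q q' c : ℝ) : ℝ :=
  4 + 2 / c + 2 / (1 - q') + 2 / midGap q q' c * (1 + 3 / ((1 - q') ^ 2 * (1 - q))) +
    4 * ((1 - q') / (1 - q))⁻¹ * (1 + 3 / ((1 - q') ^ 2 * (1 - q))) +
    8 * ((1 - q') / (1 - q) + 4)

-- Both 1/n and |1 - z0|² are small compared with τ = 1 - |z0|, so only a constant fraction of the
-- contraction is lost on the top level: τ/2 remains for M_b and κτ - κτ/2 - κτ/4 = κτ/4 for N_b,
-- whence `rateConst`. The middle levels have a gap independent of n.
set_option maxHeartbeats 1000000 in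
lemma contracts_of_large {q q' : Set.Ico (0 : ℝ) 1} {c : ℝ} (hc : 0 < c) {M : ℝ}
    (hMb : contractBound q q' c ≤ M) {n : ℕ} (hn : Large M n) {θ t : ℝ}
    (hθ : |θ| ≤ (n : ℝ) ^ (-(2 / 5) : ℝ)) (ht0 : 0 < t) (ht : t ≤ 1 - c)
    (hqt : (q : ℝ) ≤ t ∨ (q : ℝ) < 1 / 2) (N : ℕ) :
    Contracts (treeDiagB t (zZero n θ) N) (n : ℝ)⁻¹ q q' (1 - rateConst q q' * gapZero n) := by
  have hq0 : (0 : ℝ) ≤ q := q.2.1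
  have hq1 : (q : ℝ) < 1 := q.2.2
  have hq'0 : (0 : ℝ) ≤ q' := q'.2.1
  have hq'1 : (q' : ℝ) < 1 := q'.2.2
  have h1 : 0 < 1 - (q : ℝ) := by linarith
  have h2 : 0 < 1 - (q' : ℝ) := by linarith
  set κ := (1 - (q' : ℝ)) / (1 - q) with hκ
  set A := 3 / ((1 - (q' : ℝ)) ^ 2 * (1 - q)) with hA
  set g := midGap q q' c with hg
  have hκ0 : 0 < κ := by positivity
  have hA0 : 0 < A := by positivity
  have hg0 : 0 < g := midGap_pos hq1 hq'1 hc
  have p1 : 0 < 2 / c := by positivity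
  have p2 : 0 < 2 / (1 - (q' : ℝ)) := by positivity
  have p3 : 0 < 2 / g * (1 + A) := by positivity
  have p4 : 0 < 4 * κ⁻¹ * (1 + A) := by positivity
  have p5 : 0 < 8 * (κ + 4) := by positivity
  unfold contractBound at hMb
  rw [← hκ, ← hA, ← hg] at hMb
  have hM : 1 ≤ M := by linarith
  have hn0 := hn.pos hM
  have hτ0 := hn.gapZero_pos hM
  have hτM := hn.gapZero_le hM
  have hr := hn.inv_le_gapZero hM
  have hθ2 := hn.sq_le_gapZero hM hθ
  set τ := gapZero n with hτ
  set r := (n : ℝ)⁻¹ with hrdef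
  have hMpos : 0 < M := by linarith
  have hr0 : 0 ≤ r := by positivity
  have hτ1 : τ ≤ 1 / 4 := hτM.trans (one_div_le_one_div_of_le (by norm_num) (by linarith))
  have hrτ : r ≤ τ / 4 := hr.trans (div_le_div_of_nonneg_left hτ0.le (by norm_num) (by linarith))
  have hτle : ∀ y : ℝ, 0 < y → 2 / y ≤ M → 2 * τ ≤ y := by
    intro y hy hyM
    rw [div_le_iff₀ hy] at hyM
    have h3 : τ * M ≤ 1 := (le_div_iff₀ hMpos).1 hτM
    calc 2 * τ ≤ (M * y) * τ := mul_le_mul_of_nonneg_right hyM hτ0.le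
      _ = y * (τ * M) := by ring
      _ ≤ y * 1 := mul_le_mul_of_nonneg_left h3 hy.le
      _ = y := mul_one y
  have hτc : 2 * τ ≤ c := hτle c hc (by linarith)
  have hrq : r < 1 - q' := by
    have := hτle (1 - q') h2 (by linarith)
    linarith
  have hτg : τ + A * r ≤ g := by
    have h3 := hτle (g / (1 + A)) (by positivity) (by rw [div_div_eq_mul_div, mul_div_right_comm]; linarith)
    rw [le_div_iff₀ (by positivity)] at h3
    have h4 : A * r ≤ A * τ := mul_le_mul_of_nonneg_left (by linarith) hA0.le
    have h5 : 0 ≤ A * τ := by positivity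
    linarith
  have hAr : A * r ≤ κ / 4 * τ := by
    have h3 : 4 * κ⁻¹ * (1 + A) ≤ M := by linarith
    have h4 : 4 * A ≤ κ * M := by
      have : 4 * (1 + A) ≤ κ * M := by
        calc 4 * (1 + A) = κ * (4 * κ⁻¹ * (1 + A)) := by field_simp
          _ ≤ κ * M := by gcongr
      linarith
    rw [le_div_iff₀ hMpos] at hr
    have h5 : A * r * M ≤ κ / 4 * τ * M := by
      calc A * r * M = A * (r * M) := by ring
        _ ≤ A * τ := by gcongr
        _ ≤ κ / 4 * M * τ := by linarith [mul_le_mul_of_nonneg_right h4 hτ0.le]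
        _ = _ := by ring
    exact le_of_mul_le_mul_right h5 hMpos
  have hu2 : ‖1 - zZero n θ‖ ^ 2 ≤ τ ^ 2 + θ ^ 2 :=
    norm_one_sub_polar_sq_le (τ := τ) (θ := θ) hτ0.le (hτ1.trans (by norm_num))
  have hu3 : ‖1 - zZero n θ‖ ^ 2 ≤ 2 * (τ / M) := by
    refine hu2.trans ?_
    have : τ ^ 2 ≤ τ / M := by
      rw [pow_two, div_eq_mul_one_div]; gcongr
    linarith
  have hu4 : ‖1 - zZero n θ‖ ≤ 1 / 2 := by
    have : ‖1 - zZero n θ‖ ^ 2 ≤ (1 / 2) ^ 2 := by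
      refine hu3.trans ?_
      have : τ / M ≤ τ := div_le_self hτ0.le hM
      have h6 : τ / M ≤ 1 / 8 := by
        rw [div_le_iff₀ hMpos]; linarith
      linarith
    exact le_of_sq_le_sq this (by norm_num)
  have hre : (zZero n θ).re = (1 - τ) * Real.cos θ := by
    rw [zZero_eq, Complex.re_ofReal_mul, Complex.exp_ofReal_mul_I_re]
  have hre1 : (zZero n θ).re ≤ 1 - τ := by
    rw [hre]; exact mul_le_of_le_one_right (by linarith) (Real.cos_le_one θ)
  have hre0 : 0 ≤ (zZero n θ).re := by
    have h3 := (Complex.abs_re_le_norm (1 - zZero n θ)).trans hu4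
    rw [Complex.sub_re, Complex.one_re] at h3
    linarith [(abs_le.1 h3).2]
  have hrate1 : rateConst q q' * τ ≤ τ / 2 := by
    have : rateConst q q' ≤ 1 / 2 := min_le_left _ _
    linarith [mul_le_mul_of_nonneg_right this hτ0.le]
  have hrate2 : rateConst q q' * τ ≤ κ / 4 * τ := by
    have : rateConst q q' ≤ κ / 4 := min_le_right _ _
    exact mul_le_mul_of_nonneg_right this hτ0.le
  have hrate0 : 0 < rateConst q q' * τ := mul_pos (rateConst_pos hq1 hq'1) hτ0
  refine ⟨hq0, hq1, hq'0, hq'1, hr0, hrq, by simp [treeDiag], fun e => ?_, by linarith,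
    fun e he => ?_, fun e he => ?_⟩
  · rw [treeDiagB_apply, treeDiag]
    split_ifs
    · simp
    · simpa using ht0.le
    · exact hre0
  · rw [treeDiagB_apply, treeDiag, if_neg he]
    split_ifs
    · rw [Complex.norm_real, Real.norm_of_nonneg ht0.le]; linarith
    · rw [norm_zZero (by linarith)]; linarith
  · rw [treeDiagB_apply, treeDiag, if_neg he]
    split_ifs
    · have h3 := abs_mid_le hq0 hq1 hq'0 hq'1 ht0.le ht hc hqt
      rw [← Real.norm_eq_abs, ← Complex.norm_real] at h3
      push_cast at h3
      linarith
    · have h3 := norm_top_le (q := q) (q' := q') (τ := τ) hq1 hq'0 hq'1 hre1 hu4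
      rw [← hκ] at h3
      have h4 : (κ ^ 2 / 2 + 2 * κ) * ‖1 - zZero n θ‖ ^ 2 ≤ κ / 2 * τ := by
        have h5 : 8 * (κ + 4) ≤ M := by linarith
        calc _ ≤ (κ ^ 2 / 2 + 2 * κ) * (2 * (τ / M)) := by gcongr
          _ = κ * (κ + 4) * τ / M := by ring
          _ ≤ κ / 2 * τ := by
              rw [div_le_iff₀ hMpos]
              have : 0 < κ * τ := by positivity
              linarith [mul_le_mul_of_nonneg_right h5 this.le, mul_pos hMpos this]
      linarith

end TraceRec
end

noncomputable section
namespace TraceRec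

/-! ### The estimate and its error -/

/-- One step of the search for the number of nodes. -/
def extraStep (m : ℕ) (p : ℕ × ℕ) : ℕ × ℕ := if p.1 < m then (2 ^ 64 * p.1, p.2 + 1) else p

/-- The number of nodes of the extrapolation: the least `c` with `m ≤ 2 ^ (64 c)`. -/
def extraCount (m : ℕ) : ℕ := ((extraStep m)^[m] (1, 0)).2

lemma extraStep_iterate (m i : ℕ) : ∃ c, (extraStep m)^[i] (1, 0) = (2 ^ (64 * c), c) ∧
    (c = 0 ∨ 2 ^ (64 * (c - 1)) < m) ∧ (m ≤ 2 ^ (64 * c) ∨ c = i) := by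
  induction i with
  | zero => exact ⟨0, by simp, Or.inl rfl, Or.inr rfl⟩
  | succ i ih =>
    obtain ⟨c, h1, h2, h3⟩ := ih
    rw [Function.iterate_succ_apply', h1, extraStep]
    by_cases h : 2 ^ (64 * c) < m
    · refine ⟨c + 1, ?_, Or.inr h, Or.inr ?_⟩
      · rw [if_pos h, mul_add, mul_one, pow_add, mul_comm]
      · rcases h3 with h3 | h3
        · omega
        · rw [h3]
    · exact ⟨c, by rw [if_neg h], h2, Or.inl (by omega)⟩

/-- The search has converged after m rounds because 2^(64 m) ≥ m. The number 64 makes the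
interpolation loss 22^D a small power of m, while the gain 2^{-D} is still at most m^{-1/64}. -/
lemma extraCount_spec (m : ℕ) : m ≤ 2 ^ (64 * extraCount m) ∧
    (extraCount m = 0 ∨ 2 ^ (64 * (extraCount m - 1)) < m) := by
  obtain ⟨c, h1, h2, h3⟩ := extraStep_iterate m m
  rw [extraCount, h1]
  refine ⟨?_, h2⟩
  rcases h3 with h3 | rfl
  · exact h3
  · exact c.lt_two_pow_self.le.trans (Nat.pow_le_pow_right (by norm_num) (by omega))

/-- The number of the nodes that are used for `z`. -/
def nodeCount (z : ℝ) (m : ℕ) : ℕ := if 1 / 2 < z then 1 else extraCount m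

/-- The largest of the nodes that are used for `z`. -/
def nodeScale (z : ℝ) : ℝ := if 1 / 2 < z then z else 1 / 100

/-- The estimate that the algorithm computes. -/
def estimate {l : ℕ} (f : (Fin l → Bool) → ℂ) (z : ℝ) (z0 : ℂ) (n m : ℕ) (q q' : ℝ)
    (x : ℕ → Bool) (S : PMF ℕ) (Y : Fin m → ℕ → Bool) : ℂ :=
  (∑ i ∈ Finset.range (nodeCount z m), (extraCoeff (nodeScale z) z (nodeCount z m) i : ℂ) *
    nodeLin f (extraNode (nodeScale z) (nodeCount z m) i) z0 (n : ℝ)⁻¹ x (fun i => (S i).toReal) n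
      (m - 1) (fun e => (∑ j, traceStat (treeDiagB (extraNode (nodeScale z) (nodeCount z m) i) z0
        (2 ^ (l + 1) - 1)) (n : ℝ)⁻¹ q q' m (Y j) e) / m)) * (n : ℂ) ^ (l + 1) / z0

/-- The contribution of one trace to the estimate. -/
def traceEstimate {l : ℕ} (f : (Fin l → Bool) → ℂ) (z : ℝ) (z0 : ℂ) (n m : ℕ) (q q' : ℝ)
    (x : ℕ → Bool) (S : PMF ℕ) (y : ℕ → Bool) : ℂ :=
  (∑ i ∈ Finset.range (nodeCount z m), (extraCoeff (nodeScale z) z (nodeCount z m) i : ℂ) *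
    nodeStat f (extraNode (nodeScale z) (nodeCount z m) i) z0 (n : ℝ)⁻¹ x S n (m - 1) q q' m y) *
      (n : ℂ) ^ (l + 1) / z0

/-- Everything after the averaging over the samples is linear. The program averages first, so that
the system is solved once per node; concentration needs the average of the contributions of single
traces. -/
lemma estimate_eq_average {l : ℕ} (f : (Fin l → Bool) → ℂ) (z : ℝ) (z0 : ℂ) (n m : ℕ) (q q' : ℝ)
    (x : ℕ → Bool) (S : PMF ℕ) (Y : Fin m → ℕ → Bool) :
    estimate f z z0 n m q q' x S Y =
      (∑ j, traceEstimate f z z0 n m q q' x S (Y j)) / m := by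
  have h : ∀ (Φ : (ℕ → ℂ) →ₗ[ℂ] ℂ) (g : Fin m → ℕ → ℂ),
      Φ (fun e => (∑ j, g j e) / m) = (∑ j, Φ (g j)) / m := by
    intro Φ g
    have : (fun e => (∑ j, g j e) / m) = (m : ℂ)⁻¹ • ∑ j, g j := by
      ext e
      rw [Pi.smul_apply, Finset.sum_apply, smul_eq_mul, div_eq_inv_mul]
    rw [this, map_smul, map_sum, smul_eq_mul, div_eq_inv_mul]
  simp only [estimate, traceEstimate, h, nodeStat]
  rw [← Finset.sum_div, ← Finset.sum_mul, Finset.sum_comm, div_right_comm]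
  congr 1
  rw [mul_div_right_comm, Finset.sum_div]
  congr 1
  refine Finset.sum_congr rfl fun i _ => ?_
  rw [← Finset.mul_sum, mul_div_assoc]

lemma exp_hFun_le_numSamples (n : ℕ) : Real.exp (hFun n) ≤ numSamples n := Nat.le_ceil _

lemma numSamples_le_exp {n : ℕ} (h : 0 ≤ hFun n) : (numSamples n : ℝ) ≤ Real.exp (hFun n + 1) := by
  have h1 := (Nat.ceil_lt_add_one (Real.exp_pos (hFun n)).le).le
  have h2 : (1 : ℝ) ≤ Real.exp (hFun n) := Real.one_le_exp h
  have h3 : (2 : ℝ) ≤ Real.exp 1 := by have := Real.exp_one_gt_d9; linarith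
  rw [Real.exp_add]
  refine h1.trans ?_
  nlinarith

section Count

variable {z : ℝ} {n : ℕ}

lemma one_le_extraCount (h : 2 ≤ hFun n) : 1 ≤ extraCount (numSamples n) := by
  by_contra hc
  have h0 : extraCount (numSamples n) = 0 := by omega
  have h1 := (extraCount_spec (numSamples n)).1
  rw [h0, mul_zero, pow_zero] at h1
  have h2 := exp_hFun_le_numSamples n
  have h3 := Real.add_one_le_exp (hFun n)
  have h4 : (numSamples n : ℝ) ≤ 1 := by exact_mod_cast h1
  linarith

lemma two_pow_extraCount_le (h : 2 ≤ hFun n) :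
    (2 : ℝ) ^ (extraCount (numSamples n) - 1) ≤ Real.exp ((hFun n + 1) / 64) := by
  have h1 := (extraCount_spec (numSamples n)).2.resolve_left
    (by have := one_le_extraCount h; omega)
  have h2 : (2 : ℝ) ^ (64 * (extraCount (numSamples n) - 1)) ≤ Real.exp (hFun n + 1) :=
    le_trans (by exact_mod_cast h1.le) (numSamples_le_exp (by linarith))
  refine le_of_pow_le_pow_left₀ (n := 64) (by norm_num) (Real.exp_pos _).le ?_
  rw [← pow_mul, mul_comm, ← Real.exp_nat_mul]
  refine h2.trans (Real.exp_le_exp.2 (le_of_eq ?_))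
  push_cast
  ring

lemma extraCount_le (h : 8 ≤ hFun n) : (extraCount (numSamples n) : ℝ) ≤ 2 * hFun n := by
  have h1 := two_pow_extraCount_le (n := n) (by linarith)
  have h2 := one_le_extraCount (n := n) (by linarith)
  have h3 : Real.exp (((extraCount (numSamples n) - 1 : ℕ) : ℝ) * Real.log 2) ≤
      Real.exp ((hFun n + 1) / 64) := by
    rwa [Real.exp_nat_mul, Real.exp_log (by norm_num)]
  have h4 := Real.exp_le_exp.1 h3
  rw [Nat.cast_sub h2, Nat.cast_one] at h4
  have h5 := Real.log_two_gt_d9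
  have h6 : (1 : ℝ) ≤ extraCount (numSamples n) := by exact_mod_cast h2
  nlinarith

lemma pow_nodeCount_le (h : 2 ≤ hFun n) :
    (22 : ℝ) ^ nodeCount z (numSamples n) ≤ 32 * Real.exp (5 * (hFun n + 1) / 64) := by
  have h1 : (1 : ℝ) ≤ Real.exp (5 * (hFun n + 1) / 64) := Real.one_le_exp (by linarith)
  rw [nodeCount]
  split_ifs
  · linarith
  · obtain ⟨d, hd⟩ := Nat.exists_eq_add_of_le' (one_le_extraCount h)
    have h2 := two_pow_extraCount_le h
    rw [hd, Nat.add_sub_cancel] at h2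
    rw [hd]
    calc (22 : ℝ) ^ (d + 1) ≤ 32 ^ (d + 1) := by gcongr; norm_num
      _ = 32 * (2 ^ d) ^ 5 := by rw [pow_succ', ← pow_mul, mul_comm d 5, pow_mul]; norm_num
      _ ≤ 32 * Real.exp ((hFun n + 1) / 64) ^ 5 := by gcongr
      _ = _ := by rw [← Real.exp_nat_mul]; push_cast; ring_nf

lemma inv_two_pow_extraCount_le (n : ℕ) :
    (1 / 2 : ℝ) ^ extraCount (numSamples n) ≤ Real.exp (-(hFun n / 64)) := by
  have h1 := (extraCount_spec (numSamples n)).1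
  have h2 : Real.exp (hFun n) ≤ (2 : ℝ) ^ (64 * extraCount (numSamples n)) :=
    (exp_hFun_le_numSamples n).trans (by exact_mod_cast h1)
  rw [one_div, inv_pow, Real.exp_neg]
  refine inv_anti₀ (Real.exp_pos _) ?_
  refine le_of_pow_le_pow_left₀ (n := 64) (by norm_num) (by positivity) ?_
  rw [← pow_mul, mul_comm _ 64, ← Real.exp_nat_mul]
  refine le_trans (Real.exp_le_exp.2 (le_of_eq ?_)) h2
  push_cast
  ring

end Count

namespace Large

variable {M : ℝ} {n : ℕ}

/-- The factors `n^l`, `2^l`, ... are negligible compared to `exp(h(n))`. -/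
lemma poly_le (h : Large M n) (hM : 4096 ≤ M) {l : ℕ}
    (hl : (l : ℝ) ≤ 2 * (n : ℝ) ^ (1 / 5 : ℝ) + 1) :
    2 * n * (n : ℝ) ^ (l + 1) * 2 ^ l ≤ Real.exp (hFun n / 256) := by
  have hn := h.pos (by linarith)
  have h1 := h.scale_log_le (by linarith)
  have h2 := h.one_le_scale (by linarith)
  have h3 := h.log_ge
  set X := (n : ℝ) ^ (1 / 5 : ℝ)
  set L := Real.log n with hL
  have h4 : (2 : ℝ) ≤ Real.exp 1 := by have := Real.exp_one_gt_d9; linarith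
  have h5 : 2 * n * (n : ℝ) ^ (l + 1) * 2 ^ l ≤
      Real.exp 1 * Real.exp L * Real.exp L ^ (l + 1) * Real.exp 1 ^ l := by
    rw [hL, Real.exp_log hn]
    gcongr
  refine h5.trans ?_
  rw [← Real.exp_nat_mul, ← Real.exp_nat_mul, ← Real.exp_add, ← Real.exp_add, ← Real.exp_add]
  refine Real.exp_le_exp.2 ?_
  push_cast
  -- The exponent on the left is at most 9 X L, whereas h/256 is at least 16 X L.
  have h6 : 4096 * (X * L) ≤ hFun n := le_trans (by gcongr) h1
  have h7 : (l : ℝ) * L ≤ (2 * X + 1) * L := by gcongr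
  have h8 : X ≤ X * L := le_mul_of_one_le_right (by linarith) (by linarith)
  have h9 : L ≤ X * L := le_mul_of_one_le_left (by linarith) h2
  linarith

lemma log_le_hFun (h : Large M n) (hM : 4096 ≤ M) : 4096 * Real.log n ≤ hFun n := by
  have h1 := h.scale_log_le (by linarith)
  have h2 := h.one_le_scale (by linarith)
  have h3 := h.log_ge
  have h9 : Real.log n ≤ (n : ℝ) ^ (1 / 5 : ℝ) * Real.log n :=
    le_mul_of_one_le_left (by linarith) h2
  nlinarith

lemma le_self (h : Large M n) (hM : 1 ≤ M) : M ≤ n := by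
  have h1 := h.log_ge
  have h2 := Real.log_le_sub_one_of_pos (h.pos hM)
  linarith

lemma pow_le_exp (h : Large M n) (hM : 4096 ≤ M) : (n : ℝ) ^ 3 ≤ Real.exp (hFun n / 2) := by
  have h1 := h.log_le_hFun hM
  have h2 := h.log_ge
  rw [← Real.exp_log (h.pos (by linarith)), ← Real.exp_nat_mul]
  refine Real.exp_le_exp.2 ?_
  push_cast
  linarith

/-- The power is at most exp(-c m τ), and m ≥ exp(h) outweighs 1/τ ≤ n: half of the exponent h pays
for n and the other half for h/c. -/
lemma rate_pow_le (h : Large M n) (hM : 4096 ≤ M) {c : ℝ} (hc : 0 < c) (hc1 : c * gapZero n ≤ 1)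
    (hcM : 8 / c ≤ M) : (1 - c * gapZero n) ^ numSamples n ≤ Real.exp (-hFun n) := by
  have hn := h.pos (by linarith)
  have h1 := h.inv_le_gapZero (by linarith)
  have hτ := h.gapZero_pos (by linarith)
  have h2 : (n : ℝ)⁻¹ ≤ gapZero n := h1.trans (div_le_self hτ.le (by linarith))
  have hh := h.le_hFun (by linarith)
  have h3 : 1 - c * gapZero n ≤ Real.exp (-(c * gapZero n)) := by
    have := Real.add_one_le_exp (-(c * gapZero n))
    linarith
  calc (1 - c * gapZero n) ^ numSamples n ≤ Real.exp (-(c * gapZero n)) ^ numSamples n :=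
        pow_le_pow_left₀ (by linarith) h3 _
    _ = Real.exp (-(numSamples n * (c * gapZero n))) := by rw [← Real.exp_nat_mul]; ring_nf
    _ ≤ _ := by
      refine Real.exp_le_exp.2 (neg_le_neg ?_)
      have h4 := exp_hFun_le_numSamples n
      have h5 : Real.exp (hFun n) = Real.exp (hFun n / 2) * Real.exp (hFun n / 2) := by
        rw [← Real.exp_add]; ring_nf
      have h6 : (n : ℝ) ≤ Real.exp (hFun n / 2) := by
        refine le_trans ?_ (h.pow_le_exp hM)
        exact le_self_pow₀ (le_trans (by linarith) (h.le_self (by linarith))) (by norm_num)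
      have h7 := Real.quadratic_le_exp_of_nonneg (show 0 ≤ hFun n / 2 by linarith)
      have h8 : hFun n / c ≤ Real.exp (hFun n / 2) := by
        rw [div_le_iff₀ hc] at hcM ⊢
        have : 8 ≤ hFun n * c := hcM.trans (by gcongr)
        have h10 : hFun n ^ 2 / 8 ≤ Real.exp (hFun n / 2) := by linarith
        calc hFun n = hFun n * 8 / 8 := by ring
          _ ≤ hFun n * (hFun n * c) / 8 := by
            have : 0 ≤ hFun n := by linarith
            gcongr
          _ = hFun n ^ 2 / 8 * c := by ring
          _ ≤ _ := by gcongr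
      calc hFun n = (n * (hFun n / c)) * (c * (n : ℝ)⁻¹) := by field_simp
        _ ≤ (Real.exp (hFun n / 2) * Real.exp (hFun n / 2)) * (c * gapZero n) := by
          have : 0 ≤ hFun n := by linarith
          gcongr
        _ ≤ _ := by
          rw [← h5]
          gcongr

end Large

end TraceRec
end

noncomputable section
namespace TraceRec

/-! ### The estimate is accurate with high probability -/

/-- The values of `z` that are covered. -/
def Admissible (q c z : ℝ) : Prop :=
  (1 / 2 < z ∧ q ≤ z ∧ z ≤ 1 - c) ∨ (|z| ≤ 1 / 100 ∧ q < 1 / 2)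

lemma extraNode_pos_le {β : ℝ} (hβ : 0 < β) {D i : ℕ} (hi : i < D) :
    β / D ≤ extraNode β D i ∧ extraNode β D i ≤ β := by
  have hD : (0 : ℝ) < D := by
    have : 0 < D := by omega
    positivity
  have h1 : (i : ℝ) + 1 ≤ D := by exact_mod_cast hi
  have h2 : (0 : ℝ) ≤ i := Nat.cast_nonneg i
  unfold extraNode
  constructor
  · gcongr
    nlinarith
  · rw [div_le_iff₀ hD]
    gcongr

lemma Admissible.scale_pos {q c z : ℝ} (h : Admissible q c z) :
    0 < nodeScale z ∧ |z| ≤ nodeScale z := by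
  rw [nodeScale]
  rcases h with ⟨h, -⟩ | ⟨h, -⟩
  · rw [if_pos h, abs_of_pos (by linarith)]; exact ⟨by linarith, le_rfl⟩
  · rw [if_neg (by have := le_abs_self z; linarith)]; exact ⟨by norm_num, h⟩

/-- For z > 1/2 the only node is z itself. Otherwise the smallest node is 1/(100 D) with D ≤ 2h,
which is where the bound 1/(200 h) comes from; these nodes are positive even if z is not. -/
lemma Admissible.node {q c z : ℝ} (hc : c ≤ 1 / 2) (h : Admissible q c z) {n : ℕ}
    (hh : 8 ≤ hFun n) {i : ℕ} (hi : i < nodeCount z (numSamples n)) :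
    0 < extraNode (nodeScale z) (nodeCount z (numSamples n)) i ∧
    extraNode (nodeScale z) (nodeCount z (numSamples n)) i ≤ 1 - c ∧
    1 ≤ 200 * hFun n * extraNode (nodeScale z) (nodeCount z (numSamples n)) i ∧
    (q ≤ extraNode (nodeScale z) (nodeCount z (numSamples n)) i ∨ q < 1 / 2) := by
  rw [nodeScale, nodeCount] at *
  rcases h with ⟨h1, h2, h3⟩ | ⟨h1, h2⟩
  · rw [if_pos h1] at hi ⊢
    rw [if_pos h1]
    have : extraNode z 1 i = z := by
      have : i = 0 := by omega
      simp [extraNode, this]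
    rw [this]
    exact ⟨by linarith, h3, by nlinarith, Or.inl h2⟩
  · have hz : ¬ 1 / 2 < z := by have := le_abs_self z; linarith
    rw [if_neg hz] at hi ⊢
    rw [if_neg hz]
    obtain ⟨h4, h5⟩ := extraNode_pos_le (β := 1 / 100) (by norm_num) hi
    have hD : (0 : ℝ) < extraCount (numSamples n) := by
      have : 0 < extraCount (numSamples n) := by omega
      positivity
    have h6 := extraCount_le hh
    refine ⟨lt_of_lt_of_le (by positivity) h4, by linarith, ?_, Or.inr h2⟩
    calc (1 : ℝ) ≤ 200 * hFun n * (1 / 100 / extraCount (numSamples n)) := by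
          rw [← mul_div_assoc, le_div_iff₀ hD]; linarith
      _ ≤ _ := by gcongr

/-- The conditions on how large `n` has to be. -/
structure Enough (q q' c C A M : ℝ) : Prop where
  abs : 4096 ≤ M
  inv : 1 / c ≤ M
  shift : 800 * C ≤ M
  contract : contractBound q q' c ≤ M
  rate : 8 / rateConst q q' ≤ M
  fail : |A| + 4 ≤ M

lemma exists_enough (q q' c C A : ℝ) : ∃ M, Enough q q' c C A M :=
  ⟨max 4096 (max (1 / c) (max (800 * C) (max (contractBound q q' c)
    (max (8 / rateConst q q') (|A| + 4))))), by constructor <;> simp⟩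

section Main

variable {q q' : Set.Ico (0 : ℝ) 1} {c C A M θ z : ℝ} {n l a η : ℕ}
  {f : (Fin l → Bool) → ℂ} {x : ℕ → Bool} {S : PMF ℕ}

/-- The bound for the deviation of the contribution of one trace. -/
lemma scale_bound (hM : 4096 ≤ M) (hn : Large M n)
    (hl : (l : ℝ) ≤ 2 * (n : ℝ) ^ (1 / 5 : ℝ) + 1) :
    22 ^ nodeCount z (numSamples n) * (2 ^ l * (2 * (4 * 2)) * ((n : ℝ) ^ (l + 1) / (1 / 2))) ≤
      Real.exp (hFun n / 8) := by
  have hh := hn.le_hFun (by linarith)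
  have hn0 := hn.le_self (by linarith)
  have h1 := pow_nodeCount_le (z := z) (n := n) (by linarith)
  have h2 := hn.poly_le hM hl
  have h3 : 2 ^ l * (2 * (4 * 2)) * ((n : ℝ) ^ (l + 1) / (1 / 2)) ≤
      2 * n * (n : ℝ) ^ (l + 1) * 2 ^ l := by
    have : 0 ≤ (n : ℝ) ^ (l + 1) * 2 ^ l := by positivity
    nlinarith
  have h4 : (32 : ℝ) ≤ Real.exp 5 := by
    have h5 : (2 : ℝ) ≤ Real.exp 1 := by have := Real.exp_one_gt_d9; linarith
    calc (32 : ℝ) = 2 ^ 5 := by norm_num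
      _ ≤ Real.exp 1 ^ 5 := by gcongr
      _ = Real.exp 5 := by rw [← Real.exp_nat_mul]; norm_num
  calc _ ≤ (Real.exp 5 * Real.exp (5 * (hFun n + 1) / 64)) * Real.exp (hFun n / 256) := by
        gcongr
        · exact h1.trans (by gcongr)
        · exact h3.trans h2
    _ = Real.exp (5 + 5 * (hFun n + 1) / 64 + hFun n / 256) := by rw [Real.exp_add, Real.exp_add]
    _ ≤ _ := Real.exp_le_exp.2 (by linarith)

/-- The error of the extrapolation. -/
lemma extrapolation_error (hM : 4096 ≤ M) (hn : Large M n)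
    (hl : (l : ℝ) ≤ 2 * (n : ℝ) ^ (1 / 5 : ℝ) + 1) (hf : ∀ w, ‖f w‖ ≤ 1)
    (hz : Admissible q c z) :
    ‖gPoly f x (Fin.cons (zZero n θ) fun _ => (z : ℂ)) -
      ∑ i ∈ Finset.range (nodeCount z (numSamples n)),
        (extraCoeff (nodeScale z) z (nodeCount z (numSamples n)) i : ℂ) *
      gPoly f x (Fin.cons (zZero n θ) fun _ =>
        (extraNode (nodeScale z) (nodeCount z (numSamples n)) i : ℂ))‖ ≤
      2 * Real.exp (-(hFun n / 128)) := by
  have hτ0 := hn.gapZero_pos (by linarith)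
  have hτM := hn.gapZero_le (by linarith)
  have hτ1 : gapZero n ≤ 1 / 2 :=
    hτM.trans (one_div_le_one_div_of_le (by norm_num) (by linarith))
  have hnorm := norm_zZero (by linarith : gapZero n ≤ 1) θ
  have hn0 := hn.le_self (by linarith)
  rw [nodeCount, nodeScale]
  rcases hz with ⟨h1, -⟩ | ⟨h1, -⟩
  · rw [if_pos h1, if_pos h1, Finset.sum_range_one]
    have h2 : extraCoeff z z 1 0 = 1 := by simp [extraCoeff]
    have h3 : extraNode z 1 0 = z := by simp [extraNode]
    rw [h2, h3, Complex.ofReal_one, one_mul, sub_self, norm_zero]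
    positivity
  · have hz' : ¬ 1 / 2 < z := by have := le_abs_self z; linarith
    rw [if_neg hz', if_neg hz']
    have h2 := norm_gPoly_sub_extra_le (l := l) hf (z0 := zZero n θ)
      (by rw [← norm_pos_iff, hnorm]; linarith) (by rw [hnorm]; linarith) (β := 1 / 100) (z := z)
      (D := extraCount (numSamples n)) (by norm_num) (by norm_num) h1 x
    refine h2.trans ?_
    rw [hnorm, sub_sub_cancel]
    have h3 := inv_two_pow_extraCount_le n
    have h4 : (1 + 22 ^ extraCount (numSamples n)) * (2 * (1 / 100 : ℝ)) ^
        extraCount (numSamples n) ≤ 2 * Real.exp (-(hFun n / 64)) := by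
      set D := extraCount (numSamples n)
      have h5 : (1 : ℝ) ≤ 22 ^ D := one_le_pow₀ (by norm_num)
      calc (1 + 22 ^ D) * (2 * (1 / 100 : ℝ)) ^ D ≤ (2 * 22 ^ D) * (2 * (1 / 100 : ℝ)) ^ D := by
            gcongr; linarith
        _ = 2 * (22 * (2 * (1 / 100))) ^ D := by rw [mul_assoc, ← mul_pow]
        _ ≤ 2 * (1 / 2) ^ D := by gcongr; norm_num
        _ ≤ _ := by gcongr
    have h6 : (gapZero n)⁻¹ ≤ n := by
      have h7 := (hn.inv_le_gapZero (by linarith)).trans (div_le_self hτ0.le (by linarith))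
      exact inv_le_of_inv_le₀ (by linarith) h7
    have h7 : (1 - gapZero n)⁻¹ ≤ 2 := inv_le_of_inv_le₀ (by norm_num) (by norm_num; linarith)
    have h8 := hn.poly_le hM hl
    have h9 : (1 : ℝ) ≤ (n : ℝ) ^ (l + 1) := one_le_pow₀ (by linarith)
    calc _ ≤ 2 * Real.exp (-(hFun n / 64)) * (2 ^ l * (n * 2)) := by
          have h10 : 0 ≤ (1 - gapZero n)⁻¹ := inv_nonneg.2 (by linarith)
          have h11 : 0 ≤ (gapZero n)⁻¹ := inv_nonneg.2 hτ0.le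
          gcongr
      _ ≤ 2 * Real.exp (-(hFun n / 64)) * Real.exp (hFun n / 256) := by
          gcongr
          refine le_trans ?_ h8
          calc 2 ^ l * ((n : ℝ) * 2) = 2 * n * 1 * 2 ^ l := by ring
            _ ≤ _ := by gcongr
      _ = 2 * Real.exp (-(hFun n / 64) + hFun n / 256) := by rw [mul_assoc, ← Real.exp_add]
      _ ≤ _ := by
          gcongr
          have := hn.le_hFun (by linarith)
          linarith

/-- With B = exp(h/8) and t = exp(-h/8), truncating the traces and the false samples each bias the
mean by at most B exp(-h), fluctuation costs 2t and extrapolation 2 exp(-h/128). All this is at most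
6 exp(-h/128) ≤ exp(-h/256). -/
theorem measure_estimate_le (hc0 : 0 < c) (hc : c ≤ 1 / 2) (hM : Enough q q' c C A M)
    (hn : Large M n) (hl : (l : ℝ) ≤ 2 * (n : ℝ) ^ (1 / 5 : ℝ) + 1) (hf : ∀ w, ‖f w‖ ≤ 1)
    (hθ : |θ| ≤ (n : ℝ) ^ (-(2 / 5) : ℝ)) (hz : Admissible q c z)
    (hη : (η : ℝ) ≤ C * hFun n) (han : a + η < n) (hS : S.support ⊆ Set.Icc a (a + η))
    (hk : 2 * (2 ^ (l + 1) - 1) + 1 < 2 ^ (numSamples n - 1))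
    (ν : Fin (numSamples n) → Measure (ℕ → Bool)) (hν : ∀ i, IsProbabilityMeasure (ν i)) :
    Measure.pi (fun i => sampleLaw q q' S x (Real.exp (-hFun n)) (ν i))
      {Y | ¬ ‖estimate f z (zZero n θ) n (numSamples n) q q' x S Y -
        gPoly f x (Fin.cons (zZero n θ) fun _ => (z : ℂ))‖ ≤ Real.exp (-(1 / 256) * hFun n)} ≤
      ENNReal.ofReal (Real.exp (-A * n)) := by
  have := hν
  have hMa := hM.abs
  have hn0 := hn.le_self (by linarith)
  have hnp : (0 : ℝ) < n := by linarith
  have hh := hn.le_hFun (by linarith)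
  have hτ0 := hn.gapZero_pos (by linarith)
  have hτM := hn.gapZero_le (by linarith)
  have hτ1 : gapZero n ≤ 1 / 2 :=
    hτM.trans (one_div_le_one_div_of_le (by norm_num) (by linarith))
  have hnorm := norm_zZero (by linarith : gapZero n ≤ 1) θ
  set z0 := zZero n θ with hz0def
  have hz0 : 1 / 2 ≤ ‖z0‖ := by rw [hnorm]; linarith
  have hz0ne : z0 ≠ 0 := by rw [← norm_pos_iff]; linarith
  set D := nodeCount z (numSamples n) with hD
  set β := nodeScale z with hβ
  set ρ := 1 - rateConst q q' * gapZero n with hρ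
  have hrc := rateConst_pos q.2.2 q'.2.2
  have hρm : ρ ^ (numSamples n) ≤ Real.exp (-hFun n) := by
    refine hn.rate_pow_le hMa hrc ?_ hM.rate
    have : rateConst q q' ≤ 1 / 2 := min_le_left _ _
    nlinarith
  have hSn : ∀ i, S i ≠ 0 → i < n := fun i hi => by
    have := hS ((S.mem_support_iff i).2 hi)
    have := this.2
    omega
  have hsb : ∀ i < D, ShiftBound (fun i => (S i).toReal) n a η (extraNode β D i) z0 (n : ℝ)⁻¹ :=
    fun i hi => by
      obtain ⟨h1, h2, h3, h4⟩ := hz.node hc (by linarith) hi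
      exact shiftBound_of_large hc0 (by linarith) hM.inv hM.shift hn hθ h1 h2 h3 hη han hS
  have hct : ∀ i < D, Contracts (treeDiagB (extraNode β D i) z0 (2 ^ (l + 1) - 1)) (n : ℝ)⁻¹ q q'
      ρ := fun i hi => by
      obtain ⟨h1, h2, h3, h4⟩ := hz.node hc (by linarith) hi
      exact contracts_of_large hc0 hM.contract hn hθ h1 h2 h4 _
  -- the extrapolated value and the contribution of one trace
  set G := ∑ i ∈ Finset.range D, (extraCoeff β z D i : ℂ) *
      gPoly f x (Fin.cons z0 fun _ => (extraNode β D i : ℂ)) with hG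
  set φ := traceEstimate f z z0 n (numSamples n) q q' x S with hφ
  set B := Real.exp (hFun n / 8) with hB
  have hr : (0 : ℝ) < (n : ℝ)⁻¹ := by positivity
  have hGsum : G = (∑ i ∈ Finset.range D, (extraCoeff β z D i : ℂ) *
      ((((n : ℝ)⁻¹ : ℝ) : ℂ) ^ (l + 1) *
        (z0 * gPoly f x (Fin.cons z0 fun _ => (extraNode β D i : ℂ))))) *
      (n : ℂ) ^ (l + 1) / z0 := by
    rw [hG, eq_div_iff hz0ne, Finset.sum_mul, Finset.sum_mul]
    refine Finset.sum_congr rfl fun i _ => ?_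
    have hnC : (n : ℂ) ≠ 0 := by exact_mod_cast hnp.ne'
    push_cast
    rw [inv_pow]
    field_simp
  -- Used twice: with E = 1 for the deviation of a single string, with E = exp(-h) for the bias.
  have hlin : ∀ (u v : ℕ → ℂ) (E : ℝ), (∀ i < D, ‖u i - v i‖ ≤ 2 ^ l * (2 * (4 * 2)) * E) →
      0 ≤ E → ‖(∑ i ∈ Finset.range D, (extraCoeff β z D i : ℂ) * u i) * (n : ℂ) ^ (l + 1) / z0 -
        (∑ i ∈ Finset.range D, (extraCoeff β z D i : ℂ) * v i) * (n : ℂ) ^ (l + 1) / z0‖ ≤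
        B * E := by
    intro u v E huv hE
    have h1 : ‖∑ i ∈ Finset.range D, (extraCoeff β z D i : ℂ) * (u i - v i)‖ ≤
        22 ^ D * (2 ^ l * (2 * (4 * 2)) * E) := by
      refine le_trans ?_ (mul_le_mul_of_nonneg_right
        (sum_abs_extraCoeff_le (D := D) hz.scale_pos.1 hz.scale_pos.2) (by positivity))
      rw [Finset.sum_mul]
      refine norm_sum_le_of_le _ fun i hi => ?_
      rw [norm_mul, Complex.norm_real, Real.norm_eq_abs]
      have := huv i (Finset.mem_range.1 hi)
      gcongr
    rw [← sub_div, ← sub_mul, ← Finset.sum_sub_distrib]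
    simp only [← mul_sub]
    rw [mul_div_assoc, norm_mul, norm_div, norm_pow, Complex.norm_natCast]
    have h2 := scale_bound (z := z) hMa hn hl
    calc _ ≤ 22 ^ D * (2 ^ l * (2 * (4 * 2)) * E) * ((n : ℝ) ^ (l + 1) / (1 / 2)) := by gcongr
      _ = 22 ^ D * (2 ^ l * (2 * (4 * 2)) * ((n : ℝ) ^ (l + 1) / (1 / 2))) * E := by ring
      _ ≤ B * E := by gcongr
  have hφB : ∀ y, ‖φ y - G‖ ≤ B := by
    intro y
    rw [hGsum, hφ, traceEstimate]
    refine (hlin _ _ 1 (fun i hi => ?_) zero_le_one).trans (mul_one B).le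
    rw [mul_one]
    exact norm_nodeStat_sub_le hf (hsb i hi) hk hr (hct i hi) (numSamples n) y
  have hφm : Measurable φ := by
    refine ((Finset.measurable_fun_sum _ fun i hi => ?_).mul_const _).div_const _
    exact (measurable_nodeStat hf (hsb i (Finset.mem_range.1 hi)) hk _ _ (numSamples n)).const_mul _
  have hφint : ‖∫ y, φ y ∂shiftedTraceLaw q q' S x - G‖ ≤ B * Real.exp (-hFun n) := by
    have h1 : ∀ i ∈ Finset.range D, Integrable (fun y => (extraCoeff β z D i : ℂ) *
        nodeStat f (extraNode β D i) z0 (n : ℝ)⁻¹ x S n ((numSamples n) - 1) q q' (numSamples n) y)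
        (shiftedTraceLaw q q' S x) := by
      intro i hi
      have hi' := Finset.mem_range.1 hi
      refine (Integrable.of_bound
        (measurable_nodeStat hf (hsb i hi') hk _ _ (numSamples n)).aestronglyMeasurable
        (2 ^ l * (2 * (4 * 2)) + ‖(((n : ℝ)⁻¹ : ℝ) : ℂ) ^ (l + 1) *
          (z0 * gPoly f x (Fin.cons z0 fun _ => (extraNode β D i : ℂ)))‖)
        (Filter.Eventually.of_forall fun y => ?_)).const_mul _
      have h2 := norm_nodeStat_sub_le (x := x) hf (hsb i hi') hk hr (hct i hi') (numSamples n) y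
      have h3 := norm_le_norm_add_norm_sub' (nodeStat f (extraNode β D i) z0 (n : ℝ)⁻¹ x S n
        ((numSamples n) - 1) q q' (numSamples n) y) ((((n : ℝ)⁻¹ : ℝ) : ℂ) ^ (l + 1) *
          (z0 * gPoly f x (Fin.cons z0 fun _ => (extraNode β D i : ℂ))))
      linarith
    have h2 : ∫ y, φ y ∂shiftedTraceLaw q q' S x =
        (∑ i ∈ Finset.range D, (extraCoeff β z D i : ℂ) *
          ∫ y, nodeStat f (extraNode β D i) z0 (n : ℝ)⁻¹ x S n ((numSamples n) - 1) q q' (numSamples n) y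
            ∂shiftedTraceLaw q q' S x) * (n : ℂ) ^ (l + 1) / z0 := by
      rw [hφ]
      unfold traceEstimate
      rw [integral_div, integral_mul_const, integral_finsetSum _ h1]
      simp only [integral_const_mul]
    rw [h2, hGsum]
    refine hlin _ _ _ (fun i hi => ?_) (Real.exp_pos _).le
    refine (norm_integral_nodeStat_sub_le hf (hsb i hi) hk hr (hct i hi) (numSamples n) hSn).trans ?_
    calc 2 ^ l * (2 * (4 * (2 * ρ ^ (numSamples n)))) = 2 ^ l * (2 * (4 * 2)) * ρ ^ (numSamples n) := by ring
      _ ≤ _ := by gcongr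
  have hε0 : 0 ≤ Real.exp (-hFun n) := (Real.exp_pos _).le
  have hε1 : Real.exp (-hFun n) ≤ 1 := Real.exp_le_one_iff.2 (by linarith)
  have hprob : ∀ i, IsProbabilityMeasure (sampleLaw q q' S x (Real.exp (-hFun n)) (ν i)) :=
    fun i => isProbabilityMeasure_sampleLaw q q' S x hε0 hε1 (ν i)
  have hm0 : 0 < (numSamples n) := by
    have h1 := exp_hFun_le_numSamples n
    have h2 := Real.exp_pos (hFun n)
    exact_mod_cast h2.trans_le h1
  have hmain := measure_average_sub_gt_le
    (μ := fun i => sampleLaw q q' S x (Real.exp (-hFun n)) (ν i)) hφm (Real.exp_pos _) hφB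
    (fun i => norm_integral_sampleLaw_sub_le q q' S x hε0 hε1 (ν i) hφm hφB hφint)
    (Real.exp_pos (-(hFun n / 8))).le hm0
  have hext := extrapolation_error (θ := θ) (x := x) hMa hn hl hf hz
  rw [← hz0def, ← hD, ← hβ, ← hG] at hext
  refine (measure_mono fun Y hY => ?_).trans (hmain.trans (ENNReal.ofReal_le_ofReal ?_))
  · -- the errors add up
    intro hgood
    refine hY ?_
    rw [estimate_eq_average]
    have h1 : B * Real.exp (-hFun n) ≤ Real.exp (-(hFun n / 128)) := by
      rw [hB, ← Real.exp_add]; exact Real.exp_le_exp.2 (by linarith)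
    have h2 : Real.exp (-(hFun n / 8)) ≤ Real.exp (-(hFun n / 128)) :=
      Real.exp_le_exp.2 (by linarith)
    have h3 : 6 * Real.exp (-(hFun n / 128)) ≤ Real.exp (-(1 / 256) * hFun n) := by
      have h4 : Real.exp (-(1 / 256) * hFun n) =
          Real.exp (hFun n / 256) * Real.exp (-(hFun n / 128)) := by
        rw [← Real.exp_add]; ring_nf
      rw [h4]
      have h5 := Real.add_one_le_exp (hFun n / 256)
      gcongr
      linarith
    have h6 := norm_sub_le_norm_sub_add_norm_sub ((∑ j, φ (Y j)) / ((numSamples n) : ℂ)) G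
      (gPoly f x (Fin.cons z0 fun _ => (z : ℂ)))
    rw [norm_sub_rev] at hext
    refine h6.trans ((add_le_add hgood hext).trans ?_)
    rw [mul_comm (Real.exp (-hFun n)) B]
    linarith
  -- The exponent of Hoeffding's inequality is at least exp(h - h/4 - h/4)/2 = exp(h/2)/2.
  · have h1 : (n : ℝ) ^ 3 / 2 ≤ (numSamples n) * Real.exp (-(hFun n / 8)) ^ 2 / (2 * B ^ 2) := by
      have h2 : Real.exp (hFun n) * Real.exp (-(hFun n / 8)) ^ 2 / (2 * B ^ 2) =
          Real.exp (hFun n / 2) / 2 := by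
        rw [hB, ← Real.exp_nat_mul, ← Real.exp_nat_mul, ← Real.exp_add,
          div_eq_div_iff (by positivity) (by norm_num)]
        rw [mul_comm (2 : ℝ) (Real.exp _), ← mul_assoc, ← Real.exp_add]
        congr 2
        push_cast
        ring
      have h3 := hn.pow_le_exp hMa
      have h4 := exp_hFun_le_numSamples n
      calc (n : ℝ) ^ 3 / 2 ≤ Real.exp (hFun n / 2) / 2 := by gcongr
        _ = Real.exp (hFun n) * Real.exp (-(hFun n / 8)) ^ 2 / (2 * B ^ 2) := h2.symm
        _ ≤ _ := by gcongr
    have h2 : A * n + 2 ≤ (n : ℝ) ^ 3 / 2 := by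
      have h3 := hM.fail
      have h4 := le_abs_self A
      have h5 : |A| + 4 ≤ (n : ℝ) := by linarith
      have h6 : (2 : ℝ) ≤ n := by linarith [abs_nonneg A]
      have h7 : (n : ℝ) ^ 3 / 2 = (n * n) * n / 2 := by ring
      have h8 : A * n ≤ (n - 4) * n := by gcongr; linarith
      have h9 : 2 * (n * n : ℝ) ≤ n * n * n := by nlinarith
      nlinarith
    have h3 : (4 : ℝ) ≤ Real.exp 2 := by
      have h5 : (2 : ℝ) ≤ Real.exp 1 := by have := Real.exp_one_gt_d9; linarith
      calc (4 : ℝ) = 2 ^ 2 := by norm_num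
        _ ≤ Real.exp 1 ^ 2 := by gcongr
        _ = Real.exp 2 := by rw [← Real.exp_nat_mul]; norm_num
    calc _ ≤ Real.exp 2 * Real.exp (-(A * n + 2)) := by
          gcongr
          linarith
      _ = Real.exp (-A * n) := by rw [← Real.exp_add]; ring_nf

end Main

end TraceRec
end

noncomputable section
namespace TraceRec

/-! ### The steps of the program -/

/-- The states `σ` and `τ` agree outside the integer variables in `A` and the arrays in `X`. -/
structure Agree (A X : Finset (Fin 32)) (σ τ : St) : Prop where
  v : ∀ a ∉ A, τ.v a = σ.v a
  x : ∀ k ∉ X, τ.x k = σ.x k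

lemma Agree.trans {A X : Finset (Fin 32)} {σ τ υ : St} (h : Agree A X σ τ) (h' : Agree A X τ υ) :
    Agree A X σ υ :=
  ⟨fun a ha => (h'.v a ha).trans (h.v a ha), fun k hk => (h'.x k hk).trans (h.x k hk)⟩

lemma Agree.mono {A X A' X' : Finset (Fin 32)} {σ τ : St} (h : Agree A X σ τ) (hA : A ⊆ A')
    (hX : X ⊆ X') : Agree A' X' σ τ :=
  ⟨fun a ha => h.v a fun h' => ha (hA h'), fun k hk => h.x k fun h' => hk (hX h')⟩

namespace Stmt

variable (I : Input)

lemma agree_run (P : Stmt) (σ : St) : Agree P.writes P.writesX σ (P.run I σ) :=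
  ⟨fun _ ha => run_v_of_notMem I ha σ, fun _ hk => run_x_of_notMem I hk σ⟩

/-- A loop that computes the entries of one array from the entries with the same index. -/
def fill (i b k : Fin 32) (e : CExp) : Stmt := loop i b (setArr k i e)

lemma run_fill {i b k : Fin 32} {e : CExp} (σ : St) (F : ℕ → ℂ)
    (hF : ∀ j < σ.v b, ∀ τ, Agree {i} {k} σ τ → τ.v i = j → τ.x k j = σ.x k j →
      e.eval I τ = F j) (j : ℕ) :
    ((fill i b k e).run I σ).x k j = if j < σ.v b then F j else σ.x k j := by
  have h := run_loop_induct I (i := i) (b := b) (P := setArr k i e) (by simp [writes]) σ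
    (fun j τ => Agree {i} {k} σ τ ∧ ∀ j', τ.x k j' = if j' < j then F j' else σ.x k j')
    ⟨⟨fun a ha => by simp_all, fun _ _ => rfl⟩, fun j' => by simp⟩ ?_
  · exact h.2 j
  · rintro j hj τ hτ ⟨h1, h2⟩
    have h3 := hF j hj τ h1 hτ (by rw [h2, if_neg (lt_irrefl j)])
    refine ⟨⟨fun a ha => ?_, fun k' hk' => ?_⟩, fun j' => ?_⟩
    · have := h1.v a ha
      simp_all [run]
    · have := h1.x k' hk'
      funext j'
      simp_all [run]
    · simp only [run, St.setV_x, St.setX_x, true_and, hτ, h3, h2]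
      by_cases h4 : j' = j
      · subst h4; simp
      · rw [if_neg h4]
        congr 1
        simp only [eq_iff_iff]
        omega

/-- A loop over the inner nodes of the tree (their number is in the variable `4`) that computes
the entries of one array at their children. -/
def children (k : Fin 32) (e e' : CExp) : Stmt :=
  loop 11 4 (addN 14 11 11 ;; addN 14 14 6 ;; addN 15 14 6 ;; setArr k 14 e ;; setArr k 15 e')

/-- The array is overwritten in heap order, so when the children of j are computed, the entries from
1 to 2j are already final. The hypotheses on `e` and `e'` describe exactly this intermediate state;
entry 0 is never touched. -/
lemma run_children {k : Fin 32} {e e' : CExp} (σ : St) (h6 : σ.v 6 = 1) (F : ℕ → ℂ)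
    (hF : ∀ j < σ.v 4, ∀ τ, Agree {11, 14, 15} {k} σ τ → τ.v 11 = j → τ.v 14 = 2 * j + 1 →
      (∀ i, τ.x k i = if 0 < i ∧ i < 2 * j + 1 then F i else σ.x k i) → e.eval I τ = F (2 * j + 1))
    (hF' : ∀ j < σ.v 4, ∀ τ, Agree {11, 14, 15} {k} σ τ → τ.v 11 = j → τ.v 15 = 2 * j + 2 →
      (∀ i, τ.x k i = if 0 < i ∧ i < 2 * j + 2 then F i else σ.x k i) → e'.eval I τ = F (2 * j + 2))
    (i : ℕ) : ((children k e e').run I σ).x k i =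
      if 0 < i ∧ i < 2 * σ.v 4 + 1 then F i else σ.x k i := by
  have h := run_loop_induct I (i := 11) (b := 4) (P := addN 14 11 11 ;; addN 14 14 6 ;;
    addN 15 14 6 ;; setArr k 14 e ;; setArr k 15 e') (by simp [writes]) σ
    (fun j τ => Agree {11, 14, 15} {k} σ τ ∧
      ∀ i, τ.x k i = if 0 < i ∧ i < 2 * j + 1 then F i else σ.x k i)
    ⟨⟨fun a ha => by simp_all, fun _ _ => rfl⟩, fun j' => by
      rw [if_neg (by omega)]; rfl⟩ ?_
  · exact h.2 i
  · rintro j hj τ hτ ⟨h1, h2⟩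
    have h61 : τ.v 6 = 1 := (h1.v 6 (by decide)).trans h6
    set τ1 := (addN 14 11 11 ;; addN 14 14 6 ;; addN 15 14 6).run I τ with hτ1
    have hx1 : τ1.x = τ.x := rfl
    have hv1 : ∀ a, τ1.v a = if a = 15 then 2 * j + 2 else if a = 14 then 2 * j + 1 else τ.v a := by
      intro a
      simp only [hτ1, run, St.setV_v, hτ, h61]
      split_ifs <;> first | rfl | (simp_all; try omega)
    have hA1 : Agree {11, 14, 15} {k} σ τ1 := by
      refine ⟨fun a ha => ?_, fun k' hk' => by rw [hx1]; exact h1.x k' hk'⟩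
      have := h1.v a ha
      simp only [Finset.mem_insert, Finset.mem_singleton, not_or] at ha
      rw [hv1, if_neg ha.2.2, if_neg ha.2.1, this]
    have e1 : e.eval I τ1 = F (2 * j + 1) := hF j hj τ1 hA1 (by rw [hv1]; simpa using hτ)
      (by rw [hv1]; simp) (by rw [hx1]; exact h2)
    set τ2 := τ1.setX k (2 * j + 1) (F (2 * j + 1)) with hτ2
    have hA2 : Agree {11, 14, 15} {k} σ τ2 := by
      refine ⟨hA1.v, fun k' hk' => ?_⟩
      funext i
      have := Finset.notMem_singleton.1 hk'
      rw [hτ2, St.setX_x, if_neg (fun h => this h.1), hA1.x k' hk']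
    have hx2 : ∀ i, τ2.x k i = if 0 < i ∧ i < 2 * j + 2 then F i else σ.x k i := by
      intro i
      rw [hτ2, St.setX_x, hx1, h2]
      by_cases h : i = 2 * j + 1
      · subst h; simp
      · simp only [true_and, h, if_false]
        congr 1
        simp only [eq_iff_iff]
        omega
    have e2 : e'.eval I τ2 = F (2 * j + 2) := hF' j hj τ2 hA2
      (by rw [hτ2, St.setX_v, hv1]; simpa using hτ) (by rw [hτ2, St.setX_v, hv1]; simp) hx2
    have hrun : (addN 14 11 11 ;; addN 14 14 6 ;; addN 15 14 6 ;; setArr k 14 e ;;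
        setArr k 15 e').run I τ = τ2.setX k (2 * j + 2) (F (2 * j + 2)) := by
      change ((τ1.setX k (τ1.v 14) (e.eval I τ1)).setX k
        ((τ1.setX k (τ1.v 14) (e.eval I τ1)).v 15) (e'.eval I (τ1.setX k (τ1.v 14) (e.eval I τ1)))) = _
      have hv14 : τ1.v 14 = 2 * j + 1 := by rw [hv1]; simp
      have hv15 : τ1.v 15 = 2 * j + 2 := by rw [hv1]; simp
      rw [hv14, e1, ← hτ2, e2]
      rw [hτ2, St.setX_v, hv15]
    rw [hrun]
    refine ⟨⟨fun a ha => ?_, fun k' hk' => ?_⟩, fun i => ?_⟩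
    · have := hA2.v a ha
      simp only [Finset.mem_insert, Finset.mem_singleton, not_or] at ha
      rw [St.setV_v, if_neg ha.1, St.setX_v, this]
    · funext i
      have := Finset.notMem_singleton.1 hk'
      rw [St.setV_x, St.setX_x, if_neg (fun h => this h.1), hA2.x k' hk']
    · rw [St.setV_x, St.setX_x, hx2]
      by_cases h : i = 2 * j + 2
      · subst h; simp; omega
      · simp only [true_and, h, if_false]
        congr 1
        simp only [eq_iff_iff]
        omega

end Stmt

/-- What the fixed variables contain: `n`, `l`, `m`, `2^l`, the number of inner nodes, the number
of nodes, `1`, the number `D` of interpolation nodes, `0`; the points `z0`, `z`, the probabilities,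
the scale `1/n` and the largest interpolation node. -/
structure Env (n l m D : ℕ) (q q' β z : ℝ) (z0 : ℂ) (σ : St) : Prop where
  hn : σ.v 0 = n
  hl : σ.v 1 = l
  hm : σ.v 2 = m
  hH : σ.v 3 = 2 ^ l
  hN : σ.v 4 = 2 ^ (l + 1) - 1
  hE : σ.v 5 = 2 * (2 ^ (l + 1) - 1) + 1
  one : σ.v 6 = 1
  hD : σ.v 7 = D
  zero : σ.v 8 = 0
  hz0 : σ.x 1 0 = z0
  hz : σ.x 2 0 = z
  hq : σ.x 3 0 = q
  hq' : σ.x 4 0 = q'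
  hr : σ.x 5 0 = ((n : ℝ)⁻¹ : ℝ)
  hβ : σ.x 6 0 = β

/-- Variables below 9 and arrays below 7 are reserved for fixed data; that a statement respects this
is decided from its syntax. -/
lemma Env.of_agree {n l m D : ℕ} {q q' β z : ℝ} {z0 : ℂ} {σ τ : St}
    (h : Env n l m D q q' β z z0 σ) {A X : Finset (Fin 32)} (hσ : Agree A X σ τ)
    (hA : ∀ a ∈ A, 9 ≤ a := by decide) (hX : ∀ k ∈ X, 7 ≤ k := by decide) :
    Env n l m D q q' β z z0 τ := by
  have hv : ∀ a : Fin 32, a < 9 → τ.v a = σ.v a := fun a ha =>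
    hσ.v a fun h' => absurd (hA a h') (not_le.2 ha)
  have hx : ∀ k : Fin 32, k < 7 → τ.x k = σ.x k := fun k hk =>
    hσ.x k fun h' => absurd (hX k h') (not_le.2 hk)
  constructor
  · rw [hv 0 (by decide), h.hn]
  · rw [hv 1 (by decide), h.hl]
  · rw [hv 2 (by decide), h.hm]
  · rw [hv 3 (by decide), h.hH]
  · rw [hv 4 (by decide), h.hN]
  · rw [hv 5 (by decide), h.hE]
  · rw [hv 6 (by decide), h.one]
  · rw [hv 7 (by decide), h.hD]
  · rw [hv 8 (by decide), h.zero]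
  · rw [hx 1 (by decide), h.hz0]
  · rw [hx 2 (by decide), h.hz]
  · rw [hx 3 (by decide), h.hq]
  · rw [hx 4 (by decide), h.hq']
  · rw [hx 5 (by decide), h.hr]
  · rw [hx 6 (by decide), h.hβ]

namespace Stmt

open CExp

variable (I : Input) {n l m D : ℕ} {q q' β z : ℝ} {z0 : ℂ} {σ : St}

/-- The couplings to the parents for the bit in the variable `13`: the scalar `10` for the left
children, `11` for the right children. -/
def setCouplings : Stmt :=
  set 10 ((sc 5).mul ((int 1).sub (nat 13))) ;; set 11 ((sc 5).mul (nat 13))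

lemma run_setCouplings (h : Env n l m D q q' β z z0 σ) {b : Bool} (hb : σ.v 13 = b.toNat) :
    (setCouplings.run I σ).x 10 0 = (if b then 0 else (((n : ℝ)⁻¹ : ℝ) : ℂ)) ∧
    (setCouplings.run I σ).x 11 0 = if b then (((n : ℝ)⁻¹ : ℝ) : ℂ) else 0 := by
  cases b <;> simp [setCouplings, run, eval, hb, h.hr]

/-- `transfer` of the array `21` for the bit in the variable `13`; the diagonal is in `16`. -/
def transferStep : Stmt :=
  setCouplings ;; fill 12 5 18 (arr 21 12) ;;
  children 21 (((arr 16 14).mul (arr 21 14)).add ((sc 10).mul (arr 18 11)))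
    (((arr 16 15).mul (arr 21 15)).add ((sc 11).mul (arr 18 11)))

lemma transfer_left (d : ℕ → ℂ) (r : ℝ) (b : Bool) (g : ℕ → ℂ) (j : ℕ) :
    transfer d r b g (2 * j + 1) = d (2 * j + 1) * g (2 * j + 1) + (if b then 0 else (r : ℂ)) * g j := by
  have h1 : (2 * j + 1 - 1) / 2 = j := by omega
  have h2 : ¬ (2 * j + 1) % 2 = 0 := by omega
  cases b <;> simp [transfer, coupling]

lemma transfer_right (d : ℕ → ℂ) (r : ℝ) (b : Bool) (g : ℕ → ℂ) (j : ℕ) :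
    transfer d r b g (2 * j + 2) = d (2 * j + 2) * g (2 * j + 2) + (if b then (r : ℂ) else 0) * g j := by
  have h1 : (2 * j + 1) / 2 = j := by omega
  have h2 : (2 * j + 2) % 2 = 0 := by omega
  cases b <;> simp [transfer, coupling, h1, h2]

lemma agree_transferStep (σ : St) :
    Agree {11, 12, 14, 15} {10, 11, 18, 21} σ (transferStep.run I σ) :=
  (agree_run I _ σ).mono (by decide) (by decide)

/-- The update needs the old values at the parents, which an update in place has already destroyed;
they are read from the copy in the array 18. -/
lemma run_transferStep (h : Env n l m D q q' β z z0 σ) {b : Bool} (hb : σ.v 13 = b.toNat)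
    {d : ℕ → ℂ} (hd0 : d 0 = 1) (hd : ∀ e < 2 * (2 ^ (l + 1) - 1) + 1, σ.x 16 e = d e)
    (e : ℕ) (he : e < 2 * (2 ^ (l + 1) - 1) + 1) :
    (transferStep.run I σ).x 21 e = transfer d (n : ℝ)⁻¹ b (σ.x 21) e := by
  obtain ⟨c1, c2⟩ := run_setCouplings I h hb
  set σ1 := setCouplings.run I σ with hσ1
  have hA1 : Agree {} {10, 11} σ σ1 := (agree_run I setCouplings σ).mono (by decide) (by decide)
  set σ2 := (fill 12 5 18 (arr 21 12)).run I σ1 with hσ2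
  have hA2 : Agree {12} {18} σ1 σ2 := (agree_run I _ σ1).mono (by decide) (by decide)
  have h1 := h.of_agree hA1
  have h2 := h1.of_agree hA2
  have hw : ∀ e < 2 * (2 ^ (l + 1) - 1) + 1, σ2.x 18 e = σ.x 21 e := by
    intro e he
    rw [hσ2, run_fill I σ1 (fun e => σ.x 21 e), if_pos (by rw [h1.hE]; exact he)]
    intro j _ τ hτ hj _
    rw [eval, hj, hτ.x 21 (by decide), hA1.x 21 (by decide)]
  have hu : σ2.x 21 = σ.x 21 := by rw [hA2.x 21 (by decide), hA1.x 21 (by decide)]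
  have hd2 : ∀ e < 2 * (2 ^ (l + 1) - 1) + 1, σ2.x 16 e = d e := fun e he => by
    rw [hA2.x 16 (by decide), hA1.x 16 (by decide), hd e he]
  change ((children 21 _ _).run I σ2).x 21 e = _
  rw [run_children I σ2 h2.one (transfer d (n : ℝ)⁻¹ b (σ.x 21)), h2.hN]
  · rcases Nat.eq_zero_or_pos e with rfl | he0
    · rw [if_neg (by omega), hu, transfer_root hd0]
    · rw [if_pos ⟨he0, he⟩]
  · intro j hj τ hτ hj1 hj2 hτx
    rw [h2.hN] at hj
    simp only [eval, hj1, hj2]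
    rw [hτ.x 16 (by decide), hd2 _ (by omega), hτx, if_neg (by omega), hu, hτ.x 10 (by decide),
      hA2.x 10 (by decide), c1, hτ.x 18 (by decide), hw _ (by omega), transfer_left]
  · intro j hj τ hτ hj1 hj2 hτx
    rw [h2.hN] at hj
    simp only [eval, hj1, hj2]
    rw [hτ.x 16 (by decide), hd2 _ (by omega), hτx, if_neg (by omega), hu, hτ.x 11 (by decide),
      hA2.x 11 (by decide), c2, hτ.x 18 (by decide), hw _ (by omega), transfer_right]

/-- The operator `traceL` of the array `17` for the bit in the variable `13`. -/
def traceStep : Stmt :=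
  setCouplings ;; fill 12 5 18 (arr 17 12) ;;
  children 18 (((((arr 16 14).mul (arr 17 14)).add ((sc 10).mul (arr 17 11))).sub
      ((((sc 4).mul (sc 5)).div (int 2)).mul (arr 18 11))).div
        (((int 1).sub (sc 4)).add ((sc 4).mul (arr 16 14))))
    (((((arr 16 15).mul (arr 17 15)).add ((sc 11).mul (arr 17 11))).sub
      ((((sc 4).mul (sc 5)).div (int 2)).mul (arr 18 11))).div
        (((int 1).sub (sc 4)).add ((sc 4).mul (arr 16 15)))) ;;
  fill 12 5 17 (((arr 18 12).sub ((sc 3).mul (arr 17 12))).div ((int 1).sub (sc 3)))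

lemma agree_traceStep (σ : St) :
    Agree {11, 12, 14, 15} {10, 11, 17, 18} σ (traceStep.run I σ) :=
  (agree_run I _ σ).mono (by decide) (by decide)

-- The triangular system for k = Δ⁻¹ M_b g is solved by forward substitution from the root: the
-- value at a parent is already the new one when its children are computed.
open scoped BoundedContinuousFunction in
lemma run_traceStep (h : Env n l m D q q' β z z0 σ) {b : Bool} (hb : σ.v 13 = b.toNat)
    {d : ℕ →ᵇ ℂ} {ρ : ℝ} (hC : Contracts d (n : ℝ)⁻¹ q q' ρ)
    (hd : ∀ e < 2 * (2 ^ (l + 1) - 1) + 1, σ.x 16 e = d e) {g : ℕ →ᵇ ℂ}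
    (hg : ∀ e < 2 * (2 ^ (l + 1) - 1) + 1, σ.x 17 e = g e)
    (e : ℕ) (he : e < 2 * (2 ^ (l + 1) - 1) + 1) :
    (traceStep.run I σ).x 17 e = traceL d (n : ℝ)⁻¹ q q' b g e := by
  obtain ⟨k, hk1, hk2⟩ := hC.traceL_eq b g
  obtain ⟨c1, c2⟩ := run_setCouplings I h hb
  set σ1 := setCouplings.run I σ with hσ1
  have hA1 : Agree {} {10, 11} σ σ1 := (agree_run I setCouplings σ).mono (by decide) (by decide)
  set σ2 := (fill 12 5 18 (arr 17 12)).run I σ1 with hσ2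
  have hA2 : Agree {12} {18} σ1 σ2 := (agree_run I _ σ1).mono (by decide) (by decide)
  have h1 := h.of_agree hA1
  have h2 := h1.of_agree hA2
  have hw : ∀ e < 2 * (2 ^ (l + 1) - 1) + 1, σ2.x 18 e = g e := by
    intro e he
    rw [hσ2, run_fill I σ1 (fun e => σ.x 17 e), if_pos (by rw [h1.hE]; exact he), hg e he]
    intro j _ τ hτ hj _
    rw [eval, hj, hτ.x 17 (by decide), hA1.x 17 (by decide)]
  have hg2 : ∀ e < 2 * (2 ^ (l + 1) - 1) + 1, σ2.x 17 e = g e := fun e he => by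
    rw [hA2.x 17 (by decide), hA1.x 17 (by decide), hg e he]
  have hd2 : ∀ e < 2 * (2 ^ (l + 1) - 1) + 1, σ2.x 16 e = d e := fun e he => by
    rw [hA2.x 16 (by decide), hA1.x 16 (by decide), hd e he]
  -- The substitution leaves entry 0 alone, so the initial copy of g must already be right there.
  have hk0 : k 0 = g 0 := by
    have := hk1 0
    rw [hC.transfer_zero, hC.D0] at this
    simpa using this
  have hkl : ∀ j, (d (2 * j + 1) * g (2 * j + 1) + (if b then 0 else (((n : ℝ)⁻¹ : ℝ) : ℂ)) * g j -
      q' * ((n : ℝ)⁻¹ : ℝ) / 2 * k j) / (1 - q' + q' * d (2 * j + 1)) = k (2 * j + 1) := by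
    intro j
    have h3 := hk1 (2 * j + 1)
    rw [transfer_left, if_neg (by omega), show (2 * j + 1 - 1) / 2 = j by omega] at h3
    rw [div_eq_iff (hC.delta_ne _), ← h3]
    ring
  have hkr : ∀ j, (d (2 * j + 2) * g (2 * j + 2) + (if b then (((n : ℝ)⁻¹ : ℝ) : ℂ) else 0) * g j -
      q' * ((n : ℝ)⁻¹ : ℝ) / 2 * k j) / (1 - q' + q' * d (2 * j + 2)) = k (2 * j + 2) := by
    intro j
    have h3 := hk1 (2 * j + 2)
    rw [transfer_right, if_neg (by omega), show (2 * j + 2 - 1) / 2 = j by omega] at h3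
    rw [div_eq_iff (hC.delta_ne _), ← h3]
    ring
  set σ3 := (children 18 (((((arr 16 14).mul (arr 17 14)).add ((sc 10).mul (arr 17 11))).sub
      ((((sc 4).mul (sc 5)).div (int 2)).mul (arr 18 11))).div
        (((int 1).sub (sc 4)).add ((sc 4).mul (arr 16 14))))
    (((((arr 16 15).mul (arr 17 15)).add ((sc 11).mul (arr 17 11))).sub
      ((((sc 4).mul (sc 5)).div (int 2)).mul (arr 18 11))).div
        (((int 1).sub (sc 4)).add ((sc 4).mul (arr 16 15))))).run I σ2 with hσ3
  have hA3 : Agree {11, 14, 15} {18} σ2 σ3 := (agree_run I _ σ2).mono (by decide) (by decide)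
  have h3 := h2.of_agree hA3
  have hk3 : ∀ e < 2 * (2 ^ (l + 1) - 1) + 1, σ3.x 18 e = k e := by
    intro e he
    rw [hσ3, run_children I σ2 h2.one k, h2.hN]
    · rcases Nat.eq_zero_or_pos e with rfl | he0
      · rw [if_neg (by omega), hw 0 he, hk0]
      · rw [if_pos ⟨he0, he⟩]
    · intro j hj τ hτ hj1 hj2 hτx
      rw [h2.hN] at hj
      have hkj : τ.x 18 j = k j := by
        rw [hτx]
        rcases Nat.eq_zero_or_pos j with rfl | hj0
        · rw [if_neg (by omega), hw 0 (by omega), hk0]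
        · rw [if_pos (by omega)]
      have hE := h2.of_agree hτ
      simp only [eval, hj1, hj2, hkj, hE.hq', hE.hr]
      rw [hτ.x 16 (by decide), hd2 _ (by omega), hτ.x 17 (by decide), hg2 _ (by omega),
        hg2 _ (by omega), hτ.x 10 (by decide), hA2.x 10 (by decide), c1, ← hkl j]
      push_cast
      rfl
    · intro j hj τ hτ hj1 hj2 hτx
      rw [h2.hN] at hj
      have hkj : τ.x 18 j = k j := by
        rw [hτx]
        rcases Nat.eq_zero_or_pos j with rfl | hj0
        · rw [if_neg (by omega), hw 0 (by omega), hk0]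
        · rw [if_pos (by omega)]
      have hE := h2.of_agree hτ
      simp only [eval, hj1, hj2, hkj, hE.hq', hE.hr]
      rw [hτ.x 16 (by decide), hd2 _ (by omega), hτ.x 17 (by decide), hg2 _ (by omega),
        hg2 _ (by omega), hτ.x 11 (by decide), hA2.x 11 (by decide), c2, ← hkr j]
      push_cast
      rfl
  change ((fill 12 5 17 _).run I σ3).x 17 e = _
  rw [run_fill I σ3 (fun e => (σ3.x 18 e - q * σ3.x 17 e) / (1 - q)), if_pos (by rw [h3.hE]; exact he),
    hk3 e he, hA3.x 17 (by decide), hg2 e he, hk2]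
  intro j _ τ hτ hj hτj
  have hE := h3.of_agree hτ
  simp only [eval, hj, hE.hq, hτj]
  rw [hτ.x 18 (by decide)]
  push_cast
  rfl

end Stmt

end TraceRec
end

/-! ### The program: statistics of the samples and sweeps over the message. -/

noncomputable section
namespace TraceRec

lemma Agree.setV {A X : Finset (Fin 32)} {σ τ : St} (h : Agree A X σ τ) {i : Fin 32} (hi : i ∈ A)
    (k : ℕ) : Agree A X σ (τ.setV i k) := by
  refine ⟨fun a ha => ?_, h.x⟩
  rw [St.setV_v, if_neg (by rintro rfl; exact ha hi), h.v a ha]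

lemma Agree.refl (A X : Finset (Fin 32)) (σ : St) : Agree A X σ σ := ⟨fun _ _ => rfl, fun _ _ => rfl⟩

/-- The arrays `g` and `g'` agree at the nodes of the tree. -/
def TreeEq (l : ℕ) (g g' : ℕ → ℂ) : Prop := ∀ e < 2 * (2 ^ (l + 1) - 1) + 1, g e = g' e

/-- The program maintains only the finitely many entries of the tree, while the operators act on all
of ℕ. Equality on the tree suffices since the parent of a tree node lies in the tree. -/
lemma transfer_congr {l : ℕ} {g g' : ℕ → ℂ} (h : TreeEq l g g') (d : ℕ → ℂ) (r : ℝ) (b : Bool) :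
    TreeEq l (transfer d r b g) (transfer d r b g') := by
  intro e he
  rcases Nat.eq_zero_or_pos e with rfl | h0
  · simp [transfer, coupling, h 0 he]
  · obtain ⟨j, rfl | rfl⟩ : ∃ j, e = 2 * j + 1 ∨ e = 2 * j + 2 := ⟨(e - 1) / 2, by omega⟩
    · rw [Stmt.transfer_left, Stmt.transfer_left, h _ he, h j (by omega)]
    · rw [Stmt.transfer_right, Stmt.transfer_right, h _ he, h j (by omega)]

namespace Stmt

open CExp
open scoped BoundedContinuousFunction

variable (I : Input) {n l m D : ℕ} {q q' β z : ℝ} {z0 : ℂ} {σ : St}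

lemma run_fill_tree (h : Env n l m D q q' β z z0 σ) {k : Fin 32} {e : CExp} (F : ℕ → ℂ)
    (hF : ∀ j < 2 * (2 ^ (l + 1) - 1) + 1, ∀ τ, Agree {12} {k} σ τ → τ.v 12 = j →
      τ.x k j = σ.x k j → e.eval I τ = F j) : TreeEq l (((fill 12 5 k e).run I σ).x k) F := by
  intro j hj
  rw [run_fill I σ F, if_pos (by rw [h.hE]; exact hj)]
  intro j hj
  rw [h.hE] at hj
  exact hF j hj

/-- Apply the operators of all letters of the sample in the variable `17`, the last letter first,
to the array `17`. -/
def traceLoop : Stmt :=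
  loop 10 2 (subN 16 2 10 ;; subN 16 16 6 ;; readBit 13 17 16 ;; traceStep)

lemma run_traceLoop (h : Env n l m D q q' β z z0 σ) {d : ℕ →ᵇ ℂ} {ρ : ℝ}
    (hC : Contracts d (n : ℝ)⁻¹ q q' ρ) (hd : TreeEq l (σ.x 16) d) {s : ℕ} (hs : σ.v 17 = s)
    {y : ℕ → Bool} (hy : ∀ j, I.bitArr s j = y j) (hg : TreeEq l (σ.x 17) rootOne) :
    TreeEq l ((traceLoop.run I σ).x 17) (traceStat d (n : ℝ)⁻¹ q q' m y) := by
  have key := run_loop_induct I (i := 10) (b := 2)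
    (P := subN 16 2 10 ;; subN 16 16 6 ;; readBit 13 17 16 ;; traceStep) (by decide) σ
    (fun j τ => Agree {10, 11, 12, 13, 14, 15, 16} {10, 11, 17, 18} σ τ ∧ TreeEq l (τ.x 17)
      (listProd (traceL d (n : ℝ)⁻¹ q q') ((firstLetters m y).drop (m - j)) rootOne))
    ⟨(Agree.refl _ _ _).setV (by decide) _, ?_⟩ ?_
  · rw [h.hm, Nat.sub_self, List.drop_zero] at key
    exact key.2
  · have : (firstLetters m y).drop (m - 0) = [] := List.drop_eq_nil_of_le (by simp [firstLetters])
    rw [this]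
    simpa using hg
  · rintro j hj τ hτ ⟨h1, h2⟩
    rw [h.hm] at hj
    have hE := h.of_agree h1
    set τ1 := (subN 16 2 10 ;; subN 16 16 6 ;; readBit 13 17 16).run I τ with hτ1
    have hA1 : Agree {13, 16} {} τ τ1 := (agree_run I _ τ).mono (by decide) (by decide)
    have hb : τ1.v 13 = (y (m - 1 - j)).toNat := by
      have h17 : τ.v 17 = s := by rw [h1.v 17 (by decide), hs]
      simp only [hτ1, run, St.setV_v, hτ, hE.hm, hE.one, h17]
      simp [hy, Nat.sub_right_comm]
    have hE1 := hE.of_agree hA1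
    have h3 := run_traceStep I hE1 hb hC (fun e he => by
      rw [hA1.x 16 (by decide), h1.x 16 (by decide), hd e he]) (fun e he => by
      rw [hA1.x 17 (by decide), h2 e he])
    refine ⟨(h1.trans ((hA1.mono (by decide) (by decide)).trans
      ((agree_traceStep I τ1).mono (by decide) (by decide)))).setV (by decide) _, fun e he => ?_⟩
    -- Round j treats the letter m - 1 - j, which is put in front of the suffix treated so far: an
    -- ordered product is applied to a vector from its right end.
    have hL : (firstLetters m y).drop (m - (j + 1)) =
        y (m - 1 - j) :: (firstLetters m y).drop (m - j) := by
      rw [List.drop_eq_getElem_cons (by simp [firstLetters]; omega)]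
      congr 1
      · simp [firstLetters, Nat.sub_sub, add_comm]
      · congr 1
        omega
    rw [St.setV_x, hL, listProd_cons]
    exact h3 e he

/-- Add the statistic of the sample with number `N[9]` to the array `19`. -/
def sampleStep : Stmt :=
  addN 17 9 6 ;; fill 12 5 17 (int 0) ;; set 17 (int 1) ;; traceLoop ;;
  fill 12 5 19 ((arr 19 12).add (arr 17 12))

lemma agree_sampleStep (σ : St) : Agree {10, 11, 12, 13, 14, 15, 16, 17} {10, 11, 17, 18, 19} σ
    (sampleStep.run I σ) :=
  (agree_run I _ σ).mono (by decide) (by decide)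

lemma run_sampleStep (h : Env n l m D q q' β z z0 σ) {d : ℕ →ᵇ ℂ} {ρ : ℝ}
    (hC : Contracts d (n : ℝ)⁻¹ q q' ρ) (hd : TreeEq l (σ.x 16) d) {s : ℕ} (hs : σ.v 9 = s)
    {y : ℕ → Bool} (hy : ∀ j, I.bitArr (s + 1) j = y j) :
    TreeEq l ((sampleStep.run I σ).x 19)
      fun e => σ.x 19 e + traceStat d (n : ℝ)⁻¹ q q' m y e := by
  set σ1 := (addN 17 9 6).run I σ with hσ1
  have hA1 : Agree {17} {} σ σ1 := (agree_run I _ σ).mono (by decide) (by decide)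
  have h1 := h.of_agree hA1
  have h17 : σ1.v 17 = s + 1 := by simp [hσ1, run, hs, h.one]
  set σ2 := (fill 12 5 17 (int 0)).run I σ1 with hσ2
  have hA2 : Agree {12} {17} σ1 σ2 := (agree_run I _ σ1).mono (by decide) (by decide)
  have h2 := h1.of_agree hA2
  have hz : TreeEq l (σ2.x 17) (fun _ => 0) :=
    run_fill_tree I h1 _ fun _ _ _ _ _ _ => by simp [eval]
  set σ3 := (set 17 (int 1)).run I σ2 with hσ3
  have hA3 : Agree {} {17} σ2 σ3 := (agree_run I _ σ2).mono (by decide) (by decide)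
  have h3 := h2.of_agree hA3
  have hr : TreeEq l (σ3.x 17) rootOne := by
    intro e he
    have := hz e he
    by_cases h0 : e = 0
    · simp [hσ3, run, eval, h0]
    · simp [hσ3, run, h0, this]
  set σ4 := traceLoop.run I σ3 with hσ4
  have hA4 : Agree {10, 11, 12, 13, 14, 15, 16} {10, 11, 17, 18} σ3 σ4 :=
    (agree_run I _ σ3).mono (by decide) (by decide)
  have h4 := h3.of_agree hA4
  have ht : TreeEq l (σ4.x 17) (traceStat d (n : ℝ)⁻¹ q q' m y) :=
    run_traceLoop I h3 hC (fun e he => by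
      rw [hA3.x 16 (by decide), hA2.x 16 (by decide), hA1.x 16 (by decide), hd e he])
      (by rw [hA3.v 17 (by decide), hA2.v 17 (by decide), h17]) hy hr
  refine run_fill_tree I h4 _ fun j hj τ hτ hτj hx => ?_
  simp only [eval, hτj, hx, hτ.x 17 (by decide), ht j hj]
  rw [hA4.x 19 (by decide), hA3.x 19 (by decide), hA2.x 19 (by decide), hA1.x 19 (by decide)]

/-- Put the mean of the statistics of the samples into the array `19`. -/
def sampleMean : Stmt :=
  fill 12 5 19 (int 0) ;; loop 9 2 sampleStep ;; fill 12 5 19 ((arr 19 12).div (nat 2))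

lemma agree_sampleMean (σ : St) : Agree {9, 10, 11, 12, 13, 14, 15, 16, 17} {10, 11, 17, 18, 19} σ
    (sampleMean.run I σ) :=
  (agree_run I _ σ).mono (by decide) (by decide)

lemma run_sampleMean (h : Env n l m D q q' β z z0 σ) {d : ℕ →ᵇ ℂ} {ρ : ℝ}
    (hC : Contracts d (n : ℝ)⁻¹ q q' ρ) (hd : TreeEq l (σ.x 16) d) {Y : Fin m → ℕ → Bool}
    (hY : ∀ (s : Fin m) j, I.bitArr (s + 1) j = Y s j) :
    TreeEq l ((sampleMean.run I σ).x 19)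
      fun e => (∑ s, traceStat d (n : ℝ)⁻¹ q q' m (Y s) e) / m := by
  set σ1 := (fill 12 5 19 (int 0)).run I σ with hσ1
  have hA1 : Agree {12} {19} σ σ1 := (agree_run I _ σ).mono (by decide) (by decide)
  have h1 := h.of_agree hA1
  have hz : TreeEq l (σ1.x 19) (fun _ => 0) :=
    run_fill_tree I h _ fun _ _ _ _ _ _ => by simp [eval]
  have key := run_loop_induct I (i := 9) (b := 2) (P := sampleStep) (by decide) σ1
    (fun j τ => Agree {9, 10, 11, 12, 13, 14, 15, 16, 17} {10, 11, 17, 18, 19} σ1 τ ∧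
      TreeEq l (τ.x 19) (fun e => ∑ s ∈ Finset.univ.filter fun s : Fin m => (s : ℕ) < j,
        traceStat d (n : ℝ)⁻¹ q q' m (Y s) e))
    ⟨(Agree.refl _ _ _).setV (by decide) _, by simpa using hz⟩ ?_
  · set σ2 := (loop 9 2 sampleStep).run I σ1 with hσ2
    rw [h1.hm] at key
    obtain ⟨hA2, h3⟩ := key
    have h2 := h1.of_agree hA2
    refine run_fill_tree I h2 _ fun j hj τ hτ hτj hx => ?_
    have hE := h2.of_agree hτ
    simp only [eval, hτj, hx, h3 j hj, hE.hm]
    simp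
  · rintro j hj τ hτ ⟨hA, hS⟩
    rw [h1.hm] at hj
    have hE := h1.of_agree hA
    have h3 := run_sampleStep I hE hC (fun e he => by
      rw [hA.x 16 (by decide), hA1.x 16 (by decide), hd e he]) hτ (hY ⟨j, hj⟩)
    refine ⟨(hA.trans ((agree_sampleStep I τ).mono (by decide) (by decide))).setV (by decide) _,
      fun e he => ?_⟩
    have hf : (Finset.univ.filter fun s : Fin m => (s : ℕ) < j + 1) =
        insert ⟨j, hj⟩ (Finset.univ.filter fun s : Fin m => (s : ℕ) < j) := by
      ext s
      simp only [Finset.mem_filter, Finset.mem_univ, true_and, Finset.mem_insert, Fin.ext_iff]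
      omega
    rw [St.setV_x, h3 e he, hf]
    beta_reduce
    rw [hS e he, Finset.sum_insert (by simp), add_comm]

/-- One sweep over the message: the operators of the suffixes are applied to the array `21`, the
average over the shifts is added up in `22`, its diagonal in `23`. -/
def sweep : Stmt :=
  loop 19 0 (subN 16 0 19 ;; subN 16 16 6 ;; readBit 13 8 16 ;; transferStep ;;
    fill 12 5 24 ((arr 24 12).mul (arr 16 12)) ;;
    fill 12 5 22 ((arr 22 12).add ((rd 0 16).mul (arr 21 12))) ;;
    fill 12 5 23 ((arr 23 12).add ((rd 0 16).mul (arr 24 12))))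

lemma agree_sweep (σ : St) : Agree {11, 12, 13, 14, 15, 16, 19} {10, 11, 18, 21, 22, 23, 24} σ
    (sweep.run I σ) :=
  (agree_run I _ σ).mono (by decide) (by decide)

/-- One pass from the last bit to the first meets all suffix products, so their average with the
weights S and its diagonal are accumulated on the way. The weight of position n - 1 - j enters after
the operator of that bit has been applied. -/
lemma run_sweep (h : Env n l m D q q' β z z0 σ) {d : ℕ → ℂ} (hd0 : d 0 = 1)
    (hd : TreeEq l (σ.x 16) d) {x : ℕ → Bool} (hx : ∀ j < n, I.bitArr 0 j = x j) {S : ℕ → ℝ}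
    (hS : ∀ j, I.realArr 0 j = S j) {w : ℕ → ℂ} (h21 : TreeEq l (σ.x 21) w)
    (h22 : TreeEq l (σ.x 22) fun _ => 0) (h23 : TreeEq l (σ.x 23) fun _ => 0)
    (h24 : TreeEq l (σ.x 24) fun _ => 1) :
    TreeEq l ((sweep.run I σ).x 21) (suffixLin d (n : ℝ)⁻¹ x n n w) ∧
    TreeEq l ((sweep.run I σ).x 22) (shiftAvg d (n : ℝ)⁻¹ x S n w) ∧
    TreeEq l ((sweep.run I σ).x 23) (shiftDiag d S n) := by
  have key := run_loop_induct I (i := 19) (b := 0)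
    (P := subN 16 0 19 ;; subN 16 16 6 ;; readBit 13 8 16 ;; transferStep ;;
      fill 12 5 24 ((arr 24 12).mul (arr 16 12)) ;;
      fill 12 5 22 ((arr 22 12).add ((rd 0 16).mul (arr 21 12))) ;;
      fill 12 5 23 ((arr 23 12).add ((rd 0 16).mul (arr 24 12)))) (by decide) σ
    (fun j τ => Agree {11, 12, 13, 14, 15, 16, 19} {10, 11, 18, 21, 22, 23, 24} σ τ ∧
      TreeEq l (τ.x 21) (suffixLin d (n : ℝ)⁻¹ x n j w) ∧ TreeEq l (τ.x 24) (fun e => d e ^ j) ∧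
      TreeEq l (τ.x 22) (fun e => ∑ k ∈ Finset.range j,
        (S (n - 1 - k) : ℂ) * suffixLin d (n : ℝ)⁻¹ x n (k + 1) w e) ∧
      TreeEq l (τ.x 23) (fun e => ∑ k ∈ Finset.range j, (S (n - 1 - k) : ℂ) * d e ^ (k + 1)))
    ⟨(Agree.refl _ _ _).setV (by decide) _, h21, by simpa using h24, by simpa using h22,
      by simpa using h23⟩ ?_
  · rw [h.hn] at key
    refine ⟨key.2.1, fun e he => ?_, key.2.2.2.2⟩
    rw [shiftAvg, LinearMap.sum_apply, Finset.sum_apply]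
    exact key.2.2.2.1 e he
  · rintro j hj τ hτ ⟨hA, i21, i24, i22, i23⟩
    rw [h.hn] at hj
    have hE := h.of_agree hA
    set τ1 := (subN 16 0 19 ;; subN 16 16 6 ;; readBit 13 8 16).run I τ with hτ1
    have hA1 : Agree {13, 16} {} τ τ1 := (agree_run I _ τ).mono (by decide) (by decide)
    have h16 : τ1.v 16 = n - 1 - j := by
      simp [hτ1, run, hτ, hE.hn, hE.one, Nat.sub_right_comm]
    have hb : τ1.v 13 = (x (n - 1 - j)).toNat := by
      rw [← hx _ (by omega)]
      simp [hτ1, run, hτ, hE.hn, hE.one, hE.zero, Nat.sub_right_comm]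
    have hE1 := hE.of_agree hA1
    have hd1 : TreeEq l (τ1.x 16) d := fun e he => by
      rw [hA1.x 16 (by decide), hA.x 16 (by decide), hd e he]
    set τ2 := transferStep.run I τ1 with hτ2
    have hA2 : Agree {11, 12, 14, 15} {10, 11, 18, 21} τ1 τ2 := agree_transferStep I τ1
    have hE2 := hE1.of_agree hA2
    have j21 : TreeEq l (τ2.x 21) (suffixLin d (n : ℝ)⁻¹ x n (j + 1) w) := by
      intro e he
      rw [hτ2, run_transferStep I hE1 hb hd0 hd1 e he, hA1.x 21 (by decide)]
      exact transfer_congr i21 d _ _ e he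
    set τ3 := (fill 12 5 24 ((arr 24 12).mul (arr 16 12))).run I τ2 with hτ3
    have hA3 : Agree {12} {24} τ2 τ3 := (agree_run I _ τ2).mono (by decide) (by decide)
    have hE3 := hE2.of_agree hA3
    have j24 : TreeEq l (τ3.x 24) (fun e => d e ^ (j + 1)) := by
      refine run_fill_tree I hE2 _ fun e he υ hυ hυe hυx => ?_
      simp only [eval, hυe, hυx, hυ.x 16 (by decide)]
      rw [hA2.x 24 (by decide), hA1.x 24 (by decide), i24 e he, hA2.x 16 (by decide), hd1 e he,
        pow_succ]
    set τ4 := (fill 12 5 22 ((arr 22 12).add ((rd 0 16).mul (arr 21 12)))).run I τ3 with hτ4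
    have hA4 : Agree {12} {22} τ3 τ4 := (agree_run I _ τ3).mono (by decide) (by decide)
    have hE4 := hE3.of_agree hA4
    have j22 : TreeEq l (τ4.x 22) (fun e => ∑ k ∈ Finset.range (j + 1),
        (S (n - 1 - k) : ℂ) * suffixLin d (n : ℝ)⁻¹ x n (k + 1) w e) := by
      refine run_fill_tree I hE3 _ fun e he υ hυ hυe hυx => ?_
      simp only [eval, hυe, hυx, hυ.x 21 (by decide), hυ.v 16 (by decide), hS]
      rw [hA3.x 22 (by decide), hA2.x 22 (by decide), hA1.x 22 (by decide), i22 e he,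
        hA3.x 21 (by decide), j21 e he, hA3.v 16 (by decide), hA2.v 16 (by decide), h16,
        Finset.sum_range_succ]
    have j23 : TreeEq l (((fill 12 5 23 ((arr 23 12).add ((rd 0 16).mul (arr 24 12)))).run I τ4).x 23)
        (fun e => ∑ k ∈ Finset.range (j + 1), (S (n - 1 - k) : ℂ) * d e ^ (k + 1)) := by
      refine run_fill_tree I hE4 _ fun e he υ hυ hυe hυx => ?_
      simp only [eval, hυe, hυx, hυ.x 24 (by decide), hυ.v 16 (by decide), hS]
      rw [hA4.x 23 (by decide), hA3.x 23 (by decide), hA2.x 23 (by decide), hA1.x 23 (by decide),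
        i23 e he, hA4.x 24 (by decide), j24 e he, hA4.v 16 (by decide), hA3.v 16 (by decide),
        hA2.v 16 (by decide), h16, Finset.sum_range_succ]
    set τ5 := (fill 12 5 23 ((arr 23 12).add ((rd 0 16).mul (arr 24 12)))).run I τ4 with hτ5
    have hA5 : Agree {12} {23} τ4 τ5 := (agree_run I _ τ4).mono (by decide) (by decide)
    change _ ∧ TreeEq l (τ5.x 21) _ ∧ TreeEq l (τ5.x 24) _ ∧ TreeEq l (τ5.x 22) _ ∧
      TreeEq l (τ5.x 23) _
    refine ⟨(hA.trans ((agree_run I _ τ).mono (by decide) (by decide))).setV (by decide) _,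
      fun e he => ?_, fun e he => ?_, fun e he => ?_, j23⟩
    · rw [hA5.x 21 (by decide), hA4.x 21 (by decide), hA3.x 21 (by decide), j21 e he]
    · rw [hA5.x 24 (by decide), hA4.x 24 (by decide), j24 e he]
    · rw [hA5.x 22 (by decide), j22 e he]

end Stmt

end TraceRec
end

/-! ### The program: inversion of the shift, interpolation coefficients, summation over the nodes.
-/

noncomputable section
namespace TraceRec

lemma treeFunctional_eq_of_treeEq {l : ℕ} (f : (Fin l → Bool) → ℂ) {v w : ℕ → ℂ}
    (h : TreeEq l v w) : treeFunctional f v = treeFunctional f w := by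
  have h2 : 2 ^ (l + 1) = 2 * 2 ^ l := pow_succ' 2 l
  refine Finset.sum_congr rfl fun c hc => ?_
  have := Finset.mem_range.1 hc
  rw [h _ (by omega), h _ (by omega)]

namespace Stmt

open CExp
open scoped BoundedContinuousFunction

variable (I : Input) {n l m D : ℕ} {q q' β z : ℝ} {z0 : ℂ} {σ : St}

lemma run_set (k : Fin 32) (e : CExp) (σ : St) : ((set k e).run I σ).x k 0 = e.eval I σ := by
  simp [run]

/-- One step of the iteration of `solver` for the array `20` and the right hand side `19`; the
operator of the whole message is applied to the array before and yields the array `21`. -/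
def solveStep : Stmt :=
  fill 12 5 21 (arr 20 12) ;; fill 12 5 22 (int 0) ;; fill 12 5 23 (int 0) ;;
  fill 12 5 24 (int 1) ;; sweep ;;
  fill 12 5 20 ((arr 20 12).add (((arr 19 12).sub (arr 22 12)).div (arr 23 12)))

lemma agree_solveStep (σ : St) :
    Agree {11, 12, 13, 14, 15, 16, 19} {10, 11, 18, 20, 21, 22, 23, 24} σ (solveStep.run I σ) :=
  (agree_run I _ σ).mono (by decide) (by decide)

lemma run_solveStep (h : Env n l m D q q' β z z0 σ) {d : ℕ → ℂ} (hd0 : d 0 = 1)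
    (hd : TreeEq l (σ.x 16) d) {x : ℕ → Bool} (hx : ∀ j < n, I.bitArr 0 j = x j) {S : ℕ → ℝ}
    (hS : ∀ j, I.realArr 0 j = S j) {w g : ℕ → ℂ} (hw : TreeEq l (σ.x 20) w)
    (hg : TreeEq l (σ.x 19) g) :
    TreeEq l ((solveStep.run I σ).x 21) (suffixLin d (n : ℝ)⁻¹ x n n w) ∧
    TreeEq l ((solveStep.run I σ).x 20)
      (fun e => w e + (shiftDiag d S n e)⁻¹ * (g e - shiftAvg d (n : ℝ)⁻¹ x S n w e)) := by
  set σ1 := (fill 12 5 21 (arr 20 12)).run I σ with hσ1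
  have hA1 : Agree {12} {21} σ σ1 := (agree_run I _ σ).mono (by decide) (by decide)
  have h1 := h.of_agree hA1
  have i21 : TreeEq l (σ1.x 21) w := run_fill_tree I h _ fun j hj τ hτ hτj _ => by
    simp only [eval, hτj, hτ.x 20 (by decide), hw j hj]
  set σ2 := (fill 12 5 22 (int 0)).run I σ1 with hσ2
  have hA2 : Agree {12} {22} σ1 σ2 := (agree_run I _ σ1).mono (by decide) (by decide)
  have h2 := h1.of_agree hA2
  have i22 : TreeEq l (σ2.x 22) (fun _ => 0) :=
    run_fill_tree I h1 _ fun _ _ _ _ _ _ => by simp [eval]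
  set σ3 := (fill 12 5 23 (int 0)).run I σ2 with hσ3
  have hA3 : Agree {12} {23} σ2 σ3 := (agree_run I _ σ2).mono (by decide) (by decide)
  have h3 := h2.of_agree hA3
  have i23 : TreeEq l (σ3.x 23) (fun _ => 0) :=
    run_fill_tree I h2 _ fun _ _ _ _ _ _ => by simp [eval]
  set σ4 := (fill 12 5 24 (int 1)).run I σ3 with hσ4
  have hA4 : Agree {12} {24} σ3 σ4 := (agree_run I _ σ3).mono (by decide) (by decide)
  have h4 := h3.of_agree hA4
  have i24 : TreeEq l (σ4.x 24) (fun _ => 1) :=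
    run_fill_tree I h3 _ fun _ _ _ _ _ _ => by simp [eval]
  have hA : Agree {12} {21, 22, 23, 24} σ σ4 := (hA1.mono (by decide) (by decide)).trans
    ((hA2.mono (by decide) (by decide)).trans ((hA3.mono (by decide) (by decide)).trans
      (hA4.mono (by decide) (by decide))))
  obtain ⟨j21, j22, j23⟩ := run_sweep I h4 hd0 (by rw [hA.x 16 (by decide)]; exact hd) hx hS (w := w)
    (by rw [hA4.x 21 (by decide), hA3.x 21 (by decide), hA2.x 21 (by decide)]; exact i21)
    (by rw [hA4.x 22 (by decide), hA3.x 22 (by decide)]; exact i22)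
    (by rw [hA4.x 23 (by decide)]; exact i23) i24
  set σ5 := sweep.run I σ4 with hσ5
  have hA5 := agree_sweep I σ4
  have h5 := h4.of_agree hA5
  change TreeEq l (((fill 12 5 20 _).run I σ5).x 21) _ ∧ TreeEq l (((fill 12 5 20 _).run I σ5).x 20) _
  refine ⟨?_, run_fill_tree I h5 _ fun j hj τ hτ hτj hτx => ?_⟩
  · rw [(agree_run I _ σ5).x 21 (by decide)]
    exact j21
  · simp only [eval, hτj, hτx, hτ.x 19 (by decide), hτ.x 22 (by decide), hτ.x 23 (by decide)]
    rw [j22 j hj, j23 j hj, hA5.x 19 (by decide), hA5.x 20 (by decide), hA.x 19 (by decide),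
      hA.x 20 (by decide), hw j hj, hg j hj, div_eq_inv_mul]

/-- Apply `estimator` to the array `19`; the result is the array `21`. -/
def solve : Stmt := fill 12 5 20 (int 0) ;; loop 18 2 solveStep

lemma agree_solve (σ : St) : Agree {11, 12, 13, 14, 15, 16, 18, 19}
    {10, 11, 18, 20, 21, 22, 23, 24} σ (solve.run I σ) :=
  (agree_run I _ σ).mono (by decide) (by decide)

/-- Each round first pushes the current iterate through the whole message and then improves it.
After m rounds the array 21 therefore belongs to the iterate m - 1, which explains the index in
`estimate`. -/
lemma run_solve (h : Env n l m D q q' β z z0 σ) (hm : 0 < m) {d : ℕ → ℂ} (hd0 : d 0 = 1)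
    (hd : TreeEq l (σ.x 16) d) {x : ℕ → Bool} (hx : ∀ j < n, I.bitArr 0 j = x j) {S : ℕ → ℝ}
    (hS : ∀ j, I.realArr 0 j = S j) {g : ℕ → ℂ} (hg : TreeEq l (σ.x 19) g) :
    TreeEq l ((solve.run I σ).x 21) (estimator d (n : ℝ)⁻¹ x S n (m - 1) g) := by
  set σ1 := (fill 12 5 20 (int 0)).run I σ with hσ1
  have hA1 : Agree {12} {20} σ σ1 := (agree_run I _ σ).mono (by decide) (by decide)
  have h1 := h.of_agree hA1
  have hz : TreeEq l (σ1.x 20) (fun _ => 0) :=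
    run_fill_tree I h _ fun _ _ _ _ _ _ => by simp [eval]
  have key := run_loop_induct I (i := 18) (b := 2) (P := solveStep) (by decide) σ1
    (fun j τ => Agree {11, 12, 13, 14, 15, 16, 18, 19} {10, 11, 18, 20, 21, 22, 23, 24} σ1 τ ∧
      TreeEq l (τ.x 20) (solver d (n : ℝ)⁻¹ x S n j g) ∧
      (0 < j → TreeEq l (τ.x 21) (estimator d (n : ℝ)⁻¹ x S n (j - 1) g)))
    ⟨(Agree.refl _ _ _).setV (by decide) _, hz, fun h => absurd h (lt_irrefl 0)⟩ ?_
  · rw [h1.hm] at key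
    exact key.2.2 hm
  · rintro j hj τ hτ ⟨hA, i20, -⟩
    have hE := h1.of_agree hA
    obtain ⟨k21, k20⟩ := run_solveStep I hE hd0
      (by rw [hA.x 16 (by decide), hA1.x 16 (by decide)]; exact hd) hx hS i20
      (by rw [hA.x 19 (by decide), hA1.x 19 (by decide)]; exact hg)
    exact ⟨(hA.trans ((agree_solveStep I τ).mono (by decide) (by decide))).setV (by decide) _, k20,
      fun _ => k21⟩

/-- Apply `treeFunctional` to the array `21`; the result is the scalar `25`. -/
def readOff : Stmt :=
  set 25 (int 0) ;; loop 20 3 (addN 21 20 20 ;; addN 21 21 4 ;; addN 22 21 6 ;;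
    set 25 ((sc 25).add (((rd 1 20).add (iu.mul (rd 2 20))).mul ((arr 21 21).sub (arr 21 22)))))

lemma run_readOff (h : Env n l m D q q' β z z0 σ) {f : (Fin l → Bool) → ℂ}
    (hre : ∀ c, I.realArr 1 c = (f fun j => c.testBit j).re)
    (him : ∀ c, I.realArr 2 c = (f fun j => c.testBit j).im) :
    (readOff.run I σ).x 25 0 = treeFunctional f (σ.x 21) := by
  set σ1 := (set 25 (int 0)).run I σ with hσ1
  have hA1 : Agree {} {25} σ σ1 := (agree_run I _ σ).mono (by decide) (by decide)
  have h1 := h.of_agree hA1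
  have key := run_loop_induct I (i := 20) (b := 3) (P := addN 21 20 20 ;; addN 21 21 4 ;;
    addN 22 21 6 ;; set 25 ((sc 25).add (((rd 1 20).add (iu.mul (rd 2 20))).mul
      ((arr 21 21).sub (arr 21 22))))) (by decide) σ1
    (fun j τ => Agree {20, 21, 22} {25} σ1 τ ∧ τ.x 25 0 = ∑ c ∈ Finset.range j,
      (f fun i => c.testBit i) * (σ.x 21 (2 ^ (l + 1) - 1 + 2 * c) -
        σ.x 21 (2 ^ (l + 1) - 1 + 2 * c + 1)))
    ⟨(Agree.refl _ _ _).setV (by decide) _, by simp [hσ1, run, eval]⟩ ?_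
  · rw [h1.hH] at key
    exact key.2
  · rintro j hj τ hτ ⟨hA, hs⟩
    have hE := h1.of_agree hA
    set τ1 := (addN 21 20 20 ;; addN 21 21 4 ;; addN 22 21 6).run I τ with hτ1
    have hA1' : Agree {21, 22} {} τ τ1 := (agree_run I _ τ).mono (by decide) (by decide)
    have v20 : τ1.v 20 = j := by rw [hA1'.v 20 (by decide), hτ]
    have v21 : τ1.v 21 = 2 ^ (l + 1) - 1 + 2 * j := by
      simp [hτ1, run, hτ, hE.hN]; omega
    have v22 : τ1.v 22 = 2 ^ (l + 1) - 1 + 2 * j + 1 := by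
      simp [hτ1, run, hτ, hE.hN, hE.one]; omega
    have x21 : τ1.x 21 = σ.x 21 := by
      rw [hA1'.x 21 (by decide), hA.x 21 (by decide), hA1.x 21 (by decide)]
    refine ⟨(hA.trans ((agree_run I _ τ).mono (by decide) (by decide))).setV (by decide) _, ?_⟩
    change ((set 25 _).run I τ1).x 25 0 = _
    rw [run_set]
    simp only [eval, v20, v21, v22, x21, hre, him]
    rw [hA1'.x 25 (by decide), hs, Finset.sum_range_succ, mul_comm Complex.I, Complex.re_add_im]

/-- Compute the coefficient (scalar `8`) of the node with number `N[23]`, the scalar `7`. -/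
def coeff : Stmt :=
  set 8 (int 1) ;; loop 24 7 (
    set 12 (((sc 6).mul ((nat 24).add (int 1))).div (nat 7)) ;;
    set 13 ((sc 8).mul (((sc 2).sub (sc 12)).div ((sc 7).sub (sc 12)))) ;;
    ifN 23 24 (set 8 (sc 13)) (ifN 24 23 (set 8 (sc 13)) (set 8 (sc 8))))

/-- Only strict comparison is available, so the factor with index i is left out by testing j < i and
i < j separately. -/
lemma run_coeff (h : Env n l m D q q' β z z0 σ) {i : ℕ} (hi : σ.v 23 = i)
    (h7 : σ.x 7 0 = extraNode β D i) :
    (coeff.run I σ).x 8 0 = extraCoeff β z D i := by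
  set σ1 := (set 8 (int 1)).run I σ with hσ1
  have hA1 : Agree {} {8} σ σ1 := (agree_run I _ σ).mono (by decide) (by decide)
  have h1 := h.of_agree hA1
  have key := run_loop_induct I (i := 24) (b := 7) (P := set 12 (((sc 6).mul ((nat 24).add
      (int 1))).div (nat 7)) ;;
    set 13 ((sc 8).mul (((sc 2).sub (sc 12)).div ((sc 7).sub (sc 12)))) ;;
    ifN 23 24 (set 8 (sc 13)) (ifN 24 23 (set 8 (sc 13)) (set 8 (sc 8)))) (by decide) σ1
    (fun j τ => Agree {24} {8, 12, 13} σ1 τ ∧ τ.x 8 0 = ((∏ k ∈ Finset.range j, if k = i then 1 else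
      (z - extraNode β D k) / (extraNode β D i - extraNode β D k) : ℝ) : ℂ))
    ⟨(Agree.refl _ _ _).setV (by decide) _, by simp [hσ1, run, eval]⟩ ?_
  · rw [h1.hD] at key
    rw [extraCoeff, ← Finset.filter_ne', Finset.prod_filter]
    refine key.2.trans ?_
    congr 1
    exact Finset.prod_congr rfl fun k _ => by by_cases hk : k = i <;> simp [hk]
  · rintro j hj τ hτ ⟨hA, hs⟩
    have hE := h1.of_agree hA
    have v23 : τ.v 23 = i := by rw [hA.v 23 (by decide), hA1.v 23 (by decide), hi]
    have x7 : τ.x 7 0 = extraNode β D i := by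
      rw [hA.x 7 (by decide), hA1.x 7 (by decide), h7]
    refine ⟨(hA.trans ((agree_run I _ τ).mono (by decide) (by decide))).setV (by decide) _, ?_⟩
    rw [Finset.prod_range_succ, St.setV_x]
    rcases lt_trichotomy j i with hji | hji | hji
    · simp [run, eval, v23, hτ, hE.hz, hE.hD, hE.hβ, x7, hs, hji.ne, hji, extraNode]
    · simp [run, eval, v23, hτ, hE.hz, hE.hD, hE.hβ, x7, hs, hji]
    · simp [run, eval, v23, hτ, hE.hz, hE.hD, hE.hβ, x7, hs, hji.ne', hji, extraNode]

/-- Put the diagonal for the node in the scalar `7` into the array `16`. -/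
def diagonal : Stmt := fill 12 5 16 (sc 1) ;; fill 12 4 16 (sc 7) ;; set 16 (int 1)

lemma run_diagonal (h : Env n l m D q q' β z z0 σ) :
    TreeEq l ((diagonal.run I σ).x 16) (treeDiag (σ.x 7 0) z0 (2 ^ (l + 1) - 1)) := by
  set σ1 := (fill 12 5 16 (sc 1)).run I σ with hσ1
  have hA1 : Agree {12} {16} σ σ1 := (agree_run I _ σ).mono (by decide) (by decide)
  have h1 := h.of_agree hA1
  have i16 : TreeEq l (σ1.x 16) (fun _ => z0) := run_fill_tree I h _ fun _ _ τ hτ _ _ => by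
    rw [eval, hτ.x 1 (by decide), h.hz0]
  intro e he
  change (((fill 12 4 16 (sc 7)).run I σ1).setX 16 0 _).x 16 e = _
  rw [St.setX_x, run_fill I σ1 (fun _ => σ.x 7 0), h1.hN, treeDiag, i16 e he]
  · simp [eval]
  · intro j _ τ hτ _ _
    rw [eval, hτ.x 7 (by decide), hA1.x 7 (by decide)]

/-- Add the contribution of the node with number `N[23]` to the scalar `9`. -/
def nodeStep : Stmt :=
  set 7 (((sc 6).mul ((nat 23).add (int 1))).div (nat 7)) ;; coeff ;; diagonal ;; sampleMean ;;
  solve ;; readOff ;; set 9 ((sc 9).add ((sc 8).mul (sc 25)))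

lemma agree_nodeStep (σ : St) : Agree (Finset.Icc 9 22 ∪ {24}) (Finset.Icc 7 25) σ
    (nodeStep.run I σ) :=
  (agree_run I _ σ).mono (by decide) (by decide)

/-- The entries of the input `I` that the main part of the program reads. -/
structure InputSpec (I : Input) (n l m : ℕ) (x : ℕ → Bool) (S : ℕ → ℝ) (f : (Fin l → Bool) → ℂ)
    (Y : Fin m → ℕ → Bool) : Prop where
  x : ∀ j < n, I.bitArr 0 j = x j
  Y : ∀ (s : Fin m) j, I.bitArr (s + 1) j = Y s j
  S : ∀ j, I.realArr 0 j = S j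
  re : ∀ c, I.realArr 1 c = (f fun j => c.testBit j).re
  im : ∀ c, I.realArr 2 c = (f fun j => c.testBit j).im

variable {I} {x : ℕ → Bool} {S : ℕ → ℝ} {f : (Fin l → Bool) → ℂ} {Y : Fin m → ℕ → Bool}

set_option maxHeartbeats 1000000 in
lemma run_nodeStep (h : Env n l m D q q' β z z0 σ) (hI : InputSpec I n l m x S f Y) (hm : 0 < m)
    {i : ℕ} (hi : σ.v 23 = i) {ρ : ℝ} (hC : Contracts (treeDiagB (extraNode β D i) z0
      (2 ^ (l + 1) - 1)) (n : ℝ)⁻¹ q q' ρ) :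
    (nodeStep.run I σ).x 9 0 = σ.x 9 0 + extraCoeff β z D i *
      nodeLin f (extraNode β D i) z0 (n : ℝ)⁻¹ x S n (m - 1) (fun e =>
        (∑ j, traceStat (treeDiagB (extraNode β D i) z0 (2 ^ (l + 1) - 1)) (n : ℝ)⁻¹ q q' m (Y j) e)
          / m) := by
  set σ1 := (set 7 (((sc 6).mul ((nat 23).add (int 1))).div (nat 7))).run I σ with hσ1
  have hA1 : Agree {} {7} σ σ1 := (agree_run I _ σ).mono (by decide) (by decide)
  have h1 := h.of_agree hA1
  have x7 : σ1.x 7 0 = extraNode β D i := by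
    simp [hσ1, run, eval, hi, h.hβ, h.hD, extraNode]
  set σ2 := coeff.run I σ1 with hσ2
  have hA2 : Agree {24} {8, 12, 13} σ1 σ2 := (agree_run I _ σ1).mono (by decide) (by decide)
  have h2 := h1.of_agree hA2
  have x8 : σ2.x 8 0 = extraCoeff β z D i := run_coeff I h1 (by rw [hA1.v 23 (by decide), hi]) x7
  set σ3 := diagonal.run I σ2 with hσ3
  have hA3 : Agree {12} {16} σ2 σ3 := (agree_run I _ σ2).mono (by decide) (by decide)
  have h3 := h2.of_agree hA3
  have x16 : TreeEq l (σ3.x 16) (treeDiag (extraNode β D i) z0 (2 ^ (l + 1) - 1)) := by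
    have := run_diagonal I h2
    rwa [hA2.x 7 (by decide), x7] at this
  set σ4 := sampleMean.run I σ3 with hσ4
  have hA4 := agree_sampleMean I σ3
  have h4 := h3.of_agree hA4
  have x19 := run_sampleMean I h3 hC x16 hI.Y
  set σ5 := solve.run I σ4 with hσ5
  have hA5 := agree_solve I σ4
  have h5 := h4.of_agree hA5
  have x21 := run_solve I h4 hm hC.D0 (by rw [hA4.x 16 (by decide)]; exact x16) hI.x hI.S x19
  set σ6 := readOff.run I σ5 with hσ6
  have hA6 : Agree {20, 21, 22} {25} σ5 σ6 := (agree_run I _ σ5).mono (by decide) (by decide)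
  have x25 : σ6.x 25 0 = _ := run_readOff I h5 hI.re hI.im
  rw [treeFunctional_eq_of_treeEq f x21] at x25
  change ((set 9 _).run I σ6).x 9 0 = _
  rw [run_set]
  simp only [eval, x25]
  rw [hA6.x 9 (by decide), hA5.x 9 (by decide), hA4.x 9 (by decide), hA3.x 9 (by decide),
    hA2.x 9 (by decide), hA1.x 9 (by decide), hA6.x 8 (by decide), hA5.x 8 (by decide),
    hA4.x 8 (by decide), hA3.x 8 (by decide), x8]
  rfl

/-- The main part of the program: the sum over the nodes and the normalization. -/
def mainPart : Stmt :=
  set 9 (int 0) ;; loop 23 7 nodeStep ;;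
  set 10 (int 1) ;; loop 9 1 (set 10 ((sc 10).mul (nat 0))) ;;
  set 0 (((sc 9).mul ((sc 10).mul (nat 0))).div (sc 1))

lemma wf_mainPart : mainPart.wf = true := by decide

lemma bounds_mainPart : mainPart.bounds ⊆ Finset.Iic 7 := by decide

lemma run_mainPart (h : Env n l m D q q' β z z0 σ) (hI : InputSpec I n l m x S f Y) (hm : 0 < m)
    {ρ : ℝ} (hC : ∀ i < D, Contracts (treeDiagB (extraNode β D i) z0 (2 ^ (l + 1) - 1))
      (n : ℝ)⁻¹ q q' ρ) :
    (mainPart.run I σ).x 0 0 = (∑ i ∈ Finset.range D, (extraCoeff β z D i : ℂ) *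
      nodeLin f (extraNode β D i) z0 (n : ℝ)⁻¹ x S n (m - 1) (fun e =>
        (∑ j, traceStat (treeDiagB (extraNode β D i) z0 (2 ^ (l + 1) - 1)) (n : ℝ)⁻¹ q q' m (Y j) e)
          / m)) * (n : ℂ) ^ (l + 1) / z0 := by
  set σ1 := (set 9 (int 0)).run I σ with hσ1
  have hA1 : Agree {} {9} σ σ1 := (agree_run I _ σ).mono (by decide) (by decide)
  have h1 := h.of_agree hA1
  have key := run_loop_induct I (i := 23) (b := 7) (P := nodeStep) (by decide) σ1
    (fun k τ => Agree (Finset.Icc 9 24) (Finset.Icc 7 25) σ1 τ ∧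
      τ.x 9 0 = ∑ i ∈ Finset.range k, (extraCoeff β z D i : ℂ) *
        nodeLin f (extraNode β D i) z0 (n : ℝ)⁻¹ x S n (m - 1) (fun e =>
          (∑ j, traceStat (treeDiagB (extraNode β D i) z0 (2 ^ (l + 1) - 1)) (n : ℝ)⁻¹ q q' m
            (Y j) e) / m))
    ⟨(Agree.refl _ _ _).setV (by decide) _, by simp [hσ1, run, eval]⟩ ?_
  · set σ2 := (loop 23 7 nodeStep).run I σ1 with hσ2
    rw [h1.hD] at key
    obtain ⟨hA2, x9⟩ := key
    have h2 := h1.of_agree hA2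
    set σ3 := (set 10 (int 1)).run I σ2 with hσ3
    have hA3 : Agree {} {10} σ2 σ3 := (agree_run I _ σ2).mono (by decide) (by decide)
    have h3 := h2.of_agree hA3
    have key' := run_loop_induct I (i := 9) (b := 1) (P := set 10 ((sc 10).mul (nat 0)))
      (by decide) σ3 (fun k τ => Agree {9} {10} σ3 τ ∧ τ.x 10 0 = (n : ℂ) ^ k)
      ⟨(Agree.refl _ _ _).setV (by decide) _, by simp [hσ3, run, eval]⟩ ?_
    · set σ4 := (loop 9 1 (set 10 ((sc 10).mul (nat 0)))).run I σ3 with hσ4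
      rw [h3.hl] at key'
      obtain ⟨hA4, x10⟩ := key'
      have h4 := h3.of_agree hA4
      change ((set 0 _).run I σ4).x 0 0 = _
      rw [run_set]
      simp only [eval, x10, h4.hn, h4.hz0]
      rw [hA4.x 9 (by decide), hA3.x 9 (by decide), x9, pow_succ (n : ℂ)]
    · rintro j hj τ hτ ⟨hA, hs⟩
      refine ⟨(hA.trans ((agree_run I _ τ).mono (by decide) (by decide))).setV (by decide) _, ?_⟩
      simp [run, eval, hs, (h3.of_agree hA).hn, pow_succ]
  · rintro j hj τ hτ ⟨hA, hs⟩
    rw [h1.hD] at hj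
    refine ⟨(hA.trans ((agree_nodeStep I τ).mono (by decide) (by decide))).setV (by decide) _, ?_⟩
    rw [St.setV_x, run_nodeStep (h1.of_agree hA) hI hm hτ (hC j hj), hs, Finset.sum_range_succ]

end Stmt

end TraceRec
end

/-! ### The program: polynomial running time, initialization, compiled form. -/

noncomputable section
namespace TraceRec

namespace Stmt

open CExp

/-- The degree is governed by the syntax of the program alone, each loop raising it by one, so it
does not depend on the input. -/
lemma cost_le (P : Stmt) : ∃ c k : ℕ, ∀ B, P.cost B ≤ c * (B + 1) ^ k := by
  have add : ∀ (c c' k k' B : ℕ), c * (B + 1) ^ k + c' * (B + 1) ^ k' ≤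
      (c + c') * (B + 1) ^ (k + k') := by
    intro c c' k k' B
    rw [add_mul]
    gcongr <;> omega
  induction P with
  | setN | addN | subN | readBit => exact ⟨2, 0, fun B => by simp [cost]⟩
  | set k e => exact ⟨(e.code 0).length + 5, 0, fun B => by simp [cost]⟩
  | setArr k a e => exact ⟨(e.code 0).length + 14, 0, fun B => by simp [cost]⟩
  | seq P Q ih ih' =>
    obtain ⟨c, k, h⟩ := ih
    obtain ⟨c', k', h'⟩ := ih'
    exact ⟨c + c', k + k', fun B => (add_le_add (h B) (h' B)).trans (add _ _ _ _ _)⟩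
  | ifN _ _ P Q ih ih' | ifR _ _ P Q ih ih' =>
    obtain ⟨c, k, h⟩ := ih
    obtain ⟨c', k', h'⟩ := ih'
    refine ⟨c + c' + 1, k + k', fun B => ?_⟩
    have h1 := (add_le_add (h B) (h' B)).trans (add _ _ _ _ _)
    have h2 : 1 ≤ (B + 1) ^ (k + k') := Nat.one_le_pow _ _ (by omega)
    simp only [cost]
    rw [add_mul, one_mul]
    omega
  | loop i b P ih =>
    obtain ⟨c, k, h⟩ := ih
    refine ⟨c + 5, k + 1, fun B => ?_⟩
    have h2 : 1 ≤ (B + 1) ^ k := Nat.one_le_pow _ _ (by omega)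
    have h3 := h B
    have h4 : P.cost B + 3 ≤ (c + 3) * (B + 1) ^ k := by nlinarith
    calc B * (P.cost B + 3) + 2 ≤ (B + 1) * ((c + 3) * (B + 1) ^ k) + (B + 1) * (2 * (B + 1) ^ k) :=
          add_le_add (Nat.mul_le_mul (Nat.le_succ B) h4) (by nlinarith)
      _ = (c + 5) * (B + 1) ^ (k + 1) := by ring

/-- Multiply the variable `10` by `2 ^ k`. -/
def timesTwo : ℕ → Stmt
  | 0 => setN 12 0
  | k + 1 => addN 10 10 10 ;; timesTwo k

variable (I : Input) {σ : St}

lemma run_timesTwo (k : ℕ) (σ : St) : ((timesTwo k).run I σ).v 10 = 2 ^ k * σ.v 10 := by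
  induction k generalizing σ with
  | zero => simp [timesTwo, run]
  | succ k ih =>
    simp only [timesTwo, run, ih, St.setV_v]
    simp only [if_true, pow_succ]
    ring

lemma writes_timesTwo (k : ℕ) : (timesTwo k).writes ⊆ {10, 12} := by
  induction k with
  | zero => decide
  | succ k ih => exact Finset.union_subset (by decide) ih

lemma writesX_timesTwo (k : ℕ) : (timesTwo k).writesX = ∅ := by
  induction k with
  | zero => rfl
  | succ k ih => simp [timesTwo, writesX, ih]

lemma bounds_timesTwo (k : ℕ) : (timesTwo k).bounds = ∅ := by
  induction k with
  | zero => rfl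
  | succ k ih => simp [timesTwo, bounds, ih]

lemma wf_timesTwo (k : ℕ) : (timesTwo k).wf = true := by
  induction k with
  | zero => rfl
  | succ k ih => simp [timesTwo, wf, ih, bounds_timesTwo]

attribute [irreducible] timesTwo

/-- Compute `extraCount` in the variable `11`. -/
def countLoop : Stmt :=
  loop 9 2 (ifN 10 2 (timesTwo 64 ;; addN 11 11 6) (setN 12 0))

lemma writes_countLoop : countLoop.writes ⊆ {9, 10, 11, 12} := by
  have := writes_timesTwo 64
  simp only [countLoop, writes]
  refine Finset.union_subset (by decide) (Finset.union_subset (Finset.union_subset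
    (this.trans (by decide)) (by decide)) (by decide))

lemma bounds_countLoop : countLoop.bounds = {2} := by
  simp [countLoop, bounds, bounds_timesTwo]

lemma wf_countLoop : countLoop.wf = true := by
  have h := writes_timesTwo 64
  have h1 : ∀ a : Fin 32, a ≠ 10 → a ≠ 12 → a ∉ (timesTwo 64).writes := fun a h1 h2 h3 => by
    have := h h3
    simp [h1, h2] at this
  simp [countLoop, wf, wf_timesTwo, bounds, bounds_timesTwo, writes, h1]

lemma agree_countLoop (σ : St) : Agree {9, 10, 11, 12} ∅ σ (countLoop.run I σ) :=
  (agree_run I _ σ).mono writes_countLoop (by simp [countLoop, writesX, writesX_timesTwo])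

lemma run_countLoop (h6 : σ.v 6 = 1) (h10 : σ.v 10 = 1) (h11 : σ.v 11 = 0) :
    (countLoop.run I σ).v 11 = extraCount (σ.v 2) := by
  have h := writes_timesTwo 64
  have h1 : ∀ a : Fin 32, a ≠ 10 → a ≠ 12 → a ∉ (timesTwo 64).writes := fun a h1 h2 h3 => by
    have := h h3
    simp [h1, h2] at this
  have key := run_loop_induct I (i := 9) (b := 2)
    (P := ifN 10 2 (timesTwo 64 ;; addN 11 11 6) (setN 12 0)) (by simp [writes, h1]) σ
    (fun j τ => (τ.v 2 = σ.v 2 ∧ τ.v 6 = 1) ∧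
      (τ.v 10, τ.v 11) = (extraStep (σ.v 2))^[j] (1, 0))
    ⟨⟨by simp, by simp [h6]⟩, by simp [h10, h11]⟩ ?_
  · exact (Prod.ext_iff.1 key.2).2
  · rintro j hj τ hτ ⟨⟨i2, i6⟩, ip⟩
    have e11 : ((timesTwo 64).run I τ).v 11 = τ.v 11 :=
      run_v_of_notMem I (h1 11 (by decide) (by decide)) τ
    have e6 : ((timesTwo 64).run I τ).v 6 = τ.v 6 :=
      run_v_of_notMem I (h1 6 (by decide) (by decide)) τ
    have e2 : ((timesTwo 64).run I τ).v 2 = τ.v 2 :=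
      run_v_of_notMem I (h1 2 (by decide) (by decide)) τ
    have e10 := run_timesTwo I 64 τ
    rw [Function.iterate_succ_apply', ← ip, extraStep]
    by_cases hlt : τ.v 10 < τ.v 2
    · simp only [run, if_pos hlt]
      rw [i2] at hlt
      simp [hlt, e11, e6, e2, e10, i2, i6]
    · simp only [run, if_neg hlt]
      rw [i2] at hlt
      simp [hlt, i2, i6]

/-- The first part of the program: it computes the fixed variables. -/
def setup : Stmt :=
  (setN 6 1 ;; set 3 (sc 0).re ;; set 4 (sc 0).im ;; set 5 ((int 1).div (nat 0)) ;; setN 3 1 ;;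
    setN 10 1 ;; setN 11 0) ;;
  loop 9 1 (addN 3 3 3) ;;
  (addN 4 3 3 ;; subN 4 4 6 ;; addN 5 4 4 ;; addN 5 5 6) ;;
  countLoop ;;
  set 12 ((int 1).div (int 2)) ;;
  ifR 12 2 (setN 7 1 ;; set 6 (sc 2)) (addN 7 11 8 ;; set 6 ((int 1).div (int 100)))

lemma bounds_setup : setup.bounds ⊆ {1, 2} := by
  simp [setup, bounds, bounds_countLoop]

lemma wf_setup : setup.wf = true := by
  have h := writes_countLoop
  have h1 : ∀ a : Fin 32, a < 9 → a ∉ countLoop.writes := fun a h1 h2 => by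
    have := h h2
    simp only [Finset.mem_insert, Finset.mem_singleton] at this
    rcases this with rfl | rfl | rfl | rfl <;> exact absurd h1 (by decide)
  simp [setup, wf, wf_countLoop, bounds, bounds_countLoop, writes]

lemma run_setup {n l m : ℕ} {q q' z : ℝ} {z0 : ℂ} (h0 : σ.v 0 = n) (h1 : σ.v 1 = l)
    (h2 : σ.v 2 = m) (h8 : σ.v 8 = 0) (x0 : σ.x 0 0 = ⟨q, q'⟩) (x1 : σ.x 1 0 = z0)
    (x2 : σ.x 2 0 = z) :
    Env n l m (nodeCount z m) q q' (nodeScale z) z z0 (setup.run I σ) := by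
  set σ1 := (setN 6 1 ;; set 3 (sc 0).re ;; set 4 (sc 0).im ;; set 5 ((int 1).div (nat 0)) ;;
    setN 3 1 ;; setN 10 1 ;; setN 11 0).run I σ with hσ1
  have hA1 : Agree {6, 3, 10, 11} {3, 4, 5} σ σ1 := (agree_run I _ σ).mono (by decide) (by decide)
  have a6 : σ1.v 6 = 1 := by simp [hσ1, run]
  have a3 : σ1.v 3 = 1 := by simp [hσ1, run]
  have a10 : σ1.v 10 = 1 := by simp [hσ1, run]
  have a11 : σ1.v 11 = 0 := by simp [hσ1, run]
  have y3 : σ1.x 3 0 = q := by simp [hσ1, run, eval, x0]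
  have y4 : σ1.x 4 0 = q' := by simp [hσ1, run, eval, x0]
  have y5 : σ1.x 5 0 = ((n : ℝ)⁻¹ : ℝ) := by simp [hσ1, run, eval, h0]
  set σ2 := (loop 9 1 (addN 3 3 3)).run I σ1 with hσ2
  have hA2 : Agree {9, 3} {} σ1 σ2 := (agree_run I _ σ1).mono (by decide) (by decide)
  have b3 : σ2.v 3 = 2 ^ l := by
    have key := run_loop_induct I (i := 9) (b := 1) (P := addN 3 3 3) (by decide) σ1
      (fun j τ => τ.v 3 = 2 ^ j) (by simp [a3]) fun j _ τ _ hj => by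
        simp [run, hj, pow_succ, mul_two]
    rwa [hA1.v 1 (by decide), h1] at key
  have b6 : σ2.v 6 = 1 := by rw [hA2.v 6 (by decide), a6]
  set σ3 := (addN 4 3 3 ;; subN 4 4 6 ;; addN 5 4 4 ;; addN 5 5 6).run I σ2 with hσ3
  have hA3 : Agree {4, 5} {} σ2 σ3 := (agree_run I _ σ2).mono (by decide) (by decide)
  have c4 : σ3.v 4 = 2 ^ (l + 1) - 1 := by simp [hσ3, run, b3, b6, pow_succ, mul_two]
  have c5 : σ3.v 5 = 2 * (2 ^ (l + 1) - 1) + 1 := by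
    simp [hσ3, run, b3, b6, pow_succ, mul_two, two_mul]
  set σ4 := countLoop.run I σ3 with hσ4
  have hA4 := agree_countLoop I σ3
  have d11 : σ4.v 11 = extraCount m := by
    have := run_countLoop I (σ := σ3) (by rw [hA3.v 6 (by decide), b6])
      (by rw [hA3.v 10 (by decide), hA2.v 10 (by decide), a10])
      (by rw [hA3.v 11 (by decide), hA2.v 11 (by decide), a11])
    rwa [hA3.v 2 (by decide), hA2.v 2 (by decide), hA1.v 2 (by decide), h2] at this
  set σ5 := (set 12 ((int 1).div (int 2))).run I σ4 with hσ5
  have hA5 : Agree {} {12} σ4 σ5 := (agree_run I _ σ4).mono (by decide) (by decide)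
  have e12 : σ5.x 12 0 = (1 / 2 : ℝ) := by simp [hσ5, run, eval]
  have e2 : σ5.x 2 0 = z := by
    rw [hA5.x 2 (by decide), hA4.x 2 (by decide), hA3.x 2 (by decide), hA2.x 2 (by decide),
      hA1.x 2 (by decide), x2]
  have e8 : σ5.v 8 = 0 := by
    rw [hA5.v 8 (by decide), hA4.v 8 (by decide), hA3.v 8 (by decide), hA2.v 8 (by decide),
      hA1.v 8 (by decide), h8]
  have e11 : σ5.v 11 = extraCount m := by rw [hA5.v 11 (by decide), d11]
  set σ6 := (ifR 12 2 (setN 7 1 ;; set 6 (sc 2)) (addN 7 11 8 ;; set 6 ((int 1).div (int 100)))).run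
    I σ5 with hσ6
  have hA6 : Agree {7} {6} σ5 σ6 := (agree_run I _ σ5).mono (by decide) (by decide)
  have f7 : σ6.v 7 = nodeCount z m ∧ σ6.x 6 0 = nodeScale z := by
    simp only [hσ6, run, e12, e2, Complex.ofReal_re, nodeCount, nodeScale]
    split_ifs
    · simp [eval, e2]
    · simp [eval, e8, e11]
  change Env n l m (nodeCount z m) q q' (nodeScale z) z z0 σ6
  have hv : ∀ a ∉ ({7, 9, 10, 11, 12} : Finset (Fin 32)), σ6.v a = σ3.v a := fun a ha => by
    simp only [Finset.mem_insert, Finset.mem_singleton, not_or] at ha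
    rw [hA6.v a (by simp [ha]), hA5.v a (by simp), hA4.v a (by simp [ha])]
  have hx : ∀ k ∉ ({6, 12} : Finset (Fin 32)), σ6.x k = σ1.x k := fun k hk => by
    simp only [Finset.mem_insert, Finset.mem_singleton, not_or] at hk
    rw [hA6.x k (by simp [hk]), hA5.x k (by simp [hk]), hA4.x k (by simp), hA3.x k (by simp),
      hA2.x k (by simp)]
  constructor
  · rw [hv 0 (by decide), hA3.v 0 (by decide), hA2.v 0 (by decide), hA1.v 0 (by decide), h0]
  · rw [hv 1 (by decide), hA3.v 1 (by decide), hA2.v 1 (by decide), hA1.v 1 (by decide), h1]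
  · rw [hv 2 (by decide), hA3.v 2 (by decide), hA2.v 2 (by decide), hA1.v 2 (by decide), h2]
  · rw [hv 3 (by decide), hA3.v 3 (by decide), b3]
  · rw [hv 4 (by decide), c4]
  · rw [hv 5 (by decide), c5]
  · rw [hv 6 (by decide), hA3.v 6 (by decide), b6]
  · exact f7.1
  · rw [hA6.v 8 (by decide), e8]
  · rw [hx 1 (by decide), hA1.x 1 (by decide), x1]
  · rw [hx 2 (by decide), hA1.x 2 (by decide), x2]
  · rw [hx 3 (by decide), y3]
  · rw [hx 4 (by decide), y4]
  · rw [hx 5 (by decide), y5]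
  · exact f7.2

end Stmt

/-- The state that a memory represents. -/
def Mem.toSt (s : Mem) : St where
  v a := s.N a
  x k i := ⟨s.R (128 * i + 2 * k), s.R (128 * i + 2 * k + 1)⟩

lemma rep_toSt (s : Mem) : Rep s.toSt s := ⟨fun _ => rfl, fun _ _ => ⟨rfl, rfl⟩⟩

/-- The program. -/
def reconstruct : Prog := .seq Stmt.setup.compile Stmt.mainPart.compile

section Output

variable {q q' : ℝ} {n l m : ℕ} {f : (Fin l → Bool) → ℂ} {z0 : ℂ} {z : ℝ} {S : PMF ℕ}
  {x : ℕ → Bool} {Y : Fin m → ℕ → Bool}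

lemma inputSpec_estimationInput :
    Stmt.InputSpec (estimationInput q q' n l m f z0 z S x Y) n l m x (fun i => (S i).toReal) f Y where
  x j hj := by simp [estimationInput, hj]
  Y s j := by simp [estimationInput]
  S j := by simp [estimationInput]
  re c := by simp [estimationInput]
  im c := by simp [estimationInput]

/-- The program computes `estimate`, in time polynomial in `m` if `n`, `2^l` are at most `m`. -/
lemma exec_reconstruct (hm : 0 < m) {ρ : ℝ} (hC : ∀ i < nodeCount z m,
      Contracts (treeDiagB (extraNode (nodeScale z) (nodeCount z m) i) z0 (2 ^ (l + 1) - 1))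
        (n : ℝ)⁻¹ q q' ρ) (hn : n ≤ m) (hl : 2 * (2 ^ (l + 1) - 1) + 1 ≤ m)
    (hD : nodeCount z m ≤ m) :
    ∃ t s, Exec (estimationInput q q' n l m f z0 z S x Y) reconstruct
      (estimationInput q q' n l m f z0 z S x Y).initMem t s ∧
      t ≤ Stmt.setup.cost m + Stmt.mainPart.cost m ∧
      (⟨s.R 0, s.R 1⟩ : ℂ) = estimate f z z0 n m q q' x S Y := by
  set I := estimationInput q q' n l m f z0 z S x Y with hI
  have hl' : l ≤ m := by
    have h1 := (Nat.lt_two_pow_self (n := l)).le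
    have h2 : 2 ^ (l + 1) = 2 * 2 ^ l := pow_succ' 2 l
    omega
  have hi : I.initMem = ⟨fun a => [n, l, m].getD a 0, fun a => [q, q', z0.re, z0.im, z].getD a 0⟩ :=
    rfl
  generalize hs0 : I.initMem = s0 at hi ⊢
  have hE := Stmt.run_setup I (σ := s0.toSt) (n := n) (l := l) (m := m) (q := q) (q' := q') (z := z)
    (z0 := z0) (by simp [hi, Mem.toSt]) (by simp [hi, Mem.toSt]) (by simp [hi, Mem.toSt])
    (by simp [hi, Mem.toSt]) (by simp [hi, Mem.toSt]) (by simp [hi, Mem.toSt])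
    (by simp [hi, Mem.toSt, Complex.ext_iff])
  have hb : ∀ b ∈ Stmt.setup.bounds, s0.toSt.v b ≤ m := by
    intro b hb
    have := Stmt.bounds_setup hb
    simp only [Finset.mem_insert, Finset.mem_singleton] at this
    rcases this with rfl | rfl
    · simpa [hi, Mem.toSt] using hl'
    · simp [hi, Mem.toSt]
  obtain ⟨t, s, h1, h2, h3⟩ := Stmt.compile_spec I m Stmt.setup Stmt.wf_setup _ _ (rep_toSt s0) hb
  have hb' : ∀ b ∈ Stmt.mainPart.bounds, (Stmt.setup.run I s0.toSt).v b ≤ m := by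
    intro b hb
    have h8 := Stmt.bounds_mainPart hb
    have h7 : ∀ b : Fin 32, b ∈ Finset.Iic (7 : Fin 32) →
        b = 0 ∨ b = 1 ∨ b = 2 ∨ b = 3 ∨ b = 4 ∨ b = 5 ∨ b = 6 ∨ b = 7 := by decide
    have hp : 2 ^ (l + 1) = 2 * 2 ^ l := pow_succ' 2 l
    have hp1 : 1 ≤ 2 ^ l := Nat.one_le_two_pow
    rcases h7 b h8 with rfl | rfl | rfl | rfl | rfl | rfl | rfl | rfl
    · rw [hE.hn]; exact hn
    · rw [hE.hl]; exact hl'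
    · rw [hE.hm]
    · rw [hE.hH]; omega
    · rw [hE.hN]; omega
    · rw [hE.hE]; exact hl
    · rw [hE.one]; exact hm
    · rw [hE.hD]; exact hD
  obtain ⟨t', s', h4, h5, h6⟩ := Stmt.compile_spec I m Stmt.mainPart Stmt.wf_mainPart _ _ h3 hb'
  refine ⟨_, _, Exec.seq h1 h4, add_le_add h2 h5, ?_⟩
  have h7 := Stmt.run_mainPart hE (show Stmt.InputSpec I n l m x (fun i => (S i).toReal) f Y from
    inputSpec_estimationInput) hm hC
  have h8 := h6.2 0 0
  simp only [Fin.val_zero, mul_zero, add_zero, zero_add] at h8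
  rw [h8.1, h8.2, Complex.eta, h7]
  rfl

end Output

end TraceRec
end

/-! ### Running time in terms of h(n). -/

noncomputable section
namespace TraceRec

lemma two_mul_le_exp {h : ℝ} (h0 : 4 ≤ h) : 2 * h ≤ Real.exp h := by
  have := Real.quadratic_le_exp_of_nonneg (show 0 ≤ h by linarith)
  nlinarith

namespace Large

variable {M : ℝ} {n : ℕ}

lemma le_numSamples (h : Large M n) (hM : 4096 ≤ M) : n ≤ numSamples n := by
  have h1 := h.pow_le_exp hM
  have h2 := exp_hFun_le_numSamples n
  have h3 := h.le_self (by linarith)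
  have h4 := h.le_hFun (by linarith)
  have h5 : Real.exp (hFun n / 2) ≤ Real.exp (hFun n) := Real.exp_le_exp.2 (by linarith)
  have h6 : (n : ℝ) ≤ (n : ℝ) ^ 3 := le_self_pow₀ (by linarith) (by norm_num)
  have : (n : ℝ) ≤ numSamples n := by linarith
  exact_mod_cast this

lemma treeSize_lt (h : Large M n) (hM : 4096 ≤ M) {l : ℕ}
    (hl : (l : ℝ) ≤ 2 * (n : ℝ) ^ (1 / 5 : ℝ) + 1) :
    2 * (2 ^ (l + 1) - 1) + 1 < numSamples n := by
  have h1 := h.poly_le hM hl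
  have h2 := exp_hFun_le_numSamples n
  have h3 := h.le_self (by linarith)
  have h4 := h.le_hFun (by linarith)
  have h5 : Real.exp (hFun n / 256) ≤ Real.exp (hFun n) := Real.exp_le_exp.2 (by linarith)
  have h6 : (1 : ℝ) ≤ (n : ℝ) ^ (l + 1) := one_le_pow₀ (by linarith)
  have h7 : (4 : ℝ) * 1 * 2 ^ l ≤ 2 * n * (n : ℝ) ^ (l + 1) * 2 ^ l := by
    gcongr
    linarith
  have h8 : ((4 * 2 ^ l : ℕ) : ℝ) ≤ numSamples n := by push_cast; linarith
  have h9 : 4 * 2 ^ l ≤ numSamples n := by exact_mod_cast h8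
  have h10 : 2 ^ (l + 1) = 2 * 2 ^ l := pow_succ' 2 l
  have h11 : 1 ≤ 2 ^ l := Nat.one_le_two_pow
  omega

lemma nodeCount_le (h : Large M n) (hM : 4096 ≤ M) (z : ℝ) :
    nodeCount z (numSamples n) ≤ numSamples n := by
  have h2 := exp_hFun_le_numSamples n
  have h4 := h.le_hFun (by linarith)
  have h5 := extraCount_le (n := n) (by linarith)
  have h6 := two_mul_le_exp (h := hFun n) (by linarith)
  rw [nodeCount]
  split_ifs
  · have : (1 : ℝ) ≤ numSamples n := by linarith
    exact_mod_cast this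
  · have : (extraCount (numSamples n) : ℝ) ≤ numSamples n := by linarith
    exact_mod_cast this

/-- A polynomial in the number of samples is `exp(O(h(n)))`. -/
lemma poly_numSamples_le (h : Large M n) (hM : 4096 ≤ M) (c k : ℕ) :
    (c : ℝ) * (numSamples n + 1) ^ k ≤
      Real.exp ((c + 2 * k : ℕ) * hFun n * Real.log (hFun n) ^ (c + 2 * k)) := by
  have h4 := h.le_hFun (by linarith)
  have h1 := numSamples_le_exp (n := n) (by linarith)
  have h2 : (numSamples n + 1 : ℝ) ≤ Real.exp (2 * hFun n) := by
    have e1 : Real.exp (hFun n + 1) ≤ Real.exp (2 * hFun n - 1) := Real.exp_le_exp.2 (by linarith)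
    have e2 : 2 * Real.exp (2 * hFun n - 1) ≤ Real.exp (2 * hFun n) := by
      have e3 : (2 : ℝ) ≤ Real.exp 1 := by have := Real.exp_one_gt_d9; linarith
      calc 2 * Real.exp (2 * hFun n - 1) ≤ Real.exp 1 * Real.exp (2 * hFun n - 1) := by gcongr
        _ = Real.exp (2 * hFun n) := by rw [← Real.exp_add]; ring_nf
    have e4 : (1 : ℝ) ≤ Real.exp (2 * hFun n - 1) := Real.one_le_exp (by linarith)
    linarith
  have h3 : (c : ℝ) ≤ Real.exp (c * hFun n) := by
    have := Real.add_one_le_exp (c * hFun n)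
    have : (c : ℝ) * 1 ≤ c * hFun n := by gcongr; linarith
    linarith
  have hlog : 1 ≤ Real.log (hFun n) := by
    rw [Real.le_log_iff_exp_le (by linarith)]
    have := Real.exp_one_lt_d9
    linarith
  calc (c : ℝ) * (numSamples n + 1) ^ k ≤ Real.exp (c * hFun n) * Real.exp (2 * hFun n) ^ k := by
        gcongr
    _ = Real.exp ((c + 2 * k : ℕ) * hFun n * 1) := by
        rw [← Real.exp_nat_mul, ← Real.exp_add]
        push_cast
        ring_nf
    _ ≤ _ := by
        refine Real.exp_le_exp.2 (mul_le_mul_of_nonneg_left (one_le_pow₀ hlog) ?_)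
        have : 0 ≤ hFun n := by linarith
        positivity

end Large

/-- The program halts in time `exp(O(h(n)))` with the output `estimate`. -/
lemma outputs_reconstruct {c k : ℕ}
    (hck : ∀ B, (Stmt.seq Stmt.setup Stmt.mainPart).cost B ≤ c * (B + 1) ^ k)
    {q q' : Set.Ico (0 : ℝ) 1} {δ C A M : ℝ} (hδ0 : 0 < δ) (hδ : δ ≤ 1 / 2)
    (hM : Enough q q' δ C A M) {n l : ℕ} (hn : Large M n)
    (hl : (l : ℝ) ≤ 2 * (n : ℝ) ^ (1 / 5 : ℝ) + 1) (f : (Fin l → Bool) → ℂ) {θ z : ℝ}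
    (hθ : |θ| ≤ (n : ℝ) ^ (-(2 / 5) : ℝ)) (hz : Admissible q δ z) (x : ℕ → Bool) (S : PMF ℕ)
    (Y : Fin (numSamples n) → ℕ → Bool) :
    reconstruct.Outputs (estimationInput q q' n l (numSamples n) f (zZero n θ) z S x Y)
      (Real.exp ((c + 2 * k : ℕ) * hFun n * Real.log (hFun n) ^ (c + 2 * k)))
      (estimate f z (zZero n θ) n (numSamples n) q q' x S Y) := by
  have hMa := hM.abs
  have hlt := hn.treeSize_lt hMa hl
  have hh := hn.le_hFun (by linarith)
  obtain ⟨t, s, h1, h2, h3⟩ := exec_reconstruct (S := S) (x := x) (Y := Y) (f := f) (q := q)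
    (q' := q') (z := z) (z0 := zZero n θ) (by omega) (fun i hi => by
      obtain ⟨h1, h2, -, h4⟩ := hz.node hδ (by linarith) hi
      exact contracts_of_large hδ0 hM.contract hn hθ h1 h2 h4 _)
    (hn.le_numSamples hMa) hlt.le (hn.nodeCount_le hMa z)
  refine ⟨t, s, h1, ?_, h3.symm⟩
  refine le_trans ?_ (hn.poly_numSamples_le hMa c k)
  exact_mod_cast h2.trans (hck _)

end TraceRec
end
-- Choice of the constants and conclusion.
open TraceRec in
theorem mainTheorem5 (q q' : Set.Ico (0 : ℝ) 1) :
    ∃ c₀ : ℝ, 0 < c₀ ∧ ∀ c₁ c₂ : ℝ, 0 < c₂ → c₂ < c₁ → c₁ ≤ c₀ → ∀ C : ℝ, 0 < C →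
    -- the algorithm, the constant of the accuracy and the constant of the running time
    ∃ (P : Prog) (κ : ℝ) (K : ℕ), 0 < κ ∧
    -- the failure probability is at most `exp(-A n)` for large `n`, whatever `A` is
    ∀ A : ℝ, ∃ n₀ : ℕ, ∀ n : ℕ, n₀ ≤ n →
    ∀ l : ℕ, (l : ℝ) ≤ 2 * (n : ℝ) ^ (1 / 5 : ℝ) + 1 →
    ∀ f : (Fin l → Bool) → ℂ, (∀ w, ‖f w‖ ≤ 1) →
    ∀ θ z : ℝ, |θ| ≤ (n : ℝ) ^ (-(2 / 5) : ℝ) →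
    (z ∈ Set.Icc (1 - c₁) (1 - c₂) ∨ ((q : ℝ) < 1 / 2 ∧ z ∈ Set.Icc (-c₁) c₁)) →
    ∀ (x : ℕ → Bool) (S : PMF ℕ) (a η : ℕ), (η : ℝ) ≤ C * hFun n → a + η < n →
    S.support ⊆ Set.Icc a (a + η) →
    ∀ ν : Fin (numSamples n) → Measure (ℕ → Bool), (∀ i, IsProbabilityMeasure (ν i)) →
    Summable (gTerm f x (Fin.cons (zZero n θ) fun _ => (z : ℂ))) ∧
    (∀ Y : Fin (numSamples n) → ℕ → Bool, ∃ v : ℂ,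
      P.Outputs (estimationInput q q' n l (numSamples n) f (zZero n θ) z S x Y)
        (Real.exp (K * hFun n * Real.log (hFun n) ^ K)) v) ∧
    Measure.pi (fun i => sampleLaw q q' S x (Real.exp (-hFun n)) (ν i))
      {Y | ¬ ∃ v : ℂ,
        P.Outputs (estimationInput q q' n l (numSamples n) f (zZero n θ) z S x Y)
          (Real.exp (K * hFun n * Real.log (hFun n) ^ K)) v ∧
        ‖v - gPoly f x (Fin.cons (zZero n θ) fun _ => (z : ℂ))‖ ≤ Real.exp (-κ * hFun n)}
      ≤ ENNReal.ofReal (Real.exp (-A * n)) := by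
  obtain ⟨c, k, hck⟩ := (Stmt.seq Stmt.setup Stmt.mainPart).cost_le
  -- The bound 1 - q ensures z ≥ q when z ≥ 1 - c₁. The bound 1/100 is the largest interpolation
  -- node, so that |z| ≤ c₁ lies in the range of the extrapolation, and it also gives 1 - c₁ > 1/2.
  refine ⟨min (1 - q) (1 / 100), lt_min (by linarith [q.2.2]) (by norm_num), ?_⟩
  intro c₁ c₂ hc₂ hc₂₁ hc₁ C hC
  have hc₁q : c₁ ≤ 1 - q := hc₁.trans (min_le_left _ _)
  have hc₁' : c₁ ≤ 1 / 100 := hc₁.trans (min_le_right _ _)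
  -- A running time of at most c (m+1)^k is at most exp((c + 2k) h), because m + 1 ≤ exp(2h) and c ≤
  -- exp(c h).
  refine ⟨reconstruct, 1 / 256, c + 2 * k, by norm_num, fun A => ?_⟩
  obtain ⟨M, hM⟩ := exists_enough q q' c₂ C A
  have hMa := hM.abs
  obtain ⟨n₀, hn₀⟩ := Filter.eventually_atTop.1 (eventually_large M)
  refine ⟨n₀, fun n hnn l hl f hf θ z hθ hz x S a η hη han hS ν hν => ?_⟩
  have hn := hn₀ n hnn
  have hadm : Admissible q c₂ z := by
    rcases hz with ⟨h1, h2⟩ | ⟨h1, h2⟩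
    · exact Or.inl ⟨by linarith, by linarith, h2⟩
    · exact Or.inr ⟨(abs_le.2 h2).trans hc₁', h1⟩
  have hz1 : ‖(z : ℂ)‖ < 1 := by
    rw [Complex.norm_real, Real.norm_eq_abs]
    rcases hz with ⟨h1, h2⟩ | ⟨h1, h2⟩
    · rw [abs_lt]; constructor <;> linarith
    · have := abs_le.2 h2
      linarith
  have hτ0 := hn.gapZero_pos (by linarith)
  have hτ : gapZero n ≤ 1 / 2 := (hn.gapZero_le (by linarith)).trans
    (one_div_le_one_div_of_le (by norm_num) (by linarith))
  have hnorm := norm_zZero (by linarith : gapZero n ≤ 1) θ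
  have hout := fun Y => outputs_reconstruct hck hc₂ (by linarith) hM hn hl f hθ hadm x S Y
  refine ⟨summable_gTerm hf hz1 (by linarith) (by rw [← norm_pos_iff]; linarith) x,
    fun Y => ⟨_, hout Y⟩, ?_⟩
  have hlt := hn.treeSize_lt hMa hl
  -- The tree has fewer than m nodes, so m - 1 iterations of the solver reach all its levels.
  have hk : 2 * (2 ^ (l + 1) - 1) + 1 < 2 ^ (numSamples n - 1) := by
    have := (Nat.lt_two_pow_self (n := numSamples n - 1))
    omega
  refine (measure_mono fun Y hY => ?_).trans
    (measure_estimate_le hc₂ (by linarith) hM hn hl hf hθ hadm hη han hS hk ν hν)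
  exact fun h => hY ⟨_, hout Y, h⟩
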